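/- **Setting.** Consider the nonlinear Schrödinger equation $i u_t=-\Delta u+Vu+\beta(|u|^2)u$ on $\mathbb R^3$, where $\beta\in C^\infty(\mathbb R,\mathbb R)$, $\beta(0)=0$, and $V$ is real and smooth with all derivatives exponentially decaying. Let $\mathcal O\subset\mathbb R$ be an open interval and $(\phi_\omega)_{\omega\in\mathcal O}$ a smooth family of ground states: $\phi_\omega>0$, $$\Delta\phi_\omega-V\phi_\omega-\omega\phi_\omega-\beta(\phi_\omega^2)\phi_\omega=0 ,$$ with $\frac{d}{d\omega}\|\phi_\omega\|_{L^2}^2>0$, such that $L_+=-\Delta+V+\omega+\beta(\phi_\omega^2)+2\beta'(\phi_\omega^2)\phi_\omega^2$ has exactly one negative eigenvalue and no kernel. Let $\sigma_1=\begin{pmatrix}0&1\\1&0\end{pmatrix}$, $\sigma_3=\begin{pmatrix}1&0\\0&-1\end{pmatrix}$, $\langle f,g\rangle=\int_{\mathbb R^3}(f_1g_1+f_2g_2)\,dx$, and $$\mathcal H_\omega=\sigma_3\big(-\Delta+V+\omega+\beta(\phi_\omega^2)+\beta'(\phi_\omega^2)\phi_\omega^2\big)+\begin{pmatrix}0&1\\-1&0\end{pmatrix}\beta'(\phi_\omega^2)\phi_\omega^2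 .$$ Assume that the eigenvalues of $\mathcal H_\omega$ are $0$ and $\pm\lambda_j(\omega)$ with $0<\lambda_1(\omega)\le\dots\le\lambda_m(\omega)<\omega$ ($m\ge 0$ fixed), where $\xi_1(\omega),\dots,\xi_m(\omega)$ are real eigenfunctions, $\mathcal H_\omega\xi_j=\lambda_j\xi_j$, with $\langle\sigma_3\xi_j,\xi_l\rangle=\delta_{jl}$, and $\ker(\mathcal H_\omega-\lambda_j)$ is spanned by the $\xi_i$ with $\lambda_i=\lambda_j$. The families $\phi_\omega$ and $\xi_j(\omega)$ are smooth in $\omega\in\mathcal O$ (also with values in $H^1$) and in $x$, and all their $x$-derivatives decay exponentially, locally uniformly in $\omega$. Put $\Phi_\omega=(\phi_\omega,\phi_\omega)$, $Q(U)=\frac12\langle U,\sigma_1U\rangle$, $q(\omega)=Q(\Phi_\omega)=\|\phi_\omega\|_{L^2}^2$. Let $L^2_c(\mathcal H_\omega)$ be the orthogonal, for $\langle\cdot,\cdot\rangle$, of $\Phi_\omega$, $\sigma_3\partial_\omega\Phi_\omega$, $\sigma_3\xi_j$, $\sigma_1\sigma_3\xi_j$ ($1\le j\le m$), and let $P_c(\omega)$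 be the projection onto it along the span of $\sigma_3\Phi_\omega,\partial_\omega\Phi_\omega,\xi_j,\sigma_1\xi_j$. Fix $\omega_0\in\mathcal O$. On the fields $U\in H^1\times H^1$ with $\sigma_1U=\overline U$ use the coordinates $(\vartheta,\omega,z,f)$ given by $$U=e^{i\sigma_3\vartheta}(\Phi_\omega+R),\qquad R=\sum_j\big(z_j\xi_j(\omega)+\overline z_j\sigma_1\xi_j(\omega)\big)+P_c(\omega)f ,$$ where $\vartheta\in\mathbb R$, $\omega\in\mathcal O$, $z\in\mathbb C^m$, $f\in H^1\cap L^2_c(\mathcal H_{\omega_0})$ and $\sigma_1f=\overline f$. "Near the base points" means in an open set of coordinates containing $\{(\vartheta,\omega_0,0,0):\vartheta\in\mathbb R\}$. Define $$\Omega(X,Y)=\langle X,\sigma_3\sigma_1Y\rangle,\qquad \Omega_0=i\,d\vartheta\wedge dq(\omega)+\sum_jdz_j\wedge d\overline z_j+\langle f'\cdot,\sigma_3\sigma_1f'\cdot\rangle,\qquad \Omega_t=(1-t)\Omega_0+t\Omega ,$$ where $f'$ is the differential of the coordinate $f$, and the 1-form $$\alpha=\tfrac12\langle\sigma_1\sigma_3U,\cdot\rangle-\Big(-iq\,d\vartheta-\tfrac12\sum_j(\overline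 z_jdz_j-z_jd\overline z_j)+\tfrac12\langle f,\sigma_3\sigma_1f'\cdot\rangle\Big)+d\psi,\qquad \psi=\tfrac12\langle\sigma_3\Phi_\omega,R\rangle .$$ For $t\in[0,1]$ let $X^t_\vartheta$ be the vector field with $i_{X^t_\vartheta}\Omega_t=-i\,d\vartheta$, let $\Phi_s(t,\cdot)$ be its flow, let $F(t,\cdot)$ be the real function with $$F(t,\Phi_s(t,U))=i\int_0^s\alpha\big(X^t_\vartheta\big)\big(\Phi_{s'}(t,U)\big)\,ds'\qquad\text{for all }U\text{ with }\omega(U)=\omega_0\text{ and all small }|s| ,$$ let $\mathcal X^t$ be the vector field with $i_{\mathcal X^t}\Omega_t=-\alpha-i\,dF(t)$ (where $i_X\Omega_t=\Omega_t(X,\cdot)$ and $d$ acts on $U$ only), and let $\mathcal F_t$ be the flow of $\mathcal X^t$: $\mathcal F_0(U)=U$, $\frac{d}{dt}\mathcal F_t(U)=\mathcal X^t(\mathcal F_t(U))$. **Lemma.** The objects $X^t_\vartheta$, $\Phi_s(t,\cdot)$, $F$, $\mathcal X^t$ and $\mathcal F_t$, $t\in[0,1]$, exist near the base points. For every choice of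 them, the following holds near the base points. 1. For all $t\in[0,1]$ the map $\mathcal F_t$ is differentiable and $\mathcal F_t^*\Omega_t=\Omega_0$. 2. $Q\circ\mathcal F_1=q(\omega)$. 3. If $\chi$ is a function with $\partial_\vartheta\chi\equiv0$ on the domain where the vector fields are considered, then $\partial_\vartheta(\chi\circ\mathcal F_t)\equiv0$ for all $t\in[0,1]$. -/

import Mathlib

open MeasureTheory Set
open scoped Laplacian LineDeriv SchwartzMap ComplexConjugate

noncomputable section

namespace NLS

/-! ### Function spaces -/

/-- Physical space `ℝ³`. -/
abbrev E3 : Type := EuclideanSpace ℝ (Fin 3)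

/-- The space `L²(ℝ³, ℂ)`. -/
abbrev L2 : Type := Lp ℂ 2 (volume : Measure E3)

/-- The `i`-th coordinate vector of `ℝ³`. -/
def e3 (i : Fin 3) : E3 := EuclideanSpace.single i 1

/-- The Sobolev space `H¹(ℝ³, ℂ)`, realized as the space of all `(u, ∂₁u, ∂₂u, ∂₃u)` with
`u ∈ L²` whose weak partial derivatives are in `L²`; the norm is
`‖u‖² + ‖∂₁u‖² + ‖∂₂u‖² + ‖∂₃u‖²` to the power `1/2`.
(Conjugating the test function, the equation below reads `∫ η ∂ᵢu = - ∫ (∂ᵢη) u`.) -/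
def h1Submodule : Submodule ℂ (PiLp 2 (fun _ : Fin 4 => L2)) where
  carrier := {w | ∀ (i : Fin 3) (η : 𝓢(E3, ℂ)),
    inner ℂ (η.toLp 2) (w i.succ) = - inner ℂ ((∂_{e3 i} η : 𝓢(E3, ℂ)).toLp 2) (w 0)}
  zero_mem' := by intro i η; simp
  add_mem' := by
    intro a b ha hb i η
    simp only [PiLp.add_apply, inner_add_right, ha i η, hb i η]
    ring
  smul_mem' := by
    intro c a ha i η
    simp only [PiLp.smul_apply, inner_smul_right, ha i η]
    ring

/-- The Sobolev space `H¹(ℝ³, ℂ)`. -/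
abbrev H1 : Type := h1Submodule

/-- The function underlying an element of `H¹`. -/
def toL2 (u : H1) : L2 := (u : PiLp 2 (fun _ : Fin 4 => L2)) 0

open Classical in
/-- The element of `H¹` given by the function `g` (and `0` if `g` is not in `H¹`). -/
def ofFun (g : E3 → ℝ) : H1 :=
  if h : ∃ u : H1, toL2 u =ᵐ[volume] fun x => (g x : ℂ) then h.choose else 0

/-- The ambient space `H¹ × H¹` of `ℂ²`-valued fields `U`. -/
abbrev Field : Type := H1 × H1

/-- `⟨f, g⟩ = ∫ (f₁ g₁ + f₂ g₂) dx` (no complex conjugation). -/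
def pair (f g : Field) : ℂ :=
  (∫ x, toL2 f.1 x * toL2 g.1 x) + ∫ x, toL2 f.2 x * toL2 g.2 x

/-- The Pauli matrix `σ₁`. -/
def sigma1 (U : Field) : Field := (U.2, U.1)

/-- The Pauli matrix `σ₃`. -/
def sigma3 (U : Field) : Field := (U.1, -U.2)

/-- The matrix `e^{i σ₃ θ}`. -/
def rot (θ : ℝ) (U : Field) : Field :=
  (Complex.exp (Complex.I * θ) • U.1, Complex.exp (-(Complex.I * θ)) • U.2)

/-- The mass `Q(U) = ½ ⟨U, σ₁ U⟩`. -/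
def massQ (U : Field) : ℂ := 1 / 2 * pair U (sigma1 U)

/-- The reality condition `σ₁ U = Ū`. -/
def IsReal (U : Field) : Prop := ∀ᵐ x, toL2 U.2 x = conj (toL2 U.1 x)

lemma toL2_add (u v : H1) : toL2 (u + v) = toL2 u + toL2 v := rfl

lemma toL2_smul (c : ℝ) (u : H1) : toL2 (c • u) = c • toL2 u := rfl

lemma toL2_zero : toL2 0 = 0 := rfl

lemma integrable_mul (u v : L2) : Integrable (fun x => u x * v x) :=
  (Lp.memLp u).integrable_mul (Lp.memLp v)

lemma integral_mul_add (u v w : L2) :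
    (∫ x, u x * (v + w : L2) x) = (∫ x, u x * v x) + ∫ x, u x * w x := by
  rw [← integral_add (integrable_mul u v) (integrable_mul u w)]
  refine integral_congr_ae ?_
  filter_upwards [Lp.coeFn_add v w] with x hx
  rw [hx, Pi.add_apply, mul_add]

lemma integral_mul_smul (c : ℝ) (u v : L2) :
    (∫ x, u x * (c • v : L2) x) = c * ∫ x, u x * v x := by
  rw [← integral_const_mul]
  refine integral_congr_ae ?_
  filter_upwards [Lp.coeFn_smul c v] with x hx
  rw [hx, Pi.smul_apply, Complex.real_smul]
  ring

lemma pair_add_right (f g h : Field) : pair f (g + h) = pair f g + pair f h := by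
  simp only [pair, Prod.fst_add, Prod.snd_add, toL2_add, integral_mul_add]
  ring

lemma pair_smul_right (c : ℝ) (f g : Field) : pair f (c • g) = c * pair f g := by
  simp only [pair, Prod.smul_fst, Prod.smul_snd, toL2_smul, integral_mul_smul]
  ring

lemma pair_zero_right (f : Field) : pair f 0 = 0 := by
  have h := pair_smul_right 0 f 0
  simpa using h

lemma IsReal.zero : IsReal 0 := by
  have h : toL2 (0 : H1) =ᵐ[volume] 0 := by rw [toL2_zero]; exact Lp.coeFn_zero ℂ 2 volume
  filter_upwards [h] with x hx
  simp only [Prod.snd_zero, Prod.fst_zero, hx, Pi.zero_apply, map_zero]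

lemma IsReal.add {U W : Field} (hU : IsReal U) (hW : IsReal W) : IsReal (U + W) := by
  filter_upwards [hU, hW, Lp.coeFn_add (toL2 U.1) (toL2 W.1),
    Lp.coeFn_add (toL2 U.2) (toL2 W.2)] with x h1 h2 h3 h4
  simp only [Prod.snd_add, Prod.fst_add, toL2_add, h3, h4, Pi.add_apply, h1, h2, map_add]

lemma IsReal.smul (c : ℝ) {U : Field} (hU : IsReal U) : IsReal (c • U) := by
  filter_upwards [hU, Lp.coeFn_smul c (toL2 U.1), Lp.coeFn_smul c (toL2 U.2)] with x h1 h2 h3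
  simp only [Prod.smul_snd, Prod.smul_fst, toL2_smul, h2, h3, Pi.smul_apply, h1,
    Complex.real_smul, map_mul, Complex.conj_ofReal]

/-! ### The setting -/

/-- A family of real functions `g ω` on `ℝ³`, smooth in `ω ∈ O` (also as a family in `H¹`) and in
`x`, all of whose `x`-derivatives decay exponentially, locally uniformly in `ω`. -/
def IsSmoothFamily (O : Set ℝ) (g : ℝ → E3 → ℝ) : Prop :=
  ContDiffOn ℝ (⊤ : ℕ∞) (fun p : ℝ × E3 => g p.1 p.2) (O ×ˢ univ) ∧
  (∀ K ⊆ O, IsCompact K → ∀ n : ℕ, ∃ a > 0, ∃ C : ℝ, ∀ ω ∈ K, ∀ x : E3,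
    Real.exp (a * ‖x‖) * ‖iteratedFDeriv ℝ n (g ω) x‖ ≤ C) ∧
  (∀ ω ∈ O, ∃ u : H1, toL2 u =ᵐ[volume] fun x => (g ω x : ℂ)) ∧
  ContDiffOn ℝ (⊤ : ℕ∞) (fun ω => ofFun (g ω)) O

/-- `u ∈ L²` satisfies `(-Δ + W) u = μ u` in the sense of distributions. For bounded `W` this is
the eigenvalue equation for the operator `-Δ + W` with domain `H²`. -/
def WeakEigen (W : E3 → ℝ) (μ : ℂ) (u : L2) : Prop :=
  ∀ η : 𝓢(E3, ℂ), (∫ x, u x * (-(Δ η) x + W x * η x)) = μ * ∫ x, u x * η x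

/-- `(u₁, u₂) ∈ L²` satisfies, in the sense of distributions,
`(σ₃ (-Δ + A) + B (0, 1; -1, 0)) (u₁, u₂) = μ (u₁, u₂)`. -/
def WeakEigenSystem (A B : E3 → ℝ) (μ : ℂ) (u : L2 × L2) : Prop :=
  ∀ η : 𝓢(E3, ℂ),
    (∫ x, u.1 x * (-(Δ η) x + A x * η x)) + (∫ x, u.2 x * (B x * η x))
      = μ * ∫ x, u.1 x * η x ∧
    -(∫ x, u.2 x * (-(Δ η) x + A x * η x)) - (∫ x, u.1 x * (B x * η x))
      = μ * ∫ x, u.2 x * η x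

/-- The potential `V + ω + β(φ²) + β'(φ²) φ²` on the diagonal of the linearized operator. -/
def potA (β : ℝ → ℝ) (V : E3 → ℝ) (φ : ℝ → E3 → ℝ) (ω : ℝ) (x : E3) : ℝ :=
  V x + ω + β (φ ω x ^ 2) + deriv β (φ ω x ^ 2) * φ ω x ^ 2

/-- The off-diagonal potential `β'(φ²) φ²` of the linearized operator. -/
def potB (β : ℝ → ℝ) (φ : ℝ → E3 → ℝ) (ω : ℝ) (x : E3) : ℝ :=
  deriv β (φ ω x ^ 2) * φ ω x ^ 2

/-- The setting: the nonlinear Schrödinger equation `i u_t = -Δu + V u + β(|u|²) u` on `ℝ³`, a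
smooth family of ground states `φ_ω`, `ω ∈ O`, and the discrete spectrum of the linearized operator
`ℋ_ω = σ₃ (-Δ + V + ω) + σ₃ [β(φ_ω²) + β'(φ_ω²) φ_ω²] - i σ₂ β'(φ_ω²) φ_ω²`,
where `-i σ₂ = (0, 1; -1, 0)`. -/
structure Setting (m : ℕ) where
  /-- the nonlinearity -/
  β : ℝ → ℝ
  /-- the linear potential -/
  V : E3 → ℝ
  /-- the interval of frequencies -/
  O : Set ℝ
  /-- the ground states -/
  φ : ℝ → E3 → ℝ
  /-- the positive eigenvalues of `ℋ_ω` -/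
  lam : Fin m → ℝ → ℝ
  /-- the first components of the real eigenfunctions `ξ_j(ω)` -/
  ξ₁ : Fin m → ℝ → E3 → ℝ
  /-- the second components of the real eigenfunctions `ξ_j(ω)` -/
  ξ₂ : Fin m → ℝ → E3 → ℝ
  β_zero : β 0 = 0
  β_smooth : ContDiff ℝ (⊤ : ℕ∞) β
  V_smooth : ContDiff ℝ (⊤ : ℕ∞) V
  V_decay : ∀ n : ℕ, ∃ a > 0, ∃ C : ℝ, ∀ x : E3,
    ‖iteratedFDeriv ℝ n V x‖ ≤ C * Real.exp (-(a * ‖x‖))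
  O_open : IsOpen O
  O_interval : O.OrdConnected
  φ_smooth : IsSmoothFamily O φ
  φ_pos : ∀ ω ∈ O, ∀ x, 0 < φ ω x
  φ_eq : ∀ ω ∈ O, ∀ x,
    (Δ (φ ω)) x - V x * φ ω x - ω * φ ω x - β (φ ω x ^ 2) * φ ω x = 0
  /-- the mass of the ground states is strictly increasing in `ω`, infinitesimally -/
  mass_deriv_pos : ∀ ω ∈ O, 0 < deriv (fun ω' => ∫ x, φ ω' x ^ 2) ω
  /-- `L₊ = -Δ + V + ω + β(φ²) + 2 β'(φ²) φ²` has exactly one negative eigenvalue -/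
  Lplus_neg : ∀ ω ∈ O, ∃! μ : ℝ, μ < 0 ∧
    ∃ u : L2, u ≠ 0 ∧ WeakEigen (fun x => potA β V φ ω x + potB β φ ω x) μ u
  /-- `L₊` has no kernel -/
  Lplus_ker : ∀ ω ∈ O, ∀ u : L2,
    WeakEigen (fun x => potA β V φ ω x + potB β φ ω x) 0 u → u = 0
  lam_mono : ∀ ω ∈ O, Monotone fun j => lam j ω
  lam_pos : ∀ ω ∈ O, ∀ j, 0 < lam j ω
  lam_lt : ∀ ω ∈ O, ∀ j, lam j ω < ω
  ξ₁_smooth : ∀ j, IsSmoothFamily O (ξ₁ j)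
  ξ₂_smooth : ∀ j, IsSmoothFamily O (ξ₂ j)
  /-- `ℋ_ω ξ_j = λ_j ξ_j`, first component -/
  ξ_eq₁ : ∀ ω ∈ O, ∀ j x,
    -(Δ (ξ₁ j ω)) x + potA β V φ ω x * ξ₁ j ω x + potB β φ ω x * ξ₂ j ω x
      = lam j ω * ξ₁ j ω x
  /-- `ℋ_ω ξ_j = λ_j ξ_j`, second component -/
  ξ_eq₂ : ∀ ω ∈ O, ∀ j x,
    (Δ (ξ₂ j ω)) x - potA β V φ ω x * ξ₂ j ω x - potB β φ ω x * ξ₁ j ω x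
      = lam j ω * ξ₂ j ω x
  /-- the normalization `⟨σ₃ ξ_j, ξ_l⟩ = δ_{jl}` -/
  ξ_norm : ∀ ω ∈ O, ∀ j l,
    (∫ x, (ξ₁ j ω x * ξ₁ l ω x - ξ₂ j ω x * ξ₂ l ω x)) = if j = l then 1 else 0
  /-- the eigenspace of `λ_j` is spanned by the `ξ_i` with `λ_i = λ_j` -/
  eigenspace : ∀ ω ∈ O, ∀ j, ∀ u : L2 × L2,
    WeakEigenSystem (potA β V φ ω) (potB β φ ω) (lam j ω) u →
    u ∈ Submodule.span ℂ {w : L2 × L2 | ∃ i, lam i ω = lam j ω ∧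
      w = (toL2 (ofFun (ξ₁ i ω)), toL2 (ofFun (ξ₂ i ω)))}
  /-- `ℋ_ω` has no eigenvalues except for `0` and `± λ_j` -/
  no_other_eigenvalue : ∀ ω ∈ O, ∀ μ : ℂ, ∀ u : L2 × L2, u ≠ 0 →
    WeakEigenSystem (potA β V φ ω) (potB β φ ω) μ u →
    μ = 0 ∨ ∃ j, μ = lam j ω ∨ μ = -lam j ω

namespace Setting

variable {m : ℕ} (S : Setting m)

/-- `Φ_ω = (φ_ω, φ_ω)`. -/
def Phi (ω : ℝ) : Field := (ofFun (S.φ ω), ofFun (S.φ ω))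

/-- `∂_ω Φ_ω`. -/
def dPhi (ω : ℝ) : Field := deriv S.Phi ω

/-- `ξ_j(ω)`. -/
def xi (j : Fin m) (ω : ℝ) : Field := (ofFun (S.ξ₁ j ω), ofFun (S.ξ₂ j ω))

/-- `q(ω) = ‖φ_ω‖²`, the mass of the ground state. -/
def q (ω : ℝ) : ℝ := ∫ x, S.φ ω x ^ 2

/-- The projection `P_d(ℋ_ω)` onto `N_g(ℋ_ω) ⊕ ⨁_j (ker (ℋ_ω - λ_j) ⊕ ker (ℋ_ω + λ_j))` along
`L²_c(ℋ_ω)`, written in the basis `σ₃ Φ_ω, ∂_ω Φ_ω` of the generalized kernel `N_g(ℋ_ω)` and the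
eigenvectors `ξ_j`, `σ₁ ξ_j`, for the eigenvalues `λ_j`, `-λ_j`. -/
def Pd (ω : ℝ) (f : Field) : Field :=
  (((deriv S.q ω : ℝ) : ℂ)⁻¹ * pair (sigma3 (S.dPhi ω)) f) • sigma3 (S.Phi ω)
    + (((deriv S.q ω : ℝ) : ℂ)⁻¹ * pair (S.Phi ω) f) • S.dPhi ω
    + ∑ j, (pair (sigma3 (S.xi j ω)) f • S.xi j ω
        + pair (sigma1 (sigma3 (S.xi j ω))) f • sigma1 (S.xi j ω))

/-- The projection `P_c(ℋ_ω) = 1 - P_d(ℋ_ω)` onto `L²_c(ℋ_ω)`. -/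
def Pc (ω : ℝ) (f : Field) : Field := f - S.Pd ω f

/-- The real `H¹` fields in `L²_c(ℋ_ω)`: those satisfying `σ₁ f = f̄` and orthogonal to
`N_g(ℋ_ω^*) = span {Φ_ω, σ₃ ∂_ω Φ_ω}` and to the eigenvectors `σ₃ ξ_j`, `σ₁ σ₃ ξ_j` of `ℋ_ω^*`. -/
def hcSubmodule (ω : ℝ) : Submodule ℝ Field where
  carrier := {f | IsReal f ∧ pair (S.Phi ω) f = 0 ∧ pair (sigma3 (S.dPhi ω)) f = 0 ∧
    ∀ j, pair (sigma3 (S.xi j ω)) f = 0 ∧ pair (sigma1 (sigma3 (S.xi j ω))) f = 0}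
  zero_mem' := ⟨IsReal.zero, pair_zero_right _, pair_zero_right _,
    fun _ => ⟨pair_zero_right _, pair_zero_right _⟩⟩
  add_mem' := by
    rintro f g ⟨hf, h1, h2, h3⟩ ⟨hg, k1, k2, k3⟩
    refine ⟨hf.add hg, ?_, ?_, fun j => ⟨?_, ?_⟩⟩
    · rw [pair_add_right, h1, k1, add_zero]
    · rw [pair_add_right, h2, k2, add_zero]
    · rw [pair_add_right, (h3 j).1, (k3 j).1, add_zero]
    · rw [pair_add_right, (h3 j).2, (k3 j).2, add_zero]
  smul_mem' := by
    rintro c f ⟨hf, h1, h2, h3⟩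
    refine ⟨hf.smul c, ?_, ?_, fun j => ⟨?_, ?_⟩⟩
    · rw [pair_smul_right, h1, mul_zero]
    · rw [pair_smul_right, h2, mul_zero]
    · rw [pair_smul_right, (h3 j).1, mul_zero]
    · rw [pair_smul_right, (h3 j).2, mul_zero]

/-- The phase space `ℝ × ℝ × ℂᵐ × H¹_c(ω₀)` of coordinates `(ϑ, ω, z, f)`. -/
abbrev Phase (ω₀ : ℝ) : Type := ℝ × ℝ × (Fin m → ℂ) × S.hcSubmodule ω₀

variable {S} {ω₀ : ℝ}

/-- The coordinate `ϑ`. -/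
abbrev Phase.θ (p : S.Phase ω₀) : ℝ := p.1

/-- The coordinate `ω`. -/
abbrev Phase.ω (p : S.Phase ω₀) : ℝ := p.2.1

/-- The coordinate `z`. -/
abbrev Phase.z (p : S.Phase ω₀) : Fin m → ℂ := p.2.2.1

/-- The coordinate `f`. -/
abbrev Phase.f (p : S.Phase ω₀) : Field := p.2.2.2

variable (S) (ω₀)

/-- The coordinate vector field `∂/∂ϑ`. -/
def dTheta : S.Phase ω₀ := (1, 0, 0, 0)

/-- The points `(ϑ, ω₀, 0, 0)`, that is, `U = e^{i σ₃ ϑ} Φ_{ω₀}`. -/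
def base : Set (S.Phase ω₀) := {p | p.2 = (ω₀, 0, 0)}

variable {S} {ω₀}

/-- `R = z·ξ(ω) + z̄·σ₁ξ(ω) + P_c(ℋ_ω) f`. -/
def R (p : S.Phase ω₀) : Field :=
  (∑ j, (p.z j • S.xi j p.ω + conj (p.z j) • sigma1 (S.xi j p.ω))) + S.Pc p.ω p.f

/-- The coordinate map `(ϑ, ω, z, f) ↦ U = e^{i σ₃ ϑ} (Φ_ω + z·ξ(ω) + z̄·σ₁ξ(ω) + P_c(ℋ_ω) f)`. -/
def U (p : S.Phase ω₀) : Field := rot p.θ (S.Phi p.ω + R p)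

/-- The tangent vector of `H¹ × H¹` at `U(p)` with the coordinates `Y`. -/
def dU (p Y : S.Phase ω₀) : Field := fderiv ℝ (U (S := S) (ω₀ := ω₀)) p Y

/-! ### Differential forms, in the coordinates -/

/-- The symplectic form `Ω(X, Y) = ⟨X, σ₃ σ₁ Y⟩`. -/
def Omega (p X Y : S.Phase ω₀) : ℂ := pair (dU p X) (sigma3 (sigma1 (dU p Y)))

/-- The form `Ω₀ = i dϑ ∧ dq(ω) + ∑_j dz_j ∧ dz̄_j + ⟨f' ·, σ₃ σ₁ f' ·⟩`. -/
def Omega0 (p X Y : S.Phase ω₀) : ℂ :=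
  Complex.I * (X.θ * (deriv S.q p.ω * Y.ω) - Y.θ * (deriv S.q p.ω * X.ω))
    + ∑ j, (X.z j * conj (Y.z j) - Y.z j * conj (X.z j))
    + pair X.f (sigma3 (sigma1 Y.f))

/-- `Ω_t = (1 - t) Ω₀ + t Ω`. -/
def Omegat (t : ℝ) (p X Y : S.Phase ω₀) : ℂ := (1 - t) * Omega0 p X Y + t * Omega p X Y

/-- The primitive `β(U) Y = ½ ⟨σ₁ σ₃ U, Y⟩` of `Ω`. -/
def beta1 (p Y : S.Phase ω₀) : ℂ := 1 / 2 * pair (sigma1 (sigma3 (U p))) (dU p Y)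

/-- The primitive `-i q dϑ - ½ ∑_j (z̄_j dz_j - z_j dz̄_j) + ½ ⟨f, σ₃ σ₁ f' ·⟩` of `Ω₀`. -/
def beta0 (p Y : S.Phase ω₀) : ℂ :=
  -(Complex.I * S.q p.ω * Y.θ)
    - (∑ j, (conj (p.z j) * Y.z j - p.z j * conj (Y.z j))) / 2
    + 1 / 2 * pair p.f (sigma3 (sigma1 Y.f))

/-- `ψ = ½ ⟨σ₃ Φ_ω, R⟩`. -/
def psi (p : S.Phase ω₀) : ℂ := 1 / 2 * pair (sigma3 (S.Phi p.ω)) (R p)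

/-- The 1-form `α = β - β₀ + dψ`. -/
def alpha (p Y : S.Phase ω₀) : ℂ :=
  beta1 p Y - beta0 p Y + fderiv ℝ (psi (S := S) (ω₀ := ω₀)) p Y

variable (S) (ω₀)

/-- The corrected Moser vector field `𝒳^t`, with its ingredients, and its flow, near the points
`e^{i σ₃ ϑ} Φ_{ω₀}`. -/
structure MoserFlow where
  /-- a neighborhood of the base points, where the vector fields and `F` are considered -/
  dom : Set (S.Phase ω₀)
  dom_open : IsOpen dom
  base_dom : base S ω₀ ⊆ dom
  dom_sub : ∀ p ∈ dom, p.ω ∈ S.O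
  /-- the Hamiltonian vector field `X^t_ϑ` of `ϑ` with respect to `Ω_t` -/
  Xθ : ℝ → S.Phase ω₀ → S.Phase ω₀
  Xθ_spec : ∀ t ∈ Icc (0 : ℝ) 1, ∀ p ∈ dom, ∀ Y,
    Omegat t p (Xθ t p) Y = -(Complex.I * Y.θ)
  /-- a neighborhood of the base points; the flow `Φ_s(t, ·)` of `X^t_ϑ` is considered at its points
  with `ω = ω₀` -/
  ini : Set (S.Phase ω₀)
  ini_open : IsOpen ini
  base_ini : base S ω₀ ⊆ ini
  /-- the life span of the flow of `X^t_ϑ` -/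
  s₀ : ℝ
  s₀_pos : 0 < s₀
  /-- the flow `Φ_s(t, p)` of `X^t_ϑ`, with the arguments in the order `t`, `s`, `p` -/
  flowθ : ℝ → ℝ → S.Phase ω₀ → S.Phase ω₀
  flowθ_zero : ∀ t ∈ Icc (0 : ℝ) 1, ∀ p ∈ ini, p.ω = ω₀ → flowθ t 0 p = p
  flowθ_mem : ∀ t ∈ Icc (0 : ℝ) 1, ∀ p ∈ ini, p.ω = ω₀ → ∀ s ∈ Ioo (-s₀) s₀,
    flowθ t s p ∈ dom
  flowθ_deriv : ∀ t ∈ Icc (0 : ℝ) 1, ∀ p ∈ ini, p.ω = ω₀ → ∀ s ∈ Ioo (-s₀) s₀,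
    HasDerivAt (fun s' => flowθ t s' p) (Xθ t (flowθ t s p)) s
  /-- the correction `F(t, ·)`, with `F(t, Φ_s(t, p)) = i ∫_0^s α(X^t_ϑ)(Φ_{s'}(t, p)) ds'` -/
  F : ℝ → S.Phase ω₀ → ℝ
  F_diff : ∀ t ∈ Icc (0 : ℝ) 1, ∀ p ∈ dom, DifferentiableAt ℝ (F t) p
  F_spec : ∀ t ∈ Icc (0 : ℝ) 1, ∀ p ∈ ini, p.ω = ω₀ → ∀ s ∈ Ioo (-s₀) s₀,
    (F t (flowθ t s p) : ℂ) =
      Complex.I * ∫ s' in (0 : ℝ)..s, alpha (flowθ t s' p) (Xθ t (flowθ t s' p))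
  /-- the vector field `𝒳^t`, with `i_{𝒳^t} Ω_t = -α - i dF(t)` -/
  X : ℝ → S.Phase ω₀ → S.Phase ω₀
  X_spec : ∀ t ∈ Icc (0 : ℝ) 1, ∀ p ∈ dom, ∀ Y,
    Omegat t p (X t p) Y = -alpha p Y - Complex.I * (fderiv ℝ (F t) p Y : ℝ)
  /-- a neighborhood of the base points, where the flow of `𝒳^t` is defined up to time `1` -/
  flowDom : Set (S.Phase ω₀)
  flowDom_open : IsOpen flowDom
  base_flowDom : base S ω₀ ⊆ flowDom
  /-- the flow `ℱ_t` of `𝒳^t` -/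
  flow : ℝ → S.Phase ω₀ → S.Phase ω₀
  flow_zero : ∀ p ∈ flowDom, flow 0 p = p
  flow_mem : ∀ p ∈ flowDom, ∀ t ∈ Icc (0 : ℝ) 1, flow t p ∈ dom
  flow_deriv : ∀ p ∈ flowDom, ∀ t ∈ Icc (0 : ℝ) 1,
    HasDerivWithinAt (fun t' => flow t' p) (X t (flow t p)) (Icc 0 1) t

end Setting

end NLS

end

open MeasureTheory Set
open scoped Laplacian LineDeriv SchwartzMap ComplexConjugate

noncomputable section

open Filter Topology

set_option linter.unusedSectionVars false


/-! The frame is Moser's argument. The forms `Ω_t` are closed, `Ω - Ω₀ = dα`, and at the points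
`e^{iσ₃ϑ} Φ_{ω₀}` both `Ω = Ω₀` and `α = 0`. If `i_X Ω_t = -α - i dF`, Cartan's formula gives `L_X
Ω_t = -dα = -∂_t Ω_t`, so the flow of `X` pulls `Ω_t` back to `Ω₀` (`MoserData.pullback_flowX`).
Nothing depends on `ϑ`, so the flow commutes with translations in `ϑ`; this is the third claim, and
it shows that the differential of the flow fixes `∂_ϑ`. Up to the factor `i`, `∂_ϑ` is the
Hamiltonian field of `Q` for `Ω` and of `q(ω)` for `Ω₀`. Hence the pull-back identity at `t = 1`,
with `∂_ϑ` in one slot, says `d(Q ∘ ℱ_1) = dq(ω)`; the flow fixes the base points, where `Q =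
q(ω₀)`, and this determines the constant on balls around them (`SolitonModel.mass_flow_one`).

The difficulty is to solve for the vector field. On `H¹` the symplectic form is only weakly
nondegenerate: `X ↦ Ω_t(X, ·)` is injective, but does not reach every functional. The form `α` has
an explicit representative, because `P_c` is symmetric for the symplectic form
(`SolitonModel.B_adj`, `SolitonModel.B_Ga`). The differential `dF`, however, comes from a flow, and
nothing says beforehand that it is represented by a vector of the phase space. The choice of `F`
resolves this. The form `γ = α + i dF` vanishes on `X_ϑ`, so `L_{X_ϑ} γ = i_{X_ϑ} dγ = (Ω - Ω₀)(X_ϑ,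
·)`, which is representable; and on `ω = ω₀`, where `F` vanishes, `dF` is a multiple of `dω`. A
candidate for the corrected vector field is therefore transported from the level set along `X_ϑ` by
a linear differential equation (`MoserData.transport_identity`), and Grönwall's inequality shows
that it solves the defining equation (`MoserData.B_A_Xc`).

Abstractly, covectors are represented through a constant form `B` and 2-forms are written `B(A ·,
·)` with operators `A` that equal `1` at the base point, hence are invertible nearby. All objects
then solve ordinary differential equations with smooth right-hand sides in Banach spaces. Smooth
dependence on the initial point follows from the inverse function theorem for the Picard map on
`C([-1, 1], F)`, whose linearization is one minus a Volterra operator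
(`SmoothODE.exists_local_flow`).

The lemma speaks of every choice of the objects. Near the base points there is in fact only one:
nondegeneracy fixes `X_ϑ`, uniqueness of integral curves fixes its flow and with it `F`
(`CorrectedFlow.F_eq`), and then the corrected field and its flow (`CorrectedFlow.X_eq`,
`CorrectedFlow.flow_eq`).

The spectral assumptions enter through `Ω = Ω₀` at the base points (`SolitonModel.A₁_base`), which
rests on orthogonality relations. Two of them follow from the symmetry of `L₋` and `L₊`
(`pair_Phi_xi`, `pair_sigma1_sigma3_xi_xi`); the third is `L₊ ∂_ω φ = -φ` tested with an
eigenfunction, proved with differences in `ω` (`pair_sigma3_dPhi_xi`). -/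

/-! ### Superposition operators on spaces of continuous maps -/

namespace ContinuousMap

section Superposition

universe u

variable {X : Type*} [TopologicalSpace X] [CompactSpace X]
variable {F G : Type u} [NormedAddCommGroup F] [NormedSpace ℝ F]
  [NormedAddCommGroup G] [NormedSpace ℝ G]

open Classical in
/-- The superposition operator `γ ↦ v ∘ γ`, for a map `v` that is continuous on `V`, at the paths
`γ` in `V`. -/
def superpose (V : Set F) (v : F → G) (γ : C(X, F)) : C(X, G) :=
  if h : ContinuousOn v V ∧ ∀ τ, γ τ ∈ V then
    ⟨fun τ => v (γ τ), h.1.comp_continuous γ.continuous h.2⟩ else 0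

lemma superpose_apply {V : Set F} {v : F → G} (hv : ContinuousOn v V) {γ : C(X, F)}
    (hγ : ∀ τ, γ τ ∈ V) (τ : X) : superpose V v γ τ = v (γ τ) := by
  rw [superpose, dif_pos ⟨hv, hγ⟩]; rfl

lemma isOpen_forall_mem {V : Set F} (hV : IsOpen V) : IsOpen {γ : C(X, F) | ∀ τ, γ τ ∈ V} := by
  have := ContinuousMap.isOpen_setOfPred_mapsTo (isCompact_univ (X := X)) hV
  simpa [MapsTo] using this

/-- The range of `γ₀` is compact, so the room around it inside `V` and the modulus of continuity of
`v` can be taken uniform in `τ`. Pointwise estimates on `v` thus become sup-norm estimates on paths.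
-/
lemma eventually_dist_lt {V : Set F} (hV : IsOpen V) {v : F → G} (hv : ContinuousOn v V)
    {γ₀ : C(X, F)} (hγ₀ : ∀ τ, γ₀ τ ∈ V) {ε : ℝ} (hε : 0 < ε) :
    ∃ δ > 0, ∀ τ, ∀ y, dist y (γ₀ τ) < δ → y ∈ V ∧ dist (v y) (v (γ₀ τ)) < ε := by
  have hK : IsCompact (range γ₀) := isCompact_range γ₀.continuous
  have hsub : range γ₀ ⊆ V := by rintro _ ⟨τ, rfl⟩; exact hγ₀ τ
  have h1 := hK.uniformContinuousAt_of_continuousAt v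
    (fun a ha => hv.continuousAt (hV.mem_nhds (hsub ha))) (Metric.dist_mem_uniformity hε)
  obtain ⟨δ₁, hδ₁, h1⟩ := Metric.mem_uniformity_dist.1 h1
  obtain ⟨δ₂, hδ₂, h2⟩ := hK.exists_thickening_subset_open hV hsub
  refine ⟨min δ₁ δ₂, lt_min hδ₁ hδ₂, fun τ y hy => ⟨h2 ?_, ?_⟩⟩
  · exact Metric.mem_thickening_iff.2 ⟨γ₀ τ, mem_range_self τ, hy.trans_le (min_le_right _ _)⟩
  · have := h1 (a := γ₀ τ) (b := y) (by rw [dist_comm]; exact hy.trans_le (min_le_left _ _))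
      (mem_range_self τ)
    rw [dist_comm]; exact this

lemma continuousAt_superpose {V : Set F} (hV : IsOpen V) {v : F → G} (hv : ContinuousOn v V)
    {γ₀ : C(X, F)} (hγ₀ : ∀ τ, γ₀ τ ∈ V) : ContinuousAt (superpose V v) γ₀ := by
  rw [Metric.continuousAt_iff]
  intro ε hε
  obtain ⟨δ, hδ, h⟩ := eventually_dist_lt hV hv hγ₀ (half_pos hε)
  refine ⟨δ, hδ, fun γ hγ => ?_⟩
  have hd : ∀ τ, dist (γ τ) (γ₀ τ) < δ := fun τ => (dist_apply_le_dist τ).trans_lt hγ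
  have hmem : ∀ τ, γ τ ∈ V := fun τ => (h τ _ (hd τ)).1
  refine lt_of_le_of_lt ?_ (half_lt_self hε)
  rw [dist_le (half_pos hε).le]
  intro τ
  rw [superpose_apply hv hmem, superpose_apply hv hγ₀]
  exact (h τ _ (hd τ)).2.le

/-- Pointwise application of a continuous family of continuous linear maps. -/
def pointwiseApply : C(X, F →L[ℝ] G) →L[ℝ] C(X, F) →L[ℝ] C(X, G) :=
  LinearMap.mkContinuous₂
    (LinearMap.mk₂ ℝ
      (fun (A : C(X, F →L[ℝ] G)) (η : C(X, F)) =>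
        (⟨fun τ => A τ (η τ), A.continuous.clm_apply η.continuous⟩ : C(X, G)))
      (fun _ _ _ => by ext; simp) (fun _ _ _ => by ext; simp)
      (fun _ _ _ => by ext; simp) (fun _ _ _ => by ext; simp)) 1
    (fun A η => by
      rw [norm_le _ (by positivity)]
      intro τ
      refine ((A τ).le_opNorm _).trans ?_
      rw [one_mul]
      exact mul_le_mul (A.norm_coe_le_norm τ) (η.norm_coe_le_norm τ) (norm_nonneg _)
        (by positivity))

@[simp] lemma pointwiseApply_apply (A : C(X, F →L[ℝ] G)) (η : C(X, F)) (τ : X) :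
    pointwiseApply A η τ = A τ (η τ) := rfl

/-- On a ball around `γ₀ τ`, of radius independent of `τ`, the derivative of `v` varies by at most
`ε`; the mean value inequality bounds the remainder by `ε ‖η τ‖`. -/
lemma hasFDerivAt_superpose {V : Set F} (hV : IsOpen V) {v : F → G} (hv : ContDiffOn ℝ 1 v V)
    {γ₀ : C(X, F)} (hγ₀ : ∀ τ, γ₀ τ ∈ V) :
    HasFDerivAt (superpose V v) (pointwiseApply (superpose V (fderiv ℝ v) γ₀)) γ₀ := by
  have hd : ContinuousOn (fderiv ℝ v) V := hv.continuousOn_fderiv_of_isOpen hV le_rfl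
  have hdiff : ∀ y ∈ V, HasFDerivAt v (fderiv ℝ v y) y := fun y hy =>
    ((hv.differentiableOn one_ne_zero).differentiableAt (hV.mem_nhds hy)).hasFDerivAt
  rw [hasFDerivAt_iff_isLittleO_nhds_zero, Asymptotics.isLittleO_iff]
  intro ε hε
  obtain ⟨δ, hδ, h⟩ := eventually_dist_lt hV hd hγ₀ hε
  filter_upwards [Metric.ball_mem_nhds (0 : C(X, F)) hδ] with η hη
  rw [mem_ball_zero_iff] at hη
  have hlt : ∀ τ, ‖η τ‖ < δ := fun τ => (η.norm_coe_le_norm τ).trans_lt hη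
  have hmem : ∀ τ, (γ₀ + η) τ ∈ V := fun τ => (h τ _ (by simpa [dist_eq_norm] using hlt τ)).1
  rw [norm_le _ (by positivity)]
  intro τ
  have hball : ∀ y ∈ Metric.ball (γ₀ τ) δ, y ∈ V ∧ ‖fderiv ℝ v y - fderiv ℝ v (γ₀ τ)‖ ≤ ε := by
    intro y hy
    have := h τ y hy
    exact ⟨this.1, by rw [← dist_eq_norm]; exact this.2.le⟩
  have key := (convex_ball (γ₀ τ) δ).norm_image_sub_le_of_norm_hasFDerivWithin_le'
    (f := v) (f' := fderiv ℝ v) (φ := fderiv ℝ v (γ₀ τ)) (C := ε)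
    (fun y hy => (hdiff y (hball y hy).1).hasFDerivWithinAt) (fun y hy => (hball y hy).2)
    (Metric.mem_ball_self hδ) (y := γ₀ τ + η τ) (by simpa using hlt τ)
  simp only [sub_apply, pointwiseApply_apply, superpose_apply hv.continuousOn hmem,
    superpose_apply hv.continuousOn hγ₀, superpose_apply hd hγ₀, add_apply]
  simp only [add_sub_cancel_left] at key
  exact key.trans (mul_le_mul_of_nonneg_left (η.norm_coe_le_norm τ) hε.le)

/-- Induction on the order: the derivative is again a superposition operator, for `fderiv ℝ v`,
followed by the bounded linear map `pointwiseApply`. The target `G` is quantified inside, since it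
becomes `F →L[ℝ] G` at each step. -/
lemma contDiffAt_superpose_nat {V : Set F} (hV : IsOpen V) (n : ℕ) :
    ∀ {G : Type u} [NormedAddCommGroup G] [NormedSpace ℝ G] {v : F → G},
    ContDiffOn ℝ n v V → ∀ {γ₀ : C(X, F)}, (∀ τ, γ₀ τ ∈ V) →
    ContDiffAt ℝ n (superpose V v) γ₀ := by
  induction n with
  | zero =>
    intro G _ _ v hv γ₀ hγ₀
    have : ContDiffOn ℝ 0 (superpose V v) {γ : C(X, F) | ∀ τ, γ τ ∈ V} := by
      rw [contDiffOn_zero]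
      exact fun γ hγ => (continuousAt_superpose hV hv.continuousOn hγ).continuousWithinAt
    exact_mod_cast this.contDiffAt ((isOpen_forall_mem hV).mem_nhds hγ₀)
  | succ n ih =>
    intro G _ _ v hv γ₀ hγ₀
    have hv1 : ContDiffOn ℝ 1 v V := hv.of_le (by exact_mod_cast Nat.le_add_left 1 n)
    have hd : ContDiffOn ℝ n (fderiv ℝ v) V :=
      hv.fderiv_of_isOpen hV (by exact_mod_cast le_rfl)
    rw [Nat.cast_add, Nat.cast_one, contDiffAt_succ_iff_hasFDerivAt]
    refine ⟨fun γ => pointwiseApply (superpose V (fderiv ℝ v) γ),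
      ⟨_, (isOpen_forall_mem hV).mem_nhds hγ₀, fun γ hγ => hasFDerivAt_superpose hV hv1 hγ⟩, ?_⟩
    exact (pointwiseApply (X := X) (F := F) (G := G)).contDiff.contDiffAt.comp γ₀ (ih hd hγ₀)

lemma contDiffAt_superpose {V : Set F} (hV : IsOpen V) {v : F → G}
    (hv : ContDiffOn ℝ (⊤ : ℕ∞) v V) {γ₀ : C(X, F)} (hγ₀ : ∀ τ, γ₀ τ ∈ V) :
    ContDiffAt ℝ (⊤ : ℕ∞) (superpose V v) γ₀ := by
  rw [contDiffAt_infty]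
  exact fun n => contDiffAt_superpose_nat hV n (hv.of_le (by exact_mod_cast le_top)) hγ₀

end Superposition

/-! ### Integration of paths -/

section Volterra

variable {F : Type*} [NormedAddCommGroup F] [NormedSpace ℝ F]

/-- The interval `[-1, 1]`, on which paths are parametrized. -/
abbrev TimeInterval : Type := Icc (-1 : ℝ) 1

/-- The projection of `ℝ` onto `[-1, 1]`. -/
def timeProj : ℝ → TimeInterval := projIcc (-1) 1 (by norm_num)

lemma continuous_timeProj : Continuous timeProj := continuous_projIcc

lemma timeProj_of_mem {τ : ℝ} (h : τ ∈ Icc (-1 : ℝ) 1) : timeProj τ = ⟨τ, h⟩ :=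
  projIcc_of_mem _ h

/-- A path on `[-1, 1]`, extended by constants. -/
def extendPath (γ : C(TimeInterval, F)) (τ : ℝ) : F := γ (timeProj τ)

lemma continuous_extendPath (γ : C(TimeInterval, F)) : Continuous (extendPath γ) :=
  γ.continuous.comp continuous_timeProj

variable [CompleteSpace F]

/-- The operator `η ↦ ∫_0^τ η`. -/
def primitive : C(TimeInterval, F) →L[ℝ] C(TimeInterval, F) :=
  LinearMap.mkContinuous
    { toFun := fun η => ⟨fun τ => ∫ σ in (0 : ℝ)..τ, extendPath η σ,
        (intervalIntegral.continuous_primitive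
          (fun _ _ => (continuous_extendPath η).intervalIntegrable _ _) 0).comp
          continuous_subtype_val⟩
      map_add' := fun η ζ => by
        ext τ
        simp only [coe_mk, add_apply]
        rw [← intervalIntegral.integral_add ((continuous_extendPath η).intervalIntegrable _ _)
          ((continuous_extendPath ζ).intervalIntegrable _ _)]
        rfl
      map_smul' := fun c η => by
        ext τ
        simp only [coe_mk, smul_apply, RingHom.id_apply]
        rw [← intervalIntegral.integral_smul]
        rfl } 1
    (fun η => by
      rw [norm_le _ (by positivity)]
      intro τ
      refine (intervalIntegral.norm_integral_le_of_norm_le_const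
        (C := ‖η‖) (fun σ _ => η.norm_coe_le_norm _)).trans ?_
      have : |(τ : ℝ) - 0| ≤ 1 := by rw [sub_zero]; exact abs_le.2 τ.2
      nlinarith [norm_nonneg η])

lemma primitive_apply (η : C(TimeInterval, F)) (τ : TimeInterval) :
    primitive η τ = ∫ σ in (0 : ℝ)..τ, extendPath η σ := rfl

/-- Integration from `0` raises the power of `|τ|` and divides by the new exponent; iterated, it
produces the factorial that makes a Volterra operator quasinilpotent. -/
lemma norm_primitive_le (η : C(TimeInterval, F)) (n : ℕ) {C : ℝ}
    (h : ∀ τ, ‖η τ‖ ≤ C * |(τ : ℝ)| ^ n) (τ : TimeInterval) :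
    ‖primitive η τ‖ ≤ C / (n + 1) * |(τ : ℝ)| ^ (n + 1) := by
  rw [primitive_apply]
  have hb : ∀ σ : ℝ, σ ∈ Icc (-1 : ℝ) 1 → ‖extendPath η σ‖ ≤ C * |σ| ^ n := by
    intro σ hσ
    have := h (timeProj σ)
    rw [extendPath]
    rwa [timeProj_of_mem hσ] at this ⊢
  obtain ⟨τ, hτ⟩ := τ
  have hn : (0 : ℝ) < n + 1 := by positivity
  rcases le_total 0 τ with h0 | h0
  · refine (intervalIntegral.norm_integral_le_of_norm_le h0 (g := fun σ => C * σ ^ n)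
      (Eventually.of_forall fun σ hσ => ?_) (Continuous.intervalIntegrable (by fun_prop) _ _)).trans
      (le_of_eq ?_)
    · have := hb σ ⟨by linarith [hσ.1], hσ.2.trans hτ.2⟩
      rwa [abs_of_nonneg hσ.1.le] at this
    · rw [intervalIntegral.integral_const_mul, integral_pow, abs_of_nonneg h0]
      simp; ring
  · rw [intervalIntegral.integral_symm, norm_neg]
    refine (intervalIntegral.norm_integral_le_of_norm_le h0 (g := fun σ => C * (-σ) ^ n)
      (Eventually.of_forall fun σ hσ => ?_) (Continuous.intervalIntegrable (by fun_prop) _ _)).trans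
      (le_of_eq ?_)
    · have := hb σ ⟨hτ.1.trans hσ.1.le, by linarith [hσ.2]⟩
      rwa [abs_of_nonpos hσ.2] at this
    · rw [intervalIntegral.integral_const_mul,
        intervalIntegral.integral_comp_neg (fun x => x ^ n), integral_pow, abs_of_nonpos h0]
      simp; ring

/-- A Volterra operator has spectral radius zero, so `1` minus it is invertible. -/
lemma isUnit_one_sub_primitive_comp (A : C(TimeInterval, F →L[ℝ] F)) :
    IsUnit (1 - primitive.comp (pointwiseApply A) : C(TimeInterval, F) →L[ℝ] C(TimeInterval, F)) := by
  set K : C(TimeInterval, F) →L[ℝ] C(TimeInterval, F) := primitive.comp (pointwiseApply A) with hK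
  have bound : ∀ n : ℕ, ∀ η : C(TimeInterval, F), ∀ τ : TimeInterval,
      ‖(K ^ n) η τ‖ ≤ ‖A‖ ^ n / n.factorial * ‖η‖ * |(τ : ℝ)| ^ n := by
    intro n η
    induction n with
    | zero => intro τ; simpa using η.norm_coe_le_norm τ
    | succ n ih =>
      intro τ
      rw [pow_succ']
      have h1 : ∀ σ, ‖pointwiseApply A ((K ^ n) η) σ‖
          ≤ (‖A‖ * (‖A‖ ^ n / n.factorial * ‖η‖)) * |(σ : ℝ)| ^ n := by
        intro σ
        refine ((A σ).le_opNorm _).trans ?_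
        rw [mul_assoc]
        exact mul_le_mul (A.norm_coe_le_norm σ) (ih σ) (norm_nonneg _) (by positivity)
      refine (norm_primitive_le _ n h1 τ).trans (le_of_eq ?_)
      rw [Nat.factorial_succ]
      push_cast
      field_simp
      ring
  have hnorm : ∀ n : ℕ, ‖K ^ n‖ ≤ ‖A‖ ^ n / n.factorial := by
    intro n
    refine ContinuousLinearMap.opNorm_le_bound _ (by positivity) fun η => ?_
    rw [norm_le _ (by positivity)]
    intro τ
    refine (bound n η τ).trans ?_
    have : |(τ : ℝ)| ^ n ≤ 1 := pow_le_one₀ (abs_nonneg _) (abs_le.2 τ.2)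
    have h0 : 0 ≤ ‖A‖ ^ n / n.factorial * ‖η‖ := by positivity
    nlinarith
  -- The factorial wins, so some power of `K` has norm less than one, and `1 - K ^ n` is inverted by
  -- a Neumann series.
  obtain ⟨n, hn⟩ := ((FloorSemiring.tendsto_pow_div_factorial_atTop ‖A‖).eventually
    (gt_mem_nhds zero_lt_one)).exists
  have hu : IsUnit (1 - K ^ n) := 
    (Units.oneSub (K ^ n) ((hnorm n).trans_lt hn)).isUnit
  -- `1 - K` divides `1 - K ^ n`, and commuting factors of a unit are units.
  rw [← mul_neg_geom_sum K n] at hu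
  have hcomm : Commute (1 - K) (∑ i ∈ Finset.range n, K ^ i) :=
    Commute.sum_right _ _ _ fun i _ =>
      (Commute.one_left _).sub_left ((Commute.refl K).pow_right i)
  exact (hcomm.isUnit_mul_iff.1 hu).1

end Volterra

end ContinuousMap

/-! ### Smooth flows of vector fields on Banach spaces -/

namespace SmoothODE

open ContinuousMap

/-! ### Uniqueness of integral curves. -/

section Uniqueness

variable {F : Type*} [NormedAddCommGroup F] [NormedSpace ℝ F]

lemma hasDerivWithinAt_Ici {f : ℝ → F} {f' : F} {a b t : ℝ} (ht : t ∈ Ico a b)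
    (h : HasDerivWithinAt f f' (Icc a b) t) : HasDerivWithinAt f f' (Ici t) t :=
  h.mono_of_mem_nhdsWithin (Icc_mem_nhdsGE_of_mem ht)

/-- If `γ` is an integral curve of `v` in the open set `V`, then a continuous curve `δ` with the same
initial point that satisfies the equation as long as it is in `V` equals `γ`. -/
lemma eqOn_of_forall_mem {V : Set F} (hV : IsOpen V) {v : F → F} (hv : ContDiffOn ℝ 1 v V)
    {a b : ℝ} {γ δ : ℝ → F} (hγV : ∀ t ∈ Icc a b, γ t ∈ V)
    (hγ : ∀ t ∈ Icc a b, HasDerivWithinAt γ (v (γ t)) (Icc a b) t)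
    (hδc : ContinuousOn δ (Icc a b))
    (hδ : ∀ t ∈ Icc a b, δ t ∈ V → HasDerivWithinAt δ (v (δ t)) (Icc a b) t)
    (h0 : γ a = δ a) : ∀ t ∈ Icc a b, γ t = δ t := by
  have hγc : ContinuousOn γ (Icc a b) := fun t ht => (hγ t ht).continuousWithinAt
  rcases lt_or_ge b a with hab | hab
  · intro t ht; exact absurd (ht.1.trans ht.2) (not_le.2 hab)
  have hclosed : IsClosed ({t | γ t = δ t} ∩ Icc a b) := by
    have : {t | γ t = δ t} ∩ Icc a b = Icc a b ∩ (fun t => γ t - δ t) ⁻¹' {0} := by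
      ext t; simp [sub_eq_zero, and_comm]
    rw [this]
    exact (hγc.sub hδc).preimage_isClosed_of_isClosed isClosed_Icc isClosed_singleton
  -- The set of agreement is closed, so it suffices to extend it to the right. At a point of
  -- agreement `δ` lies in `V`, hence also shortly afterwards; there both curves solve the equation
  -- and a local Lipschitz bound applies.
  refine fun t ht => hclosed.Icc_subset_of_forall_exists_gt h0 ?_ ht
  rintro x ⟨hx, hxab⟩ y hy
  have hxm : x ∈ Icc a b := Ico_subset_Icc_self hxab
  obtain ⟨K, s, hs, hK⟩ :=
    (hv.contDiffAt (hV.mem_nhds (hγV x hxm))).exists_lipschitzOnWith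
  have hnhds : Icc a b ∈ 𝓝[≥] x := Icc_mem_nhdsGE_of_mem hxab
  have h1 : ∀ᶠ τ in 𝓝[≥] x, γ τ ∈ s :=
    ((hγc x hxm).mono_of_mem_nhdsWithin hnhds).eventually hs
  have h2 : ∀ᶠ τ in 𝓝[≥] x, δ τ ∈ s ∩ V :=
    ((hδc x hxm).mono_of_mem_nhdsWithin hnhds).eventually
      (by rw [← show γ x = δ x from hx]; exact inter_mem hs (hV.mem_nhds (hγV x hxm)))
  obtain ⟨u, hu, hsub⟩ := mem_nhdsGE_iff_exists_Icc_subset.1 (h1.and h2)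
  set z := min (min u b) y with hz
  have hxz : x < z := lt_min (lt_min hu hxab.2) hy
  have hzu : z ≤ u := (min_le_left _ _).trans (min_le_left _ _)
  have hzb : z ≤ b := (min_le_left _ _).trans (min_le_right _ _)
  have hIcc : Icc x z ⊆ Icc a b := Icc_subset_Icc hxab.1 hzb
  have hIco : ∀ τ ∈ Ico x z, τ ∈ Ico a b := fun τ hτ =>
    ⟨hxab.1.trans hτ.1, hτ.2.trans_le hzb⟩
  have hsu : ∀ τ ∈ Ico x z, γ τ ∈ s ∧ δ τ ∈ s ∩ V := fun τ hτ =>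
    hsub ⟨hτ.1, hτ.2.le.trans hzu⟩
  have key := ODE_solution_unique_of_mem_Icc_right (v := fun _ => v) (s := fun _ => s) (K := K)
    (f := γ) (g := δ) (a := x) (b := z) (fun _ _ => hK) (hγc.mono hIcc)
    (fun τ hτ => hasDerivWithinAt_Ici (hIco τ hτ) (hγ τ (Ico_subset_Icc_self (hIco τ hτ))))
    (fun τ hτ => (hsu τ hτ).1) (hδc.mono hIcc)
    (fun τ hτ => hasDerivWithinAt_Ici (hIco τ hτ)
      (hδ τ (Ico_subset_Icc_self (hIco τ hτ)) (hsu τ hτ).2.2))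
    (fun τ hτ => (hsu τ hτ).2.1) hx
  exact ⟨z, key ⟨hxz.le, le_rfl⟩, hxz, min_le_right _ _⟩

end Uniqueness

/-! ### Integral curves on `[-1, 1]` and their smooth dependence on the initial point. -/

section Flow

variable {F : Type*} [NormedAddCommGroup F] [NormedSpace ℝ F]

/-- `γ` is an integral curve of `v` on `[-1, 1]`, inside `V`, with `γ 0 = x`. -/
structure IsSol (V : Set F) (v : F → F) (x : F) (γ : ℝ → F) : Prop where
  zero : γ 0 = x
  mem : ∀ τ ∈ Icc (-1 : ℝ) 1, γ τ ∈ V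
  deriv : ∀ τ ∈ Icc (-1 : ℝ) 1, HasDerivWithinAt γ (v (γ τ)) (Icc (-1) 1) τ

lemma IsSol.continuousOn {V : Set F} {v : F → F} {x : F} {γ : ℝ → F} (h : IsSol V v x γ) :
    ContinuousOn γ (Icc (-1) 1) := fun τ hτ => (h.deriv τ hτ).continuousWithinAt

lemma IsSol.mono {V V' : Set F} {v : F → F} {x : F} {γ : ℝ → F} (h : IsSol V v x γ)
    (hV : ∀ τ ∈ Icc (-1 : ℝ) 1, γ τ ∈ V') : IsSol V' v x γ := ⟨h.zero, hV, h.deriv⟩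

lemma IsSol.eqOn_right {V : Set F} (hV : IsOpen V) {v : F → F} (hv : ContDiffOn ℝ 1 v V)
    {x : F} {γ : ℝ → F} (hγ : IsSol V v x γ) {δ : ℝ → F}
    (hδc : ContinuousOn δ (Icc 0 1))
    (hδ : ∀ t ∈ Icc (0 : ℝ) 1, δ t ∈ V → HasDerivWithinAt δ (v (δ t)) (Icc 0 1) t)
    (h0 : δ 0 = x) : ∀ t ∈ Icc (0 : ℝ) 1, γ t = δ t := by
  have hsub : Icc (0 : ℝ) 1 ⊆ Icc (-1) 1 := Icc_subset_Icc (by norm_num) le_rfl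
  exact eqOn_of_forall_mem hV hv (fun t ht => hγ.mem t (hsub ht))
    (fun t ht => (hγ.deriv t (hsub ht)).mono hsub) hδc hδ (hγ.zero.trans h0.symm)

lemma IsSol.eqOn {V : Set F} (hV : IsOpen V) {v : F → F} (hv : ContDiffOn ℝ 1 v V)
    {x : F} {γ δ : ℝ → F} (hγ : IsSol V v x γ) (hδ : IsSol V v x δ) :
    ∀ t ∈ Icc (-1 : ℝ) 1, γ t = δ t := by
  have hsub : Icc (0 : ℝ) 1 ⊆ Icc (-1) 1 := Icc_subset_Icc (by norm_num) le_rfl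
  have hright : ∀ (w : F → F), ContDiffOn ℝ 1 w V → ∀ γ δ : ℝ → F, IsSol V w x γ → IsSol V w x δ →
      ∀ t ∈ Icc (0 : ℝ) 1, γ t = δ t := fun w hw γ δ hγ hδ =>
    hγ.eqOn_right hV hw (hδ.continuousOn.mono hsub)
      (fun t ht _ => (hδ.deriv t (hsub ht)).mono hsub) hδ.zero
  -- Negative times are positive times for `-v`, after reversing the curve.
  have hneg : ∀ γ : ℝ → F, IsSol V v x γ → IsSol V (fun y => -v y) x (fun τ => γ (-τ)) := by
    intro γ hγ
    have hm : ∀ τ : ℝ, τ ∈ Icc (-1 : ℝ) 1 → -τ ∈ Icc (-1 : ℝ) 1 := fun τ hτ =>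
      ⟨by linarith [hτ.2], by linarith [hτ.1]⟩
    refine ⟨by simp [hγ.zero], fun τ hτ => hγ.mem _ (hm τ hτ), fun τ hτ => ?_⟩
    have := (hγ.deriv _ (hm τ hτ)).scomp τ ((hasDerivAt_neg τ).hasDerivWithinAt)
      (fun σ hσ => hm σ hσ)
    simpa [Function.comp_def] using this
  intro t ht
  rcases le_total 0 t with h | h
  · exact hright v hv γ δ hγ hδ t ⟨h, ht.2⟩
  · have := hright _ hv.neg _ _ (hneg γ hγ) (hneg δ hδ) (-t) ⟨by linarith, by linarith [ht.1]⟩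
    simpa using this

variable [CompleteSpace F]

/-- `γ ↦ γ - ∫_0^τ v ∘ γ`. A path solves the equation iff its image is constant. -/
def picardMap (V : Set F) (v : F → F) (γ : C(TimeInterval, F)) : C(TimeInterval, F) :=
  γ - primitive (superpose V v γ)

/-- The constant paths. -/
def constPath : F →L[ℝ] C(TimeInterval, F) :=
  LinearMap.mkContinuous
    { toFun := fun x => ContinuousMap.const _ x
      map_add' := fun _ _ => rfl
      map_smul' := fun _ _ => rfl } 1
    (fun x => by
      rw [one_mul, ContinuousMap.norm_le _ (norm_nonneg _)]
      exact fun _ => le_rfl)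

@[simp] lemma constPath_apply (x : F) (τ : TimeInterval) : constPath x τ = x := rfl

/-- Evaluation of a path. -/
def evalPath (τ : TimeInterval) : C(TimeInterval, F) →L[ℝ] F := ContinuousMap.evalCLM ℝ τ

/-- From an integral equation to a differential equation, with the integrand left free: it serves
for the nonlinear equation and for the variational one. -/
lemma hasDerivWithinAt_extendPath {η ζ : C(TimeInterval, F)} {x : F}
    (h : ζ - primitive η = constPath x) :
    extendPath ζ 0 = x ∧ ∀ τ ∈ Icc (-1 : ℝ) 1,
      HasDerivWithinAt (extendPath ζ) (extendPath η τ) (Icc (-1) 1) τ := by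
  have hval : ∀ τ ∈ Icc (-1 : ℝ) 1, extendPath ζ τ = x + ∫ σ in (0 : ℝ)..τ, extendPath η σ := by
    intro τ hτ
    have h1 : ζ ⟨τ, hτ⟩ - primitive η ⟨τ, hτ⟩ = x := by
      rw [← ContinuousMap.sub_apply, h]; rfl
    rw [extendPath, timeProj_of_mem hτ, ← h1, primitive_apply]; abel
  refine ⟨by rw [hval 0 (by norm_num)]; simp, fun τ hτ => ?_⟩
  have hd : HasDerivAt (fun τ => x + ∫ σ in (0 : ℝ)..τ, extendPath η σ) (extendPath η τ) τ :=
    (intervalIntegral.integral_hasDerivAt_right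
      ((continuous_extendPath η).intervalIntegrable _ _)
      ((continuous_extendPath η).stronglyMeasurableAtFilter _ _)
      (continuous_extendPath η).continuousAt).const_add x
  exact hd.hasDerivWithinAt.congr hval (hval τ hτ)

lemma picardMap_eq_constPath_of_isSol {V : Set F} {v : F → F} (hv : ContinuousOn v V) {x : F}
    {γ : ℝ → F} (hγ : IsSol V v x γ) {γ' : C(TimeInterval, F)} (h : ∀ τ, γ' τ = γ τ) :
    picardMap V v γ' = constPath x := by
  have hmem : ∀ τ, γ' τ ∈ V := fun τ => by rw [h]; exact hγ.mem τ τ.2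
  ext τ
  obtain ⟨τ, hτ⟩ := τ
  have hsub : uIcc 0 τ ⊆ Icc (-1) 1 := by
    rw [← uIcc_of_le (by norm_num : (-1 : ℝ) ≤ 1)]
    exact uIcc_subset_uIcc (by rw [uIcc_of_le] <;> norm_num) (by rw [uIcc_of_le] <;> norm_num; exact hτ)
  have hint : ∫ σ in (0 : ℝ)..τ, extendPath (superpose V v γ') σ = γ τ - γ 0 := by
    refine intervalIntegral.integral_eq_sub_of_hasDeriv_right
      (hγ.continuousOn.mono hsub) (fun σ hσ => ?_)
      ((continuous_extendPath _).intervalIntegrable _ _)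
    have hσ' : σ ∈ Icc (-1 : ℝ) 1 := hsub (Ioo_subset_Icc_self hσ)
    have hσ'' : σ ∈ Ico (-1 : ℝ) 1 := by
      refine ⟨hσ'.1, hσ.2.trans_le ?_⟩
      exact max_le (by norm_num) hτ.2
    have e : extendPath (superpose V v γ') σ = v (γ σ) := by
      rw [extendPath, timeProj_of_mem hσ', superpose_apply hv hmem, h]
    rw [e]
    exact (hasDerivWithinAt_Ici hσ'' (hγ.deriv σ hσ')).mono Ioi_subset_Ici_self
  simp only [picardMap, ContinuousMap.sub_apply, primitive_apply, constPath_apply, hint, h, hγ.zero]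
  abel

lemma isSol_of_picardMap_eq_constPath {V : Set F} {v : F → F} (hv : ContinuousOn v V) {x : F}
    {γ : C(TimeInterval, F)} (hmem : ∀ τ, γ τ ∈ V) (h : picardMap V v γ = constPath x) :
    IsSol V v x (extendPath γ) := by
  obtain ⟨h0, h1⟩ := hasDerivWithinAt_extendPath h
  refine ⟨h0, fun τ _ => hmem _, fun τ hτ => ?_⟩
  have := h1 τ hτ
  rwa [extendPath, superpose_apply hv hmem] at this

/-- Solutions depend smoothly on the initial point, near a solution on `[-1, 1]`. -/
lemma exists_local_flow {V : Set F} (hV : IsOpen V) {v : F → F}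
    (hv : ContDiffOn ℝ (⊤ : ℕ∞) v V) {x₀ : F} {γ₀ : ℝ → F} (hγ₀ : IsSol V v x₀ γ₀) :
    ∃ Ψ : F → ℝ → F, (∀ᶠ x in 𝓝 x₀, IsSol V v x (Ψ x)) ∧
      (∀ τ ∈ Icc (-1 : ℝ) 1, ContDiffAt ℝ (⊤ : ℕ∞) (fun x => Ψ x τ) x₀) ∧
      ∀ Y : F, fderiv ℝ (fun x => Ψ x 0) x₀ Y = Y ∧ ∀ τ ∈ Icc (-1 : ℝ) 1,
        HasDerivWithinAt (fun τ => fderiv ℝ (fun x => Ψ x τ) x₀ Y)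
          (fderiv ℝ v (γ₀ τ) (fderiv ℝ (fun x => Ψ x τ) x₀ Y)) (Icc (-1) 1) τ := by
  have hvc := hv.continuousOn
  have hv1 : ContDiffOn ℝ 1 v V := hv.of_le (by exact_mod_cast le_top)
  have hdc : ContinuousOn (fderiv ℝ v) V := hv1.continuousOn_fderiv_of_isOpen hV le_rfl
  let c₀ : C(TimeInterval, F) :=
    ⟨fun τ => γ₀ τ, continuousOn_iff_continuous_domRestrict.1 hγ₀.continuousOn⟩
  have hc₀ : ∀ τ, c₀ τ = γ₀ τ := fun _ => rfl
  have hc₀V : ∀ τ, c₀ τ ∈ V := fun τ => hγ₀.mem τ τ.2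
  have hsmooth : ContDiffAt ℝ (⊤ : ℕ∞) (picardMap V v) c₀ :=
    contDiffAt_id.sub (ContDiffAt.comp c₀ (g := (primitive : C(TimeInterval, F) →L[ℝ] _))
      (ContinuousLinearMap.contDiff _).contDiffAt (contDiffAt_superpose hV hv hc₀V))
  have hderiv : ∀ c : C(TimeInterval, F), (∀ τ, c τ ∈ V) → HasFDerivAt (picardMap V v)
      (1 - primitive.comp (pointwiseApply (superpose V (fderiv ℝ v) c))) c := fun c hc =>
    (hasFDerivAt_id c).sub (HasFDerivAt.comp c (g := (primitive : C(TimeInterval, F) →L[ℝ] _))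
      (ContinuousLinearMap.hasFDerivAt _) (hasFDerivAt_superpose hV hv1 hc))
  -- The linearization of the Picard map is one minus a Volterra operator, so the inverse function
  -- theorem applies without any smallness of the time interval.
  obtain ⟨u, hu⟩ := isUnit_one_sub_primitive_comp (superpose V (fderiv ℝ v) c₀)
  let e := ContinuousLinearEquiv.ofUnit u
  have he : HasFDerivAt (picardMap V v)
      (e : C(TimeInterval, F) →L[ℝ] C(TimeInterval, F)) c₀ := by
    have := hderiv c₀ hc₀V
    rw [← hu] at this
    exact this
  have h0 : picardMap V v c₀ = constPath x₀ := picardMap_eq_constPath_of_isSol hvc hγ₀ hc₀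
  let inv := hsmooth.localInverse he (by simp)
  have hinv : ContDiffAt ℝ (⊤ : ℕ∞) inv (constPath x₀) := by
    rw [← h0]; exact hsmooth.to_localInverse he (by simp)
  have hinv0 : inv (constPath x₀) = c₀ := by
    rw [← h0]; exact hsmooth.localInverse_apply_image he (by simp)
  -- Solutions are the preimages of constant paths, so the local inverse composed with `constPath`
  -- parametrizes them by the initial point.
  let ψ : F → C(TimeInterval, F) := fun x => inv (constPath x)
  have hψ : ContDiffAt ℝ (⊤ : ℕ∞) ψ x₀ := hinv.comp x₀ (constPath (F := F)).contDiff.contDiffAt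
  have hψ0 : ψ x₀ = c₀ := hinv0
  have hright : ∀ᶠ x in 𝓝 x₀, picardMap V v (ψ x) = constPath x := by
    have h1 : ∀ᶠ y in 𝓝 (constPath x₀ : C(TimeInterval, F)), picardMap V v (inv y) = y := by
      rw [← h0]
      exact (hsmooth.hasStrictFDerivAt' he (by simp)).eventually_right_inverse
    exact constPath.continuous.continuousAt.eventually h1
  have hmem : ∀ᶠ x in 𝓝 x₀, ∀ τ, ψ x τ ∈ V :=
    hψ.continuousAt.eventually
      ((isOpen_forall_mem hV).mem_nhds (by rw [hψ0]; exact hc₀V))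
  refine ⟨fun x => extendPath (ψ x), ?_, fun τ _ => ?_, fun Y => ?_⟩
  · filter_upwards [hright, hmem] with x h1 h2
    exact isSol_of_picardMap_eq_constPath hvc h2 h1
  · exact (evalPath (timeProj τ)).contDiff.contDiffAt.comp x₀ hψ
  · have hψd : HasFDerivAt ψ (fderiv ℝ ψ x₀) x₀ :=
      (hψ.differentiableAt (by simp)).hasFDerivAt
    set J := fderiv ℝ ψ x₀ Y with hJ
    have heval : ∀ τ, fderiv ℝ (fun x => extendPath (ψ x) τ) x₀ Y = extendPath J τ := by
      intro τ
      have : HasFDerivAt (fun x => extendPath (ψ x) τ)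
          ((evalPath (timeProj τ)).comp (fderiv ℝ ψ x₀)) x₀ :=
        HasFDerivAt.comp x₀ (g := (evalPath (timeProj τ) : C(TimeInterval, F) →L[ℝ] F))
          (ContinuousLinearMap.hasFDerivAt _) hψd
      rw [this.fderiv]; rfl
    -- Differentiating `picardMap V v (ψ x) = constPath x` in `x` gives the variational equation in
    -- integrated form.
    have hlin : J - primitive (pointwiseApply (superpose V (fderiv ℝ v) c₀) J) = constPath Y := by
      have h1 := (hderiv (ψ x₀) (by rw [hψ0]; exact hc₀V)).comp x₀ hψd
      have h2 : HasFDerivAt (fun x => picardMap V v (ψ x))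
          (constPath : F →L[ℝ] C(TimeInterval, F)) x₀ :=
        HasFDerivAt.congr_of_eventuallyEq (f := (constPath : F →L[ℝ] C(TimeInterval, F)))
          (ContinuousLinearMap.hasFDerivAt _) hright
      have h3 := congrArg (fun A => A Y) (h1.unique h2)
      rw [hψ0] at h3
      exact h3
    obtain ⟨hJ0, hJ1⟩ := hasDerivWithinAt_extendPath hlin
    refine ⟨(heval 0).trans hJ0, fun τ hτ => ?_⟩
    simp only [heval]
    have := hJ1 τ hτ
    have e2 : extendPath (pointwiseApply (superpose V (fderiv ℝ v) c₀) J) τ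
        = fderiv ℝ v (γ₀ τ) (extendPath J τ) := by
      rw [extendPath, pointwiseApply_apply, superpose_apply hdc hc₀V, timeProj_of_mem hτ, hc₀,
        extendPath, timeProj_of_mem hτ]
    rwa [e2] at this

/-- The initial points from which there is an integral curve of `v` in `V` on `[-1, 1]`. -/
def domain (V : Set F) (v : F → F) : Set F := {x | ∃ γ, IsSol V v x γ}

open Classical in
/-- The integral curve of `v` in `V` on `[-1, 1]` from `x`, if there is one. -/
def flow (V : Set F) (v : F → F) (x : F) : ℝ → F :=
  if h : ∃ γ, IsSol V v x γ then h.choose else fun _ => x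

lemma isSol_flow {V : Set F} {v : F → F} {x : F} (hx : x ∈ domain V v) :
    IsSol V v x (flow V v x) := by
  have h : ∃ γ, IsSol V v x γ := hx
  rw [flow, dif_pos h]
  exact h.choose_spec

variable {V : Set F} {v : F → F}

/-- By uniqueness the choice made in `flow` is immaterial, so its regularity can be read off any
local family of solutions. -/
lemma flow_eq (hV : IsOpen V) (hv : ContDiffOn ℝ (⊤ : ℕ∞) v V) {x : F} {γ : ℝ → F}
    (hγ : IsSol V v x γ) {τ : ℝ} (hτ : τ ∈ Icc (-1 : ℝ) 1) : flow V v x τ = γ τ :=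
  (isSol_flow ⟨γ, hγ⟩).eqOn hV (hv.of_le (by exact_mod_cast le_top)) hγ τ hτ

lemma eventually_isSol_flow (hV : IsOpen V) (hv : ContDiffOn ℝ (⊤ : ℕ∞) v V) {x₀ : F}
    (hx₀ : x₀ ∈ domain V v) : ∀ᶠ x in 𝓝 x₀, x ∈ domain V v := by
  obtain ⟨γ, hγ⟩ := hx₀
  obtain ⟨Ψ, h, -⟩ := exists_local_flow hV hv hγ
  filter_upwards [h] with x hx using ⟨_, hx⟩

lemma isOpen_domain (hV : IsOpen V) (hv : ContDiffOn ℝ (⊤ : ℕ∞) v V) :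
    IsOpen (domain V v) :=
  isOpen_iff_mem_nhds.2 fun _ hx => eventually_isSol_flow hV hv hx

lemma contDiffAt_flow (hV : IsOpen V) (hv : ContDiffOn ℝ (⊤ : ℕ∞) v V) {x₀ : F}
    (hx₀ : x₀ ∈ domain V v) {τ : ℝ} (hτ : τ ∈ Icc (-1 : ℝ) 1) :
    ContDiffAt ℝ (⊤ : ℕ∞) (fun x => flow V v x τ) x₀ := by
  obtain ⟨Ψ, h, hs, -⟩ := exists_local_flow hV hv (isSol_flow hx₀)
  refine (hs τ hτ).congr_of_eventuallyEq ?_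
  filter_upwards [h] with x hx using flow_eq hV hv hx hτ

/-- The derivative of the flow solves the variational equation. -/
lemma hasDerivWithinAt_fderiv_flow (hV : IsOpen V) (hv : ContDiffOn ℝ (⊤ : ℕ∞) v V) {x₀ : F}
    (hx₀ : x₀ ∈ domain V v) (Y : F) :
    fderiv ℝ (fun x => flow V v x 0) x₀ Y = Y ∧ ∀ τ ∈ Icc (-1 : ℝ) 1,
      HasDerivWithinAt (fun τ => fderiv ℝ (fun x => flow V v x τ) x₀ Y)
        (fderiv ℝ v (flow V v x₀ τ) (fderiv ℝ (fun x => flow V v x τ) x₀ Y)) (Icc (-1) 1) τ := by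
  obtain ⟨Ψ, h, -, hJ⟩ := exists_local_flow hV hv (isSol_flow hx₀)
  have e : ∀ τ ∈ Icc (-1 : ℝ) 1,
      fderiv ℝ (fun x => flow V v x τ) x₀ = fderiv ℝ (fun x => Ψ x τ) x₀ := by
    intro τ hτ
    refine EventuallyEq.fderiv_eq ?_
    filter_upwards [h] with x hx using flow_eq hV hv hx hτ
  obtain ⟨h0, h1⟩ := hJ Y
  refine ⟨by rw [e 0 (by norm_num)]; exact h0, fun τ hτ => ?_⟩
  have := h1 τ hτ
  rw [e τ hτ]
  exact this.congr (fun σ hσ => by rw [e σ hσ]) (by rw [e τ hτ])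

/-- Translations that preserve the vector field preserve its integral curves. -/
lemma IsSol.translate {x : F} {γ : ℝ → F} (hγ : IsSol V v x γ) {u : F}
    (hVu : ∀ y ∈ V, y + u ∈ V) (hvu : ∀ y ∈ V, v (y + u) = v y) :
    IsSol V v (x + u) (fun τ => γ τ + u) :=
  ⟨by rw [hγ.zero], fun τ hτ => hVu _ (hγ.mem τ hτ), fun τ hτ => by
    rw [hvu _ (hγ.mem τ hτ)]; exact (hγ.deriv τ hτ).add_const u⟩

end Flow

end SmoothODE

/-! ### Flows of `r X(t, ·)`, smooth in the scale `r`, the parameter `t` and the initial point. -/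

namespace SmoothODE

section Parametrized

variable {G : Type*} [NormedAddCommGroup G] [NormedSpace ℝ G]

lemma eq_of_hasDerivWithinAt_zero {f : ℝ → G}
    (h : ∀ τ ∈ Icc (-1 : ℝ) 1, HasDerivWithinAt f 0 (Icc (-1) 1) τ) {σ τ : ℝ}
    (hσ : σ ∈ Icc (-1 : ℝ) 1) (hτ : τ ∈ Icc (-1 : ℝ) 1) : f τ = f σ := by
  have := (convex_Icc (-1 : ℝ) 1).norm_image_sub_le_of_norm_hasDerivWithin_le (C := 0) h
    (by simp) hσ hτ
  rw [zero_mul] at this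
  exact sub_eq_zero.1 (norm_le_zero_iff.1 this)

lemma HasDerivWithinAt.snd_snd {γ : ℝ → ℝ × ℝ × G} {γ' : ℝ × ℝ × G} {s : Set ℝ} {τ : ℝ}
    (h : HasDerivWithinAt γ γ' s τ) : HasDerivWithinAt (fun τ => (γ τ).2.2) γ'.2.2 s τ :=
  (((ContinuousLinearMap.snd ℝ ℝ G).comp
    (ContinuousLinearMap.snd ℝ ℝ (ℝ × G))).hasFDerivAt (x := γ τ)).comp_hasDerivWithinAt τ h

/-- The set of `(r, t, y)` with `(t, y) ∈ U`. -/
def paramSet (U : Set (ℝ × G)) : Set (ℝ × ℝ × G) := {p | p.2 ∈ U}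

/-- The vector field `(0, 0, r X(t, y))` at `(r, t, y)`. -/
def paramField (X : ℝ × G → G) (p : ℝ × ℝ × G) : ℝ × ℝ × G := (0, 0, p.1 • X p.2)

/-- `γ` is an integral curve of `r X(t, ·)` on `[-1, 1]`, inside `U`, from `y`. -/
structure IsParamSol (U : Set (ℝ × G)) (X : ℝ × G → G) (r t : ℝ) (y : G) (γ : ℝ → G) : Prop where
  zero : γ 0 = y
  mem : ∀ τ ∈ Icc (-1 : ℝ) 1, (t, γ τ) ∈ U
  deriv : ∀ τ ∈ Icc (-1 : ℝ) 1, HasDerivWithinAt γ (r • X (t, γ τ)) (Icc (-1) 1) τ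

variable {U : Set (ℝ × G)} {X : ℝ × G → G}

lemma isOpen_paramSet (hU : IsOpen U) : IsOpen (paramSet U) := hU.preimage continuous_snd

lemma contDiffOn_paramField (hX : ContDiffOn ℝ (⊤ : ℕ∞) X U) :
    ContDiffOn ℝ (⊤ : ℕ∞) (paramField X) (paramSet U) := by
  refine contDiffOn_const.prodMk (contDiffOn_const.prodMk ?_)
  exact contDiff_fst.contDiffOn.smul (hX.comp contDiff_snd.contDiffOn fun _ h => h)

lemma IsParamSol.isSol {r t : ℝ} {y : G} {γ : ℝ → G} (h : IsParamSol U X r t y γ) :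
    IsSol (paramSet U) (paramField X) (r, t, y) (fun τ => (r, t, γ τ)) :=
  ⟨by rw [h.zero], h.mem, fun τ hτ =>
    (hasDerivWithinAt_const τ _ r).prodMk ((hasDerivWithinAt_const τ _ t).prodMk (h.deriv τ hτ))⟩

lemma IsSol.isParamSol {r t : ℝ} {y : G} {γ : ℝ → ℝ × ℝ × G}
    (h : IsSol (paramSet U) (paramField X) (r, t, y) γ) :
    IsParamSol U X r t y (fun τ => (γ τ).2.2) := by
  have h0 : (0 : ℝ) ∈ Icc (-1 : ℝ) 1 := by norm_num
  -- The parameters are state variables with zero velocity, hence constant along the curve.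
  have h1 : ∀ τ ∈ Icc (-1 : ℝ) 1, (γ τ).1 = r := fun τ hτ => by
    rw [eq_of_hasDerivWithinAt_zero (fun σ hσ => (h.deriv σ hσ).fst) h0 hτ, h.zero]
  have h2 : ∀ τ ∈ Icc (-1 : ℝ) 1, (γ τ).2.1 = t := fun τ hτ => by
    rw [eq_of_hasDerivWithinAt_zero (fun σ hσ => (h.deriv σ hσ).snd.fst) h0 hτ, h.zero]
  have h3 : ∀ τ ∈ Icc (-1 : ℝ) 1, (γ τ).2 = (t, (γ τ).2.2) := fun τ hτ => by
    rw [← h2 τ hτ]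
  refine ⟨by rw [h.zero], fun τ hτ => ?_, fun τ hτ => ?_⟩
  · rw [← h3 τ hτ]; exact h.mem τ hτ
  · rw [← h3 τ hτ]
    have : HasDerivWithinAt (fun τ => (γ τ).2.2) (paramField X (γ τ)).2.2 (Icc (-1) 1) τ :=
      HasDerivWithinAt.snd_snd (h.deriv τ hτ)
    simpa only [paramField, h1 τ hτ] using this

/-- The set of `(r, t, y)` for which `r X(t, ·)` has an integral curve on `[-1, 1]` from `y`. -/
def paramDomain (U : Set (ℝ × G)) (X : ℝ × G → G) : Set (ℝ × ℝ × G) :=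
  domain (paramSet U) (paramField X)

lemma IsParamSol.mem_paramDomain {r t : ℝ} {y : G} {γ : ℝ → G} (h : IsParamSol U X r t y γ) :
    (r, t, y) ∈ paramDomain U X := ⟨_, h.isSol⟩

variable [CompleteSpace G]

/-- The integral curve of `r X(t, ·)` on `[-1, 1]` from `y`. -/
def paramFlow (U : Set (ℝ × G)) (X : ℝ × G → G) (r t : ℝ) (y : G) (τ : ℝ) : G :=
  (flow (paramSet U) (paramField X) (r, t, y) τ).2.2

lemma isParamSol_paramFlow {r t : ℝ} {y : G} (h : (r, t, y) ∈ paramDomain U X) :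
    IsParamSol U X r t y (paramFlow U X r t y) := (isSol_flow h).isParamSol

lemma isOpen_paramDomain (hU : IsOpen U) (hX : ContDiffOn ℝ (⊤ : ℕ∞) X U) :
    IsOpen (paramDomain U X) := isOpen_domain (isOpen_paramSet hU) (contDiffOn_paramField hX)

lemma contDiffAt_paramFlow (hU : IsOpen U) (hX : ContDiffOn ℝ (⊤ : ℕ∞) X U) {p : ℝ × ℝ × G}
    (hp : p ∈ paramDomain U X) {τ : ℝ} (hτ : τ ∈ Icc (-1 : ℝ) 1) :
    ContDiffAt ℝ (⊤ : ℕ∞) (fun p : ℝ × ℝ × G => paramFlow U X p.1 p.2.1 p.2.2 τ) p :=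
  contDiff_snd.contDiffAt.comp p (contDiff_snd.contDiffAt.comp p
    (contDiffAt_flow (isOpen_paramSet hU) (contDiffOn_paramField hX) hp hτ))

lemma paramFlow_eq (hU : IsOpen U) (hX : ContDiffOn ℝ (⊤ : ℕ∞) X U) {r t : ℝ} {y : G} {γ : ℝ → G}
    (h : IsParamSol U X r t y γ) {τ : ℝ} (hτ : τ ∈ Icc (-1 : ℝ) 1) :
    paramFlow U X r t y τ = γ τ := by
  rw [paramFlow, flow_eq (isOpen_paramSet hU) (contDiffOn_paramField hX) h.isSol hτ]

/-- A curve on `[0, 1]` that solves the equation as long as it is in `U` is `paramFlow`. -/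
lemma paramFlow_eq_of_forall_mem (hU : IsOpen U) (hX : ContDiffOn ℝ (⊤ : ℕ∞) X U) {r t : ℝ} {y : G}
    (h : (r, t, y) ∈ paramDomain U X) {δ : ℝ → G} (hδc : ContinuousOn δ (Icc 0 1))
    (hδ : ∀ τ ∈ Icc (0 : ℝ) 1, (t, δ τ) ∈ U →
      HasDerivWithinAt δ (r • X (t, δ τ)) (Icc 0 1) τ)
    (h0 : δ 0 = y) {τ : ℝ} (hτ : τ ∈ Icc (0 : ℝ) 1) : paramFlow U X r t y τ = δ τ := by
  have := (isParamSol_paramFlow h).isSol.eqOn_right (isOpen_paramSet hU)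
    ((contDiffOn_paramField hX).of_le (by exact_mod_cast le_top))
    (δ := fun τ => (r, t, δ τ)) (by fun_prop)
    (fun σ hσ hm => (hasDerivWithinAt_const σ _ r).prodMk
      ((hasDerivWithinAt_const σ _ t).prodMk (hδ σ hσ hm))) (by rw [h0]) τ hτ
  exact congrArg (fun p => p.2.2) this

/-- At scale zero nothing moves, so the constant curve is a solution on the whole interval. As
`paramDomain` is open, this takes the place of a local existence theorem: a small `r` is a short
time. -/
lemma isParamSol_zero {t : ℝ} {y : G} (h : (t, y) ∈ U) :
    IsParamSol U X 0 t y (fun _ => y) :=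
  ⟨rfl, fun _ _ => h, fun τ _ => by rw [zero_smul]; exact hasDerivWithinAt_const τ _ y⟩

lemma paramFlow_zero (hU : IsOpen U) (hX : ContDiffOn ℝ (⊤ : ℕ∞) X U) {t : ℝ} {y : G}
    (h : (t, y) ∈ U) {τ : ℝ} (hτ : τ ∈ Icc (-1 : ℝ) 1) : paramFlow U X 0 t y τ = y :=
  paramFlow_eq hU hX (isParamSol_zero h) hτ

lemma IsParamSol.translate {r t : ℝ} {y : G} {γ : ℝ → G} (h : IsParamSol U X r t y γ) {u : G}
    (hUu : ∀ s y, (s, y) ∈ U → (s, y + u) ∈ U)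
    (hXu : ∀ s y, (s, y) ∈ U → X (s, y + u) = X (s, y)) :
    IsParamSol U X r t (y + u) (fun τ => γ τ + u) :=
  ⟨by rw [h.zero], fun τ hτ => hUu _ _ (h.mem τ hτ), fun τ hτ => by
    rw [hXu _ _ (h.mem τ hτ)]; exact (h.deriv τ hτ).add_const u⟩

/-- Part of an integral curve, run towards its end point, as an integral curve. -/
lemma IsParamSol.restart {r t : ℝ} {y : G} {γ : ℝ → G} (h : IsParamSol U X r t y γ) {τ : ℝ}
    (hτ : τ ∈ Icc (0 : ℝ) 1) :
    IsParamSol U X (r * (1 - τ)) t (γ τ) (fun σ => γ (τ + (1 - τ) * σ)) := by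
  -- A convex combination of `1` and `σ`, so the time stays in the interval.
  have hm : ∀ σ ∈ Icc (-1 : ℝ) 1, τ + (1 - τ) * σ ∈ Icc (-1 : ℝ) 1 := by
    intro σ hσ
    constructor <;> nlinarith [hσ.1, hσ.2, hτ.1, hτ.2]
  refine ⟨by simp, fun σ hσ => h.mem _ (hm σ hσ), fun σ hσ => ?_⟩
  have hl : HasDerivWithinAt (fun σ : ℝ => τ + (1 - τ) * σ) (1 - τ) (Icc (-1) 1) σ := by
    simpa using (((hasDerivAt_id σ).const_mul (1 - τ)).const_add τ).hasDerivWithinAt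
  have := (h.deriv _ (hm σ hσ)).scomp σ hl hm
  rw [smul_smul, mul_comm (1 - τ) r] at this
  exact this

end Parametrized

end SmoothODE

/-! ### The corrected Moser vector field, abstractly -/

/-- Two closed 2-forms `B(A₀ ·, ·)`, `B(A₁ ·, ·)` on an open subset `D` of a Banach space, invariant
under translations along `e`, which differ by the differential of the invariant 1-form `B(Ga, ·)`,
with linear functions `Θ`, `W` and a base point at which the 2-forms agree and the 1-form
vanishes. -/
structure MoserData (E : Type*) [NormedAddCommGroup E] [NormedSpace ℝ E] where
  /-- the constant form by which covectors are represented -/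
  B : E →L[ℝ] E →L[ℝ] ℝ
  B_inj : ∀ X, (∀ Y, B X Y = 0) → X = 0
  /-- the domain of the forms -/
  D : Set E
  D_open : IsOpen D
  /-- the initial 2-form -/
  A₀ : E → E →L[ℝ] E
  /-- the final 2-form -/
  A₁ : E → E →L[ℝ] E
  /-- a primitive of the difference of the 2-forms -/
  Ga : E → E
  A₀_smooth : ContDiffOn ℝ (⊤ : ℕ∞) A₀ D
  A₁_smooth : ContDiffOn ℝ (⊤ : ℕ∞) A₁ D
  Ga_smooth : ContDiffOn ℝ (⊤ : ℕ∞) Ga D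
  A₀_skew : ∀ p ∈ D, ∀ X Y, B (A₀ p X) Y = -B (A₀ p Y) X
  A₁_skew : ∀ p ∈ D, ∀ X Y, B (A₁ p X) Y = -B (A₁ p Y) X
  A₀_closed : ∀ p ∈ D, ∀ X Y Z, B (fderiv ℝ A₀ p X Y) Z + B (fderiv ℝ A₀ p Y Z) X
    + B (fderiv ℝ A₀ p Z X) Y = 0
  A₁_closed : ∀ p ∈ D, ∀ X Y Z, B (fderiv ℝ A₁ p X Y) Z + B (fderiv ℝ A₁ p Y Z) X
    + B (fderiv ℝ A₁ p Z X) Y = 0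
  Ga_deriv : ∀ p ∈ D, ∀ X Y, B (fderiv ℝ Ga p X) Y - B (fderiv ℝ Ga p Y) X
    = B (A₁ p X) Y - B (A₀ p X) Y
  /-- the direction of invariance -/
  e : E
  D_add : ∀ p ∈ D, ∀ h : ℝ, p + h • e ∈ D
  A₀_add : ∀ p ∈ D, ∀ h : ℝ, A₀ (p + h • e) = A₀ p
  A₁_add : ∀ p ∈ D, ∀ h : ℝ, A₁ (p + h • e) = A₁ p
  Ga_add : ∀ p ∈ D, ∀ h : ℝ, Ga (p + h • e) = Ga p
  /-- the function whose Hamiltonian vector field is considered -/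
  Θ : E →L[ℝ] ℝ
  /-- the function whose level set is the set of initial points -/
  W : E →L[ℝ] ℝ
  W_e : W e = 0
  /-- the representative of `Θ` -/
  gθ : E
  B_gθ : ∀ Y, B gθ Y = Θ Y
  /-- the representative of `W` -/
  gω : E
  B_gω : ∀ Y, B gω Y = W Y
  W_gθ : W gθ ≠ 0
  /-- the base point -/
  b₀ : E
  b₀_mem : b₀ ∈ D
  A₀_base : A₀ b₀ = 1
  A₁_base : A₁ b₀ = 1
  Ga_base : Ga b₀ = 0

/-! ### The Hamiltonian field of `Θ` and the transport of 1-forms along it. -/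

namespace MoserData

variable {E : Type*} [NormedAddCommGroup E] [NormedSpace ℝ E] (M : MoserData E)

/-- The 2-form `(1 - t) A₀ + t A₁`. -/
def A (t : ℝ) (p : E) : E →L[ℝ] E := (1 - t) • M.A₀ p + t • M.A₁ p

lemma A_apply (t : ℝ) (p X : E) : M.A t p X = (1 - t) • M.A₀ p X + t • M.A₁ p X := rfl

lemma A_skew (t : ℝ) {p : E} (hp : p ∈ M.D) (X Y : E) : M.B (M.A t p X) Y = -M.B (M.A t p Y) X := by
  simp only [A_apply, map_add, map_smul, add_apply, smul_apply, M.A₀_skew p hp X Y,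
    M.A₁_skew p hp X Y, smul_eq_mul]
  ring

lemma A_base (t : ℝ) : M.A t M.b₀ = 1 := by
  rw [A, M.A₀_base, M.A₁_base, ← add_smul]; simp

lemma A_add (t : ℝ) {p : E} (hp : p ∈ M.D) (h : ℝ) : M.A t (p + h • M.e) = M.A t p := by
  rw [A, M.A₀_add p hp, M.A₁_add p hp, A]

lemma contDiffOn_A :
    ContDiffOn ℝ (⊤ : ℕ∞) (fun q : ℝ × E => M.A q.1 q.2) {q | q.2 ∈ M.D} := by
  have h0 : ContDiffOn ℝ (⊤ : ℕ∞) (fun q : ℝ × E => M.A₀ q.2) {q | q.2 ∈ M.D} :=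
    M.A₀_smooth.comp contDiffOn_snd fun _ h => h
  have h1 : ContDiffOn ℝ (⊤ : ℕ∞) (fun q : ℝ × E => M.A₁ q.2) {q | q.2 ∈ M.D} :=
    M.A₁_smooth.comp contDiffOn_snd fun _ h => h
  exact ((contDiffOn_const.sub contDiffOn_fst).smul h0).add (contDiffOn_fst.smul h1)

lemma hasFDerivAt_A (t : ℝ) {p : E} (hp : p ∈ M.D) :
    HasFDerivAt (M.A t) ((1 - t) • fderiv ℝ M.A₀ p + t • fderiv ℝ M.A₁ p) p := by
  have h0 := ((M.A₀_smooth.differentiableOn (by simp)).differentiableAt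
    (M.D_open.mem_nhds hp)).hasFDerivAt
  have h1 := ((M.A₁_smooth.differentiableOn (by simp)).differentiableAt
    (M.D_open.mem_nhds hp)).hasFDerivAt
  exact (h0.const_smul (1 - t)).add (h1.const_smul t)

lemma hasFDerivAt_Ga {p : E} (hp : p ∈ M.D) : HasFDerivAt M.Ga (fderiv ℝ M.Ga p) p :=
  ((M.Ga_smooth.differentiableOn (by simp)).differentiableAt (M.D_open.mem_nhds hp)).hasFDerivAt

lemma fderiv_A_apply (t : ℝ) {p : E} (hp : p ∈ M.D) (X Y : E) :
    fderiv ℝ (M.A t) p X Y = (1 - t) • fderiv ℝ M.A₀ p X Y + t • fderiv ℝ M.A₁ p X Y := by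
  rw [(M.hasFDerivAt_A t hp).fderiv]; rfl

lemma A_closed (t : ℝ) {p : E} (hp : p ∈ M.D) (X Y Z : E) :
    M.B (fderiv ℝ (M.A t) p X Y) Z + M.B (fderiv ℝ (M.A t) p Y Z) X
      + M.B (fderiv ℝ (M.A t) p Z X) Y = 0 := by
  simp only [M.fderiv_A_apply t hp, map_add, map_smul, add_apply, smul_apply, smul_eq_mul]
  linear_combination (1 - t) * M.A₀_closed p hp X Y Z + t * M.A₁_closed p hp X Y Z

lemma fderiv_A_skew (t : ℝ) {p : E} (hp : p ∈ M.D) (V X Y : E) :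
    M.B (fderiv ℝ (M.A t) p V X) Y = -M.B (fderiv ℝ (M.A t) p V Y) X := by
  have key : ∀ X Y : E, HasFDerivAt (fun p => M.B (M.A t p X) Y)
      ((M.B.flip Y).comp ((fderiv ℝ (M.A t) p).flip X)) p := by
    intro X Y
    have h := ((M.hasFDerivAt_A t hp).differentiableAt.hasFDerivAt).clm_apply
      (hasFDerivAt_const X p)
    have := (M.B.flip Y).hasFDerivAt.comp p h
    convert! this using 1
    ext V
    simp
  have h2 : (fun p => M.B (M.A t p X) Y) =ᶠ[𝓝 p] fun p => -M.B (M.A t p Y) X := by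
    filter_upwards [M.D_open.mem_nhds hp] with p' hp' using M.A_skew t hp' X Y
  have h3 := (key X Y).unique ((key Y X).neg.congr_of_eventuallyEq h2)
  simpa using congrArg (fun f => f V) h3

variable [CompleteSpace E]

/-- The Hamiltonian vector field of `Θ` for the 2-form `A t`. -/
def Xθ (q : ℝ × E) : E := -Ring.inverse (M.A q.1 q.2) M.gθ

/-- The set where the 2-form `A t` is nondegenerate. -/
def nondeg : Set (ℝ × E) := {q | q.2 ∈ M.D ∧ IsUnit (M.A q.1 q.2)}

/-- Nondegeneracy is taken as invertibility of the operator. This is an open condition, and it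
allows solving for every covector `B(Y, ·)`, although such covectors need not exhaust the dual. -/
lemma isOpen_nondeg : IsOpen M.nondeg :=
  M.contDiffOn_A.continuousOn.isOpen_inter_preimage (M.D_open.preimage continuous_snd) Units.isOpen

lemma base_mem_nondeg (t : ℝ) : (t, M.b₀) ∈ M.nondeg :=
  ⟨M.b₀_mem, by simp [M.A_base]⟩

lemma contDiffOn_inverse :
    ContDiffOn ℝ (⊤ : ℕ∞) (fun q : ℝ × E => Ring.inverse (M.A q.1 q.2)) M.nondeg := by
  intro q hq
  obtain ⟨u, hu⟩ := hq.2
  have h1 : ContDiffAt ℝ (⊤ : ℕ∞) Ring.inverse (M.A q.1 q.2) := by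
    rw [← hu]; exact contDiffAt_ringInverse ℝ u
  exact h1.comp_contDiffWithinAt q ((M.contDiffOn_A.mono fun _ h => h.1) q hq)

lemma contDiffOn_Xθ : ContDiffOn ℝ (⊤ : ℕ∞) M.Xθ M.nondeg :=
  (M.contDiffOn_inverse.clm_apply contDiffOn_const).neg

lemma A_inverse {q : ℝ × E} (hq : q ∈ M.nondeg) (Y : E) :
    M.A q.1 q.2 (Ring.inverse (M.A q.1 q.2) Y) = Y := by
  rw [← mul_apply_eq_comp, Ring.mul_inverse_cancel _ hq.2]; rfl

lemma inverse_A {q : ℝ × E} (hq : q ∈ M.nondeg) (Y : E) :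
    Ring.inverse (M.A q.1 q.2) (M.A q.1 q.2 Y) = Y := by
  rw [← mul_apply_eq_comp, Ring.inverse_mul_cancel _ hq.2]; rfl

lemma A_Xθ {q : ℝ × E} (hq : q ∈ M.nondeg) : M.A q.1 q.2 (M.Xθ q) = -M.gθ := by
  rw [Xθ, map_neg, M.A_inverse hq]

/-- The 2-form is nondegenerate on `nondeg`. -/
lemma eq_of_forall_B_A {q : ℝ × E} (hq : q ∈ M.nondeg) {X X' : E}
    (h : ∀ Y, M.B (M.A q.1 q.2 X) Y = M.B (M.A q.1 q.2 X') Y) : X = X' := by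
  have : M.A q.1 q.2 (X - X') = 0 := M.B_inj _ fun Y => by simp [h Y]
  have h2 := M.inverse_A hq (X - X')
  rw [this, map_zero] at h2
  exact sub_eq_zero.1 h2.symm

/-- The derivative of `Xθ` in the space variable. -/
def L (q : ℝ × E) : E →L[ℝ] E := (fderiv ℝ M.Xθ q).comp (ContinuousLinearMap.inr ℝ ℝ E)

lemma contDiffOn_L : ContDiffOn ℝ (⊤ : ℕ∞) M.L M.nondeg :=
  (M.contDiffOn_Xθ.fderiv_of_isOpen M.isOpen_nondeg (by simp)).clm_comp contDiffOn_const

lemma hasFDerivAt_Xθ {t : ℝ} {p : E} (hq : (t, p) ∈ M.nondeg) :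
    HasFDerivAt (fun p => M.Xθ (t, p)) (M.L (t, p)) p := by
  have h := ((M.contDiffOn_Xθ.differentiableOn (by simp)).differentiableAt
    (M.isOpen_nondeg.mem_nhds hq)).hasFDerivAt
  exact h.comp p (hasFDerivAt_prodMk_right t p)

lemma isOpen_slice {t : ℝ} {S : Set (ℝ × E)} (hS : IsOpen S) : IsOpen {p : E | (t, p) ∈ S} :=
  hS.preimage (by fun_prop)

/-- Differentiate `A t p (Xθ) = -gθ`, whose right-hand side is constant. In this way `L` is
accessible through `A t` without differentiating an inverse. -/
lemma fderiv_A_Xθ {t : ℝ} {p : E} (hq : (t, p) ∈ M.nondeg) (V : E) :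
    fderiv ℝ (M.A t) p V (M.Xθ (t, p)) + M.A t p (M.L (t, p) V) = 0 := by
  have h1 := (M.hasFDerivAt_A t hq.1).differentiableAt.hasFDerivAt.clm_apply (M.hasFDerivAt_Xθ hq)
  have h2 : HasFDerivAt (fun p => M.A t p (M.Xθ (t, p))) (0 : E →L[ℝ] E) p := by
    refine (hasFDerivAt_const (-M.gθ) p).congr_of_eventuallyEq ?_
    filter_upwards [(isOpen_slice M.isOpen_nondeg).mem_nhds hq] with p' hp' using M.A_Xθ hp'
  have h3 := congrArg (fun f => f V) (h1.unique h2)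
  simp only [add_apply, ContinuousLinearMap.comp_apply, ContinuousLinearMap.flip_apply,
    zero_apply] at h3
  rw [add_comm]; exact h3

/-- The vector field representing `(A₁ - A₀)(Xθ, ·)` for the 2-form `A t`. -/
def drift (q : ℝ × E) : E :=
  Ring.inverse (M.A q.1 q.2) (M.A₁ q.2 (M.Xθ q) - M.A₀ q.2 (M.Xθ q))

lemma contDiffOn_drift : ContDiffOn ℝ (⊤ : ℕ∞) M.drift M.nondeg := by
  have h0 : ContDiffOn ℝ (⊤ : ℕ∞) (fun q : ℝ × E => M.A₀ q.2) M.nondeg :=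
    M.A₀_smooth.comp contDiffOn_snd fun _ h => h.1
  have h1 : ContDiffOn ℝ (⊤ : ℕ∞) (fun q : ℝ × E => M.A₁ q.2) M.nondeg :=
    M.A₁_smooth.comp contDiffOn_snd fun _ h => h.1
  exact M.contDiffOn_inverse.clm_apply
    ((h1.clm_apply M.contDiffOn_Xθ).sub (h0.clm_apply M.contDiffOn_Xθ))

/-- If the 1-form `B(Ga, ·) + dF` vanishes on `Xθ`, then the vector field of this 1-form for `A t` is
transported by the flow of `Xθ`, up to `drift`. -/
lemma transport_identity {t : ℝ} {p : E} (hq : (t, p) ∈ M.nondeg) {dF : E →L[ℝ] ℝ}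
    {ddF : E →L[ℝ] E →L[ℝ] ℝ} (hsymm : ∀ X Y, ddF X Y = ddF Y X)
    (hγ : ∀ V, M.B (fderiv ℝ M.Ga p V) (M.Xθ (t, p)) + M.B (M.Ga p) (M.L (t, p) V)
      + ddF V (M.Xθ (t, p)) + dF (M.L (t, p) V) = 0) (Ξ Y : E) :
    M.B (fderiv ℝ (M.A t) p (M.Xθ (t, p)) Ξ) Y
      + M.B (M.A t p (M.L (t, p) Ξ - M.drift (t, p))) Y
      + M.B (fderiv ℝ M.Ga p (M.Xθ (t, p))) Y + ddF (M.Xθ (t, p)) Y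
      = -(M.B (M.A t p Ξ) (M.L (t, p) Y) + M.B (M.Ga p) (M.L (t, p) Y)
        + dF (M.L (t, p) Y)) := by
  set X := M.Xθ (t, p)
  set L := M.L (t, p)
  have hp : p ∈ M.D := hq.1
  -- Invariantly: `γ = B(Ga, ·) + dF` satisfies `γ(Xθ) = 0`, so its Lie derivative along `Xθ` is
  -- `dγ(Xθ, ·) = (A₁ - A₀)(Xθ, ·)`, represented by `drift`. The form `A t` itself is preserved by
  -- `Xθ`, being closed and contracting with `Xθ` to the constant form `-Θ`.
  have e1 : M.A t p (M.drift (t, p)) = M.A₁ p X - M.A₀ p X := M.A_inverse hq _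
  have e2 := M.Ga_deriv p hp X Y
  have e3 := M.A_closed t hp X Ξ Y
  have e4 : ∀ V, M.A t p (L V) = -fderiv ℝ (M.A t) p V X := fun V =>
    eq_neg_of_add_eq_zero_right (M.fderiv_A_Xθ hq V)
  have e5 := M.fderiv_A_skew t hp Ξ X Y
  have e6 : M.B (M.A t p Ξ) (L Y) = M.B (fderiv ℝ (M.A t) p Y X) Ξ := by
    rw [M.A_skew t hp, e4]; simp
  have e7 := hγ Y
  have e8 := hsymm X Y
  rw [e6]
  simp only [map_sub, e1, e4, map_neg, sub_apply, neg_apply]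
  linarith

end MoserData

namespace MoserData

open SmoothODE

variable {E : Type*} [NormedAddCommGroup E] [NormedSpace ℝ E] [CompleteSpace E] (M : MoserData E)

/-! #### The correction of the primitive -/

/-- The set where `A t` is nondegenerate and `Xθ` is transversal to the level sets of `W`. -/
def reg : Set (ℝ × E) := {q | q ∈ M.nondeg ∧ M.W (M.Xθ q) ≠ 0}

lemma isOpen_reg : IsOpen M.reg :=
  (M.W.continuous.comp_continuousOn M.contDiffOn_Xθ.continuousOn).isOpen_inter_preimage
    M.isOpen_nondeg isOpen_ne

lemma Xθ_base (t : ℝ) : M.Xθ (t, M.b₀) = -M.gθ := by simp [Xθ, M.A_base]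

lemma base_mem_reg (t : ℝ) : (t, M.b₀) ∈ M.reg :=
  ⟨M.base_mem_nondeg t, by simpa [M.Xθ_base] using M.W_gθ⟩

/-- The reciprocal of the speed of `W` along `Xθ`. -/
def speedInv (q : ℝ × E) : ℝ := (M.W (M.Xθ q))⁻¹

lemma contDiffOn_speedInv : ContDiffOn ℝ (⊤ : ℕ∞) M.speedInv M.reg :=
  (M.W.contDiff.comp_contDiffOn (M.contDiffOn_Xθ.mono fun _ h => h.1)).inv fun _ h => h.2

/-- `Xθ`, normalized so that `W` is the time. -/
def Xn (q : ℝ × E) : E := M.speedInv q • M.Xθ q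

lemma contDiffOn_Xn : ContDiffOn ℝ (⊤ : ℕ∞) M.Xn M.reg :=
  M.contDiffOn_speedInv.smul (M.contDiffOn_Xθ.mono fun _ h => h.1)

lemma W_Xn {q : ℝ × E} (hq : q ∈ M.reg) : M.W (M.Xn q) = 1 := by
  rw [Xn, map_smul, speedInv, smul_eq_mul, inv_mul_cancel₀ hq.2]

/-- The derivative of the correction along `Xn`. -/
def rate (q : ℝ × E) : ℝ := -M.B (M.Ga q.2) (M.Xn q)

lemma contDiffOn_rate : ContDiffOn ℝ (⊤ : ℕ∞) M.rate M.reg := by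
  have h : ContDiffOn ℝ (⊤ : ℕ∞) (fun q : ℝ × E => M.B (M.Ga q.2)) M.reg :=
    M.B.contDiff.comp_contDiffOn (M.Ga_smooth.comp contDiffOn_snd fun _ h => h.1.1)
  exact (h.clm_apply M.contDiffOn_Xn).neg

/-- The space variables for which `(t, x) ∈ S`, together with a further variable. -/
def lift (K : Type*) (S : Set (ℝ × E)) : Set (ℝ × E × K) := {p | (p.1, p.2.1) ∈ S}

lemma isOpen_lift (K : Type*) [TopologicalSpace K] {S : Set (ℝ × E)} (hS : IsOpen S) :
    IsOpen (lift K S) := hS.preimage (by fun_prop)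

lemma contDiff_toBase (K : Type*) [NormedAddCommGroup K] [NormedSpace ℝ K] :
    ContDiff ℝ (⊤ : ℕ∞) (fun p : ℝ × E × K => (p.1, p.2.1)) := by fun_prop

/-- The vector field `Xn`, together with the integral of `rate` along it. -/
def fieldF (p : ℝ × E × ℝ) : E × ℝ := (M.Xn (p.1, p.2.1), M.rate (p.1, p.2.1))

lemma contDiffOn_fieldF : ContDiffOn ℝ (⊤ : ℕ∞) M.fieldF (lift ℝ M.reg) :=
  (M.contDiffOn_Xn.comp (contDiff_toBase ℝ).contDiffOn fun _ h => h).prodMk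
    (M.contDiffOn_rate.comp (contDiff_toBase ℝ).contDiffOn fun _ h => h)

/-- The flow of `fieldF`. -/
def flowF : ℝ → ℝ → E × ℝ → ℝ → E × ℝ := paramFlow (lift ℝ M.reg) M.fieldF

/-- The point `(W b₀ - W p, t, (p, 0))`, from which `flowF` reaches the level set of `W`. -/
def startF (q : ℝ × E) : ℝ × ℝ × E × ℝ := (M.W M.b₀ - M.W q.2, q.1, q.2, 0)

lemma contDiff_startF : ContDiff ℝ (⊤ : ℕ∞) M.startF := by
  unfold startF; fun_prop

/-- The domain of the correction. -/
def domF : Set (ℝ × E) := {q | M.startF q ∈ paramDomain (lift ℝ M.reg) M.fieldF}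

lemma isOpen_domF : IsOpen M.domF :=
  (isOpen_paramDomain (G := E × ℝ) (isOpen_lift ℝ M.isOpen_reg) M.contDiffOn_fieldF).preimage
    M.contDiff_startF.continuous

/-- The integral curve of `fieldF` from `p` to the level set of `W`. -/
def pathF (q : ℝ × E) : ℝ → E × ℝ := M.flowF (M.W M.b₀ - M.W q.2) q.1 (q.2, 0)

lemma isParamSol_pathF {q : ℝ × E} (hq : q ∈ M.domF) :
    IsParamSol (lift ℝ M.reg) M.fieldF (M.W M.b₀ - M.W q.2) q.1 (q.2, 0) (M.pathF q) :=
  isParamSol_paramFlow hq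

lemma pathF_eq {t : ℝ} {p : E} {γ : ℝ → E × ℝ}
    (h : IsParamSol (lift ℝ M.reg) M.fieldF (M.W M.b₀ - M.W p) t (p, 0) γ) {τ : ℝ}
    (hτ : τ ∈ Icc (-1 : ℝ) 1) : M.pathF (t, p) τ = γ τ :=
  paramFlow_eq (G := E × ℝ) (isOpen_lift ℝ M.isOpen_reg) M.contDiffOn_fieldF h hτ

lemma contDiffOn_pathF {τ : ℝ} (hτ : τ ∈ Icc (-1 : ℝ) 1) :
    ContDiffOn ℝ (⊤ : ℕ∞) (fun q => M.pathF q τ) M.domF := fun q hq =>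
  (ContDiffAt.comp q (contDiffAt_paramFlow (G := E × ℝ) (isOpen_lift ℝ M.isOpen_reg) M.contDiffOn_fieldF hq hτ)
    M.contDiff_startF.contDiffAt).contDiffWithinAt

lemma zero_mem_Icc : (0 : ℝ) ∈ Icc (-1 : ℝ) 1 := by norm_num

lemma one_mem_Icc : (1 : ℝ) ∈ Icc (-1 : ℝ) 1 := by norm_num

lemma domF_sub {q : ℝ × E} (hq : q ∈ M.domF) : q ∈ M.reg := by
  have h := (M.isParamSol_pathF hq).mem 0 zero_mem_Icc
  rw [(M.isParamSol_pathF hq).zero] at h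
  exact h

lemma mem_domF_of_W {t : ℝ} {p : E} (h : (t, p) ∈ M.reg) (hW : M.W p = M.W M.b₀) :
    (t, p) ∈ M.domF := by
  have : IsParamSol (lift ℝ M.reg) M.fieldF 0 t (p, 0) _ := isParamSol_zero (y := (p, (0 : ℝ))) h
  have := this.mem_paramDomain
  have e : M.W M.b₀ - M.W p = 0 := by rw [hW, sub_self]
  change (M.W M.b₀ - M.W p, t, p, (0 : ℝ)) ∈ paramDomain (lift ℝ M.reg) M.fieldF
  rwa [e]

lemma pathF_of_W {t : ℝ} {p : E} (h : (t, p) ∈ M.reg) (hW : M.W p = M.W M.b₀) {τ : ℝ}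
    (hτ : τ ∈ Icc (-1 : ℝ) 1) : M.pathF (t, p) τ = (p, 0) := by
  rw [pathF, hW, sub_self]
  exact paramFlow_zero (G := E × ℝ) (isOpen_lift ℝ M.isOpen_reg) M.contDiffOn_fieldF
    (y := (p, (0 : ℝ))) h hτ

lemma hasDerivWithinAt_fst {K : Type*} [NormedAddCommGroup K] [NormedSpace ℝ K] {γ : ℝ → E × K}
    {γ' : E × K} {s : Set ℝ} {τ : ℝ} (h : HasDerivWithinAt γ γ' s τ) :
    HasDerivWithinAt (fun τ => (γ τ).1) γ'.1 s τ :=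
  ((ContinuousLinearMap.fst ℝ E K).hasFDerivAt (x := γ τ)).comp_hasDerivWithinAt τ h

lemma hasDerivWithinAt_snd {K : Type*} [NormedAddCommGroup K] [NormedSpace ℝ K] {γ : ℝ → E × K}
    {γ' : E × K} {s : Set ℝ} {τ : ℝ} (h : HasDerivWithinAt γ γ' s τ) :
    HasDerivWithinAt (fun τ => (γ τ).2) γ'.2 s τ :=
  ((ContinuousLinearMap.snd ℝ E K).hasFDerivAt (x := γ τ)).comp_hasDerivWithinAt τ h

/-- `W` is affine along integral curves of `Xn`. -/
lemma W_of_isParamSol {r t : ℝ} {y : E} {γ : ℝ → E} (h : IsParamSol M.reg M.Xn r t y γ) {τ : ℝ}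
    (hτ : τ ∈ Icc (-1 : ℝ) 1) : M.W (γ τ) = M.W y + r * τ := by
  have hd : ∀ σ ∈ Icc (-1 : ℝ) 1,
      HasDerivWithinAt (fun σ => M.W (γ σ) - r * σ) 0 (Icc (-1) 1) σ := by
    intro σ hσ
    have h1 := M.W.hasFDerivAt.comp_hasDerivWithinAt σ (h.deriv σ hσ)
    rw [map_smul, M.W_Xn (h.mem σ hσ)] at h1
    have h2 := ((hasDerivAt_id σ).const_mul r).hasDerivWithinAt (s := Icc (-1) 1)
    have h3 := h1.sub h2
    rw [smul_eq_mul, sub_self] at h3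
    exact h3
  have := eq_of_hasDerivWithinAt_zero hd zero_mem_Icc hτ
  rw [h.zero] at this
  linarith

lemma isParamSol_pathF_fst {q : ℝ × E} (hq : q ∈ M.domF) :
    IsParamSol M.reg M.Xn (M.W M.b₀ - M.W q.2) q.1 q.2 (fun τ => (M.pathF q τ).1) := by
  have h := M.isParamSol_pathF hq
  refine ⟨by rw [h.zero], h.mem, fun τ hτ => hasDerivWithinAt_fst (h.deriv τ hτ)⟩

/-- The point of the level set of `W` that `p` is connected to. -/
def foot (q : ℝ × E) : E := (M.pathF q 1).1

lemma W_foot {q : ℝ × E} (hq : q ∈ M.domF) : M.W (M.foot q) = M.W M.b₀ := by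
  have := M.W_of_isParamSol (M.isParamSol_pathF_fst hq) one_mem_Icc
  rw [foot, this]; ring

lemma foot_mem_reg {q : ℝ × E} (hq : q ∈ M.domF) : (q.1, M.foot q) ∈ M.reg :=
  (M.isParamSol_pathF hq).mem 1 one_mem_Icc

lemma contDiffOn_foot : ContDiffOn ℝ (⊤ : ℕ∞) M.foot M.domF :=
  contDiff_fst.comp_contDiffOn (M.contDiffOn_pathF one_mem_Icc)

/-- The correction `F`. -/
def F (q : ℝ × E) : ℝ := -(M.pathF q 1).2

lemma contDiffOn_F : ContDiffOn ℝ (⊤ : ℕ∞) M.F M.domF :=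
  (contDiff_snd.comp_contDiffOn (M.contDiffOn_pathF one_mem_Icc)).neg

lemma F_of_W {t : ℝ} {p : E} (h : (t, p) ∈ M.reg) (hW : M.W p = M.W M.b₀) : M.F (t, p) = 0 := by
  rw [F, M.pathF_of_W h hW one_mem_Icc, neg_zero]

lemma foot_of_W {t : ℝ} {p : E} (h : (t, p) ∈ M.reg) (hW : M.W p = M.W M.b₀) :
    M.foot (t, p) = p := by
  rw [foot, M.pathF_of_W h hW one_mem_Icc]

/-- The remaining part of the curve from `p` to the level set is the curve that defines `F` at the
intermediate point, so `F` changes exactly by the integral accumulated so far. -/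
lemma restart_pathF {t : ℝ} {p : E} (hq : (t, p) ∈ M.domF) {τ : ℝ} (hτ : τ ∈ Icc (0 : ℝ) 1) :
    (t, (M.pathF (t, p) τ).1) ∈ M.domF ∧
      M.F (t, (M.pathF (t, p) τ).1) = M.F (t, p) + (M.pathF (t, p) τ).2 := by
  have hτ' : τ ∈ Icc (-1 : ℝ) 1 := ⟨by linarith [hτ.1], hτ.2⟩
  have hW := M.W_of_isParamSol (M.isParamSol_pathF_fst hq) hτ'
  -- `fieldF` does not depend on the accumulated integral, so this coordinate may be reset to zero.
  have h1 := ((M.isParamSol_pathF hq).restart hτ).translate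
    (u := ((0 : E), -(M.pathF (t, p) τ).2)) (fun s y hy => by simpa [lift] using hy)
    (fun s y hy => by simp [fieldF])
  have e1 : M.pathF (t, p) τ + ((0 : E), -(M.pathF (t, p) τ).2) = ((M.pathF (t, p) τ).1, 0) := by
    ext <;> simp
  have e2 : (M.W M.b₀ - M.W p) * (1 - τ) = M.W M.b₀ - M.W (M.pathF (t, p) τ).1 := by
    rw [hW]; ring
  dsimp only at h1
  rw [e1, e2] at h1
  refine ⟨h1.mem_paramDomain, ?_⟩
  rw [F, M.pathF_eq h1 one_mem_Icc, F]
  simp [add_comm]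

lemma contDiffOn_F_slice (t : ℝ) : ContDiffOn ℝ (⊤ : ℕ∞) (fun p => M.F (t, p))
    {p | (t, p) ∈ M.domF} :=
  M.contDiffOn_F.comp (by fun_prop) fun _ h => h

lemma hasFDerivAt_F {t : ℝ} {p : E} (hq : (t, p) ∈ M.domF) :
    HasFDerivAt (fun p => M.F (t, p)) (fderiv ℝ (fun p => M.F (t, p)) p) p :=
  (((M.contDiffOn_F_slice t).differentiableOn (by simp)).differentiableAt
    ((isOpen_slice M.isOpen_domF).mem_nhds hq)).hasFDerivAt

lemma contDiffOn_fderiv_F (t : ℝ) :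
    ContDiffOn ℝ (⊤ : ℕ∞) (fderiv ℝ (fun p => M.F (t, p))) {p | (t, p) ∈ M.domF} :=
  (M.contDiffOn_F_slice t).fderiv_of_isOpen (isOpen_slice M.isOpen_domF) (by simp)

/-- Differentiate `restart_pathF` at time zero. Both sides carry the factor `r`, which is nonzero
off the level set and cancels. -/
lemma fderiv_F_Xn_of_ne {t : ℝ} {p : E} (hq : (t, p) ∈ M.domF) (hW : M.W p ≠ M.W M.b₀) :
    fderiv ℝ (fun p => M.F (t, p)) p (M.Xn (t, p)) = M.rate (t, p) := by
  set r := M.W M.b₀ - M.W p with hr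
  have hr0 : r ≠ 0 := sub_ne_zero.2 hW.symm
  have hs := M.isParamSol_pathF hq
  have hsub : Icc (0 : ℝ) 1 ⊆ Icc (-1) 1 := Icc_subset_Icc (by norm_num) le_rfl
  have hd := (hs.deriv 0 zero_mem_Icc).mono hsub
  have h0 : M.pathF (t, p) 0 = (p, 0) := hs.zero
  rw [h0] at hd
  have h1 : HasDerivWithinAt (fun τ => M.F (t, (M.pathF (t, p) τ).1))
      (fderiv ℝ (fun p => M.F (t, p)) p (r • M.Xn (t, p))) (Icc 0 1) 0 := by
    have hF := M.hasFDerivAt_F hq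
    have e : p = (M.pathF (t, p) 0).1 := by rw [h0]
    exact HasFDerivAt.comp_hasDerivWithinAt_of_eq (0 : ℝ) hF (hasDerivWithinAt_fst hd) e
  have h2 : HasDerivWithinAt (fun τ => M.F (t, (M.pathF (t, p) τ).1))
      (r • M.rate (t, p)) (Icc 0 1) 0 := by
    have := (hasDerivWithinAt_snd hd).const_add (M.F (t, p))
    exact this.congr (fun τ hτ => (M.restart_pathF hq hτ).2)
      (M.restart_pathF hq (by norm_num)).2
  have hu : UniqueDiffWithinAt ℝ (Icc (0 : ℝ) 1) 0 :=
    uniqueDiffOn_Icc zero_lt_one 0 (by norm_num)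
  have h3 := hu.eq_deriv _ h1 h2
  rw [map_smul] at h3
  exact smul_right_injective ℝ hr0 h3

/-- The derivative of the correction along `Xn`. -/
lemma fderiv_F_Xn {t : ℝ} {p : E} (hq : (t, p) ∈ M.domF) :
    fderiv ℝ (fun p => M.F (t, p)) p (M.Xn (t, p)) = M.rate (t, p) := by
  by_cases hW : M.W p = M.W M.b₀
  swap
  · exact M.fderiv_F_Xn_of_ne hq hW
  have hopen : IsOpen {p : E | (t, p) ∈ M.domF} := isOpen_slice M.isOpen_domF
  have hXn : ContinuousOn (fun p => M.Xn (t, p)) {p | (t, p) ∈ M.domF} :=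
    M.contDiffOn_Xn.continuousOn.comp (by fun_prop) fun _ h => M.domF_sub h
  have hrate : ContinuousOn (fun p => M.rate (t, p)) {p | (t, p) ∈ M.domF} :=
    M.contDiffOn_rate.continuousOn.comp (by fun_prop) fun _ h => M.domF_sub h
  have hcont : ContinuousAt (fun p => fderiv ℝ (fun p => M.F (t, p)) p (M.Xn (t, p))
      - M.rate (t, p)) p :=
    ((((M.contDiffOn_fderiv_F t).continuousOn.clm_apply hXn).sub hrate).continuousAt
      (hopen.mem_nhds hq))
  -- On the level set `r = 0` and the curves stand still. The identity is obtained as a limit along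
  -- `gθ`, a direction that leaves the level set because `W gθ ≠ 0`.
  have hline : Tendsto (fun ε : ℝ => p + ε • M.gθ) (𝓝[≠] 0) (𝓝 p) := by
    have : Tendsto (fun ε : ℝ => p + ε • M.gθ) (𝓝 0) (𝓝 (p + (0 : ℝ) • M.gθ)) :=
      Continuous.tendsto (by fun_prop) 0
    rw [zero_smul, add_zero] at this
    exact this.mono_left nhdsWithin_le_nhds
  have hlim := hcont.tendsto.comp hline
  have hzero : (fun ε : ℝ => fderiv ℝ (fun p => M.F (t, p)) (p + ε • M.gθ)
      (M.Xn (t, p + ε • M.gθ)) - M.rate (t, p + ε • M.gθ)) =ᶠ[𝓝[≠] 0] fun _ => 0 := by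
    filter_upwards [hline.eventually (hopen.mem_nhds hq), self_mem_nhdsWithin] with ε h1 h2
    refine sub_eq_zero.2 (M.fderiv_F_Xn_of_ne h1 ?_)
    rw [map_add, map_smul, hW, smul_eq_mul]
    simpa using ⟨h2, M.W_gθ⟩
  have := tendsto_nhds_unique (hlim.congr' hzero) tendsto_const_nhds
  exact sub_eq_zero.1 this

lemma fderiv_F_Xθ {t : ℝ} {p : E} (hq : (t, p) ∈ M.domF) :
    fderiv ℝ (fun p => M.F (t, p)) p (M.Xθ (t, p)) = -M.B (M.Ga p) (M.Xθ (t, p)) := by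
  have h := M.fderiv_F_Xn hq
  rw [rate, Xn, map_smul, map_smul, ← smul_neg] at h
  exact smul_right_injective ℝ (inv_ne_zero (M.domF_sub hq).2) h

/-- At the level set of `W`, the differential of the correction is a multiple of `W`. -/
lemma fderiv_F_of_W {t : ℝ} {p : E} (h : (t, p) ∈ M.reg) (hW : M.W p = M.W M.b₀) (Y : E) :
    fderiv ℝ (fun p => M.F (t, p)) p Y = M.rate (t, p) * M.W Y := by
  have hq := M.mem_domF_of_W h hW
  -- `F` vanishes on the level set, so its differential kills the tangent directions.
  have hker : ∀ V, M.W V = 0 → fderiv ℝ (fun p => M.F (t, p)) p V = 0 := by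
    intro V hV
    have hl : HasDerivAt (fun ε : ℝ => p + ε • V) V 0 := by
      simpa using ((hasDerivAt_id (0 : ℝ)).smul_const V).const_add p
    have h1 := (M.hasFDerivAt_F hq).comp_hasDerivAt_of_eq (0 : ℝ) hl (by simp)
    have h2 : HasDerivAt ((fun p => M.F (t, p)) ∘ fun ε : ℝ => p + ε • V) 0 0 := by
      refine (hasDerivAt_const (0 : ℝ) (0 : ℝ)).congr_of_eventuallyEq ?_
      have hev : ∀ᶠ ε : ℝ in 𝓝 0, p + ε • V ∈ {p : E | (t, p) ∈ M.reg} :=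
        (show ContinuousAt (fun ε : ℝ => p + ε • V) 0 by fun_prop)
          ((isOpen_slice M.isOpen_reg).mem_nhds (by simpa using h))
      filter_upwards [hev] with ε hε
      exact M.F_of_W hε (by rw [map_add, map_smul, hV, smul_zero, add_zero, hW])
    exact h1.unique h2
  -- `Xn` has `W`-component one and spans a complement of `ker W`.
  have h1 := hker (Y - M.W Y • M.Xn (t, p)) (by
    rw [map_sub, map_smul, M.W_Xn h, smul_eq_mul, mul_one, sub_self])
  rw [map_sub, map_smul, M.fderiv_F_Xn hq, sub_eq_zero] at h1
  rw [h1, smul_eq_mul, mul_comm]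

end MoserData

namespace MoserData

open SmoothODE

variable {E : Type*} [NormedAddCommGroup E] [NormedSpace ℝ E] [CompleteSpace E] (M : MoserData E)

/-! #### The corrected vector field -/

/-- The vector field `Xn`, together with the transport of the corrected vector field along it. -/
def fieldX (p : ℝ × E × E) : E × E :=
  (M.Xn (p.1, p.2.1), M.speedInv (p.1, p.2.1) • (M.L (p.1, p.2.1) p.2.2 - M.drift (p.1, p.2.1)))

lemma contDiffOn_fieldX : ContDiffOn ℝ (⊤ : ℕ∞) M.fieldX (lift E M.reg) := by
  have hb := (contDiff_toBase (E := E) E).contDiffOn (s := lift E M.reg)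
  have hreg : MapsTo (fun p : ℝ × E × E => (p.1, p.2.1)) (lift E M.reg) M.reg := fun _ h => h
  have hnd : MapsTo (fun p : ℝ × E × E => (p.1, p.2.1)) (lift E M.reg) M.nondeg := fun _ h => h.1
  have hξ : ContDiffOn ℝ (⊤ : ℕ∞) (fun p : ℝ × E × E => p.2.2) (lift E M.reg) := by fun_prop
  exact (M.contDiffOn_Xn.comp hb hreg).prodMk ((M.contDiffOn_speedInv.comp hb hreg).smul
    (((M.contDiffOn_L.comp hb hnd).clm_apply hξ).sub (M.contDiffOn_drift.comp hb hnd)))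

/-- The corrected vector field, at the level set of `W`. -/
def initX (q : ℝ × E) : E :=
  Ring.inverse (M.A q.1 q.2) (-M.Ga q.2 - M.rate q • M.gω)

lemma contDiffOn_initX : ContDiffOn ℝ (⊤ : ℕ∞) M.initX M.reg :=
  (M.contDiffOn_inverse.mono fun _ h => h.1).clm_apply
    (((M.Ga_smooth.comp contDiffOn_snd fun _ h => h.1.1).neg).sub
      (M.contDiffOn_rate.smul contDiffOn_const))

/-- The starting point of the transport of the corrected vector field to `q`. -/
def startX (q : ℝ × E) : ℝ × ℝ × E × E :=
  (M.W q.2 - M.W M.b₀, q.1, M.foot q, M.initX (q.1, M.foot q))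

lemma contDiffOn_startX : ContDiffOn ℝ (⊤ : ℕ∞) M.startX M.domF := by
  have h1 : ContDiffOn ℝ (⊤ : ℕ∞) (fun q : ℝ × E => (q.1, M.foot q)) M.domF :=
    contDiffOn_fst.prodMk M.contDiffOn_foot
  have h2 : ContDiffOn ℝ (⊤ : ℕ∞) (fun q : ℝ × E => M.W q.2 - M.W M.b₀) M.domF := by fun_prop
  exact h2.prodMk (contDiffOn_fst.prodMk (M.contDiffOn_foot.prodMk
    (M.contDiffOn_initX.comp h1 fun q hq => M.foot_mem_reg hq)))

/-- The domain of the corrected vector field. -/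
def domX : Set (ℝ × E) := {q | q ∈ M.domF ∧ M.startX q ∈ paramDomain (lift E M.reg) M.fieldX}

lemma isOpen_domX : IsOpen M.domX :=
  M.contDiffOn_startX.continuousOn.isOpen_inter_preimage M.isOpen_domF
    (isOpen_paramDomain (G := E × E) (isOpen_lift E M.isOpen_reg) M.contDiffOn_fieldX)

/-- The integral curve of `fieldX` from the level set of `W` to `p`. -/
def pathX (q : ℝ × E) : ℝ → E × E :=
  paramFlow (lift E M.reg) M.fieldX (M.W q.2 - M.W M.b₀) q.1 (M.foot q, M.initX (q.1, M.foot q))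

/-- The corrected vector field. -/
def Xc (q : ℝ × E) : E := (M.pathX q 1).2

lemma isParamSol_pathX {q : ℝ × E} (hq : q ∈ M.domX) :
    IsParamSol (lift E M.reg) M.fieldX (M.W q.2 - M.W M.b₀) q.1
      (M.foot q, M.initX (q.1, M.foot q)) (M.pathX q) := isParamSol_paramFlow hq.2

lemma contDiffOn_Xc : ContDiffOn ℝ (⊤ : ℕ∞) M.Xc M.domX := by
  intro q hq
  have h := contDiffAt_paramFlow (G := E × E) (isOpen_lift E M.isOpen_reg) M.contDiffOn_fieldX
    hq.2 one_mem_Icc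
  exact contDiff_snd.contDiffAt.comp_contDiffWithinAt q
    (h.comp_contDiffWithinAt q ((M.contDiffOn_startX.mono fun _ h => h.1) q hq))

/-- The integral curve of `fieldX` runs along that of `fieldF`, backwards. -/
lemma pathX_fst {q : ℝ × E} (hq : q ∈ M.domX) {σ : ℝ} (hσ : σ ∈ Icc (0 : ℝ) 1) :
    (M.pathX q σ).1 = (M.pathF q (1 - σ)).1 := by
  have hX := M.isParamSol_pathX hq
  have hsol : IsParamSol M.reg M.Xn (M.W q.2 - M.W M.b₀) q.1 (M.foot q)
      (fun σ => (M.pathX q σ).1) :=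
    ⟨by rw [hX.zero], hX.mem, fun τ hτ => hasDerivWithinAt_fst (hX.deriv τ hτ)⟩
  have hF := M.isParamSol_pathF_fst hq.1
  have hm : ∀ σ ∈ Icc (0 : ℝ) 1, 1 - σ ∈ Icc (-1 : ℝ) 1 := fun σ hσ =>
    ⟨by linarith [hσ.2], by linarith [hσ.1]⟩
  have hd : ∀ σ ∈ Icc (0 : ℝ) 1, HasDerivWithinAt (fun σ => (M.pathF q (1 - σ)).1)
      ((M.W q.2 - M.W M.b₀) • M.Xn (q.1, (M.pathF q (1 - σ)).1)) (Icc 0 1) σ := by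
    intro σ hσ
    have hl : HasDerivWithinAt (fun σ : ℝ => 1 - σ) (-1) (Icc 0 1) σ := by
      simpa using ((hasDerivAt_id σ).const_sub 1).hasDerivWithinAt
    have := (hF.deriv _ (hm σ hσ)).scomp σ hl hm
    rw [smul_smul, neg_one_mul, neg_sub] at this
    exact this
  have hσ' : σ ∈ Icc (-1 : ℝ) 1 := ⟨by linarith [hσ.1], hσ.2⟩
  rw [← paramFlow_eq_of_forall_mem (U := M.reg) (X := M.Xn) M.isOpen_reg M.contDiffOn_Xn
    hsol.mem_paramDomain (fun τ hτ => (hd τ hτ).continuousWithinAt) (fun τ hτ _ => hd τ hτ)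
    (by simp [foot]) hσ]
  exact (paramFlow_eq (U := M.reg) (X := M.Xn) M.isOpen_reg M.contDiffOn_Xn hsol hσ').symm

/-- Going to the level set and back returns to the starting point, so the vector carried along the
way back is attached to `q.2`. -/
lemma pathX_one {q : ℝ × E} (hq : q ∈ M.domX) : (M.pathX q 1).1 = q.2 := by
  rw [M.pathX_fst hq (by norm_num), sub_self, (M.isParamSol_pathF hq.1).zero]

/-- The defining property of the corrected vector field. -/
theorem B_A_Xc {t : ℝ} {p : E} (hq : (t, p) ∈ M.domX) (Y : E) :
    M.B (M.A t p (M.Xc (t, p))) Y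
      = -M.B (M.Ga p) Y - fderiv ℝ (fun p => M.F (t, p)) p Y := by
  set Ft : E → ℝ := fun p => M.F (t, p) with hFt
  set s := M.W p - M.W M.b₀ with hs
  set y := M.pathX (t, p) with hy
  have hX : IsParamSol (lift E M.reg) M.fieldX s t (M.foot (t, p), M.initX (t, M.foot (t, p))) y :=
    M.isParamSol_pathX hq
  have hsub : Icc (0 : ℝ) 1 ⊆ Icc (-1) 1 := Icc_subset_Icc (by norm_num) le_rfl
  have hdom : ∀ σ ∈ Icc (0 : ℝ) 1, (t, (y σ).1) ∈ M.domF := by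
    intro σ hσ
    have := (M.restart_pathF hq.1 (τ := 1 - σ) ⟨by linarith [hσ.2], by linarith [hσ.1]⟩).1
    rwa [← M.pathX_fst hq hσ] at this
  -- The defect in the defining equation of the corrected field, along the path. It solves the
  -- homogeneous linear equation `ε' = -ε ∘ K` with initial value zero.
  let ε : ℝ → E →L[ℝ] ℝ := fun σ =>
    M.B (M.A t (y σ).1 (y σ).2) + M.B (M.Ga (y σ).1) + fderiv ℝ Ft (y σ).1
  let K : ℝ → E →L[ℝ] E := fun σ => s • M.speedInv (t, (y σ).1) • M.L (t, (y σ).1)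
  have hycont : ContinuousOn y (Icc 0 1) := fun σ hσ =>
    ((hX.deriv σ (hsub hσ)).mono hsub).continuousWithinAt
  have hderiv : ∀ σ ∈ Icc (0 : ℝ) 1,
      HasDerivWithinAt ε (-((ε σ).comp (K σ))) (Icc 0 1) σ := by
    intro σ hσ
    have hd := (hX.deriv σ (hsub hσ)).mono hsub
    have hd1 := hasDerivWithinAt_fst hd
    have hd2 := hasDerivWithinAt_snd hd
    have hqσ := hdom σ hσ
    have hreg := M.domF_sub hqσ
    have hD : (y σ).1 ∈ M.D := hreg.1.1
    have hA := ((M.hasFDerivAt_A t hD).differentiableAt.hasFDerivAt).comp_hasDerivWithinAt σ hd1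
    have hAΞ := M.B.hasFDerivAt.comp_hasDerivWithinAt σ (hA.clm_apply hd2)
    have hG := M.B.hasFDerivAt.comp_hasDerivWithinAt σ
      ((M.hasFDerivAt_Ga hD).comp_hasDerivWithinAt σ hd1)
    have hddF : HasFDerivAt (fderiv ℝ Ft) (fderiv ℝ (fderiv ℝ Ft) (y σ).1) (y σ).1 :=
      (((M.contDiffOn_fderiv_F t).differentiableOn (by simp)).differentiableAt
        ((isOpen_slice M.isOpen_domF).mem_nhds hqσ)).hasFDerivAt
    have hF := hddF.comp_hasDerivWithinAt σ hd1
    have htot := (hAΞ.add hG).add hF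
    refine htot.congr_deriv ?_
    have hsymm : ∀ V V', fderiv ℝ (fderiv ℝ Ft) (y σ).1 V V'
        = fderiv ℝ (fderiv ℝ Ft) (y σ).1 V' V := by
      have hc : ContDiffAt ℝ 2 Ft (y σ).1 :=
        ((M.contDiffOn_F_slice t).contDiffAt
          ((isOpen_slice M.isOpen_domF).mem_nhds hqσ)).of_le
            (WithTop.coe_le_coe.2 (le_top (a := (2 : ℕ∞))))
      exact fun V V' => hc.isSymmSndFDerivAt (by simp) V V'
    -- The correction was built so that `B(Ga, ·) + dF` vanishes on `Xθ`; this is the derivative of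
    -- that identity.
    have hγ : ∀ V, M.B (fderiv ℝ M.Ga (y σ).1 V) (M.Xθ (t, (y σ).1))
        + M.B (M.Ga (y σ).1) (M.L (t, (y σ).1) V)
        + fderiv ℝ (fderiv ℝ Ft) (y σ).1 V (M.Xθ (t, (y σ).1))
        + fderiv ℝ Ft (y σ).1 (M.L (t, (y σ).1) V) = 0 := by
      intro V
      have hXθ := M.hasFDerivAt_Xθ hreg.1
      have h1 := (M.B.hasFDerivAt.comp _ (M.hasFDerivAt_Ga hD)).clm_apply hXθ
      have h2 := hddF.clm_apply hXθ
      have h3 : HasFDerivAt (fun x => M.B (M.Ga x) (M.Xθ (t, x)) + fderiv ℝ Ft x (M.Xθ (t, x)))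
          (0 : E →L[ℝ] ℝ) (y σ).1 := by
        refine (hasFDerivAt_const (0 : ℝ) _).congr_of_eventuallyEq ?_
        filter_upwards [(isOpen_slice M.isOpen_domF).mem_nhds hqσ] with x hx
        rw [M.fderiv_F_Xθ hx]; ring
      have h4 := congrArg (fun f => f V) ((h1.add h2).unique h3)
      simp only [add_apply, ContinuousLinearMap.comp_apply, ContinuousLinearMap.flip_apply,
        zero_apply, Function.comp_apply] at h4
      linarith
    ext Y
    have key := M.transport_identity hreg.1 hsymm hγ (y σ).2 Y
    simp only [add_apply, ContinuousLinearMap.comp_apply, neg_apply, smul_apply, map_add, map_smul,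
      fieldX, Xn, Prod.smul_fst, Prod.smul_snd, ε, K, smul_eq_mul, map_sub, sub_apply,
      Function.comp_apply] at key ⊢
    linear_combination (s * M.speedInv (t, (y σ).1)) * key
  have hKcont : ContinuousOn K (Icc 0 1) := by
    have h1 : ContinuousOn (fun σ => (t, (y σ).1)) (Icc 0 1) := by fun_prop
    have h2 : MapsTo (fun σ => (t, (y σ).1)) (Icc 0 1) M.reg := fun σ hσ => M.domF_sub (hdom σ hσ)
    have h3 := (M.contDiffOn_speedInv.continuousOn.comp h1 h2).smul
      (M.contDiffOn_L.continuousOn.comp h1 fun σ hσ => (h2 hσ).1)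
    exact (continuousOn_const (c := s)).smul h3
  obtain ⟨C, hC⟩ := isCompact_Icc.exists_bound_of_continuousOn hKcont
  -- At the foot `dF` equals `rate` times `W`, which `rate • gω` represents. The vector `initX` is
  -- the solution for precisely this covector.
  have h0 : ε 0 = 0 := by
    have hz : y 0 = (M.foot (t, p), M.initX (t, M.foot (t, p))) := hX.zero
    have hreg := M.foot_mem_reg hq.1
    ext Y
    simp only [ε, hz, add_apply, zero_apply]
    rw [M.fderiv_F_of_W hreg (M.W_foot hq.1), initX, M.A_inverse hreg.1]
    simp only [map_sub, map_neg, map_smul, sub_apply, neg_apply, smul_apply, M.B_gω, smul_eq_mul]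
    ring
  -- Grönwall's inequality for the norm of the defect, with `C` a bound for `‖K‖` on the compact
  -- interval.
  have hzero := eq_zero_of_abs_deriv_le_mul_abs_self_of_eq_zero_right (f := ε)
    (f' := fun σ => -((ε σ).comp (K σ))) (K := C) (a := 0) (b := 1)
    (fun σ hσ => (hderiv σ hσ).continuousWithinAt)
    (fun σ hσ => hasDerivWithinAt_Ici hσ (hderiv σ (Ico_subset_Icc_self hσ))) h0
    (fun σ hσ => by
      rw [norm_neg, mul_comm]
      exact ((ε σ).opNorm_comp_le (K σ)).trans
        (mul_le_mul_of_nonneg_left (hC σ (Ico_subset_Icc_self hσ)) (norm_nonneg _)))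
    1 (by norm_num)
  have h1 := congrArg (fun f => f Y) hzero
  have hone : (y 1).1 = p := M.pathX_one hq
  simp only [ε, hone, add_apply, zero_apply] at h1
  change M.B (M.A t p (y 1).2) Y = _
  linarith

/-! #### The base point -/

lemma rate_base (t : ℝ) : M.rate (t, M.b₀) = 0 := by simp [rate, M.Ga_base]

lemma initX_base (t : ℝ) : M.initX (t, M.b₀) = 0 := by
  simp [initX, M.rate_base, M.Ga_base]

lemma base_mem_domF (t : ℝ) : (t, M.b₀) ∈ M.domF := M.mem_domF_of_W (M.base_mem_reg t) rfl

lemma startX_base (t : ℝ) : M.startX (t, M.b₀) = (0, t, M.b₀, 0) := by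
  rw [startX, M.foot_of_W (M.base_mem_reg t) rfl, sub_self, M.initX_base]

lemma base_mem_domX (t : ℝ) : (t, M.b₀) ∈ M.domX := by
  refine ⟨M.base_mem_domF t, ?_⟩
  rw [M.startX_base]
  exact (isParamSol_zero (X := M.fieldX) (y := (M.b₀, (0 : E))) (M.base_mem_reg t)).mem_paramDomain

/-- At the base point `Ga` and `rate` vanish, and the transport has length zero. The base points are
therefore equilibria, which keeps their orbits defined up to time one. -/
lemma Xc_base (t : ℝ) : M.Xc (t, M.b₀) = 0 := by
  have h := paramFlow_zero (G := E × E) (y := (M.b₀, (0 : E))) (isOpen_lift E M.isOpen_reg)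
    M.contDiffOn_fieldX (M.base_mem_reg t) one_mem_Icc
  rw [Xc, pathX, M.foot_of_W (M.base_mem_reg t) rfl, sub_self, M.initX_base, h]

/-! #### Invariance -/

lemma nondeg_add {t : ℝ} {p : E} (h : (t, p) ∈ M.nondeg) (k : ℝ) :
    (t, p + k • M.e) ∈ M.nondeg :=
  ⟨M.D_add p h.1 k, by simpa only [M.A_add t h.1] using h.2⟩

lemma Xθ_add {t : ℝ} {p : E} (h : (t, p) ∈ M.nondeg) (k : ℝ) :
    M.Xθ (t, p + k • M.e) = M.Xθ (t, p) := by
  simp only [Xθ, M.A_add t h.1]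

lemma L_add {t : ℝ} {p : E} (h : (t, p) ∈ M.nondeg) (k : ℝ) :
    M.L (t, p + k • M.e) = M.L (t, p) := by
  have h1 : HasFDerivAt (fun p => M.Xθ (t, p + k • M.e)) (M.L (t, p + k • M.e)) p := by
    have := (M.hasFDerivAt_Xθ (M.nondeg_add h k)).comp p ((hasFDerivAt_id p).add_const (k • M.e))
    simpa [Function.comp_def] using this
  refine h1.unique ((M.hasFDerivAt_Xθ h).congr_of_eventuallyEq ?_)
  filter_upwards [(isOpen_slice M.isOpen_nondeg).mem_nhds h] with x hx using M.Xθ_add hx k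

lemma reg_add {t : ℝ} {p : E} (h : (t, p) ∈ M.reg) (k : ℝ) : (t, p + k • M.e) ∈ M.reg :=
  ⟨M.nondeg_add h.1 k, by rw [M.Xθ_add h.1]; exact h.2⟩

lemma speedInv_add {t : ℝ} {p : E} (h : (t, p) ∈ M.nondeg) (k : ℝ) :
    M.speedInv (t, p + k • M.e) = M.speedInv (t, p) := by rw [speedInv, M.Xθ_add h, speedInv]

lemma Xn_add {t : ℝ} {p : E} (h : (t, p) ∈ M.nondeg) (k : ℝ) :
    M.Xn (t, p + k • M.e) = M.Xn (t, p) := by rw [Xn, M.Xθ_add h, M.speedInv_add h, Xn]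

lemma rate_add {t : ℝ} {p : E} (h : (t, p) ∈ M.nondeg) (k : ℝ) :
    M.rate (t, p + k • M.e) = M.rate (t, p) := by
  simp only [rate, M.Xn_add h, M.Ga_add p h.1]

lemma drift_add {t : ℝ} {p : E} (h : (t, p) ∈ M.nondeg) (k : ℝ) :
    M.drift (t, p + k • M.e) = M.drift (t, p) := by
  simp only [drift, M.Xθ_add h, M.A_add t h.1, M.A₀_add p h.1, M.A₁_add p h.1]

lemma initX_add {t : ℝ} {p : E} (h : (t, p) ∈ M.nondeg) (k : ℝ) :
    M.initX (t, p + k • M.e) = M.initX (t, p) := by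
  simp only [initX, M.rate_add h, M.A_add t h.1, M.Ga_add p h.1]

lemma W_add (p : E) (k : ℝ) : M.W (p + k • M.e) = M.W p := by
  rw [map_add, map_smul, M.W_e, smul_zero, add_zero]

/-- The fields do not see translations along `e`, and `W e = 0` preserves the level to be reached,
so a translated curve is the curve of the translated point. -/
lemma pathF_add {t : ℝ} {p : E} (h : (t, p) ∈ M.domF) (k : ℝ) :
    (t, p + k • M.e) ∈ M.domF ∧ ∀ τ ∈ Icc (-1 : ℝ) 1,
      M.pathF (t, p + k • M.e) τ = M.pathF (t, p) τ + (k • M.e, 0) := by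
  have h1 := (M.isParamSol_pathF h).translate (u := (k • M.e, (0 : ℝ)))
    (fun s y hy => M.reg_add hy k)
    (fun s y hy => by
      simp only [fieldF, Prod.fst_add, M.Xn_add (And.left hy), M.rate_add (And.left hy)])
  have e : (p, (0 : ℝ)) + (k • M.e, 0) = (p + k • M.e, 0) := by simp
  dsimp only at h1
  rw [e, ← M.W_add p k] at h1
  exact ⟨h1.mem_paramDomain, fun τ hτ => M.pathF_eq h1 hτ⟩

lemma foot_add {t : ℝ} {p : E} (h : (t, p) ∈ M.domF) (k : ℝ) :
    M.foot (t, p + k • M.e) = M.foot (t, p) + k • M.e := by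
  rw [foot, (M.pathF_add h k).2 1 one_mem_Icc, foot]; simp

lemma pathX_add {t : ℝ} {p : E} (h : (t, p) ∈ M.domX) (k : ℝ) :
    (t, p + k • M.e) ∈ M.domX ∧ ∀ τ ∈ Icc (-1 : ℝ) 1,
      M.pathX (t, p + k • M.e) τ = M.pathX (t, p) τ + (k • M.e, 0) := by
  have h1 := (M.isParamSol_pathX h).translate (u := (k • M.e, (0 : E)))
    (fun s y hy => M.reg_add hy k)
    (fun s y hy => by
      simp only [fieldX, Prod.fst_add, Prod.snd_add, add_zero, M.Xn_add (And.left hy),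
        M.speedInv_add (And.left hy), M.L_add (And.left hy), M.drift_add (And.left hy)])
  have hfoot := M.foot_mem_reg h.1
  have e : (M.foot (t, p), M.initX (t, M.foot (t, p))) + (k • M.e, 0)
      = (M.foot (t, p + k • M.e), M.initX (t, M.foot (t, p + k • M.e))) := by
    rw [M.foot_add h.1, M.initX_add hfoot.1, Prod.mk_add_mk, add_zero]
  dsimp only at h1
  rw [e, ← M.W_add p k] at h1
  exact ⟨⟨(M.pathF_add h.1 k).1, h1.mem_paramDomain⟩,
    fun τ hτ => paramFlow_eq (G := E × E) (isOpen_lift E M.isOpen_reg) M.contDiffOn_fieldX h1 hτ⟩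

lemma domX_add {t : ℝ} {p : E} (h : (t, p) ∈ M.domX) (k : ℝ) : (t, p + k • M.e) ∈ M.domX :=
  (M.pathX_add h k).1

lemma Xc_add {t : ℝ} {p : E} (h : (t, p) ∈ M.domX) (k : ℝ) :
    M.Xc (t, p + k • M.e) = M.Xc (t, p) := by
  rw [Xc, (M.pathX_add h k).2 1 one_mem_Icc, Xc]; simp

end MoserData

namespace SmoothODE

/-! ### Flows of time-dependent vector fields -/

section TimeDependent

variable {G : Type*} [NormedAddCommGroup G] [NormedSpace ℝ G]

/-- `γ` is an integral curve of the time-dependent field `X` on `[-1, 1]`, inside `V`, from `y`. -/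
structure IsTimeSol (V : Set (ℝ × G)) (X : ℝ × G → G) (y : G) (γ : ℝ → G) : Prop where
  zero : γ 0 = y
  mem : ∀ τ ∈ Icc (-1 : ℝ) 1, (τ, γ τ) ∈ V
  deriv : ∀ τ ∈ Icc (-1 : ℝ) 1, HasDerivWithinAt γ (X (τ, γ τ)) (Icc (-1) 1) τ

/-- The vector field `(1, X)`. -/
def timeField (X : ℝ × G → G) (q : ℝ × G) : ℝ × G := (1, X q)

variable {V : Set (ℝ × G)} {X : ℝ × G → G}

lemma contDiffOn_timeField (hX : ContDiffOn ℝ (⊤ : ℕ∞) X V) :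
    ContDiffOn ℝ (⊤ : ℕ∞) (timeField X) V := contDiffOn_const.prodMk hX

lemma IsTimeSol.isSol {y : G} {γ : ℝ → G} (h : IsTimeSol V X y γ) :
    IsSol V (timeField X) (0, y) (fun τ => (τ, γ τ)) :=
  ⟨by rw [h.zero], h.mem, fun τ hτ => (hasDerivWithinAt_id τ _).prodMk (h.deriv τ hτ)⟩

lemma IsSol.isTimeSol {y : G} {γ : ℝ → ℝ × G} (h : IsSol V (timeField X) (0, y) γ) :
    IsTimeSol V X y (fun τ => (γ τ).2) ∧ ∀ τ ∈ Icc (-1 : ℝ) 1, γ τ = (τ, (γ τ).2) := by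
  have h0 : (0 : ℝ) ∈ Icc (-1 : ℝ) 1 := by norm_num
  have h1 : ∀ τ ∈ Icc (-1 : ℝ) 1, (γ τ).1 = τ := fun τ hτ => by
    have := eq_of_hasDerivWithinAt_zero (f := fun τ => (γ τ).1 - τ) (fun σ hσ => by
      have h2 : HasDerivWithinAt (fun τ => (γ τ).1) 1 (Icc (-1) 1) σ :=
        ((ContinuousLinearMap.fst ℝ ℝ G).hasFDerivAt (x := γ σ)).comp_hasDerivWithinAt σ
          (h.deriv σ hσ)
      have h3 := h2.sub (hasDerivWithinAt_id σ (Icc (-1) 1))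
      rw [sub_self] at h3
      exact h3) h0 hτ
    rw [h.zero] at this
    linarith
  have h2 : ∀ τ ∈ Icc (-1 : ℝ) 1, γ τ = (τ, (γ τ).2) := fun τ hτ => Prod.ext (h1 τ hτ) rfl
  refine ⟨⟨by rw [h.zero], fun τ hτ => ?_, fun τ hτ => ?_⟩, h2⟩
  · rw [← h2 τ hτ]; exact h.mem τ hτ
  · rw [← h2 τ hτ]
    exact ((ContinuousLinearMap.snd ℝ ℝ G).hasFDerivAt (x := γ τ)).comp_hasDerivWithinAt τ
      (h.deriv τ hτ)

/-- The initial points of integral curves of `X` on `[-1, 1]`. -/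
def timeDomain (V : Set (ℝ × G)) (X : ℝ × G → G) : Set G :=
  {y | ((0 : ℝ), y) ∈ domain V (timeField X)}

lemma IsTimeSol.mem_timeDomain {y : G} {γ : ℝ → G} (h : IsTimeSol V X y γ) :
    y ∈ timeDomain V X := ⟨_, h.isSol⟩

variable [CompleteSpace G]

/-- The integral curve of `X` on `[-1, 1]` from `y`. -/
def timeFlow (V : Set (ℝ × G)) (X : ℝ × G → G) (y : G) (τ : ℝ) : G :=
  (flow V (timeField X) (0, y) τ).2

lemma isTimeSol_timeFlow {y : G} (h : y ∈ timeDomain V X) :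
    IsTimeSol V X y (timeFlow V X y) := (isSol_flow h).isTimeSol.1

lemma isOpen_timeDomain (hV : IsOpen V) (hX : ContDiffOn ℝ (⊤ : ℕ∞) X V) :
    IsOpen (timeDomain V X) :=
  (isOpen_domain hV (contDiffOn_timeField hX)).preimage (by fun_prop)

lemma timeFlow_eq (hV : IsOpen V) (hX : ContDiffOn ℝ (⊤ : ℕ∞) X V) {y : G} {γ : ℝ → G}
    (h : IsTimeSol V X y γ) {τ : ℝ} (hτ : τ ∈ Icc (-1 : ℝ) 1) : timeFlow V X y τ = γ τ := by
  rw [timeFlow, flow_eq hV (contDiffOn_timeField hX) h.isSol hτ]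

/-- A curve on `[0, 1]` that solves the equation as long as it is in `V` is `timeFlow`. -/
lemma timeFlow_eq_of_forall_mem (hV : IsOpen V) (hX : ContDiffOn ℝ (⊤ : ℕ∞) X V) {y : G}
    (h : y ∈ timeDomain V X) {δ : ℝ → G} (hδc : ContinuousOn δ (Icc 0 1))
    (hδ : ∀ τ ∈ Icc (0 : ℝ) 1, (τ, δ τ) ∈ V → HasDerivWithinAt δ (X (τ, δ τ)) (Icc 0 1) τ)
    (h0 : δ 0 = y) {τ : ℝ} (hτ : τ ∈ Icc (0 : ℝ) 1) : timeFlow V X y τ = δ τ := by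
  have := (isTimeSol_timeFlow h).isSol.eqOn_right hV
    ((contDiffOn_timeField hX).of_le (by exact_mod_cast le_top))
    (δ := fun τ => (τ, δ τ)) (by fun_prop)
    (fun σ hσ hm => (hasDerivWithinAt_id σ _).prodMk (hδ σ hσ hm)) (by rw [h0]) τ hτ
  exact congrArg Prod.snd this

lemma contDiffAt_timeFlow (hV : IsOpen V) (hX : ContDiffOn ℝ (⊤ : ℕ∞) X V) {y : G}
    (h : y ∈ timeDomain V X) {τ : ℝ} (hτ : τ ∈ Icc (-1 : ℝ) 1) :
    ContDiffAt ℝ (⊤ : ℕ∞) (fun y => timeFlow V X y τ) y :=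
  contDiff_snd.contDiffAt.comp y
    (ContDiffAt.comp (f := fun y : G => ((0 : ℝ), y)) y
      (contDiffAt_flow hV (contDiffOn_timeField hX) h hτ) (by fun_prop))

/-- The derivative of the flow solves the variational equation. -/
lemma hasDerivWithinAt_fderiv_timeFlow (hV : IsOpen V) (hX : ContDiffOn ℝ (⊤ : ℕ∞) X V) {y : G}
    (h : y ∈ timeDomain V X) (Y : G) :
    fderiv ℝ (fun y => timeFlow V X y 0) y Y = Y ∧ ∀ τ ∈ Icc (-1 : ℝ) 1,
      HasDerivWithinAt (fun τ => fderiv ℝ (fun y => timeFlow V X y τ) y Y)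
        (fderiv ℝ X (τ, timeFlow V X y τ) (0, fderiv ℝ (fun y => timeFlow V X y τ) y Y))
        (Icc (-1) 1) τ := by
  have hv := contDiffOn_timeField hX
  obtain ⟨h0, h1⟩ := hasDerivWithinAt_fderiv_flow hV hv h ((0 : ℝ), Y)
  set J := fun τ => fderiv ℝ (fun x => flow V (timeField X) x τ) (0, y) ((0 : ℝ), Y) with hJ
  have e : ∀ τ ∈ Icc (-1 : ℝ) 1, fderiv ℝ (fun y => timeFlow V X y τ) y Y = (J τ).2 := by
    intro τ hτ
    have hd := ((contDiffAt_flow hV hv h hτ).differentiableAt (by simp)).hasFDerivAt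
    have h2 := (ContinuousLinearMap.snd ℝ ℝ G).hasFDerivAt.comp y
      (hd.comp y (hasFDerivAt_prodMk_right (0 : ℝ) y))
    rw [show fderiv ℝ (fun y => timeFlow V X y τ) y = _ from h2.fderiv]
    simp [J]
  have hm0 : (0 : ℝ) ∈ Icc (-1 : ℝ) 1 := by norm_num
  have hfield : ∀ τ ∈ Icc (-1 : ℝ) 1, fderiv ℝ (timeField X) (flow V (timeField X) (0, y) τ) (J τ)
      = (0, fderiv ℝ X (τ, timeFlow V X y τ) (J τ)) := by
    intro τ hτ
    have hq : flow V (timeField X) (0, y) τ = (τ, timeFlow V X y τ) :=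
      (isSol_flow h).isTimeSol.2 τ hτ
    have hXd := ((hX.differentiableOn (by simp)).differentiableAt
      (hV.mem_nhds ((isTimeSol_timeFlow h).mem τ hτ))).hasFDerivAt
    have := (hasFDerivAt_const (1 : ℝ) (τ, timeFlow V X y τ)).prodMk hXd
    rw [hq, HasFDerivAt.fderiv (f := timeField X) this]
    simp
  have hd : ∀ τ ∈ Icc (-1 : ℝ) 1,
      HasDerivWithinAt J (0, fderiv ℝ X (τ, timeFlow V X y τ) (J τ)) (Icc (-1) 1) τ := by
    intro τ hτ
    have := h1 τ hτ
    rwa [hfield τ hτ] at this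
  -- Time runs at constant speed in the extended system, so a variation of the initial point alone
  -- never acquires a time component.
  have hJ1 : ∀ τ ∈ Icc (-1 : ℝ) 1, (J τ).1 = 0 := fun τ hτ => by
    rw [eq_of_hasDerivWithinAt_zero (f := fun τ => (J τ).1) (fun σ hσ =>
      ((ContinuousLinearMap.fst ℝ ℝ G).hasFDerivAt (x := J σ)).comp_hasDerivWithinAt σ (hd σ hσ))
      hm0 hτ]
    exact congrArg Prod.fst h0
  refine ⟨by rw [e 0 hm0]; exact congrArg Prod.snd h0, fun τ hτ => ?_⟩
  rw [e τ hτ]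
  have h3 : HasDerivWithinAt (fun τ => (J τ).2) (fderiv ℝ X (τ, timeFlow V X y τ) (J τ))
      (Icc (-1) 1) τ :=
    ((ContinuousLinearMap.snd ℝ ℝ G).hasFDerivAt (x := J τ)).comp_hasDerivWithinAt τ (hd τ hτ)
  have e4 : J τ = (0, (J τ).2) := Prod.ext (hJ1 τ hτ) rfl
  rw [e4] at h3
  exact h3.congr (fun σ hσ => e σ hσ) (e τ hτ)

lemma IsTimeSol.translate {y : G} {γ : ℝ → G} (h : IsTimeSol V X y γ) {u : G}
    (hVu : ∀ s y, (s, y) ∈ V → (s, y + u) ∈ V)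
    (hXu : ∀ s y, (s, y) ∈ V → X (s, y + u) = X (s, y)) :
    IsTimeSol V X (y + u) (fun τ => γ τ + u) :=
  ⟨by rw [h.zero], fun τ hτ => hVu _ _ (h.mem τ hτ), fun τ hτ => by
    rw [hXu _ _ (h.mem τ hτ)]; exact (h.deriv τ hτ).add_const u⟩

end TimeDependent

end SmoothODE

namespace MoserData

open SmoothODE

variable {E : Type*} [NormedAddCommGroup E] [NormedSpace ℝ E] [CompleteSpace E] (M : MoserData E)

/-! #### The flow of the corrected vector field -/

/-- The flow of the corrected vector field. -/
def flowX : E → ℝ → E := timeFlow M.domX M.Xc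

/-- The domain of the flow of the corrected vector field. -/
def flowDomX : Set E := timeDomain M.domX M.Xc

lemma isTimeSol_base {V : Set (ℝ × E)} (k : ℝ) (hV : ∀ t, (t, M.b₀ + k • M.e) ∈ V) :
    IsTimeSol V M.Xc (M.b₀ + k • M.e) (fun _ => M.b₀ + k • M.e) :=
  ⟨rfl, fun τ _ => hV τ, fun τ _ => by
    rw [M.Xc_add (M.base_mem_domX τ), M.Xc_base]; exact hasDerivWithinAt_const τ _ _⟩

lemma base_add_mem_domX (t k : ℝ) : (t, M.b₀ + k • M.e) ∈ M.domX :=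
  M.domX_add (M.base_mem_domX t) k

lemma flowX_base (k : ℝ) {t : ℝ} (ht : t ∈ Icc (-1 : ℝ) 1) :
    M.flowX (M.b₀ + k • M.e) t = M.b₀ + k • M.e :=
  timeFlow_eq M.isOpen_domX M.contDiffOn_Xc (M.isTimeSol_base k fun t => M.base_add_mem_domX t k) ht

lemma flowX_add {p : E} (hp : p ∈ M.flowDomX) (k : ℝ) {t : ℝ} (ht : t ∈ Icc (-1 : ℝ) 1) :
    M.flowX (p + k • M.e) t = M.flowX p t + k • M.e :=
  timeFlow_eq M.isOpen_domX M.contDiffOn_Xc ((isTimeSol_timeFlow hp).translate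
    (fun _ _ h => M.domX_add h k) fun _ _ h => M.Xc_add h k) ht

lemma differentiableAt_flowX {p : E} (hp : p ∈ M.flowDomX) {t : ℝ} (ht : t ∈ Icc (-1 : ℝ) 1) :
    DifferentiableAt ℝ (fun p => M.flowX p t) p :=
  (contDiffAt_timeFlow M.isOpen_domX M.contDiffOn_Xc hp ht).differentiableAt (by simp)

lemma hasFDerivAt_Xc {t : ℝ} {p : E} (hq : (t, p) ∈ M.domX) :
    HasFDerivAt (fun p => M.Xc (t, p)) ((fderiv ℝ M.Xc (t, p)).comp (ContinuousLinearMap.inr ℝ ℝ E))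
      p := by
  have h := ((M.contDiffOn_Xc.differentiableOn (by simp)).differentiableAt
    (M.isOpen_domX.mem_nhds hq)).hasFDerivAt
  exact h.comp p (hasFDerivAt_prodMk_right t p)

/-- The derivative of the equation for the corrected vector field, antisymmetrized. -/
lemma B_A_fderiv_Xc {t : ℝ} {p : E} (hq : (t, p) ∈ M.domX) (V Y : E) :
    M.B (fderiv ℝ (M.A t) p (M.Xc (t, p)) V) Y + M.B (M.A t p (fderiv ℝ M.Xc (t, p) (0, V))) Y
      + M.B (M.A t p V) (fderiv ℝ M.Xc (t, p) (0, Y)) = -(M.B (M.A₁ p V) Y - M.B (M.A₀ p V) Y) := by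
  have hdF := M.domF_sub hq.1
  have hp : p ∈ M.D := hdF.1.1
  set Ft : E → ℝ := fun p => M.F (t, p)
  set Ξ := M.Xc (t, p)
  have hddF : HasFDerivAt (fderiv ℝ Ft) (fderiv ℝ (fderiv ℝ Ft) p) p :=
    (((M.contDiffOn_fderiv_F t).differentiableOn (by simp)).differentiableAt
      ((isOpen_slice M.isOpen_domF).mem_nhds hq.1)).hasFDerivAt
  have hsymm : ∀ V V', fderiv ℝ (fderiv ℝ Ft) p V V' = fderiv ℝ (fderiv ℝ Ft) p V' V := by
    have hc : ContDiffAt ℝ 2 Ft p :=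
      ((M.contDiffOn_F_slice t).contDiffAt
        ((isOpen_slice M.isOpen_domF).mem_nhds hq.1)).of_le
          (WithTop.coe_le_coe.2 (le_top (a := (2 : ℕ∞))))
    exact fun V V' => hc.isSymmSndFDerivAt (by simp) V V'
  -- The derivative in the direction `V` of the equation for `Xc`, tested with `Y`.
  have key : ∀ V Y, M.B (fderiv ℝ (M.A t) p V Ξ) Y
      + M.B (M.A t p (fderiv ℝ M.Xc (t, p) (0, V))) Y + M.B (fderiv ℝ M.Ga p V) Y
      + fderiv ℝ (fderiv ℝ Ft) p V Y = 0 := by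
    intro V Y
    have h1 := (M.B.hasFDerivAt.comp p
      (((M.hasFDerivAt_A t hp).differentiableAt.hasFDerivAt).clm_apply (M.hasFDerivAt_Xc hq)))
    have h2 := M.B.hasFDerivAt.comp p (M.hasFDerivAt_Ga hp)
    have h3 : HasFDerivAt (fun p => M.B (M.A t p (M.Xc (t, p))) + M.B (M.Ga p) + fderiv ℝ Ft p)
        (0 : E →L[ℝ] E →L[ℝ] ℝ) p := by
      refine (hasFDerivAt_const (0 : E →L[ℝ] ℝ) _).congr_of_eventuallyEq ?_
      filter_upwards [(isOpen_slice M.isOpen_domX).mem_nhds hq] with x hx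
      ext Z
      simp only [add_apply, M.B_A_Xc hx, zero_apply]
      ring
    have h4 := congrArg (fun f => f V Y) (((h1.add h2).add hddF).unique h3)
    simp only [add_apply, ContinuousLinearMap.comp_apply, ContinuousLinearMap.flip_apply,
      zero_apply, ContinuousLinearMap.inr_apply, map_add] at h4
    linarith
  -- The difference of the two orders of `V` and `Y` removes the Hessian of `F` and turns the
  -- derivative of `Ga` into `A₁ - A₀`. Closedness and skewness of `A t` collect the rest into the
  -- Lie derivative along `Xc`.
  have e1 := key V Y
  have e2 := key Y V
  have e3 := hsymm V Y
  have e4 := M.Ga_deriv p hp V Y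
  have e5 := M.A_closed t hp Ξ V Y
  have e6 := M.A_skew t hp V (fderiv ℝ M.Xc (t, p) (0, Y))
  have e7 := M.fderiv_A_skew t hp V Y Ξ
  linarith

/-- The flow pulls `A t` back to `A₀`. -/
theorem pullback_flowX {p : E} (hp : p ∈ M.flowDomX) {t : ℝ} (ht : t ∈ Icc (0 : ℝ) 1) (X Y : E) :
    M.B (M.A t (M.flowX p t) (fderiv ℝ (fun p => M.flowX p t) p X))
      (fderiv ℝ (fun p => M.flowX p t) p Y) = M.B (M.A₀ p X) Y := by
  have hs := isTimeSol_timeFlow hp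
  obtain ⟨hX0, hX⟩ := hasDerivWithinAt_fderiv_timeFlow M.isOpen_domX M.contDiffOn_Xc hp X
  obtain ⟨hY0, hY⟩ := hasDerivWithinAt_fderiv_timeFlow M.isOpen_domX M.contDiffOn_Xc hp Y
  set γ := M.flowX p with hγ
  set J : ℝ → E := fun t => fderiv ℝ (fun p => M.flowX p t) p X with hJ
  set K : ℝ → E := fun t => fderiv ℝ (fun p => M.flowX p t) p Y with hK
  -- The pulled back 2-form on a pair of vectors, with the variational solutions `J`, `K`; the claim
  -- is that it does not depend on the time.
  let k : ℝ → ℝ := fun τ =>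
    (1 - τ) * M.B (M.A₀ (γ τ) (J τ)) (K τ) + τ * M.B (M.A₁ (γ τ) (J τ)) (K τ)
  have hd : ∀ τ ∈ Icc (-1 : ℝ) 1, HasDerivWithinAt k 0 (Icc (-1) 1) τ := by
    intro τ hτ
    have hq : (τ, γ τ) ∈ M.domX := hs.mem τ hτ
    have hpD : γ τ ∈ M.D := (M.domF_sub hq.1).1.1
    have hγd := hs.deriv τ hτ
    have hA0 := (((M.A₀_smooth.differentiableOn (by simp)).differentiableAt
      (M.D_open.mem_nhds hpD)).hasFDerivAt).comp_hasDerivWithinAt τ hγd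
    have hA1 := (((M.A₁_smooth.differentiableOn (by simp)).differentiableAt
      (M.D_open.mem_nhds hpD)).hasFDerivAt).comp_hasDerivWithinAt τ hγd
    have h0 := (M.B.hasFDerivAt.comp_hasDerivWithinAt τ (hA0.clm_apply (hX τ hτ))).clm_apply
      (hY τ hτ)
    have h1 := (M.B.hasFDerivAt.comp_hasDerivWithinAt τ (hA1.clm_apply (hX τ hτ))).clm_apply
      (hY τ hτ)
    have hτd := hasDerivWithinAt_id τ (Icc (-1 : ℝ) 1)
    have htot := ((hτd.const_sub 1).mul h0).add (hτd.mul h1)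
    refine htot.congr_deriv ?_
    -- The Lie derivative along `Xc` cancels the explicit time derivative `A₁ - A₀` of `A t`.
    have key := M.B_A_fderiv_Xc hq (J τ) (K τ)
    rw [M.fderiv_A_apply τ hpD] at key
    simp only [A_apply, map_add, map_smul, add_apply, smul_apply, smul_eq_mul] at key
    simp only [map_add, add_apply, Function.comp_apply, id]
    change -1 * M.B (M.A₀ (γ τ) (J τ)) (K τ) + (1 - τ) *
      (M.B (fderiv ℝ M.A₀ (γ τ) (M.Xc (τ, γ τ)) (J τ)) (K τ)
        + M.B (M.A₀ (γ τ) (fderiv ℝ M.Xc (τ, γ τ) (0, J τ))) (K τ)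
        + M.B (M.A₀ (γ τ) (J τ)) (fderiv ℝ M.Xc (τ, γ τ) (0, K τ)))
      + (1 * M.B (M.A₁ (γ τ) (J τ)) (K τ) + τ *
      (M.B (fderiv ℝ M.A₁ (γ τ) (M.Xc (τ, γ τ)) (J τ)) (K τ)
        + M.B (M.A₁ (γ τ) (fderiv ℝ M.Xc (τ, γ τ) (0, J τ))) (K τ)
        + M.B (M.A₁ (γ τ) (J τ)) (fderiv ℝ M.Xc (τ, γ τ) (0, K τ)))) = 0
    linear_combination key
  have hk := eq_of_hasDerivWithinAt_zero hd zero_mem_Icc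
    (show t ∈ Icc (-1 : ℝ) 1 from ⟨by linarith [ht.1], ht.2⟩)
  have hγ0 : γ 0 = p := hs.zero
  have hJ0 : J 0 = X := hX0
  have hK0 : K 0 = Y := hY0
  simp only [k, hγ0, hJ0, hK0, sub_zero, one_mul, zero_mul, add_zero] at hk
  rw [A_apply]
  simp only [map_add, map_smul, add_apply, smul_apply, smul_eq_mul]
  exact hk

end MoserData


/-! ### Arbitrary choices of the corrected flow: existence and uniqueness near the base points. -/

namespace MoserData

open SmoothODE

variable {E : Type*} [NormedAddCommGroup E] [NormedSpace ℝ E] [CompleteSpace E]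

/-- The corrected vector field for `M` with its ingredients, and its flow. -/
structure CorrectedFlow (M : MoserData E) where
  /-- the domain of the vector fields -/
  dom : Set E
  dom_open : IsOpen dom
  base_dom : ∀ k : ℝ, M.b₀ + k • M.e ∈ dom
  dom_sub : dom ⊆ M.D
  /-- the Hamiltonian vector field of `Θ` -/
  Xθ : ℝ → E → E
  Xθ_spec : ∀ t ∈ Icc (0 : ℝ) 1, ∀ p ∈ dom, ∀ Y, M.B (M.A t p (Xθ t p)) Y = -M.Θ Y
  /-- the domain of the flow of `Xθ` -/
  ini : Set E
  ini_open : IsOpen ini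
  base_ini : ∀ k : ℝ, M.b₀ + k • M.e ∈ ini
  /-- the life span of the flow of `Xθ` -/
  s₀ : ℝ
  s₀_pos : 0 < s₀
  /-- the flow of `Xθ` -/
  flowθ : ℝ → ℝ → E → E
  flowθ_zero : ∀ t ∈ Icc (0 : ℝ) 1, ∀ p ∈ ini, M.W p = M.W M.b₀ → flowθ t 0 p = p
  flowθ_mem : ∀ t ∈ Icc (0 : ℝ) 1, ∀ p ∈ ini, M.W p = M.W M.b₀ → ∀ s ∈ Ioo (-s₀) s₀,
    flowθ t s p ∈ dom
  flowθ_deriv : ∀ t ∈ Icc (0 : ℝ) 1, ∀ p ∈ ini, M.W p = M.W M.b₀ → ∀ s ∈ Ioo (-s₀) s₀,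
    HasDerivAt (fun s' => flowθ t s' p) (Xθ t (flowθ t s p)) s
  /-- the correction -/
  F : ℝ → E → ℝ
  F_diff : ∀ t ∈ Icc (0 : ℝ) 1, ∀ p ∈ dom, DifferentiableAt ℝ (F t) p
  F_spec : ∀ t ∈ Icc (0 : ℝ) 1, ∀ p ∈ ini, M.W p = M.W M.b₀ → ∀ s ∈ Ioo (-s₀) s₀,
    F t (flowθ t s p) = -∫ s' in (0 : ℝ)..s, M.B (M.Ga (flowθ t s' p)) (Xθ t (flowθ t s' p))
  /-- the corrected vector field -/
  X : ℝ → E → E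
  X_spec : ∀ t ∈ Icc (0 : ℝ) 1, ∀ p ∈ dom, ∀ Y,
    M.B (M.A t p (X t p)) Y = -M.B (M.Ga p) Y - fderiv ℝ (F t) p Y
  /-- the domain of the flow of the corrected vector field -/
  flowDom : Set E
  flowDom_open : IsOpen flowDom
  base_flowDom : ∀ k : ℝ, M.b₀ + k • M.e ∈ flowDom
  /-- the flow of the corrected vector field -/
  flow : ℝ → E → E
  flow_zero : ∀ p ∈ flowDom, flow 0 p = p
  flow_mem : ∀ p ∈ flowDom, ∀ t ∈ Icc (0 : ℝ) 1, flow t p ∈ dom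
  flow_deriv : ∀ p ∈ flowDom, ∀ t ∈ Icc (0 : ℝ) 1,
    HasDerivWithinAt (fun t' => flow t' p) (X t (flow t p)) (Icc 0 1) t

variable (M : MoserData E)

/-- The tube lemma over the compact time interval. -/
lemma isOpen_forall_Icc {G : Type*} [TopologicalSpace G] {S : Set (ℝ × G)} (hS : IsOpen S) :
    IsOpen {p : G | ∀ t ∈ Icc (0 : ℝ) 1, (t, p) ∈ S} := by
  rw [isOpen_iff_mem_nhds]
  intro p hp
  refine isCompact_Icc.eventually_forall_of_forall_eventually (P := fun p t => (t, p) ∈ S)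
    fun t ht => ?_
  exact (continuous_snd.prodMk continuous_fst).continuousAt.preimage_mem_nhds
    (hS.mem_nhds (hp t ht))

/-! #### Existence -/

/-- The points at which the corrected vector field is defined at all times. -/
def domU : Set E := {p | ∀ t ∈ Icc (0 : ℝ) 1, (t, p) ∈ M.domX}

lemma isOpen_domU : IsOpen M.domU := isOpen_forall_Icc M.isOpen_domX

lemma base_mem_domU (k : ℝ) : M.b₀ + k • M.e ∈ M.domU := fun t _ => M.base_add_mem_domX t k

/-- The part of `domX` over `domU`. -/
def domS : Set (ℝ × E) := M.domX ∩ Prod.snd ⁻¹' M.domU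

lemma isOpen_domS : IsOpen M.domS := M.isOpen_domX.inter (M.isOpen_domU.preimage continuous_snd)

lemma base_mem_domS (t k : ℝ) : (t, M.b₀ + k • M.e) ∈ M.domS :=
  ⟨M.base_add_mem_domX t k, M.base_mem_domU k⟩

lemma domS_add {t : ℝ} {p : E} (h : (t, p) ∈ M.domS) (k : ℝ) : (t, p + k • M.e) ∈ M.domS :=
  ⟨M.domX_add h.1 k, fun s hs => M.domX_add (h.2 s hs) k⟩

lemma domX_nondeg {q : ℝ × E} (h : q ∈ M.domX) : q ∈ M.nondeg := (M.domF_sub h.1).1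

lemma contDiffOn_Xθ_domS : ContDiffOn ℝ (⊤ : ℕ∞) M.Xθ M.domS :=
  M.contDiffOn_Xθ.mono fun _ h => M.domX_nondeg h.1

/-- The points from which the flow of `Xθ` exists up to the time `r`, for all parameters. -/
def iniSet (r : ℝ) : Set E := {p | ∀ t ∈ Icc (0 : ℝ) 1, (r, t, p) ∈ paramDomain M.domS M.Xθ}

lemma isOpen_iniSet (r : ℝ) : IsOpen (M.iniSet r) :=
  isOpen_forall_Icc (S := {q : ℝ × E | (r, q.1, q.2) ∈ paramDomain M.domS M.Xθ})
    ((isOpen_paramDomain M.isOpen_domS M.contDiffOn_Xθ_domS).preimage (by fun_prop))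

/-- At `b₀` the scale `0` works for every `t`, so by compactness in `t` some positive scale does.
Translation along `e` carries it to the whole line of base points, which is not compact but thus has
a common life span. -/
lemma exists_base_mem_iniSet : ∃ r > 0, ∀ k : ℝ, M.b₀ + k • M.e ∈ M.iniSet r := by
  have hopen : IsOpen {r : ℝ | ∀ t ∈ Icc (0 : ℝ) 1, (r, t, M.b₀) ∈ paramDomain M.domS M.Xθ} :=
    isOpen_forall_Icc (S := {q : ℝ × ℝ | (q.2, q.1, M.b₀) ∈ paramDomain M.domS M.Xθ})
      ((isOpen_paramDomain M.isOpen_domS M.contDiffOn_Xθ_domS).preimage (by fun_prop))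
  have h0 : (0 : ℝ) ∈ {r : ℝ | ∀ t ∈ Icc (0 : ℝ) 1, (r, t, M.b₀) ∈ paramDomain M.domS M.Xθ} :=
    fun t _ => (isParamSol_zero (by simpa using M.base_mem_domS t 0)).mem_paramDomain
  obtain ⟨ε, hε, hb⟩ := Metric.isOpen_iff.1 hopen 0 h0
  refine ⟨ε / 2, by positivity, fun k t ht => ?_⟩
  have h1 : (ε / 2, t, M.b₀) ∈ paramDomain M.domS M.Xθ :=
    hb (show ε / 2 ∈ Metric.ball (0 : ℝ) ε by
      rw [Metric.mem_ball, Real.dist_eq, sub_zero, abs_of_pos (by positivity)]; linarith) t ht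
  exact ((isParamSol_paramFlow h1).translate (fun s y h => M.domS_add h k)
    (fun s y h => M.Xθ_add (M.domX_nondeg h.1) k)).mem_paramDomain

lemma hasDerivAt_F_comp {t : ℝ} {γ : ℝ → E} {s : ℝ} (hγ : HasDerivAt γ (M.Xθ (t, γ s)) s)
    (hs : (t, γ s) ∈ M.domF) :
    HasDerivAt (fun s => M.F (t, γ s)) (-M.B (M.Ga (γ s)) (M.Xθ (t, γ s))) s := by
  rw [← M.fderiv_F_Xθ hs]
  exact (M.hasFDerivAt_F hs).comp_hasDerivAt s hγ

/-- Along integral curves of `Xθ` the correction is the integral of the 1-form. -/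
lemma F_comp_sub {t : ℝ} {γ : ℝ → E} {s : ℝ}
    (hγ : ∀ σ ∈ uIcc 0 s, HasDerivAt γ (M.Xθ (t, γ σ)) σ ∧ (t, γ σ) ∈ M.domF) :
    M.F (t, γ s) - M.F (t, γ 0) = -∫ σ in (0 : ℝ)..s, M.B (M.Ga (γ σ)) (M.Xθ (t, γ σ)) := by
  rw [← intervalIntegral.integral_neg]
  refine (intervalIntegral.integral_eq_sub_of_hasDerivAt
    (fun σ hσ => M.hasDerivAt_F_comp (hγ σ hσ).1 (hγ σ hσ).2) ?_).symm
  refine ContinuousOn.intervalIntegrable (ContinuousOn.neg ?_)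
  have hc : ContinuousOn γ (uIcc 0 s) := fun σ hσ => (hγ σ hσ).1.continuousAt.continuousWithinAt
  have hd : ∀ σ ∈ uIcc 0 s, (t, γ σ) ∈ M.nondeg := fun σ hσ => (M.domF_sub (hγ σ hσ).2).1
  exact (M.B.continuous.comp_continuousOn
    (M.Ga_smooth.continuousOn.comp hc fun σ hσ => (hd σ hσ).1)).clm_apply
    (M.contDiffOn_Xθ.continuousOn.comp (by fun_prop) hd)

/-- All fields are restricted to `domS`, so that the curves also remain in `domU`, where the
corrected field exists for every `t` in `[0, 1]` and not just for the current one. -/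
lemma nonempty_correctedFlow : Nonempty M.CorrectedFlow := by
  obtain ⟨r, hr, hbase⟩ := M.exists_base_mem_iniSet
  -- The curves of `r Xθ` on `[-1, 1]` are those of `Xθ` on `[-r, r]`, with the clock `s / r`.
  have hm : ∀ s ∈ Ioo (-r) r, s / r ∈ Ioo (-1 : ℝ) 1 := fun s hs =>
    ⟨by rw [lt_div_iff₀ hr]; linarith [hs.1], by rw [div_lt_iff₀ hr]; linarith [hs.2]⟩
  have hder : ∀ t ∈ Icc (0 : ℝ) 1, ∀ p ∈ M.iniSet r, ∀ s ∈ Ioo (-r) r,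
      HasDerivAt (fun s' => paramFlow M.domS M.Xθ r t p (s' / r))
        (M.Xθ (t, paramFlow M.domS M.Xθ r t p (s / r))) s := by
    intro t ht p hp s hs
    have h1 := ((isParamSol_paramFlow (hp t ht)).deriv _ (Ioo_subset_Icc_self (hm s hs))).hasDerivAt
      (Icc_mem_nhds (hm s hs).1 (hm s hs).2)
    have h2 := h1.scomp s ((hasDerivAt_id s).div_const r)
    rw [smul_smul, one_div, inv_mul_cancel₀ hr.ne', one_smul] at h2
    exact h2
  have hmem : ∀ t ∈ Icc (0 : ℝ) 1, ∀ p ∈ M.iniSet r, ∀ s ∈ Ioo (-r) r,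
      (t, paramFlow M.domS M.Xθ r t p (s / r)) ∈ M.domS := fun t ht p hp s hs =>
    (isParamSol_paramFlow (hp t ht)).mem _ (Ioo_subset_Icc_self (hm s hs))
  have hzero : ∀ t ∈ Icc (0 : ℝ) 1, ∀ p ∈ M.iniSet r,
      paramFlow M.domS M.Xθ r t p (0 / r) = p := fun t ht p hp => by
    rw [zero_div]; exact (isParamSol_paramFlow (hp t ht)).zero
  have hXc : ContDiffOn ℝ (⊤ : ℕ∞) M.Xc M.domS := M.contDiffOn_Xc.mono fun _ h => h.1
  have hIcc : ∀ t ∈ Icc (0 : ℝ) 1, t ∈ Icc (-1 : ℝ) 1 := fun t ht => ⟨by linarith [ht.1], ht.2⟩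
  exact ⟨{
    dom := M.domU
    dom_open := M.isOpen_domU
    base_dom := M.base_mem_domU
    dom_sub := fun p hp => (M.domX_nondeg (hp 0 (by norm_num))).1
    Xθ := fun t p => M.Xθ (t, p)
    Xθ_spec := fun t ht p hp Y => by
      rw [M.A_Xθ (M.domX_nondeg (hp t ht)), map_neg, neg_apply, M.B_gθ]
    ini := M.iniSet r
    ini_open := M.isOpen_iniSet r
    base_ini := hbase
    s₀ := r
    s₀_pos := hr
    flowθ := fun t s p => paramFlow M.domS M.Xθ r t p (s / r)
    flowθ_zero := fun t ht p hp _ => hzero t ht p hp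
    flowθ_mem := fun t ht p hp _ s hs => (hmem t ht p hp s hs).2
    flowθ_deriv := fun t ht p hp _ s hs => hder t ht p hp s hs
    F := fun t p => M.F (t, p)
    F_diff := fun t ht p hp => (M.hasFDerivAt_F (hp t ht).1).differentiableAt
    F_spec := fun t ht p hp hW s hs => by
      have h0 : (0 : ℝ) ∈ Ioo (-r) r := ⟨by linarith, hr⟩
      have hsub : uIcc 0 s ⊆ Ioo (-r) r := (ordConnected_Ioo).uIcc_subset h0 hs
      -- The prescribed integral is the increment of `F` along the curve, and `F` is zero at its
      -- initial point on the level set.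
      have := M.F_comp_sub (t := t) (γ := fun s => paramFlow M.domS M.Xθ r t p (s / r)) (s := s)
        fun σ hσ => ⟨hder t ht p hp σ (hsub hσ), (hmem t ht p hp σ (hsub hσ)).1.1⟩
      have hreg : (t, p) ∈ M.reg := by
        have h := (hmem t ht p hp 0 h0).1.1
        rw [hzero t ht p hp] at h
        exact M.domF_sub h
      rw [← this, hzero t ht p hp, M.F_of_W hreg hW, sub_zero]
    X := fun t p => M.Xc (t, p)
    X_spec := fun t ht p hp Y => M.B_A_Xc (hp t ht) Y
    flowDom := timeDomain M.domS M.Xc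
    flowDom_open := isOpen_timeDomain M.isOpen_domS hXc
    base_flowDom := fun k => (M.isTimeSol_base k fun t => M.base_mem_domS t k).mem_timeDomain
    flow := fun t p => timeFlow M.domS M.Xc p t
    flow_zero := fun p hp => (isTimeSol_timeFlow hp).zero
    flow_mem := fun p hp t ht => ((isTimeSol_timeFlow hp).mem t (hIcc t ht)).2
    flow_deriv := fun p hp t ht => ((isTimeSol_timeFlow hp).deriv t (hIcc t ht)).mono hIcc }⟩

/-! #### Uniqueness -/

namespace CorrectedFlow

variable {M} (D : M.CorrectedFlow)

lemma Xθ_eq {t : ℝ} (ht : t ∈ Icc (0 : ℝ) 1) {p : E} (hp : p ∈ D.dom) (hq : (t, p) ∈ M.nondeg) :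
    D.Xθ t p = M.Xθ (t, p) :=
  M.eq_of_forall_B_A hq fun Y => by
    rw [D.Xθ_spec t ht p hp, M.A_Xθ hq, map_neg, neg_apply, M.B_gθ]

/-- The set of `(t, x, v, s)` such that `x` and `v` are in the domain of `Xn`, and `s` is in the
life span of the flow of `Xθ`. -/
def lifeSet : Set (ℝ × E × E × ℝ) :=
  {q | ((q.1, q.2.1) ∈ M.reg ∧ (q.1, q.2.2.1) ∈ M.reg) ∧ q.2.1 ∈ D.dom ∧
    q.2.2.2 ∈ Ioo (-D.s₀) D.s₀}

lemma isOpen_lifeSet : IsOpen D.lifeSet :=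
  ((M.isOpen_reg.preimage (f := fun q : ℝ × E × E × ℝ => (q.1, q.2.1)) (by fun_prop)).inter
    (M.isOpen_reg.preimage (f := fun q : ℝ × E × E × ℝ => (q.1, q.2.2.1)) (by fun_prop))).inter
    ((D.dom_open.preimage (f := fun q : ℝ × E × E × ℝ => q.2.1) (by fun_prop)).inter
      (isOpen_Ioo.preimage (f := fun q : ℝ × E × E × ℝ => q.2.2.2) (by fun_prop)))

/-- The vector field `Xθ` in `x`, driven by the normalized vector field in `v`, together with the
time `s` of `x`. -/
def lifeField (M : MoserData E) (q : ℝ × E × E × ℝ) : E × E × ℝ :=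
  (M.speedInv (q.1, q.2.2.1) • M.Xθ (q.1, q.2.1), M.Xn (q.1, q.2.2.1), M.speedInv (q.1, q.2.2.1))

lemma contDiffOn_lifeField : ContDiffOn ℝ (⊤ : ℕ∞) (lifeField M) D.lifeSet := by
  have h1 : ContDiffOn ℝ (⊤ : ℕ∞) (fun q : ℝ × E × E × ℝ => (q.1, q.2.1)) D.lifeSet := by fun_prop
  have h2 : ContDiffOn ℝ (⊤ : ℕ∞) (fun q : ℝ × E × E × ℝ => (q.1, q.2.2.1)) D.lifeSet := by
    fun_prop
  have hs := M.contDiffOn_speedInv.comp h2 fun q hq => hq.1.2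
  exact (hs.smul (M.contDiffOn_Xθ.comp h1 fun q hq => hq.1.1.1)).prodMk
    ((M.contDiffOn_Xn.comp h2 fun q hq => hq.1.2).prodMk hs)

/-- The points which the flow of `Xθ` reaches from the level set of `W`. -/
def reach : Set (ℝ × E) :=
  {q | (q ∈ M.domX ∧ q.2 ∈ D.dom) ∧ (M.foot q ∈ D.ini ∧
    (M.W q.2 - M.W M.b₀, q.1, M.foot q, M.foot q, (0 : ℝ)) ∈ paramDomain D.lifeSet (lifeField M))}

lemma isOpen_reach : IsOpen D.reach := by
  have hfoot : ContinuousOn M.foot (M.domX ∩ Prod.snd ⁻¹' D.dom) :=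
    M.contDiffOn_foot.continuousOn.mono fun _ h => h.1.1
  have hstart : ContinuousOn (fun q : ℝ × E => (M.foot q,
      (M.W q.2 - M.W M.b₀, q.1, M.foot q, M.foot q, (0 : ℝ)))) (M.domX ∩ Prod.snd ⁻¹' D.dom) := by
    fun_prop
  exact hstart.isOpen_inter_preimage (M.isOpen_domX.inter (D.dom_open.preimage continuous_snd))
    (D.ini_open.prod (isOpen_paramDomain (G := E × E × ℝ) D.isOpen_lifeSet D.contDiffOn_lifeField))

lemma base_mem_reach (t k : ℝ) : (t, M.b₀ + k • M.e) ∈ D.reach := by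
  have hX := M.base_add_mem_domX t k
  have hW := M.W_add M.b₀ k
  have hfoot := M.foot_of_W (M.domF_sub hX.1) hW
  refine ⟨⟨hX, D.base_dom k⟩, by rw [hfoot]; exact D.base_ini k, ?_⟩
  rw [hfoot, hW, sub_self]
  have h : (t, M.b₀ + k • M.e, M.b₀ + k • M.e, (0 : ℝ)) ∈ D.lifeSet :=
    ⟨⟨M.domF_sub hX.1, M.domF_sub hX.1⟩, D.base_dom k, by linarith [D.s₀_pos], D.s₀_pos⟩
  exact (isParamSol_zero h).mem_paramDomain

/-- The given `F` is prescribed along `flowθ` in its own time `s`, the constructed one along curves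
whose clock is `W`. The auxiliary system `lifeField` runs both clocks: once the curves are
identified, both corrections are the same integral from the foot to `p`. -/
lemma F_eq {t : ℝ} (ht : t ∈ Icc (0 : ℝ) 1) {p : E} (hq : (t, p) ∈ D.reach) :
    D.F t p = M.F (t, p) := by
  obtain ⟨⟨hX, -⟩, hini, hpar⟩ := hq
  set y := M.foot (t, p) with hy
  set r := M.W p - M.W M.b₀ with hr
  have hWy : M.W y = M.W M.b₀ := M.W_foot hX.1
  have hsub : Icc (0 : ℝ) 1 ⊆ Icc (-1) 1 := Icc_subset_Icc (by norm_num) le_rfl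
  set γ := paramFlow D.lifeSet (lifeField M) r t (y, y, (0 : ℝ)) with hγdef
  have hγ : IsParamSol D.lifeSet (lifeField M) r t (y, y, (0 : ℝ)) γ := isParamSol_paramFlow hpar
  have hd : ∀ σ ∈ Icc (0 : ℝ) 1, HasDerivWithinAt γ (r • lifeField M (t, γ σ)) (Icc 0 1) σ :=
    fun σ hσ => (hγ.deriv σ (hsub hσ)).mono hsub
  have hd2 : ∀ σ ∈ Icc (0 : ℝ) 1, HasDerivWithinAt (fun σ => (γ σ).2.1)
      (r • M.Xn (t, (γ σ).2.1)) (Icc 0 1) σ :=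
    fun σ hσ => hasDerivWithinAt_fst (hasDerivWithinAt_snd (hd σ hσ))
  have hd3 : ∀ σ ∈ Icc (0 : ℝ) 1, HasDerivWithinAt (fun σ => (γ σ).2.2)
      (r • M.speedInv (t, (γ σ).2.1)) (Icc 0 1) σ :=
    fun σ hσ => hasDerivWithinAt_snd (hasDerivWithinAt_snd (hd σ hσ))
  have hc2 : ContinuousOn (fun σ => (γ σ).2.1) (Icc 0 1) := fun σ hσ =>
    (hd2 σ hσ).continuousWithinAt
  have hc3 : ContinuousOn (fun σ => (γ σ).2.2) (Icc 0 1) := fun σ hσ =>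
    (hd3 σ hσ).continuousWithinAt
  have hz2 : (γ 0).2.1 = y := by rw [hγ.zero]
  have hz3 : (γ 0).2.2 = 0 := by rw [hγ.zero]
  have hmem : ∀ σ ∈ Icc (0 : ℝ) 1, (t, γ σ) ∈ D.lifeSet := fun σ hσ => hγ.mem σ (hsub hσ)
  -- `flowθ` is known to remain in `D.dom`, but not in `reg`. The comparison therefore asks for the
  -- equation only while the curve is in the domain.
  have huniq : ∀ δ : ℝ → E, ContinuousOn δ (Icc 0 1) → δ 0 = y →
      (∀ σ ∈ Icc (0 : ℝ) 1, (t, δ σ) ∈ M.reg → δ σ ∈ D.dom →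
        HasDerivWithinAt δ (r • M.speedInv (t, (γ σ).2.1) • M.Xθ (t, δ σ)) (Icc 0 1) σ) →
      ∀ σ ∈ Icc (0 : ℝ) 1, (γ σ).1 = δ σ := by
    intro δ hδc hδ0 hδ σ hσ
    have := paramFlow_eq_of_forall_mem (G := E × E × ℝ) D.isOpen_lifeSet D.contDiffOn_lifeField
      hpar (δ := fun σ => (δ σ, (γ σ).2.1, (γ σ).2.2)) (by fun_prop)
      (fun τ hτ hm => (hδ τ hτ hm.1.1 hm.2.1).prodMk ((hd2 τ hτ).prodMk (hd3 τ hτ)))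
      (by rw [hδ0, hz2, hz3]) hσ
    exact congrArg Prod.fst this
  -- the first two components agree
  have e12 : ∀ σ ∈ Icc (0 : ℝ) 1, (γ σ).1 = (γ σ).2.1 := by
    refine huniq _ hc2 hz2 fun σ hσ _ _ => ?_
    exact hd2 σ hσ
  -- the first component is the flow of `Xθ`
  have e1 : ∀ σ ∈ Icc (0 : ℝ) 1, (γ σ).1 = D.flowθ t (γ σ).2.2 y := by
    have hdθ : ∀ σ ∈ Icc (0 : ℝ) 1, HasDerivWithinAt (fun σ => D.flowθ t (γ σ).2.2 y)
        ((r • M.speedInv (t, (γ σ).2.1)) • D.Xθ t (D.flowθ t (γ σ).2.2 y)) (Icc 0 1) σ :=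
      fun σ hσ => HasDerivAt.scomp_hasDerivWithinAt (g₁ := fun s => D.flowθ t s y) σ
        (D.flowθ_deriv t ht y hini hWy _ (hmem σ hσ).2.2) (hd3 σ hσ)
    refine huniq _ (fun σ hσ => (hdθ σ hσ).continuousWithinAt) ?_ fun σ hσ hm hdom => ?_
    · rw [hz3, D.flowθ_zero t ht y hini hWy]
    · have := hdθ σ hσ
      rw [D.Xθ_eq ht hdom hm.1, smul_assoc] at this
      exact this
  -- the second component is the path of the correction
  have hsol : IsParamSol M.reg M.Xn r t y (fun σ => (M.pathX (t, p) σ).1) :=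
    ⟨by rw [(M.isParamSol_pathX hX).zero], (M.isParamSol_pathX hX).mem, fun τ hτ =>
      hasDerivWithinAt_fst ((M.isParamSol_pathX hX).deriv τ hτ)⟩
  have e2 : ∀ σ ∈ Icc (0 : ℝ) 1, (M.pathX (t, p) σ).1 = (γ σ).2.1 := fun σ hσ => by
    rw [← paramFlow_eq_of_forall_mem (U := M.reg) (X := M.Xn) M.isOpen_reg M.contDiffOn_Xn
      hsol.mem_paramDomain hc2 (fun τ hτ _ => hd2 τ hτ) hz2 hσ]
    exact (paramFlow_eq M.isOpen_reg M.contDiffOn_Xn hsol (hsub hσ)).symm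
  have hdomF : ∀ σ ∈ Icc (0 : ℝ) 1, (t, D.flowθ t (γ σ).2.2 y) ∈ M.domF := by
    intro σ hσ
    rw [← e1 σ hσ, e12 σ hσ, ← e2 σ hσ, M.pathX_fst hX hσ]
    exact (M.restart_pathF hX.1 (τ := 1 - σ) ⟨by linarith [hσ.2], by linarith [hσ.1]⟩).1
  have h1 : (1 : ℝ) ∈ Icc (0 : ℝ) 1 := by norm_num
  have hp1 : D.flowθ t (γ 1).2.2 y = p := by
    rw [← e1 1 h1, e12 1 h1, ← e2 1 h1, M.pathX_one hX]
  have hs1 := (hmem 1 h1).2.2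
  have hspec := D.F_spec t ht y hini hWy _ hs1
  rw [hp1] at hspec
  set s := (γ 1).2.2 with hs
  -- By the intermediate value theorem every time between `0` and `s` is attained by the clock
  -- component, so the information along the parametrized curve covers the whole range of
  -- integration.
  have hivt : uIcc 0 s ⊆ (fun σ => (γ σ).2.2) '' Icc 0 1 := by
    have := intermediate_value_uIcc (a := (0 : ℝ)) (b := 1) (f := fun σ => (γ σ).2.2)
      (by rwa [uIcc_of_le zero_le_one])
    rwa [uIcc_of_le (zero_le_one' ℝ), hz3] at this
  have hcurve : ∀ σ ∈ uIcc 0 s, (HasDerivAt (fun s => D.flowθ t s y)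
      (M.Xθ (t, D.flowθ t σ y)) σ ∧ (t, D.flowθ t σ y) ∈ M.domF) ∧
      D.Xθ t (D.flowθ t σ y) = M.Xθ (t, D.flowθ t σ y) := by
    intro σ hσ
    obtain ⟨τ, hτ, rfl⟩ := hivt hσ
    have hlife := (hmem τ hτ).2.2
    have hF := hdomF τ hτ
    have hdθ := D.flowθ_deriv t ht y hini hWy _ hlife
    have hXθ := D.Xθ_eq ht (D.flowθ_mem t ht y hini hWy _ hlife) (M.domF_sub hF).1
    exact ⟨⟨hXθ ▸ hdθ, hF⟩, hXθ⟩
  have hF := M.F_comp_sub fun σ hσ => (hcurve σ hσ).1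
  rw [hp1, D.flowθ_zero t ht y hini hWy, M.F_of_W (M.foot_mem_reg hX.1) hWy, sub_zero] at hF
  rw [hspec, hF]
  congr 1
  refine intervalIntegral.integral_congr fun σ hσ => ?_
  rw [(hcurve σ hσ).2]

/-- Since `reach` is open, the corrections agree near `p` and have the same differential there. The
defining equations then coincide, and `A t` is nondegenerate. -/
lemma X_eq {t : ℝ} (ht : t ∈ Icc (0 : ℝ) 1) {p : E} (hq : (t, p) ∈ D.reach) :
    D.X t p = M.Xc (t, p) := by
  refine M.eq_of_forall_B_A (M.domX_nondeg hq.1.1) fun Y => ?_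
  have hev : D.F t =ᶠ[𝓝 p] fun p => M.F (t, p) := by
    filter_upwards [(isOpen_slice D.isOpen_reach).mem_nhds hq] with x hx using D.F_eq ht hx
  rw [D.X_spec t ht p hq.1.2, M.B_A_Xc hq.1.1, hev.fderiv_eq]

/-- The points at which the flow of the corrected vector field is determined. -/
def flowSet : Set E := timeDomain D.reach M.Xc ∩ D.flowDom

lemma contDiffOn_Xc_reach : ContDiffOn ℝ (⊤ : ℕ∞) M.Xc D.reach :=
  M.contDiffOn_Xc.mono fun _ h => h.1.1

lemma isOpen_flowSet : IsOpen D.flowSet :=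
  (isOpen_timeDomain D.isOpen_reach D.contDiffOn_Xc_reach).inter D.flowDom_open

lemma base_mem_flowSet (k : ℝ) : M.b₀ + k • M.e ∈ D.flowSet :=
  ⟨(M.isTimeSol_base k fun t => D.base_mem_reach t k).mem_timeDomain, D.base_flowDom k⟩

lemma isTimeSol_domX {p : E} (hp : p ∈ D.flowSet) :
    IsTimeSol M.domX M.Xc p (timeFlow D.reach M.Xc p) := by
  have h := isTimeSol_timeFlow hp.1
  exact ⟨h.zero, fun τ hτ => (h.mem τ hτ).1.1, h.deriv⟩

lemma mem_flowDomX {p : E} (hp : p ∈ D.flowSet) : p ∈ M.flowDomX :=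
  (D.isTimeSol_domX hp).mem_timeDomain

/-- The given flow solves the equation of `Xc` as long as it is in `reach`. The solution of `Xc`
from the same point stays in `reach` up to time one, and the given flow cannot depart from it. -/
lemma flow_eq {p : E} (hp : p ∈ D.flowSet) {t : ℝ} (ht : t ∈ Icc (0 : ℝ) 1) :
    D.flow t p = M.flowX p t := by
  rw [flowX, timeFlow_eq M.isOpen_domX M.contDiffOn_Xc (D.isTimeSol_domX hp)
    ⟨by linarith [ht.1], ht.2⟩]
  refine (timeFlow_eq_of_forall_mem D.isOpen_reach D.contDiffOn_Xc_reach hp.1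
    (δ := fun t => D.flow t p)
    (fun τ hτ => (D.flow_deriv p hp.2 τ hτ).continuousWithinAt) (fun τ hτ hm => ?_)
    (D.flow_zero p hp.2) ht).symm
  have := D.flow_deriv p hp.2 τ hτ
  rwa [D.X_eq hτ hm] at this

lemma flow_eventuallyEq {p : E} (hp : p ∈ D.flowSet) {t : ℝ} (ht : t ∈ Icc (0 : ℝ) 1) :
    D.flow t =ᶠ[𝓝 p] fun p => M.flowX p t := by
  filter_upwards [D.isOpen_flowSet.mem_nhds hp] with x hx using D.flow_eq hx ht

lemma differentiableAt_flow {p : E} (hp : p ∈ D.flowSet) {t : ℝ} (ht : t ∈ Icc (0 : ℝ) 1) :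
    DifferentiableAt ℝ (D.flow t) p :=
  (M.differentiableAt_flowX (D.mem_flowDomX hp)
    ⟨by linarith [ht.1], ht.2⟩).congr_of_eventuallyEq (D.flow_eventuallyEq hp ht)

/-- The flow pulls `A t` back to `A₀`. -/
theorem pullback_flow {p : E} (hp : p ∈ D.flowSet) {t : ℝ} (ht : t ∈ Icc (0 : ℝ) 1) (X Y : E) :
    M.B (M.A t (D.flow t p) (fderiv ℝ (D.flow t) p X)) (fderiv ℝ (D.flow t) p Y)
      = M.B (M.A₀ p X) Y := by
  rw [(D.flow_eventuallyEq hp ht).fderiv_eq, D.flow_eq hp ht]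
  exact M.pullback_flowX (D.mem_flowDomX hp) ht X Y

lemma flow_add {p : E} (hp : p ∈ D.flowSet) {k : ℝ} (hk : p + k • M.e ∈ D.flowSet) {t : ℝ}
    (ht : t ∈ Icc (0 : ℝ) 1) : D.flow t (p + k • M.e) = D.flow t p + k • M.e := by
  rw [D.flow_eq hk ht, D.flow_eq hp ht,
    M.flowX_add (D.mem_flowDomX hp) k ⟨by linarith [ht.1], ht.2⟩]

lemma flow_base (k : ℝ) {t : ℝ} (ht : t ∈ Icc (0 : ℝ) 1) :
    D.flow t (M.b₀ + k • M.e) = M.b₀ + k • M.e := by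
  rw [D.flow_eq (D.base_mem_flowSet k) ht, M.flowX_base k ⟨by linarith [ht.1], ht.2⟩]

/-- The differential of the flow maps the direction of invariance to itself. -/
lemma fderiv_flow_e {p : E} (hp : p ∈ D.flowSet) {t : ℝ} (ht : t ∈ Icc (0 : ℝ) 1) :
    fderiv ℝ (D.flow t) p M.e = M.e := by
  have hl : HasDerivAt (fun h : ℝ => p + h • M.e) M.e 0 := by
    simpa using ((hasDerivAt_id (0 : ℝ)).smul_const M.e).const_add p
  have h1 := (D.differentiableAt_flow hp ht).hasFDerivAt.comp_hasDerivAt_of_eq (0 : ℝ) hl (by simp)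
  have hl2 : HasDerivAt (fun h : ℝ => D.flow t p + h • M.e) M.e 0 := by
    simpa using ((hasDerivAt_id (0 : ℝ)).smul_const M.e).const_add (D.flow t p)
  refine h1.unique (hl2.congr_of_eventuallyEq ?_)
  have hev : ∀ᶠ h : ℝ in 𝓝 0, p + h • M.e ∈ D.flowSet :=
    (show ContinuousAt (fun h : ℝ => p + h • M.e) 0 by fun_prop)
      (D.isOpen_flowSet.mem_nhds (by simpa using hp))
  filter_upwards [hev] with h hh using D.flow_add hp hh ht

end CorrectedFlow

end MoserData


/-! ### Modulated solitons, abstractly -/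

/-- A family `e^{J θ} (Φ ω + ∑ (Re z_j) (a_j ω) + (Im z_j) (b_j ω) + P ω f)` in a real Banach space
with a symplectic form `σ`, parametrized by `(θ, ω, z, f) ∈ ℝ × ℝ × ℂᵐ × H`, such that at `ω₀` the
parametrization is symplectic, to first order. -/
structure SolitonModel (m : ℕ) (F H : Type*) [NormedAddCommGroup F] [NormedSpace ℝ F]
    [NormedAddCommGroup H] [NormedSpace ℝ H] where
  /-- the symplectic form -/
  σ : F →L[ℝ] F →L[ℝ] ℝ
  σ_skew : ∀ x y, σ x y = -σ y x
  /-- the generator of the rotations -/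
  J : F →L[ℝ] F
  J_J : ∀ x, J (J x) = -x
  σ_J : ∀ x y, σ (J x) (J y) = σ x y
  /-- the set of frequencies -/
  O : Set ℝ
  O_open : IsOpen O
  /-- the frequency at the base point -/
  ω₀ : ℝ
  ω₀_mem : ω₀ ∈ O
  /-- the mass -/
  q : ℝ → ℝ
  q_smooth : ContDiffOn ℝ (⊤ : ℕ∞) q O
  deriv_q_ne : deriv q ω₀ ≠ 0
  /-- the solitons -/
  Φ : ℝ → F
  Φ_smooth : ContDiffOn ℝ (⊤ : ℕ∞) Φ O
  /-- the eigenfunctions belonging to the real parts -/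
  a : Fin m → ℝ → F
  a_smooth : ∀ j, ContDiffOn ℝ (⊤ : ℕ∞) (a j) O
  /-- the eigenfunctions belonging to the imaginary parts -/
  b : Fin m → ℝ → F
  b_smooth : ∀ j, ContDiffOn ℝ (⊤ : ℕ∞) (b j) O
  /-- the projection -/
  P : ℝ → F →L[ℝ] F
  P_smooth : ContDiffOn ℝ (⊤ : ℕ∞) P O
  P_symm : ∀ ω ∈ O, ∀ x y, σ x (P ω y) = σ (P ω x) y
  /-- the inclusion of the continuous component -/
  ι : H →L[ℝ] F
  /-- the projection onto the continuous component -/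
  proj : F →L[ℝ] H
  σ_proj : ∀ w f, σ (ι (proj w)) (ι f) = σ w (ι f)
  ι_nondeg : ∀ f, (∀ g, σ (ι f) (ι g) = 0) → f = 0
  P_ι : ∀ f, P ω₀ (ι f) = ι f
  σ_JΦ_deriv : σ (J (Φ ω₀)) (deriv Φ ω₀) = deriv q ω₀
  σ_JΦ_a : ∀ j, σ (J (Φ ω₀)) (a j ω₀) = 0
  σ_JΦ_b : ∀ j, σ (J (Φ ω₀)) (b j ω₀) = 0
  σ_JΦ_ι : ∀ f, σ (J (Φ ω₀)) (ι f) = 0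
  σ_deriv_a : ∀ j, σ (deriv Φ ω₀) (a j ω₀) = 0
  σ_deriv_b : ∀ j, σ (deriv Φ ω₀) (b j ω₀) = 0
  σ_deriv_ι : ∀ f, σ (deriv Φ ω₀) (ι f) = 0
  σ_a_a : ∀ j l, σ (a j ω₀) (a l ω₀) = 0
  σ_b_b : ∀ j l, σ (b j ω₀) (b l ω₀) = 0
  σ_a_b : ∀ j l, σ (a j ω₀) (b l ω₀) = if j = l then -2 else 0
  σ_a_ι : ∀ j f, σ (a j ω₀) (ι f) = 0
  σ_b_ι : ∀ j f, σ (b j ω₀) (ι f) = 0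
  σ_Φ_JΦ : σ (Φ ω₀) (J (Φ ω₀)) = -2 * q ω₀
  σ_deriv_Φ : σ (deriv Φ ω₀) (Φ ω₀) = 0

/-! ### The parametrization, its differential and the representation of the forms. -/

namespace SolitonModel

variable {m : ℕ} {F H : Type*} [NormedAddCommGroup F] [NormedSpace ℝ F]
  [NormedAddCommGroup H] [NormedSpace ℝ H]

variable (H m) in
/-- The space of the parameters `(θ, ω, z, f)`. -/
abbrev Param : Type _ := ℝ × ℝ × (Fin m → ℂ) × H

/-- The coordinate `θ`. -/
def thetaL : Param m H →L[ℝ] ℝ := ContinuousLinearMap.fst ℝ ℝ _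

/-- The coordinate `ω`. -/
def omegaL : Param m H →L[ℝ] ℝ :=
  (ContinuousLinearMap.fst ℝ ℝ _).comp (ContinuousLinearMap.snd ℝ ℝ _)

/-- The coordinates `(z, f)`. -/
def restL : Param m H →L[ℝ] (Fin m → ℂ) × H :=
  (ContinuousLinearMap.snd ℝ ℝ _).comp (ContinuousLinearMap.snd ℝ ℝ _)

/-- The coordinate `Re z_j`. -/
def reL (j : Fin m) : Param m H →L[ℝ] ℝ :=
  Complex.reCLM.comp ((ContinuousLinearMap.proj (R := ℝ) (φ := fun _ : Fin m => ℂ) j).comp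
    ((ContinuousLinearMap.fst ℝ _ _).comp restL))

/-- The coordinate `Im z_j`. -/
def imL (j : Fin m) : Param m H →L[ℝ] ℝ :=
  Complex.imCLM.comp ((ContinuousLinearMap.proj (R := ℝ) (φ := fun _ : Fin m => ℂ) j).comp
    ((ContinuousLinearMap.fst ℝ _ _).comp restL))

/-- The coordinate `f`. -/
def fL : Param m H →L[ℝ] H := (ContinuousLinearMap.snd ℝ _ _).comp restL

@[simp] lemma thetaL_apply (p : Param m H) : thetaL p = p.1 := rfl
@[simp] lemma omegaL_apply (p : Param m H) : omegaL p = p.2.1 := rfl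
@[simp] lemma reL_apply (j : Fin m) (p : Param m H) : reL j p = (p.2.2.1 j).re := rfl
@[simp] lemma imL_apply (j : Fin m) (p : Param m H) : imL j p = (p.2.2.1 j).im := rfl
@[simp] lemma fL_apply (p : Param m H) : fL p = p.2.2.2 := rfl

/-- The direction of `θ`. -/
def eTheta : Param m H := (1, 0, 0, 0)

/-- The direction of `ω`. -/
def eOmega : Param m H := (0, 1, 0, 0)

variable (M : SolitonModel m F H)

/-- The domain of the parametrization. -/
def dom : Set (Param m H) := {p | p.2.1 ∈ M.O}

lemma isOpen_dom : IsOpen M.dom := M.O_open.preimage (by fun_prop)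

/-- The parametrization at `θ = 0`. -/
def T (p : Param m H) : F :=
  M.Φ p.2.1 + ∑ j, ((p.2.2.1 j).re • M.a j p.2.1 + (p.2.2.1 j).im • M.b j p.2.1)
    + M.P p.2.1 (M.ι p.2.2.2)

lemma contDiffOn_T : ContDiffOn ℝ (⊤ : ℕ∞) M.T M.dom := by
  have hω : ContDiffOn ℝ (⊤ : ℕ∞) (fun p : Param m H => p.2.1) M.dom := by fun_prop
  have hm : MapsTo (fun p : Param m H => p.2.1) M.dom M.O := fun _ h => h
  have hr : ∀ j, ContDiffOn ℝ (⊤ : ℕ∞) (fun p : Param m H => (p.2.2.1 j).re) M.dom :=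
    fun j => (reL (m := m) (H := H) j).contDiff.contDiffOn
  have hi : ∀ j, ContDiffOn ℝ (⊤ : ℕ∞) (fun p : Param m H => (p.2.2.1 j).im) M.dom :=
    fun j => (imL (m := m) (H := H) j).contDiff.contDiffOn
  have hf : ContDiffOn ℝ (⊤ : ℕ∞) (fun p : Param m H => M.ι p.2.2.2) M.dom :=
    (M.ι.comp fL).contDiff.contDiffOn
  refine ((M.Φ_smooth.comp hω hm).add (ContDiffOn.sum fun j _ => ?_)).add
    ((M.P_smooth.comp hω hm).clm_apply hf)
  exact ((hr j).smul ((M.a_smooth j).comp hω hm)).add ((hi j).smul ((M.b_smooth j).comp hω hm))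

lemma hasFDerivAt_T {p : Param m H} (hp : p ∈ M.dom) : HasFDerivAt M.T (fderiv ℝ M.T p) p :=
  ((M.contDiffOn_T.differentiableOn (by simp)).differentiableAt
    (M.isOpen_dom.mem_nhds hp)).hasFDerivAt

/-- The parametrization is affine in `z` and `f` and constant in `θ`, so in these directions the
derivative is read off a line. -/
lemma fderiv_T_eq {p : Param m H} (hp : p ∈ M.dom) {Y : Param m H} {v : F}
    (h : ∀ s : ℝ, M.T (p + s • Y) = M.T p + s • v) : fderiv ℝ M.T p Y = v := by
  have hl : HasDerivAt (fun s : ℝ => p + s • Y) Y 0 := by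
    simpa using ((hasDerivAt_id (0 : ℝ)).smul_const Y).const_add p
  have h1 := (M.hasFDerivAt_T hp).comp_hasDerivAt_of_eq (0 : ℝ) hl (by simp)
  have h2 : HasDerivAt (fun s : ℝ => M.T p + s • v) v 0 := by
    simpa using ((hasDerivAt_id (0 : ℝ)).smul_const v).const_add (M.T p)
  refine h1.unique (h2.congr_of_eventuallyEq (Eventually.of_forall h))

lemma T_add (p : Param m H) (k : ℝ) : M.T (p + k • eTheta) = M.T p := by
  simp [T, eTheta]

lemma fderiv_T_theta {p : Param m H} (hp : p ∈ M.dom) : fderiv ℝ M.T p eTheta = 0 :=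
  M.fderiv_T_eq hp fun s => by rw [M.T_add, smul_zero, add_zero]

/-- The linear part of the parametrization. -/
def lin (ω : ℝ) (z : Fin m → ℂ) (f : H) : F :=
  ∑ j, ((z j).re • M.a j ω + (z j).im • M.b j ω) + M.P ω (M.ι f)

lemma fderiv_T_rest {p : Param m H} (hp : p ∈ M.dom) (z : Fin m → ℂ) (f : H) :
    fderiv ℝ M.T p (0, 0, z, f) = M.lin p.2.1 z f := by
  refine M.fderiv_T_eq hp fun s => ?_
  have e : ∀ j, ((p.2.2.1 j + s • z j).re • M.a j p.2.1 + (p.2.2.1 j + s • z j).im • M.b j p.2.1)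
      = ((p.2.2.1 j).re • M.a j p.2.1 + (p.2.2.1 j).im • M.b j p.2.1)
        + s • ((z j).re • M.a j p.2.1 + (z j).im • M.b j p.2.1) := fun j => by
    simp only [Complex.add_re, Complex.add_im, Complex.real_smul, Complex.re_ofReal_mul,
      Complex.im_ofReal_mul]
    module
  simp only [T, lin, Prod.smul_mk, smul_zero, Prod.fst_add, Prod.snd_add, add_zero, Pi.add_apply,
    Pi.smul_apply, e, Finset.sum_add_distrib, map_add, map_smul, ← Finset.smul_sum]
  module

lemma eq_coords (Y : Param m H) :
    Y = Y.1 • eTheta + Y.2.1 • eOmega + (0, 0, Y.2.2.1, Y.2.2.2) := by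
  ext <;> simp [eTheta, eOmega]

lemma fderiv_T_apply {p : Param m H} (hp : p ∈ M.dom) (Y : Param m H) :
    fderiv ℝ M.T p Y = Y.2.1 • fderiv ℝ M.T p eOmega + M.lin p.2.1 Y.2.2.1 Y.2.2.2 := by
  conv_lhs => rw [eq_coords Y]
  rw [map_add, map_add, map_smul, map_smul, M.fderiv_T_theta hp, M.fderiv_T_rest hp, smul_zero,
    zero_add]

/-- The base point. -/
def base₀ : Param m H := (0, M.ω₀, 0, 0)

lemma base₀_mem : M.base₀ ∈ M.dom := M.ω₀_mem

lemma T_base : M.T M.base₀ = M.Φ M.ω₀ := by simp [T, base₀]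

lemma hasDerivAt_Φ {ω : ℝ} (hω : ω ∈ M.O) : HasDerivAt M.Φ (deriv M.Φ ω) ω :=
  ((M.Φ_smooth.differentiableOn (by simp)).differentiableAt (M.O_open.mem_nhds hω)).hasDerivAt

lemma fderiv_T_base : fderiv ℝ M.T M.base₀ eOmega = deriv M.Φ M.ω₀ := by
  have hl : HasDerivAt (fun s : ℝ => M.base₀ + s • (eOmega : Param m H)) eOmega 0 := by
    simpa using ((hasDerivAt_id (0 : ℝ)).smul_const (eOmega : Param m H)).const_add M.base₀
  have h1 := (M.hasFDerivAt_T M.base₀_mem).comp_hasDerivAt_of_eq (0 : ℝ) hl (by simp)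
  have h2 : HasDerivAt (fun s : ℝ => M.Φ (M.ω₀ + s)) (deriv M.Φ M.ω₀) 0 := by
    have h3 : HasDerivAt (fun s : ℝ => M.ω₀ + s) 1 0 := by
      simpa using (hasDerivAt_id (0 : ℝ)).const_add M.ω₀
    have h4 := (M.hasDerivAt_Φ M.ω₀_mem).scomp_of_eq (0 : ℝ) h3 (by simp)
    rw [one_smul] at h4
    exact h4
  refine h1.unique (h2.congr_of_eventuallyEq (Eventually.of_forall fun s => ?_))
  simp [T, base₀, eOmega]

/-- The rotations. -/
def rotL (θ : ℝ) : F →L[ℝ] F := Real.cos θ • ContinuousLinearMap.id ℝ F + Real.sin θ • M.J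

lemma rotL_apply (θ : ℝ) (x : F) : M.rotL θ x = Real.cos θ • x + Real.sin θ • M.J x := rfl

lemma σ_J_left (x y : F) : M.σ (M.J x) y = -M.σ x (M.J y) := by
  rw [← M.σ_J (M.J x) y, M.J_J, map_neg, neg_apply]

lemma σ_rotL (θ : ℝ) (x y : F) : M.σ (M.rotL θ x) (M.rotL θ y) = M.σ x y := by
  simp only [rotL_apply, map_add, map_smul, add_apply, smul_apply, smul_eq_mul, M.σ_J,
    M.σ_J_left]
  linear_combination (M.σ x y) * Real.cos_sq_add_sin_sq θ

/-- The parametrization. -/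
def U (p : Param m H) : F := M.rotL p.1 (M.T p)

lemma contDiffOn_U : ContDiffOn ℝ (⊤ : ℕ∞) M.U M.dom := by
  have h1 : ContDiffOn ℝ (⊤ : ℕ∞) (fun p : Param m H => M.rotL p.1) M.dom := by
    have hc : ContDiff ℝ (⊤ : ℕ∞) fun p : Param m H => Real.cos p.1 :=
      Real.contDiff_cos.comp contDiff_fst
    have hs : ContDiff ℝ (⊤ : ℕ∞) fun p : Param m H => Real.sin p.1 :=
      Real.contDiff_sin.comp contDiff_fst
    exact ((hc.smul contDiff_const).add (hs.smul contDiff_const)).contDiffOn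
  exact h1.clm_apply M.contDiffOn_T

/-- The derivative of the parametrization, rotated back. -/
def dV (p : Param m H) : Param m H →L[ℝ] F := thetaL.smulRight (M.J (M.T p)) + fderiv ℝ M.T p

lemma dV_apply (p Y : Param m H) : M.dV p Y = Y.1 • M.J (M.T p) + fderiv ℝ M.T p Y := rfl

lemma contDiffOn_fderiv_T : ContDiffOn ℝ (⊤ : ℕ∞) (fderiv ℝ M.T) M.dom :=
  M.contDiffOn_T.fderiv_of_isOpen M.isOpen_dom (by simp)

lemma contDiffOn_dV : ContDiffOn ℝ (⊤ : ℕ∞) M.dV M.dom :=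
  (contDiffOn_const.smulRight (M.J.contDiff.comp_contDiffOn M.contDiffOn_T)).add
    M.contDiffOn_fderiv_T

lemma hasFDerivAt_U {p : Param m H} (hp : p ∈ M.dom) :
    HasFDerivAt M.U ((M.rotL p.1).comp (M.dV p)) p := by
  have hθ : HasFDerivAt (fun p : Param m H => p.1) thetaL p :=
    (thetaL (m := m) (H := H)).hasFDerivAt
  have hc := ((Real.hasDerivAt_cos p.1).comp_hasFDerivAt p hθ).smul (M.hasFDerivAt_T hp)
  have hs := ((Real.hasDerivAt_sin p.1).comp_hasFDerivAt p hθ).smul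
    (M.J.hasFDerivAt.comp p (M.hasFDerivAt_T hp))
  refine (hc.add hs).congr_fderiv ?_
  refine ContinuousLinearMap.ext fun Y => ?_
  simp only [add_apply, smul_apply, ContinuousLinearMap.smulRight_apply, Function.comp_apply,
    ContinuousLinearMap.comp_apply, rotL_apply, dV_apply, map_add, map_smul, M.J_J,
    thetaL_apply, smul_eq_mul]
  module

lemma fderiv_U {p : Param m H} (hp : p ∈ M.dom) (Y : Param m H) :
    fderiv ℝ M.U p Y = M.rotL p.1 (M.dV p Y) := by rw [(M.hasFDerivAt_U hp).fderiv]; rfl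

lemma dV_eTheta {p : Param m H} (hp : p ∈ M.dom) : M.dV p eTheta = M.J (M.T p) := by
  rw [dV_apply, M.fderiv_T_theta hp, add_zero]; simp [eTheta]

lemma fderiv_T_add (p : Param m H) (k : ℝ) :
    fderiv ℝ M.T (p + k • eTheta) = fderiv ℝ M.T p := by
  rw [← fderiv_comp_add_right]
  simp only [M.T_add]

lemma dV_add (p : Param m H) (k : ℝ) : M.dV (p + k • eTheta) = M.dV p := by
  rw [dV, M.T_add, M.fderiv_T_add, dV]

/-! #### The 2-forms -/

/-- The derivative of the mass at the base point. -/
def q₀ : ℝ := deriv M.q M.ω₀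

/-- The constant 2-form. -/
def B : Param m H →L[ℝ] Param m H →L[ℝ] ℝ :=
  M.q₀ • ((ContinuousLinearMap.mul ℝ ℝ).bilinearComp thetaL omegaL
      - (ContinuousLinearMap.mul ℝ ℝ).bilinearComp omegaL thetaL)
    + (2 : ℝ) • ∑ j, ((ContinuousLinearMap.mul ℝ ℝ).bilinearComp (imL j) (reL j)
      - (ContinuousLinearMap.mul ℝ ℝ).bilinearComp (reL j) (imL j))
    + M.σ.bilinearComp (M.ι.comp fL) (M.ι.comp fL)

lemma B_apply (X Y : Param m H) :
    M.B X Y = M.q₀ * (X.1 * Y.2.1 - X.2.1 * Y.1)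
      + 2 * ∑ j, ((X.2.2.1 j).im * (Y.2.2.1 j).re - (X.2.2.1 j).re * (Y.2.2.1 j).im)
      + M.σ (M.ι X.2.2.2) (M.ι Y.2.2.2) := by
  simp [B, sum_apply]

lemma B_skew (X Y : Param m H) : M.B X Y = -M.B Y X := by
  rw [B_apply, B_apply, M.σ_skew]
  have : ∀ j, ((X.2.2.1 j).im * (Y.2.2.1 j).re - (X.2.2.1 j).re * (Y.2.2.1 j).im)
      = -((Y.2.2.1 j).im * (X.2.2.1 j).re - (Y.2.2.1 j).re * (X.2.2.1 j).im) := fun j => by ring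
  simp only [this, Finset.sum_neg_distrib]
  ring

lemma q₀_ne : M.q₀ ≠ 0 := M.deriv_q_ne

lemma B_inj (X : Param m H) (h : ∀ Y, M.B X Y = 0) : X = 0 := by
  have h1 := h eOmega
  have h2 := h eTheta
  have h3 := fun j => h (0, 0, Pi.single j 1, 0)
  have h4 := fun j => h (0, 0, Pi.single j Complex.I, 0)
  have h5 := fun f => h (0, 0, 0, f)
  simp only [B_apply, eOmega, eTheta, Pi.zero_apply, Complex.zero_re, Complex.zero_im, mul_zero,
    sub_zero, Finset.sum_const_zero, map_zero, add_zero, mul_one, zero_sub, zero_add,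
    mul_eq_zero, M.q₀_ne, false_or, mul_neg, neg_eq_zero] at h1 h2 h5
  refine Prod.ext h1 (Prod.ext h2 (Prod.ext (funext fun j => ?_) (M.ι_nondeg _ h5)))
  have h3j := h3 j
  have h4j := h4 j
  rw [B_apply, Finset.sum_eq_single j (fun i _ hi => by simp [hi]) (by simp)] at h3j h4j
  simp only [mul_zero, sub_self, zero_add, Pi.single_eq_same, Complex.one_re, Complex.one_im,
    Complex.I_re, Complex.I_im, map_zero, add_zero, mul_one, sub_zero, zero_sub, mul_neg,
    neg_eq_zero, mul_eq_zero, OfNat.ofNat_ne_zero, false_or] at h3j h4j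
  exact Complex.ext h4j h3j

/-- The adjoint of `dV`. -/
def adj (p : Param m H) : F →L[ℝ] Param m H :=
  (M.q₀⁻¹ • M.σ.flip (fderiv ℝ M.T p eOmega)).smulRight eTheta
    - (M.q₀⁻¹ • M.σ.flip (M.J (M.T p))).smulRight eOmega
    + ∑ j, (((2⁻¹ : ℝ) • M.σ.flip (M.a j p.2.1)).smulRight (0, 0, Pi.single j Complex.I, 0)
      - ((2⁻¹ : ℝ) • M.σ.flip (M.b j p.2.1)).smulRight (0, 0, Pi.single j 1, 0))
    + (((ContinuousLinearMap.inr ℝ ℝ (ℝ × (Fin m → ℂ) × H)).comp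
        ((ContinuousLinearMap.inr ℝ ℝ ((Fin m → ℂ) × H)).comp
        (ContinuousLinearMap.inr ℝ (Fin m → ℂ) H))).comp M.proj).comp (M.P p.2.1)

lemma contDiffOn_adj : ContDiffOn ℝ (⊤ : ℕ∞) M.adj M.dom := by
  have hω : ContDiffOn ℝ (⊤ : ℕ∞) (fun p : Param m H => p.2.1) M.dom := by fun_prop
  have hm : MapsTo (fun p : Param m H => p.2.1) M.dom M.O := fun _ h => h
  have hσ : ∀ (c : ℝ) (v : Param m H → F), ContDiffOn ℝ (⊤ : ℕ∞) v M.dom →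
      ContDiffOn ℝ (⊤ : ℕ∞) (fun p => c • M.σ.flip (v p)) M.dom := fun c v hv =>
    (contDiffOn_const (c := c)).smul (M.σ.flip.contDiff.comp_contDiffOn hv)
  refine ContDiffOn.add (ContDiffOn.add (ContDiffOn.sub ?_ ?_) (ContDiffOn.sum fun j _ =>
    ContDiffOn.sub ?_ ?_)) ?_
  · exact (hσ _ _ (M.contDiffOn_fderiv_T.clm_apply contDiffOn_const)).smulRight contDiffOn_const
  · exact (hσ _ _ (M.J.contDiff.comp_contDiffOn M.contDiffOn_T)).smulRight contDiffOn_const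
  · exact (hσ _ _ ((M.a_smooth j).comp hω hm)).smulRight contDiffOn_const
  · exact (hσ _ _ ((M.b_smooth j).comp hω hm)).smulRight contDiffOn_const
  · exact contDiffOn_const.clm_comp (M.P_smooth.comp hω hm)

lemma adj_add (p : Param m H) (k : ℝ) : M.adj (p + k • eTheta) = M.adj p := by
  rw [adj, M.fderiv_T_add, M.T_add, adj]
  simp [eTheta]

lemma B_eTheta (Y : Param m H) : M.B eTheta Y = M.q₀ * Y.2.1 := by
  simp [B_apply, eTheta]

lemma B_eOmega (Y : Param m H) : M.B eOmega Y = -(M.q₀ * Y.1) := by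
  simp [B_apply, eOmega]

lemma B_rest_I (j : Fin m) (Y : Param m H) :
    M.B (0, 0, Pi.single j Complex.I, 0) Y = 2 * (Y.2.2.1 j).re := by
  rw [B_apply, Finset.sum_eq_single j (fun i _ hi => by simp [hi]) (by simp)]
  simp

lemma B_rest_one (j : Fin m) (Y : Param m H) :
    M.B (0, 0, Pi.single j 1, 0) Y = -(2 * (Y.2.2.1 j).im) := by
  rw [B_apply, Finset.sum_eq_single j (fun i _ hi => by simp [hi]) (by simp)]
  simp

lemma B_f (f : H) (Y : Param m H) : M.B (0, 0, 0, f) Y = M.σ (M.ι f) (M.ι Y.2.2.2) := by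
  simp [B_apply]

/-- `adj` is the adjoint of `dV`. -/
lemma B_adj {p : Param m H} (hp : p ∈ M.dom) (w : F) (Y : Param m H) :
    M.B (M.adj p w) Y = M.σ w (M.dV p Y) := by
  have hq := M.q₀_ne
  simp only [adj, map_add, map_sub, map_sum, add_apply, sub_apply, sum_apply,
    ContinuousLinearMap.smulRight_apply, smul_apply, ContinuousLinearMap.flip_apply, map_smul,
    ContinuousLinearMap.comp_apply, M.B_eTheta, M.B_eOmega, M.B_rest_I, M.B_rest_one, smul_eq_mul]
  -- Here the adjoint is kept inside the phase space: `P` is symmetric for `σ` and moves onto `w`,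
  -- and `proj` does not change the pairing with elements of `H`.
  have hf : M.B (ContinuousLinearMap.inr ℝ ℝ (ℝ × (Fin m → ℂ) × H)
      (ContinuousLinearMap.inr ℝ ℝ ((Fin m → ℂ) × H) (ContinuousLinearMap.inr ℝ (Fin m → ℂ) H
        (M.proj (M.P p.2.1 w))))) Y = M.σ w (M.P p.2.1 (M.ι Y.2.2.2)) := by
    rw [M.P_symm _ hp, ← M.σ_proj, ← M.B_f]; rfl
  rw [hf, dV_apply, M.fderiv_T_apply hp Y, lin]
  simp only [map_add, map_smul, map_sum, smul_eq_mul]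
  have hs : ∀ j, (2⁻¹ * M.σ w (M.a j p.2.1)) * (2 * (Y.2.2.1 j).re)
      - (2⁻¹ * M.σ w (M.b j p.2.1)) * (-(2 * (Y.2.2.1 j).im))
      = (Y.2.2.1 j).re * M.σ w (M.a j p.2.1) + (Y.2.2.1 j).im * M.σ w (M.b j p.2.1) := fun j => by
    ring
  simp only [hs]
  field_simp
  ring

/-- The 2-form that belongs to `σ`. -/
def A₁ (p : Param m H) : Param m H →L[ℝ] Param m H := (M.adj p).comp (M.dV p)

lemma contDiffOn_A₁ : ContDiffOn ℝ (⊤ : ℕ∞) M.A₁ M.dom := M.contDiffOn_adj.clm_comp M.contDiffOn_dV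

lemma B_A₁ {p : Param m H} (hp : p ∈ M.dom) (X Y : Param m H) :
    M.B (M.A₁ p X) Y = M.σ (M.dV p X) (M.dV p Y) := M.B_adj hp _ _

/-- Rotations preserve `σ`, so the form pulled back by `U` can be computed from `dV`, where the
rotation is absent. -/
lemma B_A₁' {p : Param m H} (hp : p ∈ M.dom) (X Y : Param m H) :
    M.B (M.A₁ p X) Y = M.σ (fderiv ℝ M.U p X) (fderiv ℝ M.U p Y) := by
  rw [M.B_A₁ hp, M.fderiv_U hp, M.fderiv_U hp, M.σ_rotL]

/-- The projection onto the coordinates `θ` and `ω`. -/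
def planeL : Param m H →L[ℝ] Param m H := thetaL.smulRight eTheta + omegaL.smulRight eOmega

/-- The 2-form `dθ ∧ dq(ω) + 2 ∑ Im (dz_j ⊗ dz̄_j) + σ(f' ·, f' ·)`. -/
def A₀ (p : Param m H) : Param m H →L[ℝ] Param m H :=
  ContinuousLinearMap.id ℝ (Param m H) + (deriv M.q p.2.1 / M.q₀ - 1) • planeL

lemma B_A₀ (p X Y : Param m H) :
    M.B (M.A₀ p X) Y = M.B X Y + (deriv M.q p.2.1 - M.q₀) * (X.1 * Y.2.1 - X.2.1 * Y.1) := by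
  have hq := M.q₀_ne
  simp only [A₀, planeL, add_apply, smul_apply, ContinuousLinearMap.id_apply, map_add, map_smul,
    ContinuousLinearMap.smulRight_apply, M.B_eTheta, M.B_eOmega, smul_eq_mul, thetaL_apply,
    omegaL_apply]
  field_simp
  ring

lemma contDiffOn_deriv_q : ContDiffOn ℝ (⊤ : ℕ∞) (fun p : Param m H => deriv M.q p.2.1) M.dom :=
  (M.q_smooth.deriv_of_isOpen M.O_open (by simp)).comp (by fun_prop) fun _ h => h

lemma contDiffOn_A₀ : ContDiffOn ℝ (⊤ : ℕ∞) M.A₀ M.dom :=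
  contDiffOn_const.add (((M.contDiffOn_deriv_q.div_const _).sub contDiffOn_const).smul
    contDiffOn_const)

lemma B_fderiv_apply {A : Param m H → Param m H →L[ℝ] Param m H} {p : Param m H}
    (hA : DifferentiableAt ℝ A p) (X Y Z : Param m H) :
    M.B (fderiv ℝ A p X Y) Z = fderiv ℝ (fun p => M.B (A p Y) Z) p X := by
  have h := (M.B.flip Z).hasFDerivAt.comp p (hA.hasFDerivAt.clm_apply (hasFDerivAt_const Y p))
  rw [show fderiv ℝ (fun p => M.B (A p Y) Z) p = _ from h.fderiv]
  simp

/-- Only the coefficient of `dθ ∧ dω` varies, and only with `ω`, so its differential contributes `dω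
∧ dθ ∧ dω = 0`. -/
lemma A₀_closed {p : Param m H} (hp : p ∈ M.dom) (X Y Z : Param m H) :
    M.B (fderiv ℝ M.A₀ p X Y) Z + M.B (fderiv ℝ M.A₀ p Y Z) X + M.B (fderiv ℝ M.A₀ p Z X) Y = 0 := by
  have hd : DifferentiableAt ℝ M.A₀ p := (M.contDiffOn_A₀.differentiableOn (by simp)).differentiableAt
    (M.isOpen_dom.mem_nhds hp)
  have hq : HasDerivAt (deriv M.q) (deriv (deriv M.q) p.2.1) p.2.1 :=
    (((M.q_smooth.deriv_of_isOpen (m := (⊤ : ℕ∞)) M.O_open (by simp)).differentiableOn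
      (by simp)).differentiableAt (M.O_open.mem_nhds hp)).hasDerivAt
  have key : ∀ X Y Z : Param m H, fderiv ℝ (fun p => M.B (M.A₀ p Y) Z) p X
      = deriv (deriv M.q) p.2.1 * X.2.1 * (Y.1 * Z.2.1 - Y.2.1 * Z.1) := by
    intro X Y Z
    have h1 : HasFDerivAt (fun p : Param m H => deriv M.q p.2.1)
        (deriv (deriv M.q) p.2.1 • omegaL) p :=
      HasDerivAt.comp_hasFDerivAt (h₂ := deriv M.q) p hq
        (omegaL (m := m) (H := H)).hasFDerivAt
    have h2 := ((h1.sub_const M.q₀).mul_const (Y.1 * Z.2.1 - Y.2.1 * Z.1)).const_add (M.B Y Z)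
    have h3 : HasFDerivAt (fun p : Param m H => M.B (M.A₀ p Y) Z) _ p :=
      h2.congr_of_eventuallyEq (Eventually.of_forall fun p => M.B_A₀ p Y Z)
    rw [h3.fderiv]
    simp
    ring
  rw [M.B_fderiv_apply hd, M.B_fderiv_apply hd, M.B_fderiv_apply hd, key, key, key]
  ring

lemma hasFDerivAt_fderiv_U {p : Param m H} (hp : p ∈ M.dom) :
    HasFDerivAt (fderiv ℝ M.U) (fderiv ℝ (fderiv ℝ M.U) p) p :=
  (((M.contDiffOn_U.fderiv_of_isOpen (m := (⊤ : ℕ∞)) M.isOpen_dom (by simp)).differentiableOn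
    (by simp)).differentiableAt (M.isOpen_dom.mem_nhds hp)).hasFDerivAt

lemma fderiv_fderiv_symm {G : Type*} [NormedAddCommGroup G] [NormedSpace ℝ G]
    {f : Param m H → G} (hf : ContDiffOn ℝ (⊤ : ℕ∞) f M.dom) {p : Param m H}
    (hp : p ∈ M.dom) (X Y : Param m H) :
    fderiv ℝ (fderiv ℝ f) p X Y = fderiv ℝ (fderiv ℝ f) p Y X := by
  have hc : ContDiffAt ℝ 2 f p := (hf.contDiffAt (M.isOpen_dom.mem_nhds hp)).of_le
    (WithTop.coe_le_coe.2 (le_top (a := (2 : ℕ∞))))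
  exact hc.isSymmSndFDerivAt (by simp) X Y

lemma fderiv_σ_U {p : Param m H} (hp : p ∈ M.dom) (X Y Z : Param m H) :
    fderiv ℝ (fun p => M.σ (fderiv ℝ M.U p Y) (fderiv ℝ M.U p Z)) p X
      = M.σ (fderiv ℝ (fderiv ℝ M.U) p X Y) (fderiv ℝ M.U p Z)
        + M.σ (fderiv ℝ M.U p Y) (fderiv ℝ (fderiv ℝ M.U) p X Z) := by
  have hU := M.hasFDerivAt_fderiv_U hp
  have h1 := M.σ.hasFDerivAt.comp p (hU.clm_apply (hasFDerivAt_const Y p))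
  have h2 := h1.clm_apply (hU.clm_apply (hasFDerivAt_const Z p))
  rw [show fderiv ℝ (fun p => M.σ (fderiv ℝ M.U p Y) (fderiv ℝ M.U p Z)) p = _ from h2.fderiv]
  simp [add_comm]

/-- The pull-back of a constant 2-form: the second derivatives of `U` are symmetric and cancel in
pairs in the cyclic sum, by skewness of `σ`. -/
lemma A₁_closed {p : Param m H} (hp : p ∈ M.dom) (X Y Z : Param m H) :
    M.B (fderiv ℝ M.A₁ p X Y) Z + M.B (fderiv ℝ M.A₁ p Y Z) X + M.B (fderiv ℝ M.A₁ p Z X) Y = 0 := by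
  have hd : DifferentiableAt ℝ M.A₁ p := (M.contDiffOn_A₁.differentiableOn (by simp)).differentiableAt
    (M.isOpen_dom.mem_nhds hp)
  have key : ∀ X Y Z : Param m H, M.B (fderiv ℝ M.A₁ p X Y) Z
      = M.σ (fderiv ℝ (fderiv ℝ M.U) p X Y) (fderiv ℝ M.U p Z)
        + M.σ (fderiv ℝ M.U p Y) (fderiv ℝ (fderiv ℝ M.U) p X Z) := by
    intro X Y Z
    have hev : (fun p => M.B (M.A₁ p Y) Z) =ᶠ[𝓝 p]
        fun p => M.σ (fderiv ℝ M.U p Y) (fderiv ℝ M.U p Z) := by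
      filter_upwards [M.isOpen_dom.mem_nhds hp] with x hx using M.B_A₁' hx Y Z
    rw [M.B_fderiv_apply hd, hev.fderiv_eq, M.fderiv_σ_U hp]
  have hs := M.fderiv_fderiv_symm M.contDiffOn_U hp
  rw [key, key, key, hs Y X, hs Z Y, hs X Z, M.σ_skew (fderiv ℝ M.U p Y), M.σ_skew (fderiv ℝ M.U p Z),
    M.σ_skew (fderiv ℝ M.U p X)]
  ring

/-! #### The primitive -/

/-- The representative of `θ`. -/
def gθ : Param m H := -M.q₀⁻¹ • eOmega

/-- The representative of `ω`. -/
def gω : Param m H := M.q₀⁻¹ • eTheta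

lemma B_gθ (Y : Param m H) : M.B M.gθ Y = Y.1 := by
  rw [gθ, map_smul, smul_apply, M.B_eOmega, smul_eq_mul]
  field_simp [M.q₀_ne]

lemma B_gω (Y : Param m H) : M.B M.gω Y = Y.2.1 := by
  rw [gω, map_smul, smul_apply, M.B_eTheta, smul_eq_mul]
  field_simp [M.q₀_ne]

/-- The coordinates `(z, f)`, as an endomorphism. -/
def restE : Param m H →L[ℝ] Param m H := ContinuousLinearMap.id ℝ (Param m H) - planeL

lemma B_restE (X Y : Param m H) :
    M.B (restE X) Y = M.B X Y - M.q₀ * (X.1 * Y.2.1 - X.2.1 * Y.1) := by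
  simp only [restE, planeL, sub_apply, add_apply, ContinuousLinearMap.id_apply, map_add, map_sub,
    map_smul, ContinuousLinearMap.smulRight_apply, smul_apply, M.B_eTheta, M.B_eOmega, smul_eq_mul,
    thetaL_apply, omegaL_apply]
  ring

/-- The representative of the difference of the primitives. -/
def Ga (p : Param m H) : Param m H :=
  (2⁻¹ : ℝ) • M.adj p (M.T p - M.Φ p.2.1) + M.q p.2.1 • M.gθ - (2⁻¹ : ℝ) • restE p
    - (2⁻¹ * M.σ (deriv M.Φ p.2.1) (M.T p)) • M.gω
    + (2⁻¹ * M.σ (M.Φ p.2.1) (M.J (M.T p))) • M.gθ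

lemma contDiffOn_ω {G : Type*} [NormedAddCommGroup G] [NormedSpace ℝ G] {g : ℝ → G}
    (hg : ContDiffOn ℝ (⊤ : ℕ∞) g M.O) :
    ContDiffOn ℝ (⊤ : ℕ∞) (fun p : Param m H => g p.2.1) M.dom :=
  hg.comp (by fun_prop) fun _ h => h

lemma contDiffOn_Ga : ContDiffOn ℝ (⊤ : ℕ∞) M.Ga M.dom := by
  have hΦ := M.contDiffOn_ω M.Φ_smooth
  have hΦ' := M.contDiffOn_ω (M.Φ_smooth.deriv_of_isOpen (m := (⊤ : ℕ∞)) M.O_open (by simp))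
  have hq := M.contDiffOn_ω M.q_smooth
  have hT := M.contDiffOn_T
  have h1 := (M.σ.contDiff.comp_contDiffOn hΦ').clm_apply hT
  have h2 := (M.σ.contDiff.comp_contDiffOn hΦ).clm_apply (M.J.contDiff.comp_contDiffOn hT)
  have h3 : ContDiffOn ℝ (⊤ : ℕ∞) (fun p : Param m H => restE p) M.dom :=
    (restE (m := m) (H := H)).contDiff.contDiffOn
  exact (((((contDiffOn_const (c := (2⁻¹ : ℝ))).smul (M.contDiffOn_adj.clm_apply (hT.sub hΦ))).add
    (hq.smul contDiffOn_const)).sub ((contDiffOn_const (c := (2⁻¹ : ℝ))).smul h3)).sub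
    (((contDiffOn_const (c := (2⁻¹ : ℝ))).mul h1).smul contDiffOn_const)).add
    (((contDiffOn_const (c := (2⁻¹ : ℝ))).mul h2).smul contDiffOn_const)

/-- The exact part of the difference of the primitives. -/
def ψ (p : Param m H) : ℝ := -(2⁻¹ * M.σ (M.Φ p.2.1) (M.T p))

lemma contDiffOn_ψ : ContDiffOn ℝ (⊤ : ℕ∞) M.ψ M.dom :=
  ((contDiffOn_const (c := (2⁻¹ : ℝ))).mul ((M.σ.contDiff.comp_contDiffOn
    (M.contDiffOn_ω M.Φ_smooth)).clm_apply M.contDiffOn_T)).neg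

lemma fderiv_ψ {p : Param m H} (hp : p ∈ M.dom) (Y : Param m H) :
    fderiv ℝ M.ψ p Y = -(2⁻¹ * (Y.2.1 * M.σ (deriv M.Φ p.2.1) (M.T p)
      + M.σ (M.Φ p.2.1) (fderiv ℝ M.T p Y))) := by
  have hΦ : HasFDerivAt (fun p : Param m H => M.Φ p.2.1) _ p :=
    (M.hasDerivAt_Φ hp).hasFDerivAt.comp p (omegaL (m := m) (H := H)).hasFDerivAt
  have h := (((M.σ.hasFDerivAt.comp p hΦ).clm_apply (M.hasFDerivAt_T hp)).const_mul (2⁻¹ : ℝ)).neg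
  rw [show fderiv ℝ M.ψ p = _ from h.fderiv]
  simp
  ring

/-- The 1-form represented by `Ga`. -/
lemma B_Ga {p : Param m H} (hp : p ∈ M.dom) (Y : Param m H) :
    M.B (M.Ga p) Y = 2⁻¹ * M.σ (M.U p) (fderiv ℝ M.U p Y)
      - (-(M.q p.2.1 * Y.1) + 2⁻¹ * (M.B p Y - M.q₀ * (p.1 * Y.2.1 - p.2.1 * Y.1)))
      + fderiv ℝ M.ψ p Y := by
  -- The soliton part of `½ σ(T, dT ·)` is cancelled by `dψ`, up to multiples of `dθ` and `dω`. This
  -- is why `adj` is applied to `T - Φ` only, and why the form vanishes at the base point.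
  rw [M.fderiv_ψ hp, M.fderiv_U hp, U, M.σ_rotL]
  simp only [Ga, map_add, map_sub, map_smul, add_apply, sub_apply, smul_apply, M.B_gθ, M.B_gω,
    M.B_restE, M.B_adj hp, smul_eq_mul]
  rw [M.dV_apply]
  simp only [map_add, map_smul, smul_eq_mul]
  ring

/-- Exterior derivative of `B_Ga`: the term `½ σ(U, dU ·)` gives the form of `A₁`, the bracket gives
that of `A₀`, and the Hessians of `U` and `ψ` are symmetric and drop out. -/
lemma Ga_deriv {p : Param m H} (hp : p ∈ M.dom) (X Y : Param m H) :
    M.B (fderiv ℝ M.Ga p X) Y - M.B (fderiv ℝ M.Ga p Y) X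
      = M.B (M.A₁ p X) Y - M.B (M.A₀ p X) Y := by
  have hGa : HasFDerivAt M.Ga (fderiv ℝ M.Ga p) p :=
    ((M.contDiffOn_Ga.differentiableOn (by simp)).differentiableAt
      (M.isOpen_dom.mem_nhds hp)).hasFDerivAt
  have hU : HasFDerivAt M.U (fderiv ℝ M.U p) p := (M.hasFDerivAt_U hp).differentiableAt.hasFDerivAt
  have hUU := M.hasFDerivAt_fderiv_U hp
  have hψ : HasFDerivAt (fderiv ℝ M.ψ) (fderiv ℝ (fderiv ℝ M.ψ) p) p :=
    (((M.contDiffOn_ψ.fderiv_of_isOpen (m := (⊤ : ℕ∞)) M.isOpen_dom (by simp)).differentiableOn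
      (by simp)).differentiableAt (M.isOpen_dom.mem_nhds hp)).hasFDerivAt
  have hq : HasDerivAt M.q (deriv M.q p.2.1) p.2.1 :=
    ((M.q_smooth.differentiableOn (by simp)).differentiableAt (M.O_open.mem_nhds hp)).hasDerivAt
  have key : ∀ X Y : Param m H, M.B (fderiv ℝ M.Ga p X) Y
      = 2⁻¹ * (M.σ (fderiv ℝ M.U p X) (fderiv ℝ M.U p Y)
          + M.σ (M.U p) (fderiv ℝ (fderiv ℝ M.U) p X Y))
        - (-(deriv M.q p.2.1 * X.2.1 * Y.1)
          + 2⁻¹ * (M.B X Y - M.q₀ * (X.1 * Y.2.1 - X.2.1 * Y.1)))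
        + fderiv ℝ (fderiv ℝ M.ψ) p X Y := by
    intro X Y
    have h1 := (M.B.flip Y).hasFDerivAt.comp p hGa
    have h2 := ((M.σ.hasFDerivAt.comp p hU).clm_apply
      (hUU.clm_apply (hasFDerivAt_const Y p))).const_mul (2⁻¹ : ℝ)
    have h3 := (HasDerivAt.comp_hasFDerivAt p hq
      (omegaL (m := m) (H := H)).hasFDerivAt).mul_const Y.1
    have h4 := (((M.B.flip Y).hasFDerivAt (x := p)).sub
      ((((thetaL (m := m) (H := H)).hasFDerivAt (x := p)).mul_const Y.2.1).sub
        (((omegaL (m := m) (H := H)).hasFDerivAt (x := p)).mul_const Y.1) |>.const_mul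
          M.q₀)).const_mul (2⁻¹ : ℝ)
    have h5 := hψ.clm_apply (hasFDerivAt_const Y p)
    have h6 := (h2.sub (h3.neg.add h4)).add h5
    have h7 := h1.unique (h6.congr_of_eventuallyEq (by
      filter_upwards [M.isOpen_dom.mem_nhds hp] with x hx using M.B_Ga hx Y))
    have h8 := congrArg (fun f => f X) h7
    simp only [ContinuousLinearMap.comp_apply, ContinuousLinearMap.flip_apply, add_apply,
      sub_apply, smul_apply, neg_apply, smul_eq_mul, zero_apply, map_zero, thetaL_apply,
      omegaL_apply, Function.comp_apply, zero_add] at h8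
    rw [h8]
    ring
  rw [key, key, M.B_A₁' hp, M.B_A₀, M.fderiv_fderiv_symm M.contDiffOn_U hp Y X,
    M.fderiv_fderiv_symm M.contDiffOn_ψ hp Y X, M.σ_skew (fderiv ℝ M.U p Y), M.B_skew Y X]
  ring

/-! #### The base point -/

lemma dV_base (Y : Param m H) : M.dV M.base₀ Y = Y.1 • M.J (M.Φ M.ω₀)
    + (Y.2.1 • deriv M.Φ M.ω₀ + (∑ j, ((Y.2.2.1 j).re • M.a j M.ω₀ + (Y.2.2.1 j).im • M.b j M.ω₀)
      + M.ι Y.2.2.2)) := by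
  rw [dV_apply, M.fderiv_T_apply M.base₀_mem, M.fderiv_T_base, M.T_base, lin,
    show M.base₀.2.1 = M.ω₀ from rfl, M.P_ι]

lemma σ_self (x : F) : M.σ x x = 0 := by linarith [M.σ_skew x x]

/-- The relations assumed in the model say that the images of the coordinate vectors at the base
point have the constant form `B` as their table of products. -/
lemma A₁_base : M.A₁ M.base₀ = 1 := by
  have hk : ∀ x y, M.σ x y = 0 → M.σ y x = 0 := fun x y h => by rw [M.σ_skew, h, neg_zero]
  have hba : ∀ j l, M.σ (M.b j M.ω₀) (M.a l M.ω₀) = if j = l then 2 else 0 := fun j l => by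
    rw [M.σ_skew, M.σ_a_b]
    by_cases h : j = l
    · simp [h]
    · simp [h, Ne.symm h]
  refine ContinuousLinearMap.ext fun X => ?_
  refine sub_eq_zero.1 (M.B_inj _ fun Y => ?_)
  rw [map_sub, sub_apply, M.B_A₁ M.base₀_mem, M.dV_base, M.dV_base, sub_eq_zero,
    one_apply_eq_self, B_apply]
  simp only [map_add, map_sum, map_smul, add_apply, sum_apply, smul_apply, smul_eq_mul,
    M.σ_self, M.σ_JΦ_deriv, M.σ_JΦ_a, M.σ_JΦ_b, M.σ_JΦ_ι, M.σ_deriv_a, M.σ_deriv_b, M.σ_deriv_ι,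
    M.σ_a_a, M.σ_b_b, M.σ_a_b, M.σ_a_ι, M.σ_b_ι, hba, hk _ _ (M.σ_JΦ_a _), hk _ _ (M.σ_JΦ_b _),
    hk _ _ (M.σ_JΦ_ι _), hk _ _ (M.σ_deriv_a _), hk _ _ (M.σ_deriv_b _), hk _ _ (M.σ_deriv_ι _),
    hk _ _ (M.σ_a_ι _ _), hk _ _ (M.σ_b_ι _ _), mul_zero, add_zero, zero_add,
    Finset.sum_const_zero, mul_ite, Finset.sum_add_distrib, Finset.sum_ite_eq',
    Finset.mem_univ, if_true]
  rw [M.σ_skew (deriv M.Φ M.ω₀), M.σ_JΦ_deriv, q₀, ← Finset.sum_add_distrib, Finset.mul_sum]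
  have e : ∀ j, (Y.2.2.1 j).re * ((X.2.2.1 j).im * 2) + (Y.2.2.1 j).im * ((X.2.2.1 j).re * -2)
      = 2 * ((X.2.2.1 j).im * (Y.2.2.1 j).re - (X.2.2.1 j).re * (Y.2.2.1 j).im) := fun j => by ring
  simp only [e]
  ring

/-- At the base point `T = Φ`, and the coordinates `z`, `f` vanish. What remains is `q` times `gθ`,
compensated by `½ σ(Φ, JΦ) = -q`, and `σ(Φ', Φ) = 0`. -/
lemma Ga_base : M.Ga M.base₀ = 0 := by
  have h1 : restE M.base₀ = 0 := by
    rw [restE, planeL]; ext <;> simp [base₀, eTheta, eOmega]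
  have h2 : M.base₀.2.1 = M.ω₀ := rfl
  rw [Ga, M.T_base, h1, h2, sub_self, M.σ_deriv_Φ, M.σ_Φ_JΦ]
  simp only [map_zero, smul_zero, mul_zero, zero_smul, sub_zero, zero_add]
  module

/-- The data for the corrected Moser flow. -/
def moserData : MoserData (Param m H) where
  B := M.B
  B_inj := M.B_inj
  D := M.dom
  D_open := M.isOpen_dom
  A₀ := M.A₀
  A₁ := M.A₁
  Ga := M.Ga
  A₀_smooth := M.contDiffOn_A₀
  A₁_smooth := M.contDiffOn_A₁
  Ga_smooth := M.contDiffOn_Ga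
  A₀_skew := fun p _ X Y => by rw [M.B_A₀, M.B_A₀, M.B_skew X Y]; ring
  A₁_skew := fun p hp X Y => by rw [M.B_A₁ hp, M.B_A₁ hp, M.σ_skew]
  A₀_closed := fun p hp => M.A₀_closed hp
  A₁_closed := fun p hp => M.A₁_closed hp
  Ga_deriv := fun p hp => M.Ga_deriv hp
  e := eTheta
  D_add := fun p hp k => by simpa [dom, eTheta] using hp
  A₀_add := fun p _ k => by simp [A₀, eTheta]
  A₁_add := fun p _ k => by rw [A₁, M.adj_add, M.dV_add, A₁]
  Ga_add := fun p _ k => by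
    have h1 : (p + k • (eTheta : Param m H)).2.1 = p.2.1 := by simp [eTheta]
    have h2 : restE (p + k • (eTheta : Param m H)) = restE p := by
      rw [map_add, map_smul]; simp [restE, planeL, eTheta]
    rw [Ga, M.adj_add, M.T_add, h1, h2, Ga]
  Θ := thetaL
  W := omegaL
  W_e := rfl
  gθ := M.gθ
  B_gθ := M.B_gθ
  gω := M.gω
  B_gω := M.B_gω
  W_gθ := by simp [gθ, eOmega, M.q₀_ne]
  b₀ := M.base₀
  b₀_mem := M.base₀_mem
  A₀_base := by 
    refine ContinuousLinearMap.ext fun X => ?_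
    have h : deriv M.q M.base₀.2.1 / M.q₀ = 1 := div_self M.q₀_ne
    rw [A₀, h, sub_self, add_apply, smul_apply, zero_smul, add_zero]
    rfl
  A₁_base := M.A₁_base
  Ga_base := M.Ga_base

end SolitonModel


namespace NLS

/-! ### The function spaces -/

/-- The inclusion of `H¹` into `L²`. -/
def toL2L : H1 →L[ℂ] L2 :=
  (PiLp.proj (𝕜 := ℂ) 2 (fun _ : Fin 4 => L2) 0).comp h1Submodule.subtypeL

@[simp] lemma toL2L_apply (u : H1) : toL2L u = toL2 u := rfl

lemma inner_toLp_eq_zero {w : L2} (h : ∀ η : 𝓢(E3, ℂ), inner ℂ (η.toLp 2) w = 0) : w = 0 := by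
  have h1 : ∀ v : L2, inner ℂ v w = 0 := by
    intro v
    have hd := SchwartzMap.denseRange_toLpCLM (E := E3) (F := ℂ) (p := 2) (μ := volume)
      (by norm_num)
    refine hd.induction_on (p := fun v => inner ℂ v w = 0) v
      (isClosed_eq (by fun_prop) continuous_const) fun η => h η
  exact inner_self_eq_zero.1 (h1 w)

/-- The other three components are weak derivatives of the first, and Schwartz functions are dense
in `L²`, so the first component determines them. -/
lemma toL2_injective : Function.Injective toL2 := by
  intro u v huv
  rw [← sub_eq_zero]
  set w := u - v with hw
  have h0 : (w : PiLp 2 (fun _ : Fin 4 => L2)) 0 = 0 := by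
    have : toL2L w = 0 := by rw [hw, map_sub, toL2L_apply, toL2L_apply, huv, sub_self]
    exact this
  refine Subtype.ext (PiLp.ext fun i => ?_)
  refine Fin.cases h0 (fun i => ?_) i
  refine inner_toLp_eq_zero fun η => ?_
  rw [w.2 i η, h0, inner_zero_right, neg_zero]

lemma isClosed_h1Submodule : IsClosed (h1Submodule : Set (PiLp 2 (fun _ : Fin 4 => L2))) := by
  have : (h1Submodule : Set (PiLp 2 (fun _ : Fin 4 => L2)))
      = ⋂ (i : Fin 3) (η : 𝓢(E3, ℂ)), {w : PiLp 2 (fun _ : Fin 4 => L2) |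
        inner ℂ (η.toLp 2 : L2) (w i.succ) = - inner ℂ ((∂_{e3 i} η : 𝓢(E3, ℂ)).toLp 2 : L2) (w 0)} := by
    ext w; simp only [mem_iInter]; rfl
  rw [this]
  exact isClosed_iInter fun i => isClosed_iInter fun η => isClosed_eq (by fun_prop) (by fun_prop)

instance : CompleteSpace H1 := isClosed_h1Submodule.completeSpace_coe

/-! #### The pairing -/

/-- The pairing of `L²`, without complex conjugation. -/
def pairL2 : L2 →L[ℂ] L2 →L[ℂ] ℂ := (ContinuousLinearMap.mul ℂ ℂ).lpPairing volume 2 2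

lemma pairL2_apply (u v : L2) : pairL2 u v = ∫ x, u x * v x := by
  rw [pairL2, ContinuousLinearMap.lpPairing_eq_integral]; rfl

lemma pairL2_comm (u v : L2) : pairL2 u v = pairL2 v u := by
  simp only [pairL2_apply, mul_comm]

/-- The pairing of fields, as a bilinear map. -/
def pairL : Field →L[ℂ] Field →L[ℂ] ℂ :=
  pairL2.bilinearComp (toL2L.comp (ContinuousLinearMap.fst ℂ H1 H1))
      (toL2L.comp (ContinuousLinearMap.fst ℂ H1 H1))
    + pairL2.bilinearComp (toL2L.comp (ContinuousLinearMap.snd ℂ H1 H1))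
      (toL2L.comp (ContinuousLinearMap.snd ℂ H1 H1))

lemma pairL_apply (f g : Field) : pairL f g = pair f g := by
  simp [pairL, pair, pairL2_apply]

lemma pair_eq (f g : Field) :
    pair f g = pairL2 (toL2 f.1) (toL2 g.1) + pairL2 (toL2 f.2) (toL2 g.2) := by
  simp [pair, pairL2_apply]

lemma pair_comm (f g : Field) : pair f g = pair g f := by
  rw [pair_eq, pair_eq, pairL2_comm, pairL2_comm (toL2 f.2)]

lemma pair_smul_right' (c : ℂ) (f g : Field) : pair f (c • g) = c * pair f g := by
  rw [← pairL_apply, map_smul, pairL_apply, smul_eq_mul]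

lemma pair_smul_left' (c : ℂ) (f g : Field) : pair (c • f) g = c * pair f g := by
  rw [pair_comm, pair_smul_right', pair_comm]

lemma pair_add_left (f g h : Field) : pair (f + g) h = pair f h + pair g h := by
  rw [pair_comm, pair_add_right, pair_comm, pair_comm h]

lemma pair_neg_right (f g : Field) : pair f (-g) = -pair f g := by
  rw [← pairL_apply, map_neg, pairL_apply]

lemma pair_neg_left (f g : Field) : pair (-f) g = -pair f g := by
  rw [pair_comm, pair_neg_right, pair_comm]

lemma pair_sub_right (f g h : Field) : pair f (g - h) = pair f g - pair f h := by
  rw [← pairL_apply, map_sub, pairL_apply, pairL_apply]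

lemma pair_sum_right {ι : Type*} (s : Finset ι) (f : Field) (g : ι → Field) :
    pair f (∑ i ∈ s, g i) = ∑ i ∈ s, pair f (g i) := by
  simp only [← pairL_apply, map_sum]

/-- `σ₁` as a linear map. -/
def sigma1L : Field →L[ℂ] Field :=
  (ContinuousLinearMap.snd ℂ H1 H1).prod (ContinuousLinearMap.fst ℂ H1 H1)

/-- `σ₃` as a linear map. -/
def sigma3L : Field →L[ℂ] Field :=
  (ContinuousLinearMap.fst ℂ H1 H1).prod (-ContinuousLinearMap.snd ℂ H1 H1)

@[simp] lemma sigma1L_apply (f : Field) : sigma1L f = sigma1 f := rfl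

@[simp] lemma sigma3L_apply (f : Field) : sigma3L f = sigma3 f := rfl

lemma sigma1_add (f g : Field) : sigma1 (f + g) = sigma1 f + sigma1 g := map_add sigma1L f g

lemma sigma3_add (f g : Field) : sigma3 (f + g) = sigma3 f + sigma3 g := map_add sigma3L f g

lemma sigma1_smul (c : ℂ) (f : Field) : sigma1 (c • f) = c • sigma1 f := map_smul sigma1L c f

lemma sigma3_smul (c : ℂ) (f : Field) : sigma3 (c • f) = c • sigma3 f := map_smul sigma3L c f

lemma sigma3_neg (f : Field) : sigma3 (-f) = -sigma3 f := map_neg sigma3L f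

@[simp] lemma sigma1_sigma1 (f : Field) : sigma1 (sigma1 f) = f := rfl

@[simp] lemma sigma3_sigma3 (f : Field) : sigma3 (sigma3 f) = f := by
  simp [sigma3]

lemma sigma1_sigma3 (f : Field) : sigma1 (sigma3 f) = -sigma3 (sigma1 f) := by
  simp [sigma3, sigma1]

lemma pair_sigma1 (f g : Field) : pair (sigma1 f) g = pair f (sigma1 g) := by
  simp only [pair_eq, sigma1]; ring

lemma pair_sigma3 (f g : Field) : pair (sigma3 f) g = pair f (sigma3 g) := by
  have h : ∀ u : H1, toL2 (-u) = -toL2 u := fun u => map_neg toL2L u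
  simp [pair_eq, sigma3, h]

/-- The symplectic form `Im ⟨w, σ₃ σ₁ w'⟩`. -/
def symp : Field →L[ℝ] Field →L[ℝ] ℝ :=
  (ContinuousLinearMap.compL ℝ Field ℂ ℝ Complex.imCLM).comp
    (pairL.bilinearComp (ContinuousLinearMap.id ℂ Field)
      (sigma3L.comp sigma1L) |>.bilinearRestrictScalars ℝ)

lemma symp_apply (w w' : Field) : symp w w' = (pair w (sigma3 (sigma1 w'))).im := by
  simp [symp, ← pairL_apply]

lemma pair_J_skew (w w' : Field) :
    pair w (sigma3 (sigma1 w')) = -pair w' (sigma3 (sigma1 w)) := by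
  rw [pair_comm, pair_sigma3, pair_sigma1, sigma1_sigma3, pair_neg_right]

lemma symp_skew (w w' : Field) : symp w w' = -symp w' w := by
  rw [symp_apply, pair_J_skew, Complex.neg_im, symp_apply]

/-! #### Complex conjugation -/

/-- Complex conjugation of `L²`. -/
def conjL2 : L2 →L[ℝ] L2 := (Complex.conjCLE : ℂ →L[ℝ] ℂ).compLpL 2 volume

lemma coeFn_conjL2 (u : L2) : conjL2 u =ᵐ[volume] fun x => conj (u x) :=
  (Complex.conjCLE : ℂ →L[ℝ] ℂ).coeFn_compLpL u

lemma norm_conjL2 (u : L2) : ‖conjL2 u‖ = ‖u‖ := by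
  rw [Lp.norm_def, Lp.norm_def]
  congr 1
  refine eLpNorm_congr_norm_ae ?_
  filter_upwards [coeFn_conjL2 u] with x hx
  rw [hx, RCLike.norm_conj]

lemma conjL2_conjL2 (u : L2) : conjL2 (conjL2 u) = u := by
  refine Lp.ext ?_
  filter_upwards [coeFn_conjL2 (conjL2 u), coeFn_conjL2 u] with x h1 h2
  rw [h1, h2, Complex.conj_conj]

lemma pairL2_conj (u v : L2) : pairL2 (conjL2 u) (conjL2 v) = conj (pairL2 u v) := by
  rw [pairL2_apply, pairL2_apply, ← integral_conj]
  refine integral_congr_ae ?_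
  filter_upwards [coeFn_conjL2 u, coeFn_conjL2 v] with x h1 h2
  rw [h1, h2, map_mul]

lemma inner_conjL2 (u v : L2) : inner ℂ u (conjL2 v) = conj (inner ℂ (conjL2 u) v) := by
  rw [L2.inner_def, L2.inner_def, ← integral_conj]
  refine integral_congr_ae ?_
  filter_upwards [coeFn_conjL2 u, coeFn_conjL2 v] with x h1 h2
  simp [h1, h2, mul_comm]

/-- Complex conjugation of test functions. -/
def conjS (η : 𝓢(E3, ℂ)) : 𝓢(E3, ℂ) :=
  SchwartzMap.postcompCLM (Complex.conjCLE : ℂ →L[ℝ] ℂ) η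

lemma conjS_apply (η : 𝓢(E3, ℂ)) (x : E3) : conjS η x = conj (η x) := rfl

lemma toLp_conjS (η : 𝓢(E3, ℂ)) : (conjS η).toLp 2 = conjL2 (η.toLp 2) := by
  refine Lp.ext ?_
  filter_upwards [(conjS η).coeFn_toLp 2, coeFn_conjL2 (η.toLp 2), η.coeFn_toLp 2] with x h1 h2 h3
  rw [h1, h2, h3, conjS_apply]

lemma lineDeriv_conjS (η : 𝓢(E3, ℂ)) (v : E3) : ∂_{v} (conjS η) = conjS (∂_{v} η) := by
  ext x
  rw [conjS_apply, SchwartzMap.lineDerivOp_apply_eq_fderiv,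
    SchwartzMap.lineDerivOp_apply_eq_fderiv]
  have h := (Complex.conjCLE : ℂ →L[ℝ] ℂ).hasFDerivAt.comp x (η.differentiableAt (x := x)).hasFDerivAt
  have h2 : HasFDerivAt (conjS η) _ x := h
  rw [h2.fderiv]; rfl

/-- Complex conjugation of `H¹`, as a linear map. -/
def conjH1ₗ : H1 →ₗ[ℝ] H1 where
  toFun u := ⟨WithLp.toLp 2 fun i => conjL2 ((u : PiLp 2 (fun _ : Fin 4 => L2)) i), fun i η => by
    change inner ℂ _ (conjL2 _) = -inner ℂ _ (conjL2 _)
    rw [inner_conjL2, inner_conjL2, ← toLp_conjS, ← toLp_conjS, u.2 i, lineDeriv_conjS, map_neg]⟩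
  map_add' u v := Subtype.ext (PiLp.ext fun i => map_add conjL2 _ _)
  map_smul' c u := Subtype.ext (PiLp.ext fun i => map_smul conjL2 c _)

/-- Complex conjugation of `H¹`. -/
def conjH1 : H1 →L[ℝ] H1 := conjH1ₗ.mkContinuous 1 fun u => by
  rw [one_mul]
  refine le_of_eq ?_
  change ‖(conjH1ₗ u : PiLp 2 (fun _ : Fin 4 => L2))‖ = ‖(u : PiLp 2 (fun _ : Fin 4 => L2))‖
  rw [PiLp.norm_eq_of_L2, PiLp.norm_eq_of_L2]
  congr 1
  exact Finset.sum_congr rfl fun i _ => by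
    rw [show (conjH1ₗ u : PiLp 2 (fun _ : Fin 4 => L2)) i
      = conjL2 ((u : PiLp 2 (fun _ : Fin 4 => L2)) i) from rfl, norm_conjL2]

lemma toL2_conjH1 (u : H1) : toL2 (conjH1 u) = conjL2 (toL2 u) := rfl

lemma isReal_iff (U : Field) : IsReal U ↔ U.2 = conjH1 U.1 := by
  constructor
  · intro h
    refine toL2_injective (Lp.ext ?_)
    rw [toL2_conjH1]
    filter_upwards [h, coeFn_conjL2 (toL2 U.1)] with x h1 h2
    rw [h1, h2]
  · intro h
    rw [IsReal, h, toL2_conjH1]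
    exact coeFn_conjL2 _

lemma conjH1_conjH1 (u : H1) : conjH1 (conjH1 u) = u :=
  toL2_injective (by rw [toL2_conjH1, toL2_conjH1, conjL2_conjL2])

/-- The real part of a field, for the reality condition `σ₁ U = Ū`. -/
def realPart : Field →L[ℝ] Field :=
  (2⁻¹ : ℝ) • (ContinuousLinearMap.id ℝ Field
    + (conjH1.comp (ContinuousLinearMap.snd ℝ H1 H1)).prod
      (conjH1.comp (ContinuousLinearMap.fst ℝ H1 H1)))

lemma realPart_apply (U : Field) :
    realPart U = ((2⁻¹ : ℝ) • (U.1 + conjH1 U.2), (2⁻¹ : ℝ) • (U.2 + conjH1 U.1)) := rfl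

lemma isReal_realPart (U : Field) : IsReal (realPart U) := by
  rw [isReal_iff, realPart_apply, map_smul, map_add, conjH1_conjH1, add_comm U.2]

/-- For real fields `⟨w, σ₃ σ₁ w'⟩` is imaginary. -/
lemma pair_J_of_isReal {w w' : Field} (hw : IsReal w) (hw' : IsReal w') :
    pair w (sigma3 (sigma1 w')) = Complex.I * symp w w' := by
  have h : conj (pair w (sigma3 (sigma1 w'))) = -pair w (sigma3 (sigma1 w')) := by
    rw [isReal_iff] at hw hw'
    have hn : ∀ u : H1, toL2 (-u) = -toL2 u := fun u => map_neg toL2L u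
    simp only [pair_eq, sigma1, sigma3, map_add, hn, map_neg, ← pairL2_conj, hw, hw', toL2_conjH1,
      conjL2_conjL2]
    ring
  have h2 := congrArg Complex.re h
  rw [Complex.conj_re, Complex.neg_re] at h2
  rw [symp_apply]
  apply Complex.ext
  · simp; linarith
  · simp

/-- The symplectic form against a real field sees only the real part. -/
lemma symp_realPart {w w' : Field} (hw' : IsReal w') : symp (realPart w) w' = symp w w' := by
  have h : symp (conjH1 w.2, conjH1 w.1) w' = symp w w' := by
    rw [isReal_iff] at hw'
    have hn : ∀ u : H1, toL2 (-u) = -toL2 u := fun u => map_neg toL2L u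
    have h1 : pairL2 (conjL2 (toL2 w.1)) (toL2 w'.1)
        = conj (pairL2 (toL2 w.1) (conjL2 (toL2 w'.1))) := by rw [← pairL2_conj, conjL2_conjL2]
    simp only [symp_apply, pair_eq, sigma1, sigma3, hn, map_neg, hw', toL2_conjH1, pairL2_conj,
      h1, Complex.add_im, Complex.neg_im, Complex.conj_im]
    ring
  have h2 : realPart w = (2⁻¹ : ℝ) • (w + (conjH1 w.2, conjH1 w.1)) := rfl
  rw [h2, map_smul, map_add, smul_apply, add_apply, h, smul_eq_mul]
  ring

/-- Testing with `σ₃ w` and `i σ₃ w` gives the two parts of `∫ w₁ w̄₁`. Both test fields are again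
in `H¹ × H¹`. -/
lemma eq_zero_of_symp {w : Field} (hw : IsReal w) (h : ∀ w', symp w w' = 0) : w = 0 := by
  have key : pairL2 (toL2 w.1) (conjL2 (toL2 w.1)) = 0 := by
    have h1 := h (Complex.I • sigma3 w)
    have h2 := h (sigma3 w)
    rw [isReal_iff] at hw
    have hn : ∀ u : H1, toL2 (-u) = -toL2 u := fun u => map_neg toL2L u
    rw [symp_apply] at h1 h2
    rw [sigma1_smul, sigma3_smul, pair_smul_right'] at h1
    simp only [pair_eq, sigma1, sigma3, hn, map_neg, hw, toL2_conjH1,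
      pairL2_comm (conjL2 (toL2 w.1))] at h1 h2
    simp at h1 h2
    apply Complex.ext
    · simp; linarith
    · simp; linarith
  have h0 : toL2 w.1 = 0 := by
    have h3 : inner ℂ (toL2 w.1) (toL2 w.1) = pairL2 (toL2 w.1) (conjL2 (toL2 w.1)) := by
      rw [L2.inner_def, pairL2_apply]
      refine integral_congr_ae ?_
      filter_upwards [coeFn_conjL2 (toL2 w.1)] with x hx
      rw [hx]; simp [Complex.mul_conj']
    exact inner_self_eq_zero.1 (h3.trans key)
  have h1 : w.1 = 0 := toL2_injective (h0.trans toL2_zero.symm)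
  rw [isReal_iff, h1, map_zero] at hw
  exact Prod.ext h1 hw

end NLS


/-! ### Operators of rank one -/

section RankOne

variable {F : Type*} [NormedAddCommGroup F] [NormedSpace ℝ F] [NormedSpace ℂ F]
  [IsScalarTower ℝ ℂ F]

/-- The operator `f ↦ ⟨a, f⟩ b`, for a bilinear form `P`. -/
def rankOne (P : F →L[ℝ] F →L[ℝ] ℂ) (a b : F) : F →L[ℝ] F :=
  ((ContinuousLinearMap.lsmul ℝ ℂ).flip b).comp (P a)

lemma rankOne_apply (P : F →L[ℝ] F →L[ℝ] ℂ) (a b f : F) : rankOne P a b f = P a f • b := by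
  simp [rankOne]

lemma contDiffOn_rankOne {G : Type*} [NormedAddCommGroup G] [NormedSpace ℝ G] {s : Set G}
    (P : F →L[ℝ] F →L[ℝ] ℂ) {a b : G → F} (ha : ContDiffOn ℝ (⊤ : ℕ∞) a s)
    (hb : ContDiffOn ℝ (⊤ : ℕ∞) b s) :
    ContDiffOn ℝ (⊤ : ℕ∞) (fun x => rankOne P (a x) (b x)) s := by
  have h1 : ContDiffOn ℝ (⊤ : ℕ∞) (fun x => (ContinuousLinearMap.lsmul ℝ ℂ :
      ℂ →L[ℝ] F →L[ℝ] F).flip (b x)) s := (ContinuousLinearMap.contDiff _).comp_contDiffOn hb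
  exact h1.clm_comp (P.contDiff.comp_contDiffOn ha)

/-- The projection onto the span of `σ₃ Φ`, `Φ'` and the `ξ_j`, `σ₁ ξ_j`, in terms of a bilinear
form and two involutions. -/
def spanProj {m : ℕ} (P : F →L[ℝ] F →L[ℝ] ℂ) (s₁ s₃ : F →L[ℝ] F) (c : ℝ) (Φ Φ' : F)
    (ξ : Fin m → F) : F →L[ℝ] F :=
  c • rankOne P (s₃ Φ') (s₃ Φ) + c • rankOne P Φ Φ'
    + ∑ j, (rankOne P (s₃ (ξ j)) (ξ j) + rankOne P (s₁ (s₃ (ξ j))) (s₁ (ξ j)))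

lemma spanProj_apply {m : ℕ} (P : F →L[ℝ] F →L[ℝ] ℂ) (s₁ s₃ : F →L[ℝ] F) (c : ℝ) (Φ Φ' : F)
    (ξ : Fin m → F) (f : F) :
    spanProj P s₁ s₃ c Φ Φ' ξ f = ((c : ℂ) * P (s₃ Φ') f) • s₃ Φ + ((c : ℂ) * P Φ f) • Φ'
      + ∑ j, (P (s₃ (ξ j)) f • ξ j + P (s₁ (s₃ (ξ j))) f • s₁ (ξ j)) := by
  have hc : ∀ x : F, (c : ℂ) • x = c • x := fun x => algebraMap_smul ℂ c x
  simp only [spanProj, add_apply, smul_apply, sum_apply, rankOne_apply, mul_smul, hc]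

lemma contDiffOn_spanProj {G : Type*} [NormedAddCommGroup G] [NormedSpace ℝ G] {s : Set G} {m : ℕ}
    (P : F →L[ℝ] F →L[ℝ] ℂ) (s₁ s₃ : F →L[ℝ] F) {c : G → ℝ} {Φ Φ' : G → F} {ξ : Fin m → G → F}
    (hc : ContDiffOn ℝ (⊤ : ℕ∞) c s) (hΦ : ContDiffOn ℝ (⊤ : ℕ∞) Φ s)
    (hΦ' : ContDiffOn ℝ (⊤ : ℕ∞) Φ' s) (hξ : ∀ j, ContDiffOn ℝ (⊤ : ℕ∞) (ξ j) s) :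
    ContDiffOn ℝ (⊤ : ℕ∞) (fun x => spanProj P s₁ s₃ (c x) (Φ x) (Φ' x) fun j => ξ j x) s := by
  have h1 : ∀ {a : G → F}, ContDiffOn ℝ (⊤ : ℕ∞) a s → ContDiffOn ℝ (⊤ : ℕ∞) (fun x => s₁ (a x)) s :=
    fun ha => s₁.contDiff.comp_contDiffOn ha
  have h3 : ∀ {a : G → F}, ContDiffOn ℝ (⊤ : ℕ∞) a s → ContDiffOn ℝ (⊤ : ℕ∞) (fun x => s₃ (a x)) s :=
    fun ha => s₃.contDiff.comp_contDiffOn ha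
  refine ((hc.smul (contDiffOn_rankOne P (h3 hΦ') (h3 hΦ))).add
    (hc.smul (contDiffOn_rankOne P hΦ hΦ'))).add (ContDiffOn.sum fun j _ => ?_)
  exact (contDiffOn_rankOne P (h3 (hξ j)) (hξ j)).add
    (contDiffOn_rankOne P (h1 (h3 (hξ j))) (h1 (hξ j)))

/-- The real part of half of `P(Φ, Φ)`, differentiated. -/
lemma hasDerivAt_re_half {P : F →L[ℝ] F →L[ℝ] ℂ} (hP : ∀ x y, P x y = P y x) {Φ : ℝ → F} {Φ' : F}
    {ω : ℝ} (h : HasDerivAt Φ Φ' ω) :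
    HasDerivAt (fun ω => 2⁻¹ * (P (Φ ω) (Φ ω)).re) (P (Φ ω) Φ').re ω := by
  have h1 := (P.hasFDerivAt.comp_hasDerivAt ω h).clm_apply h
  have h2 := (Complex.reCLM.hasFDerivAt.comp_hasDerivAt ω h1).const_mul (2⁻¹ : ℝ)
  refine h2.congr_deriv ?_
  simp only [Complex.reCLM_apply, Complex.add_re, Function.comp_apply]
  rw [hP Φ']
  ring

lemma contDiffOn_bilin_apply {G F' : Type*} [NormedAddCommGroup G] [NormedSpace ℝ G]
    [NormedAddCommGroup F'] [NormedSpace ℝ F'] {s : Set G}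
    (P : F →L[ℝ] F →L[ℝ] F') {a b : G → F} (ha : ContDiffOn ℝ (⊤ : ℕ∞) a s)
    (hb : ContDiffOn ℝ (⊤ : ℕ∞) b s) : ContDiffOn ℝ (⊤ : ℕ∞) (fun x => P (a x) (b x)) s :=
  (P.contDiff.comp_contDiffOn ha).clm_apply hb

end RankOne

namespace NLS

/-! #### Reality -/

/-- The conjugation `U ↦ σ₁ Ū`. -/
def bar : Field →L[ℝ] Field :=
  (conjH1.comp (ContinuousLinearMap.snd ℝ H1 H1)).prod
    (conjH1.comp (ContinuousLinearMap.fst ℝ H1 H1))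

lemma bar_apply (U : Field) : bar U = (conjH1 U.2, conjH1 U.1) := rfl

lemma isReal_iff_bar (U : Field) : IsReal U ↔ bar U = U := by
  rw [isReal_iff, bar_apply]
  constructor
  · intro h; rw [h, conjH1_conjH1, ← h]
  · intro h; exact (congrArg Prod.snd h).symm

lemma conjH1_smul (c : ℂ) (u : H1) : conjH1 (c • u) = conj c • conjH1 u := by
  refine toL2_injective (Lp.ext ?_)
  have h1 : toL2 (c • u) = c • toL2 u := rfl
  have h2 : toL2 (conj c • conjH1 u) = conj c • conjL2 (toL2 u) := rfl
  rw [toL2_conjH1, h1, h2]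
  filter_upwards [coeFn_conjL2 (c • toL2 u), Lp.coeFn_smul c (toL2 u),
    Lp.coeFn_smul (conj c) (conjL2 (toL2 u)), coeFn_conjL2 (toL2 u)] with x h1 h2 h3 h4
  rw [h1, h2, h3, Pi.smul_apply, Pi.smul_apply, h4, smul_eq_mul, smul_eq_mul, map_mul]

lemma bar_smul (c : ℂ) (U : Field) : bar (c • U) = conj c • bar U := by
  simp only [bar_apply, Prod.smul_fst, Prod.smul_snd, conjH1_smul, Prod.smul_mk]

lemma bar_sigma1 (U : Field) : bar (sigma1 U) = sigma1 (bar U) := rfl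

lemma bar_sigma3 (U : Field) : bar (sigma3 U) = -sigma3 (bar U) := by
  simp [bar_apply, sigma3]

lemma pair_bar (U W : Field) : pair (bar U) (bar W) = conj (pair U W) := by
  simp only [pair_eq, bar_apply, toL2_conjH1, pairL2_conj, map_add]
  ring

lemma bar_bar (U : Field) : bar (bar U) = U := by
  simp only [bar_apply, conjH1_conjH1]

lemma pair_bar_right (U W : Field) : pair U (bar W) = conj (pair (bar U) W) := by
  rw [← pair_bar, bar_bar]

lemma conjH1_of_ae_eq {u : H1} {g : E3 → ℝ} (h : toL2 u =ᵐ[volume] fun x => (g x : ℂ)) :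
    conjH1 u = u := by
  refine toL2_injective (Lp.ext ?_)
  rw [toL2_conjH1]
  filter_upwards [coeFn_conjL2 (toL2 u), h] with x h1 h2
  rw [h1, h2, Complex.conj_ofReal]

lemma conjH1_ofFun (g : E3 → ℝ) : conjH1 (ofFun g) = ofFun g := by
  by_cases h : ∃ u : H1, toL2 u =ᵐ[volume] fun x => (g x : ℂ)
  · rw [ofFun, dif_pos h]; exact conjH1_of_ae_eq h.choose_spec
  · rw [ofFun, dif_neg h, map_zero]

lemma toL2_ofFun {g : E3 → ℝ} (h : ∃ u : H1, toL2 u =ᵐ[volume] fun x => (g x : ℂ)) :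
    toL2 (ofFun g) =ᵐ[volume] fun x => (g x : ℂ) := by
  rw [ofFun, dif_pos h]; exact h.choose_spec

/-! #### The maps, over the real numbers -/

/-- The pairing, as a real bilinear map. -/
def pairR : Field →L[ℝ] Field →L[ℝ] ℂ := pairL.bilinearRestrictScalars ℝ

lemma pairR_apply (f g : Field) : pairR f g = pair f g := pairL_apply f g

/-- `σ₁`, as a real-linear map. -/
def sigma1R : Field →L[ℝ] Field := sigma1L.restrictScalars ℝ

/-- `σ₃`, as a real-linear map. -/
def sigma3R : Field →L[ℝ] Field := sigma3L.restrictScalars ℝ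

lemma sigma1R_apply (f : Field) : sigma1R f = sigma1 f := rfl

lemma sigma3R_apply (f : Field) : sigma3R f = sigma3 f := rfl

/-- The real-linear map `i σ₃`. -/
def iSigma3 : Field →L[ℝ] Field := (Complex.I • sigma3L).restrictScalars ℝ

lemma iSigma3_apply (f : Field) : iSigma3 f = Complex.I • sigma3 f := rfl

namespace Setting

variable {m : ℕ} (S : Setting m)

/-! ### The ground states and the eigenfunctions, as elements of function spaces -/

lemma bar_Phi (ω : ℝ) : bar (S.Phi ω) = S.Phi ω := by
  rw [bar_apply, Phi, conjH1_ofFun]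

lemma bar_xi (j : Fin m) (ω : ℝ) : bar (S.xi j ω) = sigma1 (S.xi j ω) := by
  rw [bar_apply, xi, conjH1_ofFun, conjH1_ofFun]; rfl

lemma sigma1_Phi (ω : ℝ) : sigma1 (S.Phi ω) = S.Phi ω := rfl

lemma contDiffOn_Phi : ContDiffOn ℝ (⊤ : ℕ∞) S.Phi S.O :=
  S.φ_smooth.2.2.2.prodMk S.φ_smooth.2.2.2

lemma contDiffOn_xi (j : Fin m) : ContDiffOn ℝ (⊤ : ℕ∞) (S.xi j) S.O :=
  (S.ξ₁_smooth j).2.2.2.prodMk (S.ξ₂_smooth j).2.2.2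

lemma contDiffOn_dPhi : ContDiffOn ℝ (⊤ : ℕ∞) S.dPhi S.O :=
  S.contDiffOn_Phi.deriv_of_isOpen S.O_open (by simp)

variable {S}

lemma hasDerivAt_Phi {ω : ℝ} (hω : ω ∈ S.O) : HasDerivAt S.Phi (S.dPhi ω) ω :=
  ((S.contDiffOn_Phi.differentiableOn (by simp)).differentiableAt
    (S.O_open.mem_nhds hω)).hasDerivAt

/-- A fixed bounded linear symmetry of the curve `Φ_ω` is inherited by its derivative. -/
lemma map_dPhi {ω : ℝ} (hω : ω ∈ S.O) (L : Field →L[ℝ] Field) (h : ∀ ω, L (S.Phi ω) = S.Phi ω) :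
    L (S.dPhi ω) = S.dPhi ω := by
  have h1 := L.hasFDerivAt.comp_hasDerivAt ω (hasDerivAt_Phi hω)
  have e : L ∘ S.Phi = S.Phi := funext h
  rw [e] at h1
  exact h1.unique (hasDerivAt_Phi hω)

lemma sigma1_dPhi {ω : ℝ} (hω : ω ∈ S.O) : sigma1 (S.dPhi ω) = S.dPhi ω :=
  map_dPhi hω sigma1R S.sigma1_Phi

lemma bar_dPhi {ω : ℝ} (hω : ω ∈ S.O) : bar (S.dPhi ω) = S.dPhi ω := map_dPhi hω bar S.bar_Phi

lemma toL2_φ {ω : ℝ} (hω : ω ∈ S.O) :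
    toL2 (ofFun (S.φ ω)) =ᵐ[volume] fun x => (S.φ ω x : ℂ) :=
  toL2_ofFun (S.φ_smooth.2.2.1 ω hω)

lemma toL2_ξ₁ {ω : ℝ} (hω : ω ∈ S.O) (j : Fin m) :
    toL2 (ofFun (S.ξ₁ j ω)) =ᵐ[volume] fun x => (S.ξ₁ j ω x : ℂ) :=
  toL2_ofFun ((S.ξ₁_smooth j).2.2.1 ω hω)

lemma toL2_ξ₂ {ω : ℝ} (hω : ω ∈ S.O) (j : Fin m) :
    toL2 (ofFun (S.ξ₂ j ω)) =ᵐ[volume] fun x => (S.ξ₂ j ω x : ℂ) :=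
  toL2_ofFun ((S.ξ₂_smooth j).2.2.1 ω hω)

/-- The mass of the ground state. -/
lemma pair_Phi_Phi {ω : ℝ} (hω : ω ∈ S.O) : pair (S.Phi ω) (S.Phi ω) = 2 * (S.q ω : ℂ) := by
  have h : ∫ x, toL2 (ofFun (S.φ ω)) x * toL2 (ofFun (S.φ ω)) x = (S.q ω : ℂ) := by
    rw [q, ← integral_complex_ofReal]
    refine integral_congr_ae ?_
    filter_upwards [toL2_φ hω] with x hx
    rw [hx]; push_cast; ring
  rw [pair, Phi, h]; ring

lemma q_eq {ω : ℝ} (hω : ω ∈ S.O) : S.q ω = 2⁻¹ * (pairR (S.Phi ω) (S.Phi ω)).re := by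
  rw [pairR_apply, pair_Phi_Phi hω]; simp

lemma hasDerivAt_q {ω : ℝ} (hω : ω ∈ S.O) :
    HasDerivAt S.q (pair (S.Phi ω) (S.dPhi ω)).re ω := by
  have h := hasDerivAt_re_half (P := pairR) (fun x y => by
    rw [pairR_apply, pairR_apply, pair_comm]) (hasDerivAt_Phi hω)
  rw [pairR_apply] at h
  refine h.congr_of_eventuallyEq ?_
  filter_upwards [S.O_open.mem_nhds hω] with ω' hω' using q_eq hω'

lemma deriv_q_pos {ω : ℝ} (hω : ω ∈ S.O) : 0 < deriv S.q ω := S.mass_deriv_pos ω hω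

lemma pair_Phi_dPhi {ω : ℝ} (hω : ω ∈ S.O) :
    pair (S.Phi ω) (S.dPhi ω) = (deriv S.q ω : ℝ) := by
  have h : conj (pair (S.Phi ω) (S.dPhi ω)) = pair (S.Phi ω) (S.dPhi ω) := by
    rw [← pair_bar, S.bar_Phi, bar_dPhi hω]
  rw [(hasDerivAt_q hω).deriv]
  exact (Complex.conj_eq_iff_re.1 h).symm

variable (S)

lemma contDiffOn_q : ContDiffOn ℝ (⊤ : ℕ∞) S.q S.O := by
  have h : ContDiffOn ℝ (⊤ : ℕ∞) (fun ω => pairR (S.Phi ω) (S.Phi ω)) S.O :=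
    contDiffOn_bilin_apply pairR S.contDiffOn_Phi S.contDiffOn_Phi
  exact (contDiffOn_const.mul (Complex.reCLM.contDiff.comp_contDiffOn h)).congr fun ω hω => q_eq hω

/-- The projection `P_d`, as a real-linear map. -/
def PdL (ω : ℝ) : Field →L[ℝ] Field :=
  spanProj pairR sigma1R sigma3R (deriv S.q ω)⁻¹ (S.Phi ω) (S.dPhi ω) fun j => S.xi j ω

lemma PdL_apply (ω : ℝ) (f : Field) : S.PdL ω f = S.Pd ω f := by
  rw [PdL, spanProj_apply, Complex.ofReal_inv]
  simp only [pairR_apply, sigma1R_apply, sigma3R_apply]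
  rfl

lemma contDiffOn_PdL : ContDiffOn ℝ (⊤ : ℕ∞) S.PdL S.O :=
  contDiffOn_spanProj pairR sigma1R sigma3R ((S.contDiffOn_q.deriv_of_isOpen S.O_open
    (by simp)).inv fun _ hω => (deriv_q_pos hω).ne') S.contDiffOn_Phi S.contDiffOn_dPhi
    S.contDiffOn_xi

variable {S}

/-- The conjugation exchanges `ξ_j` and `σ₁ ξ_j`, hence the two terms of each summand. In the first
term the sign from `σ₃ Φ` cancels the one from the coefficient. -/
lemma bar_Pd {ω : ℝ} (hω : ω ∈ S.O) (f : Field) : bar (S.Pd ω f) = S.Pd ω (bar f) := by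
  have hx : ∀ j, bar (sigma1 (S.xi j ω)) = S.xi j ω := fun j => by
    rw [bar_sigma1, bar_xi, sigma1_sigma1]
  simp only [Pd, map_add, map_sum, bar_smul, map_mul, map_inv₀, Complex.conj_ofReal, bar_sigma3,
    S.bar_Phi, bar_dPhi hω, bar_xi, hx, pair_bar_right, sigma1_sigma3, map_neg,
    pair_neg_left, neg_neg]
  congr 1
  · congr 1
    module
  · refine Finset.sum_congr rfl fun j _ => ?_
    module

lemma J_xi (j : Fin m) (ω : ℝ) :
    sigma3 (sigma1 (S.xi j ω)) = -sigma1 (sigma3 (S.xi j ω)) := by rw [sigma1_sigma3, neg_neg]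

/-- Written out, the expression is visibly antisymmetric in `w` and `w'`, which is the symmetry of
`P_d` for the symplectic form. -/
lemma pair_J_Pd_aux {ω : ℝ} (hω : ω ∈ S.O) (w w' : Field) :
    pair w (sigma3 (sigma1 (S.Pd ω w')))
      = ((deriv S.q ω : ℝ) : ℂ)⁻¹ * (pair (S.Phi ω) w' * pair (sigma3 (S.dPhi ω)) w
        - pair (sigma3 (S.dPhi ω)) w' * pair (S.Phi ω) w)
      + ∑ j, (pair (sigma1 (sigma3 (S.xi j ω))) w' * pair (sigma3 (S.xi j ω)) w
        - pair (sigma3 (S.xi j ω)) w' * pair (sigma1 (sigma3 (S.xi j ω))) w) := by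
  have h1 : sigma3 (sigma1 (sigma3 (S.Phi ω))) = -S.Phi ω := by
    rw [sigma1_sigma3, S.sigma1_Phi, sigma3_neg, sigma3_sigma3]
  have hsum : ∀ g : Fin m → Field,
      sigma3 (sigma1 (∑ j, g j)) = ∑ j, sigma3 (sigma1 (g j)) := fun g =>
    map_sum (sigma3L.comp sigma1L) g Finset.univ
  rw [Pd]
  simp only [sigma1_add, sigma3_add, sigma1_smul, sigma3_smul, hsum, h1, sigma1_dPhi hω,
    sigma1_sigma1, J_xi, pair_add_right, pair_sum_right, pair_smul_right', pair_neg_right]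
  rw [pair_comm w (S.Phi ω), pair_comm w (sigma3 (S.dPhi ω))]
  congr 1
  · ring
  · refine Finset.sum_congr rfl fun j _ => ?_
    rw [pair_comm w, pair_comm w]
    ring

/-- The projection `P_d` is symmetric for the symplectic form. -/
lemma pair_J_Pd {ω : ℝ} (hω : ω ∈ S.O) (w w' : Field) :
    pair w (sigma3 (sigma1 (S.Pd ω w'))) = pair (S.Pd ω w) (sigma3 (sigma1 w')) := by
  rw [pair_J_skew (S.Pd ω w), pair_J_Pd_aux hω, pair_J_Pd_aux hω, neg_add, ← mul_neg,
    ← Finset.sum_neg_distrib]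
  congr 1
  · ring
  · refine Finset.sum_congr rfl fun j _ => ?_
    ring

end Setting

end NLS


/-! ### Symmetry of Schrödinger operators on Schwartz functions -/

section Schwartz

variable {E : Type*} [NormedAddCommGroup E] [NormedSpace ℝ E]

/-- A smooth function with exponentially decaying derivatives, as a Schwartz function. -/
def schwartzOfExpDecay (g : E → ℝ) (hg : ContDiff ℝ (⊤ : ℕ∞) g)
    (h : ∀ n : ℕ, ∃ a > 0, ∃ C : ℝ, ∀ x, Real.exp (a * ‖x‖) * ‖iteratedFDeriv ℝ n g x‖ ≤ C) :
    𝓢(E, ℝ) where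
  toFun := g
  smooth' := hg
  decay' k n := by
    obtain ⟨a, ha, C, hC⟩ := h n
    refine ⟨k.factorial / a ^ k * C, fun x => ?_⟩
    have h1 := Real.pow_div_factorial_le_exp (x := a * ‖x‖) (by positivity) k
    have h2 : ‖x‖ ^ k ≤ k.factorial / a ^ k * Real.exp (a * ‖x‖) := by
      rw [mul_pow, div_le_iff₀ (by positivity)] at h1
      rw [div_mul_eq_mul_div, le_div_iff₀ (by positivity)]
      linarith
    calc ‖x‖ ^ k * ‖iteratedFDeriv ℝ n g x‖
        ≤ k.factorial / a ^ k * Real.exp (a * ‖x‖) * ‖iteratedFDeriv ℝ n g x‖ := by gcongr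
      _ ≤ _ := by rw [mul_assoc]; gcongr; exact hC x

end Schwartz

namespace SchwartzMap

variable {E : Type*} [NormedAddCommGroup E] [InnerProductSpace ℝ E] [FiniteDimensional ℝ E]
  [MeasurableSpace E] [BorelSpace E]

lemma integrable_mul' (f g : 𝓢(E, ℝ)) : Integrable (fun x => f x * g x) :=
  (f.memLp 2).integrable_mul (g.memLp 2)

/-- The Laplacian is symmetric. -/
lemma integral_laplacian_symm (f g : 𝓢(E, ℝ)) :
    Integrable (fun x => f x * (Δ (g : E → ℝ)) x - g x * (Δ (f : E → ℝ)) x) ∧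
      ∫ x, (f x * (Δ (g : E → ℝ)) x - g x * (Δ (f : E → ℝ)) x) = 0 := by
  simp only [← laplacian_apply]
  have h1 := f.integrable_mul' (Δ g)
  have h2 := g.integrable_mul' (Δ f)
  refine ⟨h1.sub h2, ?_⟩
  rw [integral_sub h1 h2, integral_mul_laplacian_right_eq_left, sub_eq_zero]
  exact integral_congr_ae (ae_of_all _ fun x => mul_comm _ _)

/-- If `(-Δ + W) f = a f'` and `(-Δ + W) g = b g'`, then `a ∫ f' g = b ∫ f g'`. -/
lemma schrodinger_symm {W : E → ℝ} {f f' g g' : 𝓢(E, ℝ)} {a b : ℝ}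
    (hf : ∀ x, -(Δ (f : E → ℝ)) x + W x * f x = a * f' x)
    (hg : ∀ x, -(Δ (g : E → ℝ)) x + W x * g x = b * g' x) :
    a * ∫ x, f' x * g x = b * ∫ x, f x * g' x := by
  rw [← integral_const_mul, ← integral_const_mul, ← sub_eq_zero, ← integral_sub
    ((f'.integrable_mul' g).const_mul a) ((f.integrable_mul' g').const_mul b),
    ← (integral_laplacian_symm f g).2]
  refine integral_congr_ae (ae_of_all _ fun x => ?_)
  have h1 := hf x
  have h2 := hg x
  dsimp only
  linear_combination (-g x) * h1 + f x * h2

end SchwartzMap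

/-- The second order remainder of a `C²` function is quadratic on bounded intervals. -/
lemma exists_taylor_bound {h : ℝ → ℝ} (hh : ContDiff ℝ (⊤ : ℕ∞) h) (M : ℝ) :
    ∃ C, ∀ x, |x| ≤ M → ∀ y, |y| ≤ M → |h y - h x - deriv h x * (y - x)| ≤ C * (y - x) ^ 2 := by
  have hd : ContDiff ℝ (⊤ : ℕ∞) (deriv h) := ((contDiff_infty_iff_deriv (𝕜 := ℝ)).1 hh).2
  have hdd : Continuous (deriv (deriv h)) :=
    ((contDiff_infty_iff_deriv (𝕜 := ℝ)).1 hd).2.continuous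
  obtain ⟨C, hC⟩ := (isCompact_Icc (a := -M) (b := M)).exists_bound_of_continuousOn
    hdd.continuousOn
  have hlip : ∀ x ∈ Icc (-M) M, ∀ y ∈ Icc (-M) M, |deriv h y - deriv h x| ≤ C * |y - x| :=
    fun x hx y hy => (convex_Icc (-M) M).norm_image_sub_le_of_norm_deriv_le
      (fun z _ => (hd.differentiable (by simp)).differentiableAt) hC hx hy
  refine ⟨C, fun x hx y hy => ?_⟩
  have hx' := abs_le.1 hx
  have hy' := abs_le.1 hy
  have hC0 : 0 ≤ C := (norm_nonneg _).trans (hC x hx')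
  have key := (convex_uIcc x y).norm_image_sub_le_of_norm_deriv_le
    (f := fun z => h z - deriv h x * z) (C := C * |y - x|) (x := x) (y := y)
    (fun z _ => ((hh.differentiable (by simp)).differentiableAt.sub
      (differentiableAt_id.const_mul _))) (fun z hz => by
      have e : deriv (fun z => h z - deriv h x * z) z = deriv h z - deriv h x := by
        have h1 := ((hh.differentiable (by simp)).differentiableAt (x := z)).hasDerivAt.sub
          ((hasDerivAt_id z).const_mul (deriv h x))
        rw [mul_one] at h1
        exact h1.deriv
      rw [e, Real.norm_eq_abs]
      have hz' : z ∈ Icc (-M) M := uIcc_subset_Icc hx' hy' hz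
      exact (hlip x hx' z hz').trans
        (mul_le_mul_of_nonneg_left (abs_sub_left_of_mem_uIcc hz) hC0)) left_mem_uIcc right_mem_uIcc
  simp only [Real.norm_eq_abs] at key
  calc _ = |h y - deriv h x * y - (h x - deriv h x * x)| := by congr 1; ring
    _ ≤ _ := key
    _ = C * (y - x) ^ 2 := by rw [mul_assoc, abs_mul_abs_self]; ring

lemma isBigO_bilin_self {F G α : Type*} [NormedAddCommGroup F] [NormedSpace ℝ F]
    [NormedAddCommGroup G] [NormedSpace ℝ G] (P : F →L[ℝ] F →L[ℝ] G) (a : α → F) (l : Filter α) :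
    (fun x => P (a x) (a x)) =O[l] fun x => ‖a x‖ * ‖a x‖ :=
  Asymptotics.IsBigO.of_bound ‖P‖ (Eventually.of_forall fun x => by
    rw [norm_mul, norm_norm, ← mul_assoc]; exact P.le_opNorm₂ _ _)

/-! ### Orthogonality relations from the equations for `φ_ω` and `ξ_j`. -/

namespace NLS

/-- A smooth family at fixed `ω`, as a Schwartz function. -/
def IsSmoothFamily.schwartz {O : Set ℝ} {g : ℝ → E3 → ℝ} (hg : IsSmoothFamily O g) {ω : ℝ}
    (hω : ω ∈ O) : 𝓢(E3, ℝ) :=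
  schwartzOfExpDecay (g ω)
    (contDiffOn_univ.1 (hg.1.comp (contDiff_const.prodMk contDiff_id).contDiffOn
      (fun x _ => ⟨hω, mem_univ x⟩)))
    (fun n => by
      obtain ⟨a, ha, C, h⟩ := hg.2.1 {ω} (singleton_subset_iff.2 hω) isCompact_singleton n
      exact ⟨a, ha, C, h ω rfl⟩)

lemma IsSmoothFamily.coe_schwartz {O : Set ℝ} {g : ℝ → E3 → ℝ} (hg : IsSmoothFamily O g) {ω : ℝ}
    (hω : ω ∈ O) : ⇑(hg.schwartz hω) = g ω := rfl

/-- A smooth family is bounded, locally uniformly in `ω`. -/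
lemma IsSmoothFamily.eventually_bounded {O : Set ℝ} {g : ℝ → E3 → ℝ} (hg : IsSmoothFamily O g)
    (hO : IsOpen O) {ω₀ : ℝ} (hω : ω₀ ∈ O) : ∃ M, ∀ᶠ ω in 𝓝 ω₀, ∀ x, |g ω x| ≤ M := by
  obtain ⟨K, hK, hKO, hKc⟩ := local_compact_nhds (hO.mem_nhds hω)
  obtain ⟨a, ha, C, h⟩ := hg.2.1 K hKO hKc 0
  refine ⟨C, ?_⟩
  filter_upwards [hK] with ω hω x
  have h1 := h ω hω x
  rw [norm_iteratedFDeriv_zero] at h1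
  refine le_trans ?_ h1
  exact le_mul_of_one_le_left (abs_nonneg _) (Real.one_le_exp (by positivity))

lemma integral_toL2_mul {u v : H1} {f g : E3 → ℝ} (hu : toL2 u =ᵐ[volume] fun x => (f x : ℂ))
    (hv : toL2 v =ᵐ[volume] fun x => (g x : ℂ)) :
    ∫ x, toL2 u x * toL2 v x = ((∫ x, f x * g x : ℝ) : ℂ) := by
  rw [← integral_complex_ofReal]
  refine integral_congr_ae ?_
  filter_upwards [hu, hv] with x h1 h2
  rw [h1, h2]; push_cast; rfl

namespace Setting

variable {m : ℕ} {S : Setting m} {ω : ℝ}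

/-- `φ_ω`, as a Schwartz function. -/
def φS (hω : ω ∈ S.O) : 𝓢(E3, ℝ) := S.φ_smooth.schwartz hω

/-- The sum of the components of `ξ_j`. -/
def ζS (hω : ω ∈ S.O) (j : Fin m) : 𝓢(E3, ℝ) :=
  (S.ξ₁_smooth j).schwartz hω + (S.ξ₂_smooth j).schwartz hω

/-- The difference of the components of `ξ_j`. -/
def ηS (hω : ω ∈ S.O) (j : Fin m) : 𝓢(E3, ℝ) :=
  (S.ξ₁_smooth j).schwartz hω - (S.ξ₂_smooth j).schwartz hω

lemma φS_apply (hω : ω ∈ S.O) (x : E3) : φS hω x = S.φ ω x := rfl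

lemma ζS_apply (hω : ω ∈ S.O) (j : Fin m) (x : E3) : ζS hω j x = S.ξ₁ j ω x + S.ξ₂ j ω x := rfl

lemma ηS_apply (hω : ω ∈ S.O) (j : Fin m) (x : E3) : ηS hω j x = S.ξ₁ j ω x - S.ξ₂ j ω x := rfl

lemma laplacian_ζS (hω : ω ∈ S.O) (j : Fin m) (x : E3) :
    (Δ (ζS hω j : E3 → ℝ)) x = (Δ (S.ξ₁ j ω)) x + (Δ (S.ξ₂ j ω)) x := by
  exact (((S.ξ₁_smooth j).schwartz hω).smooth 2).contDiffAt.laplacian_add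
    (((S.ξ₂_smooth j).schwartz hω).smooth 2).contDiffAt

lemma laplacian_ηS (hω : ω ∈ S.O) (j : Fin m) (x : E3) :
    (Δ (ηS hω j : E3 → ℝ)) x = (Δ (S.ξ₁ j ω)) x - (Δ (S.ξ₂ j ω)) x := by
  exact (((S.ξ₁_smooth j).schwartz hω).smooth 2).contDiffAt.laplacian_sub
    (((S.ξ₂_smooth j).schwartz hω).smooth 2).contDiffAt

/-- `L₋ φ = 0`. -/
lemma Lminus_φ (hω : ω ∈ S.O) (x : E3) :
    -(Δ (φS hω : E3 → ℝ)) x + (S.V x + ω + S.β (S.φ ω x ^ 2)) * φS hω x = 0 * φS hω x := by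
  have h : (Δ (φS hω : E3 → ℝ)) x = (Δ (S.φ ω)) x := rfl
  have := S.φ_eq ω hω x
  rw [h, φS_apply]
  linear_combination -this

/-- `L₋ (ξ₁ - ξ₂) = λ (ξ₁ + ξ₂)`. -/
lemma Lminus_η (hω : ω ∈ S.O) (j : Fin m) (x : E3) :
    -(Δ (ηS hω j : E3 → ℝ)) x + (S.V x + ω + S.β (S.φ ω x ^ 2)) * ηS hω j x
      = S.lam j ω * ζS hω j x := by
  have h1 := S.ξ_eq₁ ω hω j x
  have h2 := S.ξ_eq₂ ω hω j x
  rw [laplacian_ηS, ηS_apply, ζS_apply]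
  rw [potA, potB] at h1 h2
  linear_combination h1 + h2

/-- `L₊ (ξ₁ + ξ₂) = λ (ξ₁ - ξ₂)`. -/
lemma Lplus_ζ (hω : ω ∈ S.O) (j : Fin m) (x : E3) :
    -(Δ (ζS hω j : E3 → ℝ)) x + (S.V x + ω + S.β (S.φ ω x ^ 2)
      + 2 * (deriv S.β (S.φ ω x ^ 2) * S.φ ω x ^ 2)) * ζS hω j x = S.lam j ω * ηS hω j x := by
  have h1 := S.ξ_eq₁ ω hω j x
  have h2 := S.ξ_eq₂ ω hω j x
  rw [laplacian_ζS, ηS_apply, ζS_apply]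
  rw [potA, potB] at h1 h2
  linear_combination h1 - h2

/-- Symmetry of `L₋` applied to `L₋ φ = 0` and `L₋ η = λ ζ`, where `λ > 0`. -/
lemma integral_φ_ζ (hω : ω ∈ S.O) (j : Fin m) : ∫ x, φS hω x * ζS hω j x = 0 := by
  have h := SchwartzMap.schrodinger_symm (Lminus_φ hω) (Lminus_η hω j)
  rw [zero_mul] at h
  exact (mul_eq_zero.1 h.symm).resolve_left (S.lam_pos ω hω j).ne'

/-- Symmetry of `L₋` gives `λ_j a = λ_l b`, that of `L₊` gives `λ_j b = λ_l a`. Subtracting, `(λ_j +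
λ_l)(a - b) = 0`, and the eigenvalues are positive; no case distinction on `λ_j = λ_l` is needed. -/
lemma integral_ζ_η (hω : ω ∈ S.O) (j l : Fin m) :
    ∫ x, ζS hω j x * ηS hω l x = ∫ x, ηS hω j x * ζS hω l x := by
  have h1 := SchwartzMap.schrodinger_symm (Lminus_η hω j) (Lminus_η hω l)
  have h2 := SchwartzMap.schrodinger_symm (Lplus_ζ hω j) (Lplus_ζ hω l)
  have hj := S.lam_pos ω hω j
  have hl := S.lam_pos ω hω l
  set a := ∫ x, ζS hω j x * ηS hω l x
  set b := ∫ x, ηS hω j x * ζS hω l x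
  have h3 : (S.lam j ω + S.lam l ω) * (a - b) = 0 := by linear_combination h1 - h2
  exact sub_eq_zero.1 ((mul_eq_zero.1 h3).resolve_left (by positivity))

lemma pair_Phi_xi (hω : ω ∈ S.O) (j : Fin m) : pair (S.Phi ω) (S.xi j ω) = 0 := by
  rw [pair, Phi, xi, integral_toL2_mul (toL2_φ hω) (toL2_ξ₁ hω j),
    integral_toL2_mul (toL2_φ hω) (toL2_ξ₂ hω j), ← Complex.ofReal_add, Complex.ofReal_eq_zero,
    ← integral_φ_ζ hω j]
  refine (integral_add ((φS hω).integrable_mul' ((S.ξ₁_smooth j).schwartz hω))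
      ((φS hω).integrable_mul' ((S.ξ₂_smooth j).schwartz hω))).symm.trans ?_
  refine integral_congr_ae (ae_of_all _ fun x => ?_)
  simp only [ζS_apply, φS_apply, IsSmoothFamily.coe_schwartz]; ring

lemma toL2_neg_ξ₂ (hω : ω ∈ S.O) (j : Fin m) :
    toL2 (-ofFun (S.ξ₂ j ω)) =ᵐ[volume] fun x => ((-S.ξ₂ j ω x : ℝ) : ℂ) := by
  have h : toL2 (-ofFun (S.ξ₂ j ω)) = -toL2 (ofFun (S.ξ₂ j ω)) := rfl
  rw [h]
  filter_upwards [Lp.coeFn_neg (toL2 (ofFun (S.ξ₂ j ω))), toL2_ξ₂ hω j] with x h1 h2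
  rw [h1, Pi.neg_apply, h2]; push_cast; rfl

lemma pair_sigma3_xi_xi (hω : ω ∈ S.O) (j l : Fin m) :
    pair (sigma3 (S.xi j ω)) (S.xi l ω) = if j = l then 1 else 0 := by
  have h := S.ξ_norm ω hω j l
  have h1 := ((S.ξ₁_smooth j).schwartz hω).integrable_mul' ((S.ξ₁_smooth l).schwartz hω)
  have h2 := (-((S.ξ₂_smooth j).schwartz hω)).integrable_mul' ((S.ξ₂_smooth l).schwartz hω)
  rw [pair, sigma3, xi, xi, integral_toL2_mul (toL2_ξ₁ hω j) (toL2_ξ₁ hω l),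
    integral_toL2_mul (toL2_neg_ξ₂ hω j) (toL2_ξ₂ hω l), ← Complex.ofReal_add]
  refine (congrArg Complex.ofReal ((integral_add h1 h2).symm.trans ?_)).trans
    (?_ : ((if j = l then 1 else 0 : ℝ) : ℂ) = _)
  · rw [← h]
    refine integral_congr_ae (ae_of_all _ fun x => ?_)
    simp only [neg_apply, IsSmoothFamily.coe_schwartz]; ring
  · split_ifs <;> simp

lemma pair_sigma1_sigma3_xi_xi (hω : ω ∈ S.O) (j l : Fin m) :
    pair (sigma1 (sigma3 (S.xi j ω))) (S.xi l ω) = 0 := by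
  have h1 := (-((S.ξ₂_smooth j).schwartz hω)).integrable_mul' ((S.ξ₁_smooth l).schwartz hω)
  have h2 := ((S.ξ₁_smooth j).schwartz hω).integrable_mul' ((S.ξ₂_smooth l).schwartz hω)
  have h := sub_eq_zero.2 (integral_ζ_η hω j l)
  rw [← integral_sub ((ζS hω j).integrable_mul' (ηS hω l))
    ((ηS hω j).integrable_mul' (ζS hω l))] at h
  rw [pair, sigma3, sigma1, xi, xi, integral_toL2_mul (toL2_ξ₁ hω j) (toL2_ξ₂ hω l),
    integral_toL2_mul (toL2_neg_ξ₂ hω j) (toL2_ξ₁ hω l), ← Complex.ofReal_add,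
    Complex.ofReal_eq_zero]
  refine (integral_add h1 h2).symm.trans ?_
  have e : ∀ x, ζS hω j x * ηS hω l x - ηS hω j x * ζS hω l x
      = (-2) * ((-((S.ξ₂_smooth j).schwartz hω)) x * (S.ξ₁_smooth l).schwartz hω x
        + (S.ξ₁_smooth j).schwartz hω x * (S.ξ₂_smooth l).schwartz hω x) := fun x => by
    simp only [neg_apply, IsSmoothFamily.coe_schwartz, ζS_apply, ηS_apply]; ring
  simp only [e] at h
  rw [integral_const_mul] at h
  exact (mul_eq_zero.1 h).resolve_left (by norm_num)

/-- The function whose derivative enters `L₊`. -/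
lemma hasDerivAt_mul_β (S : Setting m) (s : ℝ) :
    HasDerivAt (fun s => S.β (s ^ 2) * s)
      (S.β (s ^ 2) + 2 * (deriv S.β (s ^ 2) * s ^ 2)) s := by
  have h1 := ((S.β_smooth.differentiable (by simp)).differentiableAt (x := s ^ 2)).hasDerivAt
  have h2 := (HasDerivAt.comp (h := fun s : ℝ => s ^ 2) s h1 (hasDerivAt_pow 2 s)).mul (hasDerivAt_id s)
  refine h2.congr_deriv ?_
  simp; ring

/-- The nonlinearity `s ↦ β(s²) s` is expanded at `φ_{ω₀}(x)`. The constant is uniform in `x`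
because the ground states are bounded uniformly for `ω` near `ω₀`. -/
lemma exists_φ_taylor_bound {ω₀ : ℝ} (hω₀ : ω₀ ∈ S.O) : ∃ C, ∀ᶠ ω in 𝓝 ω₀, ∀ x,
    |S.β (S.φ ω x ^ 2) * S.φ ω x - S.β (S.φ ω₀ x ^ 2) * S.φ ω₀ x
      - (S.β (S.φ ω₀ x ^ 2) + 2 * (deriv S.β (S.φ ω₀ x ^ 2) * S.φ ω₀ x ^ 2))
        * (S.φ ω x - S.φ ω₀ x)| ≤ C * (S.φ ω x - S.φ ω₀ x) ^ 2 := by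
  obtain ⟨M, hM⟩ := S.φ_smooth.eventually_bounded S.O_open hω₀
  obtain ⟨C, hC⟩ := exists_taylor_bound (h := fun s => S.β (s ^ 2) * s)
    ((S.β_smooth.comp (contDiff_id.pow 2)).mul contDiff_id) M
  refine ⟨C, ?_⟩
  filter_upwards [hM] with ω hω x
  have h := hC _ (hM.self_of_nhds x) _ (hω x)
  rwa [(hasDerivAt_mul_β S _).deriv] at h

/-- `L₊ ∂_ω φ = -φ` in difference form: for `u = φ_ω - φ_{ω₀}`, `L₊ u` is `-(ω - ω₀) φ_ω` plus a
quadratic remainder, and `λ ∫ u η = ∫ u L₊ ζ`. Differences avoid relating the `H¹`-derivative of the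
family to a pointwise one. -/
lemma exists_integral_φ_η_bound {ω₀ : ℝ} (hω₀ : ω₀ ∈ S.O) (j : Fin m) : ∃ C,
    ∀ᶠ ω in 𝓝 ω₀, ∀ hω : ω ∈ S.O,
      |S.lam j ω₀ * ∫ x, (φS hω - φS hω₀) x * ηS hω₀ j x|
        ≤ |ω - ω₀| * |∫ x, (φS hω - φS hω₀) x * ζS hω₀ j x|
          + C * ∫ x, (φS hω - φS hω₀) x * (φS hω - φS hω₀) x := by
  obtain ⟨C, hC⟩ := exists_φ_taylor_bound hω₀
  obtain ⟨Z, -, hZ⟩ := (ζS hω₀ j).decay 0 0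
  simp only [pow_zero, one_mul, norm_iteratedFDeriv_zero, Real.norm_eq_abs] at hZ
  refine ⟨Z * C, ?_⟩
  filter_upwards [hC] with ω hrem hω
  set u := φS hω - φS hω₀ with hu
  set ζ := ζS hω₀ j with hζ
  set η := ηS hω₀ j with hη
  obtain ⟨hs1, hs2⟩ := SchwartzMap.integral_laplacian_symm u ζ
  have hi1 := (u.integrable_mul' η).const_mul (S.lam j ω₀)
  have hi2 := ((φS hω).integrable_mul' ζ).const_mul (ω - ω₀)
  have hΔ : ∀ x, (Δ (u : E3 → ℝ)) x = (Δ (S.φ ω)) x - (Δ (S.φ ω₀)) x := fun x =>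
    ((φS hω).smooth 2).contDiffAt.laplacian_sub ((φS hω₀).smooth 2).contDiffAt
  have hux : ∀ x, u x = S.φ ω x - S.φ ω₀ x := fun x => rfl
  have hf : ∀ x, ‖S.lam j ω₀ * (u x * η x) + (u x * (Δ (ζ : E3 → ℝ)) x - ζ x * (Δ (u : E3 → ℝ)) x)
      + (ω - ω₀) * (φS hω x * ζ x)‖ ≤ Z * C * (u x * u x) := fun x => by
    have h1 := Lplus_ζ hω₀ j x
    have h2 := S.φ_eq ω hω x
    have h3 := S.φ_eq ω₀ hω₀ x
    rw [← hζ, ← hη] at h1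
    have e : S.lam j ω₀ * (u x * η x) + (u x * (Δ (ζ : E3 → ℝ)) x - ζ x * (Δ (u : E3 → ℝ)) x)
        + (ω - ω₀) * (φS hω x * ζ x)
        = -(ζ x * (S.β (S.φ ω x ^ 2) * S.φ ω x - S.β (S.φ ω₀ x ^ 2) * S.φ ω₀ x
      - (S.β (S.φ ω₀ x ^ 2) + 2 * (deriv S.β (S.φ ω₀ x ^ 2) * S.φ ω₀ x ^ 2))
        * (S.φ ω x - S.φ ω₀ x))) := by
      rw [hΔ, hux, φS_apply]
      linear_combination -(S.φ ω x - S.φ ω₀ x) * h1 - ζ x * h2 + ζ x * h3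
    rw [e, norm_neg, norm_mul, Real.norm_eq_abs, Real.norm_eq_abs, mul_assoc, ← pow_two]
    exact mul_le_mul (hZ x) (hrem x) (abs_nonneg _) ((abs_nonneg _).trans (hZ x))
  have h := norm_integral_le_of_norm_le ((u.integrable_mul' u).const_mul (Z * C))
    (ae_of_all _ hf)
  -- `φ_{ω₀}` is orthogonal to `ζ`, so a second small factor `u` appears in the term that is linear
  -- in `ω - ω₀`.
  have hφ : ∫ x, φS hω x * ζ x = ∫ x, u x * ζ x := by
    have e : ∀ x, u x * ζ x = φS hω x * ζ x - φS hω₀ x * ζ x := fun x => by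
      rw [hux, φS_apply, φS_apply]; ring
    simp only [e]
    rw [integral_sub ((φS hω).integrable_mul' ζ) ((φS hω₀).integrable_mul' ζ), hζ,
      integral_φ_ζ hω₀ j, sub_zero]
  have e1 := integral_add (f := fun x => S.lam j ω₀ * (u x * η x)
    + (u x * (Δ (ζ : E3 → ℝ)) x - ζ x * (Δ (u : E3 → ℝ)) x)) (hi1.add hs1) hi2
  rw [e1, integral_add hi1 hs1, hs2, add_zero, integral_const_mul,
    integral_const_mul, integral_const_mul, hφ, Real.norm_eq_abs] at h
  have h4 := abs_sub_le (S.lam j ω₀ * ∫ x, u x * η x) (-((ω - ω₀) * ∫ x, u x * ζ x)) 0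
  rw [sub_zero, sub_zero, sub_neg_eq_add, abs_neg, abs_mul (ω - ω₀)] at h4
  linarith

lemma toL2_φ_sub {ω₀ : ℝ} (hω : ω ∈ S.O) (hω₀ : ω₀ ∈ S.O) :
    toL2 (ofFun (S.φ ω) - ofFun (S.φ ω₀)) =ᵐ[volume] fun x => (((φS hω - φS hω₀) x : ℝ) : ℂ) := by
  have h : toL2 (ofFun (S.φ ω) - ofFun (S.φ ω₀)) = toL2 (ofFun (S.φ ω)) - toL2 (ofFun (S.φ ω₀)) :=
    rfl
  rw [h]
  filter_upwards [Lp.coeFn_sub (toL2 (ofFun (S.φ ω))) (toL2 (ofFun (S.φ ω₀))), toL2_φ hω,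
    toL2_φ hω₀] with x h1 h2 h3
  rw [h1, Pi.sub_apply, h2, h3, sub_apply, φS_apply, φS_apply]; push_cast; rfl

lemma pair_Phi_sub_xi {ω₀ : ℝ} (hω : ω ∈ S.O) (hω₀ : ω₀ ∈ S.O) (j : Fin m) :
    pair (S.xi j ω₀) (S.Phi ω - S.Phi ω₀)
      = ((∫ x, (φS hω - φS hω₀) x * ζS hω₀ j x : ℝ) : ℂ) := by
  rw [pair_comm, pair, Phi, Phi, xi, Prod.fst_sub, Prod.snd_sub,
    integral_toL2_mul (toL2_φ_sub hω hω₀) (toL2_ξ₁ hω₀ j),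
    integral_toL2_mul (toL2_φ_sub hω hω₀) (toL2_ξ₂ hω₀ j), ← Complex.ofReal_add]
  refine congrArg Complex.ofReal ((integral_add ((φS hω - φS hω₀).integrable_mul'
    ((S.ξ₁_smooth j).schwartz hω₀)) ((φS hω - φS hω₀).integrable_mul'
    ((S.ξ₂_smooth j).schwartz hω₀))).symm.trans ?_)
  refine integral_congr_ae (ae_of_all _ fun x => ?_)
  simp only [ζS_apply, IsSmoothFamily.coe_schwartz]; ring

lemma pair_Phi_sub_sigma3_xi {ω₀ : ℝ} (hω : ω ∈ S.O) (hω₀ : ω₀ ∈ S.O) (j : Fin m) :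
    pair (sigma3 (S.xi j ω₀)) (S.Phi ω - S.Phi ω₀)
      = ((∫ x, (φS hω - φS hω₀) x * ηS hω₀ j x : ℝ) : ℂ) := by
  rw [pair_comm, pair, Phi, Phi, xi, sigma3, Prod.fst_sub, Prod.snd_sub,
    integral_toL2_mul (toL2_φ_sub hω hω₀) (toL2_ξ₁ hω₀ j),
    integral_toL2_mul (toL2_φ_sub hω hω₀) (toL2_neg_ξ₂ hω₀ j), ← Complex.ofReal_add]
  refine congrArg Complex.ofReal ((integral_add ((φS hω - φS hω₀).integrable_mul'
    ((S.ξ₁_smooth j).schwartz hω₀)) ((φS hω - φS hω₀).integrable_mul'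
    (-((S.ξ₂_smooth j).schwartz hω₀)))).symm.trans ?_)
  refine integral_congr_ae (ae_of_all _ fun x => ?_)
  simp only [ηS_apply, IsSmoothFamily.coe_schwartz, neg_apply]; ring

lemma pair_Phi_sub_self {ω₀ : ℝ} (hω : ω ∈ S.O) (hω₀ : ω₀ ∈ S.O) :
    pair (S.Phi ω - S.Phi ω₀) (S.Phi ω - S.Phi ω₀)
      = ((2 * ∫ x, (φS hω - φS hω₀) x * (φS hω - φS hω₀) x : ℝ) : ℂ) := by
  rw [pair, Phi, Phi, Prod.fst_sub, Prod.snd_sub,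
    integral_toL2_mul (toL2_φ_sub hω hω₀) (toL2_φ_sub hω hω₀), ← Complex.ofReal_add, two_mul]

/-- Both terms of the bound are of second order, as `Φ_ω - Φ_{ω₀} = O(ω - ω₀)`. Hence `ω ↦ ⟨σ₃ ξ_j,
Φ_ω⟩`, with `ξ_j` taken at `ω₀`, has derivative zero at `ω₀`. -/
lemma pair_sigma3_dPhi_xi {ω₀ : ℝ} (hω₀ : ω₀ ∈ S.O) (j : Fin m) :
    pair (sigma3 (S.dPhi ω₀)) (S.xi j ω₀) = 0 := by
  rw [pair_sigma3, pair_comm]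
  obtain ⟨C, hC⟩ := exists_integral_φ_η_bound hω₀ j
  have hP := hasDerivAt_Phi hω₀
  have hO : (fun ω => S.Phi ω - S.Phi ω₀) =O[𝓝 ω₀] fun ω => ω - ω₀ := hP.isBigO_sub
  have h1 : HasDerivAt (fun ω => pairR (sigma3 (S.xi j ω₀)) (S.Phi ω))
      (pairR (sigma3 (S.xi j ω₀)) (S.dPhi ω₀)) ω₀ :=
    (pairR (sigma3 (S.xi j ω₀))).hasFDerivAt.comp_hasDerivAt ω₀ hP
  have hsub : Tendsto (fun ω => ω - ω₀) (𝓝 ω₀) (𝓝 0) := by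
    simpa using (continuous_id.sub continuous_const).tendsto (x := ω₀) (f := fun ω => ω - ω₀)
  have hone : (fun ω => ω - ω₀) =o[𝓝 ω₀] fun _ => (1 : ℝ) :=
    (Asymptotics.isLittleO_one_iff ℝ).2 hsub
  have hA : (fun ω => (ω - ω₀) * ‖pairR (S.xi j ω₀) (S.Phi ω - S.Phi ω₀)‖) =o[𝓝 ω₀]
      fun ω => ω - ω₀ := by
    have h := (Asymptotics.isBigO_refl (fun ω => ω - ω₀) (𝓝 ω₀)).mul_isLittleO
      ((((pairR (S.xi j ω₀)).isBigO_comp _ _).trans hO).trans_isLittleO hone).norm_left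
    simpa using h
  have hB : (fun ω => C * ‖pairR (S.Phi ω - S.Phi ω₀) (S.Phi ω - S.Phi ω₀)‖) =o[𝓝 ω₀]
      fun ω => ω - ω₀ := by
    have h2 : (fun ω => pairR (S.Phi ω - S.Phi ω₀) (S.Phi ω - S.Phi ω₀)) =O[𝓝 ω₀]
        fun ω => ‖S.Phi ω - S.Phi ω₀‖ * ‖S.Phi ω - S.Phi ω₀‖ :=
      isBigO_bilin_self pairR _ _
    have h3 := h2.trans (hO.norm_left.mul hO.norm_left)
    have h5 : (fun ω => (ω - ω₀) * (ω - ω₀)) =o[𝓝 ω₀] fun ω => ω - ω₀ := by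
      simpa using (Asymptotics.isBigO_refl (fun ω => ω - ω₀) (𝓝 ω₀)).mul_isLittleO hone
    exact ((h3.trans_isLittleO h5).norm_left).const_mul_left C
  have hl := S.lam_pos ω₀ hω₀ j
  have h0 : HasDerivAt (fun ω => pairR (sigma3 (S.xi j ω₀)) (S.Phi ω)) 0 ω₀ := by
    rw [hasDerivAt_iff_isLittleO]
    simp only [smul_zero, sub_zero]
    refine Asymptotics.IsLittleO.of_norm_left ?_
    have hAB := (hA.norm_left.add hB.norm_left).const_mul_left (S.lam j ω₀)⁻¹
    refine Asymptotics.IsBigO.trans_isLittleO (Asymptotics.IsBigO.of_bound 1 ?_) hAB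
    filter_upwards [hC, S.O_open.mem_nhds hω₀] with ω hω hωO
    have h := hω hωO
    rw [← map_sub, pairR_apply, pairR_apply, pairR_apply, pair_Phi_sub_sigma3_xi hωO hω₀,
      pair_Phi_sub_xi hωO hω₀, pair_Phi_sub_self hωO hω₀]
    simp only [Complex.norm_real, one_mul, norm_mul, Real.norm_eq_abs, abs_abs] at h ⊢
    rw [abs_mul, abs_of_pos hl] at h
    rw [abs_of_pos (inv_pos.2 hl), inv_mul_eq_div, le_div_iff₀ hl, mul_comm]
    refine h.trans (le_trans (add_le_add le_rfl ?_) (le_abs_self _))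
    refine (le_abs_self _).trans ?_
    rw [abs_mul]
    refine mul_le_mul_of_nonneg_left ?_ (abs_nonneg _)
    refine le_mul_of_one_le_left (abs_nonneg _) ?_
    norm_num
  rw [← pairR_apply]
  exact h1.unique h0

end Setting

end NLS


namespace NLS

/-- `σ₁` is symmetric and anticommutes with `σ₃`, so the pairing of two `σ₁`-invariant fields equals
its negative. -/
lemma pair_sigma3_eq_zero {w w' : Field} (hw : sigma1 w = w) (hw' : sigma1 w' = w') :
    pair w (sigma3 w') = 0 := by
  have h : pair w (sigma3 w') = -pair w (sigma3 w') := by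
    conv_lhs => rw [← hw, pair_sigma1, sigma1_sigma3, hw', pair_neg_right]
  exact self_eq_neg.1 h

namespace Setting

variable {m : ℕ} {S : Setting m} {ω : ℝ}

/-! ### The projections -/

lemma deriv_q_ne_zero (hω : ω ∈ S.O) : ((deriv S.q ω : ℝ) : ℂ) ≠ 0 :=
  Complex.ofReal_ne_zero.2 (deriv_q_pos hω).ne'

lemma pair_xi_sigma3_xi (hω : ω ∈ S.O) (j l : Fin m) :
    pair (S.xi j ω) (sigma3 (S.xi l ω)) = if j = l then 1 else 0 := by
  rw [← pair_sigma3, pair_sigma3_xi_xi hω]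

lemma pair_xi_J_xi (hω : ω ∈ S.O) (j l : Fin m) :
    pair (S.xi j ω) (sigma3 (sigma1 (S.xi l ω))) = 0 := by
  rw [← pair_sigma3, ← pair_sigma1, pair_sigma1_sigma3_xi_xi hω]

lemma pair_sigma1_xi_sigma3_xi (hω : ω ∈ S.O) (j l : Fin m) :
    pair (sigma1 (S.xi j ω)) (sigma3 (S.xi l ω)) = 0 := by
  rw [pair_sigma1, sigma1_sigma3, pair_neg_right, pair_xi_J_xi hω, neg_zero]

lemma pair_sigma1_xi_J_xi (hω : ω ∈ S.O) (j l : Fin m) :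
    pair (sigma1 (S.xi j ω)) (sigma3 (sigma1 (S.xi l ω))) = -if j = l then 1 else 0 := by
  rw [pair_sigma1, sigma1_sigma3, sigma1_sigma1, pair_neg_right, pair_xi_sigma3_xi hω]

lemma pair_Phi_sigma1_xi (hω : ω ∈ S.O) (j : Fin m) :
    pair (S.Phi ω) (sigma1 (S.xi j ω)) = 0 := by
  rw [← pair_sigma1, sigma1_Phi, pair_Phi_xi hω]

lemma sigma1_sigma3_dPhi (hω : ω ∈ S.O) :
    sigma1 (sigma3 (S.dPhi ω)) = -sigma3 (S.dPhi ω) := by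
  rw [sigma1_sigma3, sigma1_dPhi hω]

lemma pair_sigma3_dPhi_sigma1_xi (hω : ω ∈ S.O) (j : Fin m) :
    pair (sigma3 (S.dPhi ω)) (sigma1 (S.xi j ω)) = 0 := by
  rw [← pair_sigma1, sigma1_sigma3_dPhi hω, pair_neg_left, pair_sigma3_dPhi_xi hω, neg_zero]

/-- By the orthogonality relations the functionals that define `L²_c` are, after normalization by
`q'`, dual to the vectors spanning the range of `P_d`. This and its three analogues put the range of
`P_c` into `L²_c`. -/
lemma pair_Phi_Pd (hω : ω ∈ S.O) (w : Field) : pair (S.Phi ω) (S.Pd ω w) = pair (S.Phi ω) w := by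
  simp only [Pd, pair_add_right, pair_sum_right, pair_smul_right',
    pair_sigma3_eq_zero (S.sigma1_Phi ω) (S.sigma1_Phi ω), pair_Phi_dPhi hω, pair_Phi_xi hω,
    pair_Phi_sigma1_xi hω, mul_zero, add_zero, Finset.sum_const_zero, zero_add]
  field_simp [deriv_q_ne_zero hω]

lemma pair_sigma3_dPhi_Pd (hω : ω ∈ S.O) (w : Field) :
    pair (sigma3 (S.dPhi ω)) (S.Pd ω w) = pair (sigma3 (S.dPhi ω)) w := by
  have h1 : pair (sigma3 (S.dPhi ω)) (sigma3 (S.Phi ω)) = (deriv S.q ω : ℝ) := by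
    rw [pair_sigma3, sigma3_sigma3, pair_comm, pair_Phi_dPhi hω]
  have h2 : pair (sigma3 (S.dPhi ω)) (S.dPhi ω) = 0 := by
    rw [pair_comm, pair_sigma3_eq_zero (sigma1_dPhi hω) (sigma1_dPhi hω)]
  simp only [Pd, pair_add_right, pair_sum_right, pair_smul_right', h1, h2,
    pair_sigma3_dPhi_xi hω, pair_sigma3_dPhi_sigma1_xi hω, mul_zero, add_zero,
    Finset.sum_const_zero]
  field_simp [deriv_q_ne_zero hω]

lemma pair_xi_Phi (hω : ω ∈ S.O) (j : Fin m) :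
    pair (S.xi j ω) (S.Phi ω) = 0 := by rw [pair_comm, pair_Phi_xi hω]

lemma pair_sigma3_xi_Pd (hω : ω ∈ S.O) (j : Fin m) (w : Field) :
    pair (sigma3 (S.xi j ω)) (S.Pd ω w) = pair (sigma3 (S.xi j ω)) w := by
  have h1 : pair (sigma3 (S.xi j ω)) (sigma3 (S.Phi ω)) = 0 := by
    rw [pair_sigma3, sigma3_sigma3, pair_xi_Phi hω]
  have h2 : pair (sigma3 (S.xi j ω)) (S.dPhi ω) = 0 := by
    rw [pair_sigma3, pair_comm, pair_sigma3_dPhi_xi hω]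
  have h3 : ∀ l, pair (sigma3 (S.xi j ω)) (sigma1 (S.xi l ω)) = 0 := fun l => by
    rw [pair_sigma3, pair_xi_J_xi hω]
  simp only [Pd, pair_add_right, pair_sum_right, pair_smul_right', h1, h2, h3,
    pair_sigma3_xi_xi hω, mul_zero, add_zero, zero_add, mul_ite, mul_one, Finset.sum_ite_eq,
    Finset.mem_univ, if_true]

lemma pair_sigma1_sigma3_xi_Pd (hω : ω ∈ S.O) (j : Fin m) (w : Field) :
    pair (sigma1 (sigma3 (S.xi j ω))) (S.Pd ω w) = pair (sigma1 (sigma3 (S.xi j ω))) w := by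
  have h1 : pair (sigma1 (sigma3 (S.xi j ω))) (sigma3 (S.Phi ω)) = 0 := by
    rw [pair_sigma1, sigma1_sigma3, sigma1_Phi, pair_neg_right, pair_sigma3, sigma3_sigma3,
      pair_xi_Phi hω, neg_zero]
  have h2 : pair (sigma1 (sigma3 (S.xi j ω))) (S.dPhi ω) = 0 := by
    rw [pair_sigma1, sigma1_dPhi hω, pair_sigma3, pair_comm, pair_sigma3_dPhi_xi hω]
  have h3 : ∀ l, pair (sigma1 (sigma3 (S.xi j ω))) (sigma1 (S.xi l ω)) = if j = l then 1 else 0 :=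
    fun l => by rw [pair_sigma1, sigma1_sigma1, pair_sigma3_xi_xi hω]
  simp only [Pd, pair_add_right, pair_sum_right, pair_smul_right', h1, h2, h3,
    pair_sigma1_sigma3_xi_xi hω, mul_zero, add_zero, zero_add, mul_ite, mul_one,
    Finset.sum_ite_eq, Finset.mem_univ, if_true]

/-- The projection `P_c`, as a real-linear map. -/
def PcL (S : Setting m) (ω : ℝ) : Field →L[ℝ] Field := ContinuousLinearMap.id ℝ Field - S.PdL ω

lemma PcL_apply (S : Setting m) (ω : ℝ) (f : Field) : S.PcL ω f = S.Pc ω f := by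
  rw [PcL, sub_apply, PdL_apply]; rfl

lemma contDiffOn_PcL (S : Setting m) : ContDiffOn ℝ (⊤ : ℕ∞) S.PcL S.O :=
  contDiffOn_const.sub S.contDiffOn_PdL

lemma isReal_Pc (hω : ω ∈ S.O) {f : Field} (hf : IsReal f) : IsReal (S.Pc ω f) := by
  rw [isReal_iff_bar, Pc, map_sub, bar_Pd hω, (isReal_iff_bar f).1 hf]

/-- The projection `P_c` is symmetric for the symplectic form. -/
lemma symp_Pc (hω : ω ∈ S.O) (w w' : Field) : symp w (S.Pc ω w') = symp (S.Pc ω w) w' := by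
  have h : symp w (S.Pd ω w') = symp (S.Pd ω w) w' := by
    rw [symp_apply, symp_apply, pair_J_Pd hω]
  rw [Pc, Pc, map_sub, map_sub, sub_apply, h]

lemma Pc_mem (hω : ω ∈ S.O) {w : Field} (hw : IsReal w) : S.Pc ω w ∈ S.hcSubmodule ω := by
  refine ⟨isReal_Pc hω hw, ?_, ?_, fun j => ⟨?_, ?_⟩⟩
  · rw [Pc, pair_sub_right, pair_Phi_Pd hω, sub_self]
  · rw [Pc, pair_sub_right, pair_sigma3_dPhi_Pd hω, sub_self]
  · rw [Pc, pair_sub_right, pair_sigma3_xi_Pd hω, sub_self]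
  · rw [Pc, pair_sub_right, pair_sigma1_sigma3_xi_Pd hω, sub_self]

lemma Pc_of_mem {f : Field} (hf : f ∈ S.hcSubmodule ω) : S.Pc ω f = f := by
  obtain ⟨-, h1, h2, h3⟩ := hf
  have h4 := fun j => (h3 j).1
  have h5 := fun j => (h3 j).2
  simp only [Pc, Pd, h1, h2, h4, h5, mul_zero, zero_smul, add_zero, Finset.sum_const_zero,
    sub_zero]

lemma isClosed_hcSubmodule (S : Setting m) (ω : ℝ) :
    IsClosed (S.hcSubmodule ω : Set Field) := by
  have hp : ∀ w : Field, IsClosed {f : Field | pair w f = 0} := fun w => by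
    have h : Continuous fun f => pair w f := (pairR w).continuous.congr (pairR_apply w)
    exact isClosed_eq h continuous_const
  have hr : IsClosed {f : Field | IsReal f} := by
    simp only [isReal_iff_bar]
    exact isClosed_eq bar.continuous continuous_id
  have e : (S.hcSubmodule ω : Set Field) = {f | IsReal f} ∩ ({f | pair (S.Phi ω) f = 0} ∩
      ({f | pair (sigma3 (S.dPhi ω)) f = 0} ∩ ⋂ j, ({f | pair (sigma3 (S.xi j ω)) f = 0} ∩
        {f | pair (sigma1 (sigma3 (S.xi j ω))) f = 0}))) := by
    ext f
    simp only [mem_inter_iff, mem_iInter, mem_ofPred_eq]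
    rfl
  rw [e]
  exact hr.inter ((hp _).inter ((hp _).inter (isClosed_iInter fun j => (hp _).inter (hp _))))

instance (S : Setting m) (ω : ℝ) : CompleteSpace (S.hcSubmodule ω) :=
  (S.isClosed_hcSubmodule ω).completeSpace_coe

/-- The projection of a field onto the real continuous component. -/
def hcProj (hω : ω ∈ S.O) : Field →L[ℝ] S.hcSubmodule ω :=
  ((S.PcL ω).comp realPart).codRestrict (S.hcSubmodule ω) fun w => by
    rw [ContinuousLinearMap.comp_apply, PcL_apply]
    exact Pc_mem hω (isReal_realPart w)

lemma coe_hcProj (hω : ω ∈ S.O) (w : Field) : (hcProj hω w : Field) = S.Pc ω (realPart w) :=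
  S.PcL_apply ω _

lemma symp_hcProj (hω : ω ∈ S.O) (w : Field) (f : S.hcSubmodule ω) :
    symp (hcProj hω w) f = symp w f := by
  rw [coe_hcProj, ← symp_Pc hω, Pc_of_mem f.2, symp_realPart f.2.1]

/-- Against an element of the continuous component, any field may be replaced by its projection, so
nondegeneracy on all fields passes to the subspace. -/
lemma symp_nondeg (hω : ω ∈ S.O) (f : S.hcSubmodule ω)
    (h : ∀ g : S.hcSubmodule ω, symp (f : Field) g = 0) : f = 0 := by
  refine Subtype.ext (eq_zero_of_symp f.2.1 fun w => ?_)
  rw [symp_skew, ← symp_hcProj hω, ← symp_skew]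
  exact h _

/-! ### The symplectic form on the discrete component -/

/-- The direction of the real part of `z_j`. -/
def xiRe (S : Setting m) (j : Fin m) (ω : ℝ) : Field := S.xi j ω + sigma1 (S.xi j ω)

/-- The direction of the imaginary part of `z_j`. -/
def xiIm (S : Setting m) (j : Fin m) (ω : ℝ) : Field :=
  Complex.I • (S.xi j ω - sigma1 (S.xi j ω))

lemma sigma1_sub (f g : Field) : sigma1 (f - g) = sigma1 f - sigma1 g := map_sub sigma1L f g

lemma sigma3_sub (f g : Field) : sigma3 (f - g) = sigma3 f - sigma3 g := map_sub sigma3L f g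

lemma J_xiRe (j : Fin m) (ω : ℝ) : sigma3 (sigma1 (S.xiRe j ω))
    = sigma3 (sigma1 (S.xi j ω)) + sigma3 (S.xi j ω) := by
  rw [xiRe, sigma1_add, sigma1_sigma1, sigma3_add]

lemma J_xiIm (j : Fin m) (ω : ℝ) : sigma3 (sigma1 (S.xiIm j ω))
    = Complex.I • (sigma3 (sigma1 (S.xi j ω)) - sigma3 (S.xi j ω)) := by
  rw [xiIm, sigma1_smul, sigma3_smul, sigma1_sub, sigma1_sigma1, sigma3_sub]

lemma symp_iSigma3 (w w' : Field) : symp (iSigma3 w) w' = (pair w (sigma1 w')).re := by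
  rw [symp_apply, iSigma3_apply, pair_smul_left', pair_sigma3, sigma3_sigma3]
  simp

lemma iSigma3_iSigma3 (w : Field) : iSigma3 (iSigma3 w) = -w := by
  rw [iSigma3_apply, iSigma3_apply, sigma3_smul, sigma3_sigma3, smul_smul, Complex.I_mul_I,
    neg_one_smul]

lemma symp_iSigma3_iSigma3 (w w' : Field) : symp (iSigma3 w) (iSigma3 w') = symp w w' := by
  rw [symp_iSigma3, iSigma3_apply, sigma1_smul, sigma1_sigma3, pair_smul_right', pair_neg_right,
    symp_apply]
  simp

lemma symp_xiRe_xiRe (hω : ω ∈ S.O) (j l : Fin m) : symp (S.xiRe j ω) (S.xiRe l ω) = 0 := by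
  rw [symp_apply, J_xiRe, xiRe]
  simp only [pair_add_left, pair_add_right, pair_xi_sigma3_xi hω, pair_xi_J_xi hω,
    pair_sigma1_xi_sigma3_xi hω, pair_sigma1_xi_J_xi hω]
  simp

lemma symp_xiIm_xiIm (hω : ω ∈ S.O) (j l : Fin m) : symp (S.xiIm j ω) (S.xiIm l ω) = 0 := by
  rw [symp_apply, J_xiIm, xiIm, sub_eq_add_neg, sub_eq_add_neg]
  simp only [pair_smul_left', pair_smul_right', pair_add_left, pair_add_right, pair_neg_left,
    pair_neg_right, pair_xi_sigma3_xi hω, pair_xi_J_xi hω, pair_sigma1_xi_sigma3_xi hω,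
    pair_sigma1_xi_J_xi hω]
  simp

/-- The factor is that of `dz ∧ dz̄ = -2i dx ∧ dy`, once `i` is divided out. -/
lemma symp_xiRe_xiIm (hω : ω ∈ S.O) (j l : Fin m) :
    symp (S.xiRe j ω) (S.xiIm l ω) = if j = l then -2 else 0 := by
  rw [symp_apply, J_xiIm, xiRe, sub_eq_add_neg]
  simp only [pair_smul_right', pair_add_left, pair_add_right, pair_neg_right,
    pair_xi_sigma3_xi hω, pair_xi_J_xi hω, pair_sigma1_xi_sigma3_xi hω, pair_sigma1_xi_J_xi hω]
  split_ifs <;> simp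
  norm_num

lemma pair_J_dPhi (hω : ω ∈ S.O) (w : Field) :
    pair (S.dPhi ω) (sigma3 (sigma1 w)) = -pair (sigma3 (S.dPhi ω)) w := by
  rw [← pair_sigma3, ← pair_sigma1, sigma1_sigma3_dPhi hω, pair_neg_left]

lemma pair_Phi_xiRe (hω : ω ∈ S.O) (j : Fin m) : pair (S.Phi ω) (S.xiRe j ω) = 0 := by
  rw [xiRe, pair_add_right, pair_Phi_xi hω, pair_Phi_sigma1_xi hω, add_zero]

lemma pair_Phi_xiIm (hω : ω ∈ S.O) (j : Fin m) : pair (S.Phi ω) (S.xiIm j ω) = 0 := by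
  rw [xiIm, pair_smul_right', pair_sub_right, pair_Phi_xi hω, pair_Phi_sigma1_xi hω, sub_zero,
    mul_zero]

lemma pair_sigma3_dPhi_xiRe (hω : ω ∈ S.O) (j : Fin m) :
    pair (sigma3 (S.dPhi ω)) (S.xiRe j ω) = 0 := by
  rw [xiRe, pair_add_right, pair_sigma3_dPhi_xi hω, pair_sigma3_dPhi_sigma1_xi hω, add_zero]

lemma pair_sigma3_dPhi_xiIm (hω : ω ∈ S.O) (j : Fin m) :
    pair (sigma3 (S.dPhi ω)) (S.xiIm j ω) = 0 := by
  rw [xiIm, pair_smul_right', pair_sub_right, pair_sigma3_dPhi_xi hω,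
    pair_sigma3_dPhi_sigma1_xi hω, sub_zero, mul_zero]

lemma symp_iSigma3_Phi (ω : ℝ) (w : Field) :
    symp (iSigma3 (S.Phi ω)) w = (pair (S.Phi ω) w).re := by
  rw [symp_iSigma3, ← pair_sigma1, sigma1_Phi]

lemma symp_dPhi (hω : ω ∈ S.O) (w : Field) :
    symp (S.dPhi ω) w = -(pair (sigma3 (S.dPhi ω)) w).im := by
  rw [symp_apply, pair_J_dPhi hω, Complex.neg_im]

lemma symp_xiRe_of_mem (j : Fin m) {f : Field} (hf : f ∈ S.hcSubmodule ω) :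
    symp (S.xiRe j ω) f = 0 := by
  obtain ⟨-, -, -, h⟩ := hf
  rw [symp_skew, symp_apply, J_xiRe, J_xi, pair_comm, pair_add_left, pair_neg_left, (h j).1,
    (h j).2]
  simp

lemma symp_xiIm_of_mem (j : Fin m) {f : Field} (hf : f ∈ S.hcSubmodule ω) :
    symp (S.xiIm j ω) f = 0 := by
  obtain ⟨-, -, -, h⟩ := hf
  rw [symp_skew, symp_apply, J_xiIm, J_xi, pair_comm, pair_smul_left', sub_eq_add_neg,
    pair_add_left, pair_neg_left, pair_neg_left, (h j).1, (h j).2]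
  simp

/-- The abstract model of the setting. -/
def model (S : Setting m) {ω₀ : ℝ} (hω₀ : ω₀ ∈ S.O) : SolitonModel m Field (S.hcSubmodule ω₀) where
  σ := symp
  σ_skew := symp_skew
  J := iSigma3
  J_J := iSigma3_iSigma3
  σ_J := symp_iSigma3_iSigma3
  O := S.O
  O_open := S.O_open
  ω₀ := ω₀
  ω₀_mem := hω₀
  q := S.q
  q_smooth := S.contDiffOn_q
  deriv_q_ne := (deriv_q_pos hω₀).ne'
  Φ := S.Phi
  Φ_smooth := S.contDiffOn_Phi
  a := S.xiRe
  a_smooth := fun j => (S.contDiffOn_xi j).add (sigma1R.contDiff.comp_contDiffOn (S.contDiffOn_xi j))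
  b := S.xiIm
  b_smooth := fun j => ((Complex.I • ContinuousLinearMap.id ℂ Field).restrictScalars ℝ).contDiff.comp_contDiffOn
    ((S.contDiffOn_xi j).sub (sigma1R.contDiff.comp_contDiffOn (S.contDiffOn_xi j)))
  P := S.PcL
  P_smooth := S.contDiffOn_PcL
  P_symm := fun ω hω x y => by rw [PcL_apply, PcL_apply, symp_Pc hω]
  ι := (S.hcSubmodule ω₀).subtypeL
  proj := hcProj hω₀
  σ_proj := symp_hcProj hω₀
  ι_nondeg := symp_nondeg hω₀
  P_ι := fun f => (S.PcL_apply ω₀ f).trans (Pc_of_mem f.2)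
  σ_JΦ_deriv := (symp_iSigma3_Phi ω₀ (S.dPhi ω₀)).trans (by
    rw [pair_Phi_dPhi hω₀, Complex.ofReal_re])
  σ_JΦ_a := fun j => by rw [symp_iSigma3_Phi, pair_Phi_xiRe hω₀, Complex.zero_re]
  σ_JΦ_b := fun j => by rw [symp_iSigma3_Phi, pair_Phi_xiIm hω₀, Complex.zero_re]
  σ_JΦ_ι := fun f => (symp_iSigma3_Phi ω₀ (f : Field)).trans (by rw [f.2.2.1, Complex.zero_re])
  σ_deriv_a := fun j => (symp_dPhi hω₀ _).trans (by
    rw [pair_sigma3_dPhi_xiRe hω₀, Complex.zero_im, neg_zero])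
  σ_deriv_b := fun j => (symp_dPhi hω₀ _).trans (by
    rw [pair_sigma3_dPhi_xiIm hω₀, Complex.zero_im, neg_zero])
  σ_deriv_ι := fun f => (symp_dPhi hω₀ (f : Field)).trans (by
    rw [f.2.2.2.1, Complex.zero_im, neg_zero])
  σ_a_a := symp_xiRe_xiRe hω₀
  σ_b_b := symp_xiIm_xiIm hω₀
  σ_a_b := symp_xiRe_xiIm hω₀
  σ_a_ι := fun j f => symp_xiRe_of_mem j f.2
  σ_b_ι := fun j f => symp_xiIm_of_mem j f.2
  σ_Φ_JΦ := by
    rw [symp_skew, symp_iSigma3_Phi, pair_Phi_Phi hω₀]; simp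
  σ_deriv_Φ := (symp_dPhi hω₀ _).trans (by
    rw [pair_comm, pair_sigma3_eq_zero (S.sigma1_Phi ω₀) (sigma1_dPhi hω₀), Complex.zero_im,
      neg_zero])

end Setting

end NLS


/-! ### Balls around the base points, and invariance along the flow. -/

namespace MoserData.CorrectedFlow

variable {E : Type*} [NormedAddCommGroup E] [NormedSpace ℝ E] [CompleteSpace E] {M : MoserData E}
  (D : M.CorrectedFlow)

/-- The union of the balls around the base points that are contained in `flowSet`. -/
def ballSet : Set E := {p | ∃ k r : ℝ, 0 < r ∧ Metric.ball (M.b₀ + k • M.e) r ⊆ D.flowSet ∧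
  p ∈ Metric.ball (M.b₀ + k • M.e) r}

lemma isOpen_ballSet : IsOpen D.ballSet := by
  rw [isOpen_iff_mem_nhds]
  rintro p ⟨k, r, hr, hsub, hp⟩
  filter_upwards [Metric.isOpen_ball.mem_nhds hp] with x hx using ⟨k, r, hr, hsub, hx⟩

lemma base_mem_ballSet (k : ℝ) : M.b₀ + k • M.e ∈ D.ballSet := by
  obtain ⟨r, hr, h⟩ := Metric.isOpen_iff.1 D.isOpen_flowSet _ (D.base_mem_flowSet k)
  exact ⟨k, r, hr, h, Metric.mem_ball_self hr⟩

lemma ballSet_subset : D.ballSet ⊆ D.flowSet := fun _ ⟨_, _, _, hsub, hp⟩ => hsub hp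

lemma ballSet_subset_flowDom : D.ballSet ⊆ D.flowDom := fun _ h => (D.ballSet_subset h).2

/-- A function with vanishing differential on `flowSet` that vanishes at the base points. -/
lemma eq_zero_of_fderiv_eq_zero {g : E → ℝ} (hg : ∀ p ∈ D.flowSet, HasFDerivAt g (0 : E →L[ℝ] ℝ) p)
    (h0 : ∀ k : ℝ, g (M.b₀ + k • M.e) = 0) {p : E} (hp : p ∈ D.ballSet) : g p = 0 := by
  obtain ⟨k, r, hr, hsub, hp⟩ := hp
  rw [← h0 k]
  exact (convex_ball _ r).is_const_of_fderivWithin_eq_zero (𝕜 := ℝ)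
    (fun x hx => (hg x (hsub hx)).differentiableAt.differentiableWithinAt)
    (fun x hx => (hg x (hsub hx)).hasFDerivWithinAt.fderivWithin
      (Metric.isOpen_ball.uniqueDiffWithinAt hx)) hp (Metric.mem_ball_self hr)

/-- Functions that are invariant in the direction `e` stay so along the flow. -/
lemma hasLineDerivAt_comp_flow {G : Type*} [NormedAddCommGroup G] [NormedSpace ℝ G] {χ : E → G}
    (hχ : ∀ p ∈ D.dom, HasLineDerivAt ℝ χ 0 p M.e) {p : E} (hp : p ∈ D.flowSet) {t : ℝ}
    (ht : t ∈ Icc (0 : ℝ) 1) : HasLineDerivAt ℝ (fun p' => χ (D.flow t p')) 0 p M.e := by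
  have h := hχ _ (D.flow_mem p hp.2 t ht)
  rw [HasLineDerivAt] at h ⊢
  refine h.congr_of_eventuallyEq ?_
  have hc : ContinuousAt (fun k : ℝ => p + k • M.e) 0 := by fun_prop
  have hm : ∀ᶠ k : ℝ in 𝓝 0, p + k • M.e ∈ D.flowSet :=
    hc.eventually (D.isOpen_flowSet.mem_nhds (by simpa using hp))
  filter_upwards [hm] with k hk
  rw [D.flow_add hp hk ht]

end MoserData.CorrectedFlow

/-! ### The mass as Hamiltonian of `∂_θ`, and the forms in coordinates. -/

namespace SolitonModel

variable {m : ℕ} {F H : Type*} [NormedAddCommGroup F] [NormedSpace ℝ F]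
  [NormedAddCommGroup H] [NormedSpace ℝ H] (M : SolitonModel m F H)

/-- The mass of a field. -/
def mass (x : F) : ℝ := 2⁻¹ * M.σ (M.J x) x

lemma σ_J_symm (x y : F) : M.σ (M.J x) y = M.σ (M.J y) x := by
  rw [M.σ_J_left, M.σ_skew x, neg_neg]

lemma hasFDerivAt_mass (x : F) : HasFDerivAt M.mass (M.σ (M.J x)) x := by
  have h := ((M.σ.comp M.J).hasFDerivAt (x := x)).clm_apply (hasFDerivAt_id x)
  refine (h.const_mul (2⁻¹ : ℝ)).congr_fderiv ?_
  ext y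
  simp [M.σ_J_symm y x]
  ring

lemma J_rotL (θ : ℝ) (x : F) : M.J (M.rotL θ x) = M.rotL θ (M.J x) := by
  simp only [rotL_apply, map_add, map_smul]

lemma mass_rotL (θ : ℝ) (x : F) : M.mass (M.rotL θ x) = M.mass x := by
  rw [mass, J_rotL, σ_rotL, mass]

lemma mass_Φ : M.mass (M.Φ M.ω₀) = M.q M.ω₀ := by
  rw [mass, M.σ_skew, M.σ_Φ_JΦ]; ring

lemma fderiv_U_eTheta {p : Param m H} (hp : p ∈ M.dom) : fderiv ℝ M.U p eTheta = M.J (M.U p) := by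
  rw [M.fderiv_U hp, M.dV_eTheta hp, ← J_rotL, U]

/-- The vector field `∂_θ` is the Hamiltonian vector field of the mass. -/
lemma hasFDerivAt_mass_U {p : Param m H} (hp : p ∈ M.dom) :
    HasFDerivAt (fun p => M.mass (M.U p)) (M.B (M.A₁ p eTheta)) p := by
  have h := (M.hasFDerivAt_mass (M.U p)).comp p (M.hasFDerivAt_U hp)
  refine h.congr_fderiv (ContinuousLinearMap.ext fun Y => ?_)
  rw [M.B_A₁' hp, M.fderiv_U_eTheta hp, M.fderiv_U hp Y]
  rfl

lemma U_base_add (k : ℝ) :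
    M.U (M.base₀ + k • (eTheta : Param m H)) = M.rotL k (M.Φ M.ω₀) := by
  rw [U, T_add, T_base]
  simp [base₀, eTheta]

/-! #### The forms, as functions -/

/-- The 2-form at the time `t`. -/
def form (t : ℝ) (p X Y : Param m H) : ℝ := M.moserData.B (M.moserData.A t p X) Y

/-- The initial 2-form. -/
def form₀ (p X Y : Param m H) : ℝ := M.moserData.B (M.moserData.A₀ p X) Y

/-- The difference of the primitives. -/
def prim (p Y : Param m H) : ℝ := M.moserData.B (M.moserData.Ga p) Y

/-- The differential of the parametrization. -/
def dU (p Y : Param m H) : F := fderiv ℝ M.U p Y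

/-- The differential of `ψ`. -/
def dψ (p Y : Param m H) : ℝ := fderiv ℝ M.ψ p Y

lemma form₀_eq (p X Y : Param m H) :
    M.form₀ p X Y = deriv M.q p.2.1 * (X.1 * Y.2.1 - X.2.1 * Y.1)
      + 2 * ∑ j, ((X.2.2.1 j).im * (Y.2.2.1 j).re - (X.2.2.1 j).re * (Y.2.2.1 j).im)
      + M.σ (M.ι X.2.2.2) (M.ι Y.2.2.2) := by
  refine (M.B_A₀ p X Y).trans ?_
  rw [B_apply]
  ring

lemma form_eq (t : ℝ) {p : Param m H} (hp : p ∈ M.dom) (X Y : Param m H) :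
    M.form t p X Y = (1 - t) * M.form₀ p X Y + t * M.σ (M.dU p X) (M.dU p Y) := by
  have h : M.moserData.B (M.moserData.A₁ p X) Y = M.σ (M.dU p X) (M.dU p Y) := M.B_A₁' hp X Y
  rw [form, MoserData.A_apply, map_add, map_smul, map_smul, add_apply, smul_apply, smul_apply, h,
    smul_eq_mul, smul_eq_mul, form₀]

lemma prim_eq {p : Param m H} (hp : p ∈ M.dom) (Y : Param m H) :
    M.prim p Y = 2⁻¹ * M.σ (M.U p) (M.dU p Y)
      - (-(M.q p.2.1 * Y.1)
        + ∑ j, ((p.2.2.1 j).im * (Y.2.2.1 j).re - (p.2.2.1 j).re * (Y.2.2.1 j).im)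
        + 2⁻¹ * M.σ (M.ι p.2.2.2) (M.ι Y.2.2.2)) + M.dψ p Y := by
  refine (M.B_Ga hp Y).trans ?_
  rw [B_apply, dU, dψ]
  ring

lemma dψ_eq_of_eventuallyEq {p : Param m H} (hp : p ∈ M.dom) {g : Param m H → ℂ}
    (h : g =ᶠ[𝓝 p] fun p => Complex.I * (M.ψ p : ℂ)) (Y : Param m H) :
    fderiv ℝ g p Y = Complex.I * (M.dψ p Y : ℂ) := by
  have hψ := ((M.contDiffOn_ψ.differentiableOn (by simp)).differentiableAt
    (M.isOpen_dom.mem_nhds hp)).hasFDerivAt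
  have h1 := (Complex.ofRealCLM.hasFDerivAt.comp p hψ).const_mul Complex.I
  have h2 : HasFDerivAt g _ p := h1.congr_of_eventuallyEq h
  rw [h2.fderiv]
  rfl

/-- Real-linear conditions that hold for `U` hold for its differential. -/
lemma map_dU {p : Param m H} (hp : p ∈ M.dom) (L : F →L[ℝ] F) (h : ∀ x ∈ M.dom, L (M.U x) = M.U x)
    (Y : Param m H) : L (M.dU p Y) = M.dU p Y := by
  have hU := (M.hasFDerivAt_U hp).differentiableAt.hasFDerivAt
  have h1 := L.hasFDerivAt.comp p hU
  have h2 := h1.unique (hU.congr_of_eventuallyEq (by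
    filter_upwards [M.isOpen_dom.mem_nhds hp] with x hx using h x hx))
  exact congrArg (fun L => L Y) h2

lemma base₀_add (k : ℝ) : M.moserData.b₀ + k • M.moserData.e = ((k, M.ω₀, 0, 0) : Param m H) := by
  change M.base₀ + k • (eTheta : Param m H) = _
  ext <;> simp [base₀, eTheta]

lemma moserData_Θ (Y : Param m H) : M.moserData.Θ Y = Y.1 := rfl

lemma moserData_B_A (t : ℝ) (p X Y : Param m H) :
    M.moserData.B (M.moserData.A t p X) Y = M.form t p X Y := rfl

lemma moserData_B_A₀ (p X Y : Param m H) :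
    M.moserData.B (M.moserData.A₀ p X) Y = M.form₀ p X Y := rfl

lemma moserData_B_Ga (p Y : Param m H) : M.moserData.B (M.moserData.Ga p) Y = M.prim p Y := rfl

lemma W_eq_iff (p : Param m H) : M.moserData.W p = M.moserData.W M.moserData.b₀ ↔ p.2.1 = M.ω₀ :=
  Iff.rfl

variable [CompleteSpace H]

/-- The flow maps the mass to the coordinate function `q(ω)`. -/
theorem mass_flow_one (D : M.moserData.CorrectedFlow) {p : Param m H} (hp : p ∈ D.ballSet) :
    M.mass (M.U (D.flow 1 p)) = M.q p.2.1 := by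
  have h1 : (1 : ℝ) ∈ Icc (0 : ℝ) 1 := ⟨zero_le_one, le_rfl⟩
  rw [← sub_eq_zero]
  refine D.eq_zero_of_fderiv_eq_zero (g := fun p => M.mass (M.U (D.flow 1 p)) - M.q p.2.1)
    (fun x hx => ?_) (fun k => ?_) hp
  · have hdom : D.flow 1 x ∈ M.dom := D.dom_sub (D.flow_mem x hx.2 1 h1)
    have hx0 : x ∈ M.dom := by
      have := D.dom_sub (D.flow_mem x hx.2 0 ⟨le_rfl, zero_le_one⟩)
      rwa [D.flow_zero x hx.2] at this
    have hf := (M.hasFDerivAt_mass_U hdom).comp x (D.differentiableAt_flow hx h1).hasFDerivAt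
    have hq : HasFDerivAt (fun p : Param m H => M.q p.2.1) (deriv M.q x.2.1 • omegaL) x :=
      HasDerivAt.comp_hasFDerivAt (h₂ := M.q) x
        ((M.q_smooth.differentiableOn (by simp)).differentiableAt
          (M.O_open.mem_nhds hx0)).hasDerivAt (omegaL (m := m) (H := H)).hasFDerivAt
    refine (hf.sub hq).congr_fderiv (ContinuousLinearMap.ext fun Y => ?_)
    -- The pull-back identity with `∂_θ` in the first slot. The flow differential fixes `∂_θ`, so
    -- the left-hand side is the differential of the mass along the flow and the right-hand side is
    -- `dq(ω)`.
    have hpull := D.pullback_flow hx h1 eTheta Y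
    have he : fderiv ℝ (D.flow 1) x eTheta = eTheta := D.fderiv_flow_e hx h1
    have hA : M.moserData.A 1 (D.flow 1 x) = M.A₁ (D.flow 1 x) := by
      simp only [MoserData.A, sub_self, zero_smul, one_smul, zero_add]; rfl
    rw [he, hA] at hpull
    have hB : M.B (M.A₁ (D.flow 1 x) eTheta) (fderiv ℝ (D.flow 1) x Y)
        = M.B (M.A₀ x eTheta) Y := hpull
    rw [sub_apply, ContinuousLinearMap.comp_apply, hB, M.B_A₀, M.B_eTheta, smul_apply,
      omegaL_apply, zero_apply, smul_eq_mul]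
    simp only [eTheta]
    ring
  -- The base points are fixed by the flow, and rotations preserve the mass, which settles the
  -- constant of integration.
  · have hb : D.flow 1 (M.moserData.b₀ + k • M.moserData.e)
        = M.base₀ + k • (eTheta : Param m H) := D.flow_base k h1
    have hω : (M.moserData.b₀ + k • M.moserData.e).2.1 = M.ω₀ := by
      change (M.base₀ + k • (eTheta : Param m H)).2.1 = M.ω₀
      simp [base₀, eTheta]
    rw [hb, hω, U_base_add, mass_rotL, mass_Φ, sub_self]

end SolitonModel


namespace NLS.Setting

variable {m : ℕ} {S : Setting m} {ω₀ : ℝ} (hω₀ : ω₀ ∈ S.O)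

/-! ### The coordinates of the setting and of the model -/

/-- For each mode, `z ξ + z̄ σ₁ξ = Re z (ξ + σ₁ξ) + Im z · i (ξ - σ₁ξ)`. -/
lemma model_T_eq (p : S.Phase ω₀) : (S.model hω₀).T p = S.Phi p.ω + R p := by
  have hterm : ∀ (z : ℂ) (x : Field), z.re • (x + sigma1 x)
      + z.im • (Complex.I • (x - sigma1 x)) = z • x + conj z • sigma1 x := fun z x => by
    have hr : ∀ (c : ℝ) (y : Field), c • y = (c : ℂ) • y := fun c y => (algebraMap_smul ℂ c y).symm
    have hz : conj z = z.re - z.im * Complex.I := by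
      conv_lhs => rw [← Complex.re_add_im z]
      simp only [map_add, map_mul, Complex.conj_ofReal, Complex.conj_I]
      ring
    rw [hr, hr, hz]
    conv_rhs => rw [← Complex.re_add_im z]
    simp only [Complex.add_re, Complex.add_im, Complex.ofReal_re, Complex.ofReal_im,
      Complex.re_ofReal_mul, Complex.im_ofReal_mul, Complex.I_re, Complex.I_im, mul_zero, mul_one,
      add_zero, zero_add]
    module
  have hsum : ∑ j, ((p.z j).re • S.xiRe j p.ω + (p.z j).im • S.xiIm j p.ω)
      = ∑ j, (p.z j • S.xi j p.ω + conj (p.z j) • sigma1 (S.xi j p.ω)) :=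
    Finset.sum_congr rfl fun j _ => hterm _ _
  rw [R, ← hsum, ← PcL_apply, ← add_assoc]
  rfl

lemma model_rotL (θ : ℝ) (x : Field) : (S.model hω₀).rotL θ x = rot θ x := by
  have hr : ∀ (c : ℝ) (y : H1), c • y = (c : ℂ) • y := fun c y => (algebraMap_smul ℂ c y).symm
  have e1 : Complex.exp (Complex.I * θ) = Real.cos θ + Real.sin θ * Complex.I := by
    rw [mul_comm, Complex.exp_mul_I]; push_cast; rfl
  have e2 : Complex.exp (-(Complex.I * θ)) = Real.cos θ - Real.sin θ * Complex.I := by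
    rw [← neg_mul, mul_comm, ← neg_mul_comm, Complex.exp_mul_I, Complex.cos_neg, Complex.sin_neg]
    push_cast; ring
  have h : (S.model hω₀).rotL θ x
      = Real.cos θ • x + Real.sin θ • (Complex.I • sigma3 x) := rfl
  rw [h, rot, e1, e2]
  refine Prod.ext ?_ ?_
  · simp only [Prod.fst_add, Prod.smul_fst, sigma3, hr]
    module
  · simp only [Prod.snd_add, Prod.smul_snd, sigma3, hr]
    module

lemma model_U : (S.model hω₀).U = (U : S.Phase ω₀ → Field) := by
  funext p
  rw [SolitonModel.U, model_rotL, model_T_eq]; rfl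

lemma dU_eq (p Y : S.Phase ω₀) : dU p Y = (S.model hω₀).dU p Y := by
  rw [SolitonModel.dU, model_U]; rfl

lemma isReal_T {p : S.Phase ω₀} (hp : p.ω ∈ S.O) : IsReal ((S.model hω₀).T p) := by
  rw [isReal_iff_bar, model_T_eq, R, map_add, map_add, map_sum, bar_Phi,
    (isReal_iff_bar _).1 (isReal_Pc hp p.2.2.2.2.1)]
  congr 2
  refine Finset.sum_congr rfl fun j _ => ?_
  rw [map_add, bar_smul, bar_smul, bar_sigma1, bar_xi, sigma1_sigma1, Complex.conj_conj, add_comm]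

lemma isReal_U (hω₀ : ω₀ ∈ S.O) {p : S.Phase ω₀} (hp : p.ω ∈ S.O) : IsReal (U p) := by
  have h := isReal_T hω₀ hp
  rw [isReal_iff_bar] at h ⊢
  have e : ∀ θ : ℝ, conj (Complex.exp (Complex.I * θ)) = Complex.exp (-(Complex.I * θ)) := fun θ => by
    rw [← Complex.exp_conj]; simp
  have e' : ∀ θ : ℝ, conj (Complex.exp (-(Complex.I * θ))) = Complex.exp (Complex.I * θ) :=
    fun θ => by rw [← Complex.exp_conj]; simp
  rw [U, ← model_T_eq hω₀]
  set x := (S.model hω₀).T p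
  rw [bar_apply, rot, conjH1_smul, conjH1_smul, e, e']
  rw [bar_apply] at h
  have h1 := congrArg Prod.fst h
  have h2 := congrArg Prod.snd h
  dsimp only at h1 h2 ⊢
  rw [h1, h2]

lemma isReal_dU (hω₀ : ω₀ ∈ S.O) {p : S.Phase ω₀} (hp : p.ω ∈ S.O) (Y : S.Phase ω₀) : IsReal (dU p Y) := by
  rw [isReal_iff_bar, dU_eq hω₀]
  exact (S.model hω₀).map_dU hp bar (fun x hx => by
    rw [model_U]; exact (isReal_iff_bar _).1 (isReal_U hω₀ hx)) Y

/-! ### The forms -/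

/-- The data of the corrected Moser flow for the setting. -/
abbrev moser (S : Setting m) {ω₀ : ℝ} (hω₀ : ω₀ ∈ S.O) : MoserData (S.Phase ω₀) :=
  (S.model hω₀).moserData

lemma Omega_eq (hω₀ : ω₀ ∈ S.O) {p : S.Phase ω₀} (hp : p.ω ∈ S.O) (X Y : S.Phase ω₀) :
    Omega p X Y = Complex.I * (symp (dU p X) (dU p Y) : ℝ) :=
  pair_J_of_isReal (isReal_dU hω₀ hp X) (isReal_dU hω₀ hp Y)

lemma mul_conj_sub (z w : ℂ) : z * conj w - w * conj z
    = Complex.I * ((2 * (z.im * w.re - z.re * w.im) : ℝ) : ℂ) := by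
  apply Complex.ext
  · simp; ring
  · simp; ring

lemma pair_coe (f g : S.hcSubmodule ω₀) : pair (f : Field) (sigma3 (sigma1 (g : Field)))
    = Complex.I * symp (f : Field) (g : Field) := pair_J_of_isReal f.2.1 g.2.1

lemma Omega0_eq (p X Y : S.Phase ω₀) :
    Omega0 p X Y = Complex.I * ((S.model hω₀).form₀ p X Y : ℝ) := by
  have h : (S.model hω₀).form₀ p X Y
      = deriv S.q p.ω * (X.θ * Y.ω - X.ω * Y.θ)
        + 2 * ∑ j, ((X.z j).im * (Y.z j).re - (X.z j).re * (Y.z j).im) + symp X.f Y.f :=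
    (S.model hω₀).form₀_eq p X Y
  rw [h, Omega0, pair_coe]
  simp only [mul_conj_sub]
  rw [← Finset.mul_sum, Finset.mul_sum Finset.univ _ (2 : ℝ)]
  push_cast
  ring

lemma Omegat_eq (t : ℝ) {p : S.Phase ω₀} (hp : p.ω ∈ S.O) (X Y : S.Phase ω₀) :
    Omegat t p X Y = Complex.I * ((S.model hω₀).form t p X Y : ℝ) := by
  have h : (S.model hω₀).form t p X Y
      = (1 - t) * (S.model hω₀).form₀ p X Y + t * symp (dU p X) (dU p Y) := by
    rw [dU_eq hω₀, dU_eq hω₀]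
    exact (S.model hω₀).form_eq t hp X Y
  rw [Omegat, Omega_eq hω₀ hp, Omega0_eq hω₀, h]
  push_cast
  ring

lemma beta1_eq (hω₀ : ω₀ ∈ S.O) {p : S.Phase ω₀} (hp : p.ω ∈ S.O) (Y : S.Phase ω₀) :
    beta1 p Y = Complex.I * ((2⁻¹ * symp (U p) (dU p Y) : ℝ) : ℂ) := by
  rw [beta1, pair_sigma1, pair_sigma3, pair_J_of_isReal (isReal_U hω₀ hp) (isReal_dU hω₀ hp Y)]
  push_cast
  ring

lemma beta0_eq (p Y : S.Phase ω₀) :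
    beta0 p Y = Complex.I * ((-(S.q p.ω * Y.θ)
      + ∑ j, ((p.z j).im * (Y.z j).re - (p.z j).re * (Y.z j).im)
      + 2⁻¹ * symp p.f Y.f : ℝ) : ℂ) := by
  have hs : ∀ j, conj (p.z j) * Y.z j - p.z j * conj (Y.z j)
      = -(Complex.I * ((2 * ((p.z j).im * (Y.z j).re - (p.z j).re * (Y.z j).im) : ℝ) : ℂ)) :=
    fun j => by rw [← mul_conj_sub]; ring
  rw [beta0, pair_coe]
  simp only [hs]
  rw [Finset.sum_neg_distrib, ← Finset.mul_sum, ← Complex.ofReal_sum, ← Finset.mul_sum]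
  push_cast
  ring

/-- The model uses all of `T = Φ + R` where the setting uses `R`; the difference is `⟨σ₃ Φ, Φ⟩ = 0`.
-/
lemma psi_eq {p : S.Phase ω₀} (hp : p.ω ∈ S.O) :
    psi p = Complex.I * ((S.model hω₀).ψ p : ℂ) := by
  have h0 : pair (sigma3 (S.Phi p.ω)) (S.Phi p.ω) = 0 := by
    rw [pair_comm, pair_sigma3_eq_zero (S.sigma1_Phi _) (S.sigma1_Phi _)]
  have h1 : pair (S.Phi p.ω) (sigma3 (sigma1 ((S.model hω₀).T p)))
      = -pair (sigma3 (S.Phi p.ω)) (R p) := by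
    rw [← pair_sigma3, ← pair_sigma1, sigma1_sigma3, sigma1_Phi, model_T_eq, pair_add_right,
      pair_neg_left, pair_neg_left, h0, neg_zero, zero_add]
  have h2 := pair_J_of_isReal ((isReal_iff_bar _).2 (S.bar_Phi p.ω)) (isReal_T hω₀ hp)
  have h3 : (S.model hω₀).ψ p = -(2⁻¹ * symp (S.Phi p.ω) ((S.model hω₀).T p)) := rfl
  rw [h1] at h2
  rw [psi, h3]
  push_cast
  linear_combination (-1 / 2 : ℂ) * h2

lemma fderiv_psi {p : S.Phase ω₀} (hp : p.ω ∈ S.O) (Y : S.Phase ω₀) :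
    fderiv ℝ (psi (S := S) (ω₀ := ω₀)) p Y
      = Complex.I * ((S.model hω₀).dψ p Y : ℂ) := by
  exact (S.model hω₀).dψ_eq_of_eventuallyEq hp (by
    filter_upwards [(S.model hω₀).isOpen_dom.mem_nhds hp] with x hx using psi_eq hω₀ hx) Y

/-- On real fields the 1-form is purely imaginary, as are the 2-forms, so dividing by `i` leaves a
problem about real forms. -/
lemma alpha_eq {p : S.Phase ω₀} (hp : p.ω ∈ S.O) (Y : S.Phase ω₀) :
    alpha p Y = Complex.I * ((S.model hω₀).prim p Y : ℝ) := by
  have h : (S.model hω₀).prim p Y = 2⁻¹ * symp (U p) (dU p Y) - (-(S.q p.ω * Y.θ)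
      + ∑ j, ((p.z j).im * (Y.z j).re - (p.z j).re * (Y.z j).im)
      + 2⁻¹ * symp p.f Y.f) + (S.model hω₀).dψ p Y := by
    rw [dU_eq hω₀, ← model_U hω₀]
    exact (S.model hω₀).prim_eq hp Y
  rw [h, alpha, beta1_eq hω₀ hp, beta0_eq, fderiv_psi hω₀ hp]
  push_cast
  ring

lemma I_mul_ofReal_inj {a b : ℝ} : Complex.I * (a : ℂ) = Complex.I * (b : ℂ) ↔ a = b := by
  rw [mul_right_inj' Complex.I_ne_zero, Complex.ofReal_inj]

/-- The factor `i` in front of the integral meets the one in `α`; this is the origin of the minus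
sign in the real formulation of `F`. -/
lemma integral_alpha {γ v : ℝ → S.Phase ω₀} {s : ℝ} (hγ : ∀ σ ∈ uIcc 0 s, (γ σ).ω ∈ S.O) :
    Complex.I * ∫ σ in (0 : ℝ)..s, alpha (γ σ) (v σ)
      = ((-∫ σ in (0 : ℝ)..s, (S.model hω₀).prim (γ σ) (v σ) : ℝ) : ℂ) := by
  have h : ∫ σ in (0 : ℝ)..s, alpha (γ σ) (v σ)
      = ∫ σ in (0 : ℝ)..s, Complex.I *
        ((S.model hω₀).prim (γ σ) (v σ) : ℝ) :=
    intervalIntegral.integral_congr fun σ hσ => alpha_eq hω₀ (hγ σ hσ) _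
  rw [h, intervalIntegral.integral_const_mul, intervalIntegral.integral_ofReal, ← mul_assoc,
    Complex.I_mul_I]
  push_cast
  ring

lemma mem_base_iff (p : S.Phase ω₀) :
    p ∈ base S ω₀ ↔ ∃ k : ℝ, p = (S.moser hω₀).b₀ + k • (S.moser hω₀).e := by
  have h : ∀ k : ℝ, (S.moser hω₀).b₀ + k • (S.moser hω₀).e = ((k, ω₀, 0, 0) : S.Phase ω₀) :=
    (S.model hω₀).base₀_add
  simp only [h]
  constructor
  · intro hp; exact ⟨p.1, Prod.ext rfl hp⟩
  · rintro ⟨k, rfl⟩; rfl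

lemma base_subset_iff {s : Set (S.Phase ω₀)} :
    base S ω₀ ⊆ s ↔ ∀ k : ℝ, (S.moser hω₀).b₀ + k • (S.moser hω₀).e ∈ s := by
  constructor
  · intro h k; exact h ((mem_base_iff hω₀ _).2 ⟨k, rfl⟩)
  · intro h p hp
    obtain ⟨k, rfl⟩ := (mem_base_iff hω₀ p).1 hp
    exact h k

/-! ### The flows -/

lemma uIcc_subset_Ioo {s s₀ : ℝ} (hs : s ∈ Ioo (-s₀) s₀) (h0 : 0 < s₀) :
    uIcc 0 s ⊆ Ioo (-s₀) s₀ := by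
  intro σ hσ
  rcases le_total 0 s with h | h
  · rw [uIcc_of_le h] at hσ; exact ⟨by linarith [hσ.1], by linarith [hσ.2, hs.2]⟩
  · rw [uIcc_of_ge h] at hσ; exact ⟨by linarith [hσ.1, hs.1], by linarith [hσ.2]⟩

lemma Omegat_eq_iff (t : ℝ) {p : S.Phase ω₀} (hp : p.ω ∈ S.O) (X Y : S.Phase ω₀) :
    Omegat t p X Y = -(Complex.I * Y.θ) ↔ (S.model hω₀).form t p X Y = -Y.θ := by
  rw [Omegat_eq hω₀ t hp, ← mul_neg, ← Complex.ofReal_neg, I_mul_ofReal_inj]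

lemma Omegat_eq_neg_alpha_iff (t : ℝ) {p : S.Phase ω₀} (hp : p.ω ∈ S.O) (X Y : S.Phase ω₀)
    (c : ℝ) : Omegat t p X Y = -alpha p Y - Complex.I * (c : ℝ) ↔
      (S.model hω₀).form t p X Y = -(S.model hω₀).prim p Y - c := by
  rw [Omegat_eq hω₀ t hp, alpha_eq hω₀ hp, ← mul_neg, ← mul_sub, ← Complex.ofReal_neg,
    ← Complex.ofReal_sub, I_mul_ofReal_inj]

lemma eq_integral_alpha_iff {γ v : ℝ → S.Phase ω₀} {s : ℝ}
    (hγ : ∀ σ ∈ uIcc 0 s, (γ σ).ω ∈ S.O) (c : ℝ) :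
    (c : ℂ) = Complex.I * ∫ σ in (0 : ℝ)..s, alpha (γ σ) (v σ) ↔
      c = -∫ σ in (0 : ℝ)..s, (S.model hω₀).prim (γ σ) (v σ) := by
  rw [integral_alpha hω₀ hγ, Complex.ofReal_inj]

lemma massQ_U {p : S.Phase ω₀} (hp : p.ω ∈ S.O) :
    massQ (U p) = ((S.model hω₀).mass ((S.model hω₀).U p) : ℝ) := by
  have h1 : (S.model hω₀).mass ((S.model hω₀).U p) = 2⁻¹ * symp (iSigma3 (U p)) (U p) := by
    rw [model_U]; rfl
  have h2 : conj (pair (U p) (sigma1 (U p))) = pair (U p) (sigma1 (U p)) := by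
    rw [← pair_bar, bar_sigma1, (isReal_iff_bar _).1 (isReal_U hω₀ hp)]
  rw [h1, symp_iSigma3, massQ]
  push_cast
  rw [Complex.conj_eq_iff_re.1 h2]
  ring

end NLS.Setting


/-! ### Translation between the setting and the abstract data. -/

namespace NLS.Setting

variable {m : ℕ} {S : Setting m} {ω₀ : ℝ} (hω₀ : ω₀ ∈ S.O)

/-- The corrected Moser flow in the setting, as one for the abstract data. -/
def MoserFlow.toCorrectedFlow (D : S.MoserFlow ω₀) : (S.moser hω₀).CorrectedFlow where
  dom := D.dom
  dom_open := D.dom_open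
  base_dom := (base_subset_iff hω₀).1 D.base_dom
  dom_sub := D.dom_sub
  Xθ := D.Xθ
  Xθ_spec := fun t ht p hp Y => by
    rw [SolitonModel.moserData_Θ, SolitonModel.moserData_B_A]
    exact (Omegat_eq_iff hω₀ t (D.dom_sub p hp) (D.Xθ t p) Y).1 (D.Xθ_spec t ht p hp Y)
  ini := D.ini
  ini_open := D.ini_open
  base_ini := (base_subset_iff hω₀).1 D.base_ini
  s₀ := D.s₀
  s₀_pos := D.s₀_pos
  flowθ := D.flowθ
  flowθ_zero := fun t ht p hp hW => D.flowθ_zero t ht p hp (((S.model hω₀).W_eq_iff p).1 hW)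
  flowθ_mem := fun t ht p hp hW => D.flowθ_mem t ht p hp (((S.model hω₀).W_eq_iff p).1 hW)
  flowθ_deriv := fun t ht p hp hW => D.flowθ_deriv t ht p hp (((S.model hω₀).W_eq_iff p).1 hW)
  F := D.F
  F_diff := D.F_diff
  F_spec := fun t ht p hp hW s hs => by
    have hW' := ((S.model hω₀).W_eq_iff p).1 hW
    simp only [SolitonModel.moserData_B_Ga]
    exact (eq_integral_alpha_iff hω₀ (fun σ hσ => D.dom_sub _ (D.flowθ_mem t ht p hp
      hW' σ (uIcc_subset_Ioo hs D.s₀_pos hσ))) _).1 (D.F_spec t ht p hp hW' s hs)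
  X := D.X
  X_spec := fun t ht p hp Y => by
    simp only [SolitonModel.moserData_B_Ga, SolitonModel.moserData_B_A]
    exact (Omegat_eq_neg_alpha_iff hω₀ t (D.dom_sub p hp) _ Y _).1 (D.X_spec t ht p hp Y)
  flowDom := D.flowDom
  flowDom_open := D.flowDom_open
  base_flowDom := (base_subset_iff hω₀).1 D.base_flowDom
  flow := D.flow
  flow_zero := D.flow_zero
  flow_mem := D.flow_mem
  flow_deriv := D.flow_deriv

/-- The corrected flow for the abstract data, as a corrected Moser flow in the setting. -/
def moserFlowOf (D : (S.moser hω₀).CorrectedFlow) : S.MoserFlow ω₀ where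
  dom := D.dom
  dom_open := D.dom_open
  base_dom := (base_subset_iff hω₀).2 D.base_dom
  dom_sub := fun _ hp => D.dom_sub hp
  Xθ := D.Xθ
  Xθ_spec := fun t ht p hp Y => by
    have h := D.Xθ_spec t ht p hp Y
    rw [SolitonModel.moserData_Θ, SolitonModel.moserData_B_A] at h
    exact (Omegat_eq_iff hω₀ t (D.dom_sub hp) (D.Xθ t p) Y).2 h
  ini := D.ini
  ini_open := D.ini_open
  base_ini := (base_subset_iff hω₀).2 D.base_ini
  s₀ := D.s₀
  s₀_pos := D.s₀_pos
  flowθ := D.flowθ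
  flowθ_zero := fun t ht p hp hW => D.flowθ_zero t ht p hp (((S.model hω₀).W_eq_iff p).2 hW)
  flowθ_mem := fun t ht p hp hW => D.flowθ_mem t ht p hp (((S.model hω₀).W_eq_iff p).2 hW)
  flowθ_deriv := fun t ht p hp hW => D.flowθ_deriv t ht p hp (((S.model hω₀).W_eq_iff p).2 hW)
  F := D.F
  F_diff := D.F_diff
  F_spec := fun t ht p hp hW s hs => by
    have hW' := ((S.model hω₀).W_eq_iff p).2 hW
    have h := D.F_spec t ht p hp hW' s hs
    simp only [SolitonModel.moserData_B_Ga] at h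
    exact (eq_integral_alpha_iff hω₀ (γ := fun σ => D.flowθ t σ p)
      (v := fun σ => D.Xθ t (D.flowθ t σ p)) (fun σ hσ => D.dom_sub (D.flowθ_mem t ht p hp
      hW' σ (uIcc_subset_Ioo hs D.s₀_pos hσ))) _).2 h
  X := D.X
  X_spec := fun t ht p hp Y => by
    have h := D.X_spec t ht p hp Y
    simp only [SolitonModel.moserData_B_Ga, SolitonModel.moserData_B_A] at h
    exact (Omegat_eq_neg_alpha_iff hω₀ t (D.dom_sub hp) _ Y _).2 h
  flowDom := D.flowDom
  flowDom_open := D.flowDom_open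
  base_flowDom := (base_subset_iff hω₀).2 D.base_flowDom
  flow := D.flow
  flow_zero := D.flow_zero
  flow_mem := D.flow_mem
  flow_deriv := D.flow_deriv

end NLS.Setting

end

theorem lemma6p10 {m : ℕ} (S : NLS.Setting m) (ω₀ : ℝ) (hω₀ : ω₀ ∈ S.O) :
    -- the corrected Moser vector field and its flow exist near the points `e^{i σ₃ ϑ} Φ_{ω₀}`
    Nonempty (S.MoserFlow ω₀) ∧
    ∀ D : S.MoserFlow ω₀, ∃ N : Set (S.Phase ω₀),
      IsOpen N ∧ NLS.Setting.base S ω₀ ⊆ N ∧ N ⊆ D.flowDom ∧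
      -- `ℱ_t^* Ω_t = Ω₀`
      (∀ t ∈ Set.Icc (0 : ℝ) 1, ∀ p ∈ N, DifferentiableAt ℝ (D.flow t) p ∧
        ∀ X Y : S.Phase ω₀,
          NLS.Setting.Omegat t (D.flow t p)
              (fderiv ℝ (D.flow t) p X) (fderiv ℝ (D.flow t) p Y)
            = NLS.Setting.Omega0 p X Y) ∧
      -- `Q ∘ ℱ_1 = q(ω)`
      (∀ p ∈ N, NLS.massQ (NLS.Setting.U (D.flow 1 p)) = (S.q p.ω : ℂ)) ∧
      -- `∂_ϑ χ = 0` implies `∂_ϑ (χ ∘ ℱ_t) = 0`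
      (∀ χ : S.Phase ω₀ → ℂ,
        (∀ p ∈ D.dom, HasLineDerivAt ℝ χ 0 p (NLS.Setting.dTheta S ω₀)) →
        ∀ t ∈ Set.Icc (0 : ℝ) 1, ∀ p ∈ N,
          HasLineDerivAt ℝ (fun p' => χ (D.flow t p')) 0 p (NLS.Setting.dTheta S ω₀)) := by
  refine ⟨?_, fun D => ?_⟩
  · obtain ⟨D⟩ := (S.moser hω₀).nonempty_correctedFlow
    exact ⟨NLS.Setting.moserFlowOf hω₀ D⟩
  · have hdom : ∀ t ∈ Set.Icc (0 : ℝ) 1, ∀ p ∈ D.flowDom, (D.flow t p).ω ∈ S.O :=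
      fun t ht p hp => D.dom_sub _ (D.flow_mem p hp t ht)
    let D' := D.toCorrectedFlow hω₀
    -- The neighborhood is a union of balls centred at base points because the second claim
    -- integrates a differential from such a point; the other claims hold on all of `flowSet`.
    refine ⟨D'.ballSet, D'.isOpen_ballSet, (NLS.Setting.base_subset_iff hω₀).2 D'.base_mem_ballSet,
      D'.ballSet_subset_flowDom, fun t ht p hp => ⟨D'.differentiableAt_flow (D'.ballSet_subset hp) ht,
      fun X Y => ?_⟩, fun p hp => ?_, fun χ hχ t ht p hp =>
      D'.hasLineDerivAt_comp_flow hχ (D'.ballSet_subset hp) ht⟩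
    · rw [NLS.Setting.Omegat_eq hω₀ t (hdom t ht p (D'.ballSet_subset_flowDom hp)),
        NLS.Setting.Omega0_eq hω₀, NLS.Setting.I_mul_ofReal_inj]
      have h := D'.pullback_flow (D'.ballSet_subset hp) ht X Y
      simp only [SolitonModel.moserData_B_A, SolitonModel.moserData_B_A₀] at h
      exact h
    · rw [NLS.Setting.massQ_U hω₀ (hdom 1 ⟨zero_le_one, le_rfl⟩ p (D'.ballSet_subset_flowDom hp))]
      exact congrArg Complex.ofReal ((S.model hω₀).mass_flow_one D' hp)
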